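/- **Setting.** Let $M$ be a finite dimensional smooth (Hausdorff) manifold, $X_1,\dots,X_m$ smooth vector fields on $M$, $\Delta\subset\mathbb R^m$ the standard simplex, $\mathcal X$ the set of fields $\sum_i u_iX_i$, $u\in\Delta$, and $\mathcal X(x)$ the set of their values at $x$. Let $c\colon M\to\mathbb R$ be smooth, $x_0\in M$, $T>0$. An admissible trajectory is an absolutely continuous $\xi\colon[0,T]\to M$ with $\xi(0)=x_0$ and $\dot\xi(t)\in\mathcal X(\xi(t))$ for a.e. $t$. For a vector field $f$ on $M$ the associated Hamiltonian on $T^*M$ is $\ell\mapsto\langle\ell,f(\pi\ell)\rangle$, $\pi\colon T^*M\to M$; $\vec F$ is the Hamiltonian vector field of $F$, i.e. $\sigma(v,\vec F)=\langle dF,v\rangle$ with $\sigma=d(p\,dq)$, and $\{F,G\}=\langle dG,\vec F\rangle$. **Reference extremal.** Let $0<\hat\tau_1<\hat\tau_2<T$, $h_1,h_2,h_3\in\{X_1,\dots,X_m\}$, $f_1=h_3-h_2$, $\hat\upsilon$ a measurable function on $[\hat\tau_2,T]$ with values in $(0,1)$, and let $\hat f_t$ be $h_1$ for $t<\hat\tau_1$,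 $h_2$ for $\hat\tau_1<t<\hat\tau_2$, $h_2+\hat\upsilon(t)f_1$ for $t>\hat\tau_2$. Let $\hat\xi$ be an absolutely continuous solution of $\dot\xi=\hat f_t(\xi)$, $\xi(0)=x_0$, on $[0,T]$, and $\hat x_f=\hat\xi(T)$. Let $H_i,F_1,\hat F_t$ be the Hamiltonians of $h_i,f_1,\hat f_t$, and put $H_{ij}=\{H_i,H_j\}$, $H_{ijk}=\{H_i,\{H_j,H_k\}\}$. Assume that there is an absolutely continuous $\hat\lambda\colon[0,T]\to T^*M$ with: 1. (PMP) $\pi\hat\lambda=\hat\xi$, $\dot{\hat\lambda}(t)=\vec{\hat F}_t(\hat\lambda(t))$ for a.e. $t$, $\hat\lambda(T)=-dc(\hat x_f)$, and $\hat F_t(\hat\lambda(t))=\max_{v\in\mathcal X(\hat\xi(t))}\langle\hat\lambda(t),v\rangle$ for $t\in[0,T]$; 2. on $[0,\hat\tau_1)$ one has $\langle\hat\lambda(t),X(\hat\xi(t))\rangle<H_1(\hat\lambda(t))$ for every field $X\in\mathcal X$, $X\neq h_1$; on $(\hat\tau_1,\hat\tau_2)$ the same holds with $h_2,H_2$ in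 place of $h_1,H_1$; 3. for $t\in[\hat\tau_2,T]$ and $a\in[0,1]$, $\langle\hat\lambda(t),X(\hat\xi(t))\rangle<(H_2+aF_1)(\hat\lambda(t))$ for every field $X\in\mathcal X$ not of the form $h_2+sf_1$, $s\in[0,1]$; and at $t=\hat\tau_1$ the analogous strict inequality holds for every $X\in\mathcal X$ not of the form $h_1+s(h_2-h_1)$, $s\in[0,1]$; 4. $H_{12}(\hat\lambda(\hat\tau_1))>0$ and $H_{232}(\hat\lambda(\hat\tau_2))>0$; 5. $\{F_1,\{H_2,F_1\}\}(\hat\lambda(t))>0$ for $t\in[\hat\tau_2,T]$. **Modified cost.** Let $\mathcal O$ be an open neighbourhood of $\hat x_f$. Either $L_{f_1}^2c(\hat x_f)>0$ and $\tilde c\colon\mathcal O\to\mathbb R$ is the extension of $c|_{\{x\in\mathcal O\,:\,L_{f_1}c(x)=0\}}$ that is constant along the integral lines of $f_1$ in $\mathcal O$ ($\mathcal O$ so small that each such line through a point of $\mathcal O$ reaches this set and that $\tilde c$ is well defined and smooth); or $L_{f_1}c\equiv0$ on $\mathcal O$ and $\tilde c=c$. Let $\Lambda=\{d(-\tilde c)(x):x\in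 V\}$, where $V\subseteq\mathcal O$ is an open neighbourhood of $\hat x_f$. **Overmaximised flow.** On an open neighbourhood $\mathcal O_s$ of $\hat\lambda([\hat\tau_2,T])$ let $\theta$ be a smooth solution of $H_{23}\circ\exp(\theta\vec F_1)=0$ with $\theta=0$ where $H_{23}=0$, and let $\widetilde H_2(\ell)=H_2(\exp(\theta(\ell)\vec F_1)(\ell))$. On an open neighbourhood $\mathcal O_2$ of $\hat\lambda(\hat\tau_2)$ let $t_2$ be a smooth solution of $H_{23}\circ\exp((t_2-\hat\tau_2)\vec{\widetilde H}_2)=0$ with $t_2=\hat\tau_2$ where $H_{23}=0$, let $\tau_2=\min\{t_2,\hat\tau_2\}$, and let $\tau_1$ be a continuous solution of $(H_2-H_1)\circ\exp((\tau_1-\tau_2)\vec H_2)\circ\exp((\tau_2-\hat\tau_2)\vec{\widetilde H}_2)=0$ with $\tau_1(\hat\lambda(\hat\tau_2))=\hat\tau_1$; $\mathcal O_2$ is so small that $0<\tau_1<\tau_2$ on it. For $\ell\in\Lambda$ let $t\mapsto\mathcal H_t(\ell)$, $t\in[0,T]$, be the curve with $\mathcal H_T(\ell)=\ell$ that is an integral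 curve of the Hamiltonian vector field of $\widetilde H_2+\hat\upsilon(t)F_1$ on $[\hat\tau_2,T]$ and, with $\tilde\ell=\mathcal H_{\hat\tau_2}(\ell)\in\mathcal O_2$, of $\vec{\widetilde H}_2$ on $[\tau_2(\tilde\ell),\hat\tau_2]$, of $\vec H_2$ on $[\tau_1(\tilde\ell),\tau_2(\tilde\ell)]$ and of $\vec H_1$ on $[0,\tau_1(\tilde\ell)]$ (the arcs governed by $\widetilde H_2$ lying in $\mathcal O_s$). **Theorem.** Assume that $(t,\ell)\mapsto(t,\pi\mathcal H_t(\ell))$ is a bijection of $[0,T]\times\Lambda$ onto a neighbourhood of the graph of $\hat\xi$ in $[0,T]\times M$, with locally Lipschitz inverse. Then $\hat\xi$ is a strict strong local minimiser for the cost $\tilde c(\xi(T))$: there is a neighbourhood $\mathcal U$ of the graph of $\hat\xi$ in $\mathbb R\times M$ such that every admissible trajectory $\xi\neq\hat\xi$ with graph in $\mathcal U$ satisfies $\xi(T)\in\mathcal O$ and $\tilde c(\hat\xi(T))<\tilde c(\xi(T))$. -/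

import Mathlib

open Set Filter Topology MeasureTheory Bundle
open scoped Manifold ContDiff NNReal

namespace BangBangSingular

noncomputable section

/-! ## Curves and maps on manifolds -/

section General

variable {E : Type*} [NormedAddCommGroup E] [NormedSpace ℝ E]
  {H : Type*} [TopologicalSpace H] (I : ModelWithCorners ℝ E H)
  {N : Type*} [TopologicalSpace N] [ChartedSpace H N]
  {E' : Type*} [NormedAddCommGroup E'] [NormedSpace ℝ E']
  {H' : Type*} [TopologicalSpace H'] (I' : ModelWithCorners ℝ E' H')
  {N' : Type*} [TopologicalSpace N'] [ChartedSpace H' N']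

/-- The curve `γ` on `[a, b]` is absolutely continuous: it is continuous, and it is absolutely
continuous in every chart on every subinterval that it maps into the domain of that chart. -/
def AbsContOn (γ : ℝ → N) (a b : ℝ) : Prop :=
  ContinuousOn γ (Icc a b) ∧
    ∀ (x : N) (a' b' : ℝ), a ≤ a' → a' ≤ b' → b' ≤ b →
      MapsTo γ (Icc a' b') (extChartAt I x).source →
      AbsolutelyContinuousOnInterval (fun t => extChartAt I x (γ t)) a' b'

/-- The curve `γ` has velocity `v` at time `t`. -/
def HasVelocityAt (γ : ℝ → N) (t : ℝ) (v : TangentSpace I (γ t)) : Prop :=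
  HasMFDerivAt 𝓘(ℝ, ℝ) I γ t ((1 : ℝ →L[ℝ] ℝ).smulRight v)

/-- `γ` is a Carathéodory solution on `[a, b]` of the time-dependent equation
`γ' (t) = V t (γ t)`: it is absolutely continuous and satisfies the equation for almost
every `t`. -/
def IsCaratheodorySolution (V : ℝ → (x : N) → TangentSpace I x) (γ : ℝ → N) (a b : ℝ) : Prop :=
  AbsContOn I γ a b ∧
    ∀ᵐ t ∂(volume.restrict (Icc a b)), HasVelocityAt I γ t (V t (γ t))

/-- The map `f`, restricted to the set `S`, is locally Lipschitz (with respect to charts). -/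
def LocLipschitzOn (f : N → N') (S : Set N) : Prop :=
  ∀ p ∈ S, ContinuousWithinAt f S p ∧
    ∃ (K : ℝ≥0) (W : Set N), W ∈ 𝓝 p ∧
      LipschitzOnWith K (writtenInExtChartAt I I' p f)
        (extChartAt I p '' (S ∩ W ∩ (extChartAt I p).source))

end General

section Cotangent

variable (E : Type*) [NormedAddCommGroup E] [NormedSpace ℝ E]
  (M : Type*) [TopologicalSpace M] [ChartedSpace E M] [IsManifold 𝓘(ℝ, E) ∞ M]

/-- The cotangent bundle `T*M`, with the topology and the charts of the bundle of linear maps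
from the tangent bundle to the trivial line bundle. Its preferred chart at `ℓ` is the canonical
chart `(q, p)` induced by the preferred chart of `M` at the base point of `ℓ`. -/
abbrev Cotangent : Type _ :=
  TotalSpace (E →L[ℝ] ℝ) (fun x : M => TangentSpace 𝓘(ℝ, E) x →L[ℝ] Bundle.Trivial M ℝ x)

/-- The model with corners of the cotangent bundle. -/
abbrev cotModel : ModelWithCorners ℝ (E × (E →L[ℝ] ℝ)) (ModelProd E (E →L[ℝ] ℝ)) :=
  𝓘(ℝ, E).prod 𝓘(ℝ, E →L[ℝ] ℝ)

variable {E M}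

/-- The differential of a function at a point, as an element of the cotangent bundle. -/
def differential (φ : M → ℝ) (x : M) : Cotangent E M := ⟨x, mfderiv 𝓘(ℝ, E) 𝓘(ℝ, ℝ) φ x⟩

/-- The canonical symplectic form `σ = dθ`, with `θ` the Liouville form `p dq`. In the canonical
coordinates `(q, p)` this is `dp ∧ dq`. -/
def symplecticForm (ℓ : Cotangent E M) (v w : TangentSpace (cotModel E) ℓ) : ℝ :=
  (show E × (E →L[ℝ] ℝ) from v).2 (show E × (E →L[ℝ] ℝ) from w).1
    - (show E × (E →L[ℝ] ℝ) from w).2 (show E × (E →L[ℝ] ℝ) from v).1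

/-- The differential of a function on the cotangent bundle. -/
def cotDiff (F : Cotangent E M → ℝ) (ℓ : Cotangent E M) : E × (E →L[ℝ] ℝ) →L[ℝ] ℝ :=
  mfderiv (cotModel E) 𝓘(ℝ, ℝ) F ℓ

variable [FiniteDimensional ℝ E]

/-- The Hamiltonian vector field of `F`: in canonical coordinates `(∂F/∂p, -∂F/∂q)`. -/
def hamField (F : Cotangent E M → ℝ) (ℓ : Cotangent E M) : TangentSpace (cotModel E) ℓ :=
  show E × (E →L[ℝ] ℝ) from
    (∑ i, cotDiff F ℓ (0, LinearMap.toContinuousLinearMap ((Module.finBasis ℝ E).coord i)) •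
        Module.finBasis ℝ E i,
      -(cotDiff F ℓ).comp (ContinuousLinearMap.inl ℝ E (E →L[ℝ] ℝ)))

/-- The Hamiltonian vector field of `F` is the vector field with
`σ (v, hamField F) = ⟨dF, v⟩` for all tangent vectors `v`. -/
theorem symplecticForm_hamField (F : Cotangent E M → ℝ) (ℓ : Cotangent E M)
    (v : TangentSpace (cotModel E) ℓ) :
    symplecticForm ℓ v (hamField F ℓ) = cotDiff F ℓ v := by
  obtain ⟨q, p⟩ := (show E × (E →L[ℝ] ℝ) from v)
  have hp : p = ∑ i, p (Module.finBasis ℝ E i) •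
      LinearMap.toContinuousLinearMap ((Module.finBasis ℝ E).coord i) := by
    ext y
    have hy : p y = p (∑ i, (Module.finBasis ℝ E).repr y i • Module.finBasis ℝ E i) := by
      rw [(Module.finBasis ℝ E).sum_repr y]
    rw [hy, map_sum]
    simp [mul_comm]
  have hsum : cotDiff F ℓ (0, p) = ∑ i, p (Module.finBasis ℝ E i) *
      cotDiff F ℓ (0, LinearMap.toContinuousLinearMap ((Module.finBasis ℝ E).coord i)) := by
    have h1 : ((0 : E), p) = ContinuousLinearMap.inr ℝ E (E →L[ℝ] ℝ) p := rfl
    have h2 : ∀ r : E →L[ℝ] ℝ, cotDiff F ℓ ((0 : E), r) =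
      ((cotDiff F ℓ).comp (ContinuousLinearMap.inr ℝ E (E →L[ℝ] ℝ))) r := fun r => rfl
    simp only [h2]
    conv_lhs => rw [hp]
    rw [map_sum]
    simp
  have hsplit : cotDiff F ℓ (q, p) = cotDiff F ℓ (0, p) + cotDiff F ℓ (q, 0) := by
    rw [← map_add]; simp
  change p (∑ i, cotDiff F ℓ (0, LinearMap.toContinuousLinearMap
      ((Module.finBasis ℝ E).coord i)) • Module.finBasis ℝ E i) -
    (-(cotDiff F ℓ).comp (ContinuousLinearMap.inl ℝ E (E →L[ℝ] ℝ))) q = cotDiff F ℓ (q, p)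
  rw [hsplit, hsum, map_sum]
  simp [mul_comm]

/-- The Poisson bracket `{F, G}`, i.e. the derivative of `G` along the Hamiltonian vector field
of `F`. -/
def poisson (F G : Cotangent E M → ℝ) (ℓ : Cotangent E M) : ℝ :=
  cotDiff G ℓ (hamField F ℓ)

/-- The Hamiltonian `ℓ ↦ ⟨ℓ, f (π ℓ)⟩` associated with a vector field `f` on `M`. -/
def lift (f : (x : M) → TangentSpace 𝓘(ℝ, E) x) (ℓ : Cotangent E M) : ℝ := ℓ.2 (f ℓ.1)

/-- `exp (s F) ℓ = ℓ'` within `S`: the integral curve of the Hamiltonian vector field of `F` that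
starts at `ℓ` at time `0` is defined up to time `s`, lies in `S`, and is at `ℓ'` at time `s`
(`s` may be negative). -/
def ExpTo (F : Cotangent E M → ℝ) (S : Set (Cotangent E M)) (s : ℝ) (ℓ ℓ' : Cotangent E M) :
    Prop :=
  ∃ γ : ℝ → Cotangent E M, γ 0 = ℓ ∧ γ s = ℓ' ∧ MapsTo γ (uIcc 0 s) S ∧
    IsMIntegralCurveOn (I := cotModel E) γ (hamField F) (uIcc 0 s)

open Classical in
/-- `exp (s F) ℓ`, the point reached at time `s` by the integral curve of the Hamiltonian vector
field of `F` starting at `ℓ` (and `ℓ` itself if that curve is not defined up to time `s`). -/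
def hamExp (F : Cotangent E M → ℝ) (s : ℝ) (ℓ : Cotangent E M) : Cotangent E M :=
  if h : ∃ ℓ', ExpTo F univ s ℓ ℓ' then h.choose else ℓ

/-- The Lie derivative of a function along a vector field. -/
def lieD (f : (x : M) → TangentSpace 𝓘(ℝ, E) x) (a : M → ℝ) (x : M) : ℝ :=
  (mfderiv 𝓘(ℝ, E) 𝓘(ℝ, ℝ) a x : E →L[ℝ] ℝ) (f x)

end Cotangent

/-! ## The control problem and the reference extremal -/

section Problem

variable {E : Type*} [NormedAddCommGroup E] [NormedSpace ℝ E]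
  {M : Type*} [TopologicalSpace M] [ChartedSpace E M]

/-- The vector field `∑ i, u i • X i`. -/
def comb {m : ℕ} (X : Fin m → (x : M) → TangentSpace 𝓘(ℝ, E) x) (u : Fin m → ℝ) (x : M) :
    TangentSpace 𝓘(ℝ, E) x :=
  ∑ i, u i • X i x

/-- The admissible velocities at `x`: the convex hull of the vectors `X i x`. -/
def velocities {m : ℕ} (X : Fin m → (x : M) → TangentSpace 𝓘(ℝ, E) x) (x : M) :
    Set (TangentSpace 𝓘(ℝ, E) x) :=
  {v | ∃ u ∈ stdSimplex ℝ (Fin m), v = comb X u x}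

/-- `ξ` is an admissible trajectory on `[0, T]` starting at `x₀`. -/
def IsAdmissible {m : ℕ} (X : Fin m → (x : M) → TangentSpace 𝓘(ℝ, E) x) (x₀ : M) (T : ℝ)
    (ξ : ℝ → M) : Prop :=
  AbsContOn 𝓘(ℝ, E) ξ 0 T ∧ ξ 0 = x₀ ∧
    ∀ᵐ t ∂(volume.restrict (Icc 0 T)), ∃ v ∈ velocities X (ξ t), HasVelocityAt 𝓘(ℝ, E) ξ t v

/-- `ξr` is a strict strong local minimiser of the cost `φ (ξ T)`, where `φ` is a cost that is
defined on `O`: there is a neighbourhood `U` of the graph of `ξr` in `ℝ × M` (so small that `φ`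
is defined at the end point of each curve with graph in `U`) such that `ξr` costs strictly less
than every other admissible trajectory with graph in `U`. -/
def IsStrictStrongLocalMin {m : ℕ} (X : Fin m → (x : M) → TangentSpace 𝓘(ℝ, E) x) (x₀ : M)
    (T : ℝ) (O : Set M) (φ : M → ℝ) (ξr : ℝ → M) : Prop :=
  IsAdmissible X x₀ T ξr ∧
    ∃ U : Set (ℝ × M), IsOpen U ∧ (∀ t ∈ Icc 0 T, (t, ξr t) ∈ U) ∧ (∀ x, (T, x) ∈ U → x ∈ O) ∧
      ∀ ξ : ℝ → M, IsAdmissible X x₀ T ξ → (∀ t ∈ Icc 0 T, (t, ξ t) ∈ U) →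
        ¬ EqOn ξ ξr (Icc 0 T) → φ (ξr T) < φ (ξ T)

/-- The reference vector field: `h₁` before `τ₁`, `h₂` between `τ₁` and `τ₂`,
`h₂ + υ (t) (h₃ - h₂)` after `τ₂`. -/
def refField (h₁ h₂ h₃ : (x : M) → TangentSpace 𝓘(ℝ, E) x) (τ₁ τ₂ : ℝ) (υ : ℝ → ℝ) (t : ℝ)
    (x : M) : TangentSpace 𝓘(ℝ, E) x :=
  if t < τ₁ then h₁ x else if t < τ₂ then h₂ x else h₂ x + υ t • (h₃ x - h₂ x)

variable [IsManifold 𝓘(ℝ, E) ∞ M] [FiniteDimensional ℝ E]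

/-- Pontryagin maximum principle (normal form, free end point) for the trajectory `ξr` of the
time-dependent vector field `fr`, with adjoint curve `lam`. -/
structure PMP {m : ℕ} (X : Fin m → (x : M) → TangentSpace 𝓘(ℝ, E) x) (c : M → ℝ) (T : ℝ)
    (fr : ℝ → (x : M) → TangentSpace 𝓘(ℝ, E) x) (ξr : ℝ → M) (lam : ℝ → Cotangent E M) :
    Prop where
  proj : ∀ t ∈ Icc 0 T, (lam t).1 = ξr t
  adjoint : IsCaratheodorySolution (cotModel E) (fun t => hamField (lift (fr t))) lam 0 T
  final : lam T = differential (fun x => -c x) (ξr T)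
  maximum : ∀ t ∈ Icc 0 T,
    IsGreatest ((fun v => (lam t).2 v) '' velocities X (lam t).1) (lift (fr t) (lam t))

/-- Regularity along the two bang arcs: the reference field is the only maximising field. -/
def RegularBang {m : ℕ} (X : Fin m → (x : M) → TangentSpace 𝓘(ℝ, E) x)
    (h₁ h₂ : (x : M) → TangentSpace 𝓘(ℝ, E) x) (τ₁ τ₂ : ℝ) (lam : ℝ → Cotangent E M) : Prop :=
  (∀ t ∈ Ico 0 τ₁, ∀ u ∈ stdSimplex ℝ (Fin m), comb X u ≠ h₁ →
      lift (comb X u) (lam t) < lift h₁ (lam t)) ∧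
    ∀ t ∈ Ioo τ₁ τ₂, ∀ u ∈ stdSimplex ℝ (Fin m), comb X u ≠ h₂ →
      lift (comb X u) (lam t) < lift h₂ (lam t)

/-- At the covector `ℓ` the fields that maximise the Hamiltonian are those on the edge between
`h` and `k`: each other field of the system gives a strictly smaller value than every field of
the edge. -/
def OnlyEdgeMaximises {m : ℕ} (X : Fin m → (x : M) → TangentSpace 𝓘(ℝ, E) x)
    (h k : (x : M) → TangentSpace 𝓘(ℝ, E) x) (ℓ : Cotangent E M) : Prop :=
  ∀ u ∈ stdSimplex ℝ (Fin m), (∀ s ∈ Icc (0 : ℝ) 1, comb X u ≠ fun x => h x + s • (k x - h x)) →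
    ∀ a ∈ Icc (0 : ℝ) 1, lift (comb X u) ℓ < lift h ℓ + a * (lift k ℓ - lift h ℓ)

/-- Regularity at the two switching times: the inequalities `H₁₂ > 0` at the first one and
`H₂₃₂ > 0` at the second one. -/
def RegularSwitch (h₁ h₂ h₃ : (x : M) → TangentSpace 𝓘(ℝ, E) x) (τ₁ τ₂ : ℝ)
    (lam : ℝ → Cotangent E M) : Prop :=
  0 < poisson (lift h₁) (lift h₂) (lam τ₁) ∧
    0 < poisson (lift h₂) (poisson (lift h₃) (lift h₂)) (lam τ₂)

/-- Strong generalised Legendre condition on the singular arc: with `F₁` the Hamiltonian of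
`h₃ - h₂`, the bracket `{F₁, {H₂, F₁}}` is positive. -/
def StrongLegendre (h₂ h₃ : (x : M) → TangentSpace 𝓘(ℝ, E) x) (τ₂ T : ℝ)
    (lam : ℝ → Cotangent E M) : Prop :=
  ∀ t ∈ Icc τ₂ T, 0 < poisson (lift fun x => h₃ x - h₂ x)
    (poisson (lift h₂) (lift fun x => h₃ x - h₂ x)) (lam t)

/-- `ct` is the modified cost on the open neighbourhood `O` of `xf`. Either the second Lie
derivative of `c` along `f` is positive at `xf`, and `ct` is the (smooth) extension of `c` from
the set `{L_f c = 0}` that is constant along the integral curves of `f` in `O`; or `L_f c`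
vanishes on `O`, and `ct = c` there. -/
def IsModifiedCost (f : (x : M) → TangentSpace 𝓘(ℝ, E) x) (c : M → ℝ) (xf : M) (O : Set M)
    (ct : M → ℝ) : Prop :=
  IsOpen O ∧ xf ∈ O ∧
    ((0 < lieD f (lieD f c) xf ∧
        ContMDiffOn 𝓘(ℝ, E) 𝓘(ℝ, ℝ) ∞ ct O ∧
        (∀ x ∈ O, ∃ (r : ℝ) (γ : ℝ → M), lieD f c (γ 0) = 0 ∧ γ r = x ∧
          MapsTo γ (uIcc 0 r) O ∧ IsMIntegralCurveOn (I := 𝓘(ℝ, E)) γ f (uIcc 0 r)) ∧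
        (∀ (r : ℝ) (γ : ℝ → M), lieD f c (γ 0) = 0 →
          MapsTo γ (uIcc 0 r) O → IsMIntegralCurveOn (I := 𝓘(ℝ, E)) γ f (uIcc 0 r) →
          ct (γ r) = c (γ 0))) ∨
      ((∀ x ∈ O, lieD f c x = 0) ∧ EqOn ct c O))

/-! ## The overmaximised flow -/

/-- `θ` solves on `Os` the implicit problem `H₂₃ ∘ exp (θ F₁) = 0`, `θ = 0` where `H₂₃ = 0`;
here `Os` is an open neighbourhood of the singular arc and `F₁` is the Hamiltonian of
`h₃ - h₂`. -/
structure IsTheta (h₂ h₃ : (x : M) → TangentSpace 𝓘(ℝ, E) x) (τ₂ T : ℝ)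
    (lam : ℝ → Cotangent E M) (Os : Set (Cotangent E M)) (θ : Cotangent E M → ℝ) : Prop where
  isOpen : IsOpen Os
  arc : ∀ t ∈ Icc τ₂ T, lam t ∈ Os
  smooth : ContMDiffOn (cotModel E) 𝓘(ℝ, ℝ) ∞ θ Os
  solves : ∀ ℓ ∈ Os, ∃ ℓ', ExpTo (lift fun x => h₃ x - h₂ x) univ (θ ℓ) ℓ ℓ' ∧
    poisson (lift h₂) (lift h₃) ℓ' = 0
  zero : ∀ ℓ ∈ Os, poisson (lift h₂) (lift h₃) ℓ = 0 → θ ℓ = 0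

/-- `H₂ ∘ exp (θ F₁)`, with `F₁` the Hamiltonian of `h₃ - h₂`. -/
def tildeH (h₂ h₃ : (x : M) → TangentSpace 𝓘(ℝ, E) x) (θ : Cotangent E M → ℝ)
    (ℓ : Cotangent E M) : ℝ :=
  lift h₂ (hamExp (lift fun x => h₃ x - h₂ x) (θ ℓ) ℓ)

/-- The corrected second switching time `min (t₂, τ₂)`. -/
def switch₂ (τ₂ : ℝ) (t₂ : Cotangent E M → ℝ) (ℓ : Cotangent E M) : ℝ := min (t₂ ℓ) τ₂

/-- On the open neighbourhood `O₂` of `lam τ₂`, the functions `t₂` and `s₁` solve the implicit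
problems that define the switching times: `H₂₃` vanishes after time `t₂ - τ₂` along the flow of
`tildeH`, with `t₂ = τ₂` where `H₂₃ = 0`; and, after following `tildeH` from time `τ₂` to time
`switch₂ = min (t₂, τ₂)` and then `H₂` from there to time `s₁`, one has `H₂ = H₁`, with
`s₁ = τ₁` at `lam τ₂`. The neighbourhood is so small that `0 < s₁ < switch₂` on it. -/
structure AreSwitchingTimes (h₁ h₂ h₃ : (x : M) → TangentSpace 𝓘(ℝ, E) x) (τ₁ τ₂ : ℝ)
    (lam : ℝ → Cotangent E M) (Os : Set (Cotangent E M)) (θ : Cotangent E M → ℝ)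
    (O₂ : Set (Cotangent E M)) (t₂ s₁ : Cotangent E M → ℝ) : Prop where
  isOpen : IsOpen O₂
  mem : lam τ₂ ∈ O₂
  smooth_t₂ : ContMDiffOn (cotModel E) 𝓘(ℝ, ℝ) ∞ t₂ O₂
  solves_t₂ : ∀ ℓ ∈ O₂, ∃ ℓ', ExpTo (tildeH h₂ h₃ θ) Os (t₂ ℓ - τ₂) ℓ ℓ' ∧
    poisson (lift h₂) (lift h₃) ℓ' = 0
  eq_t₂ : ∀ ℓ ∈ O₂, poisson (lift h₂) (lift h₃) ℓ = 0 → t₂ ℓ = τ₂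
  continuous_s₁ : ContinuousOn s₁ O₂
  solves_s₁ : ∀ ℓ ∈ O₂, ∃ ℓ' ℓ'', ExpTo (tildeH h₂ h₃ θ) Os (switch₂ τ₂ t₂ ℓ - τ₂) ℓ ℓ' ∧
    ExpTo (lift h₂) univ (s₁ ℓ - switch₂ τ₂ t₂ ℓ) ℓ' ℓ'' ∧ lift h₂ ℓ'' = lift h₁ ℓ''
  eq_s₁ : s₁ (lam τ₂) = τ₁
  order : ∀ ℓ ∈ O₂, 0 < s₁ ℓ ∧ s₁ ℓ < switch₂ τ₂ t₂ ℓ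

/-- `Φ t ℓ`, for `t ∈ [0, T]` and `ℓ ∈ Λ`, is the overmaximised flow starting at time `T` at `ℓ`
and run backwards: it follows the Hamiltonian `tildeH + υ (t) F₁` on `[τ₂, T]` and then, with
`ℓ₂ = Φ τ₂ ℓ`, the Hamiltonian `tildeH` on `[switch₂ ℓ₂, τ₂]`, `H₂` on `[s₁ ℓ₂, switch₂ ℓ₂]`
and `H₁` on `[0, s₁ ℓ₂]`. -/
structure IsOvermaximisedFlow (h₁ h₂ h₃ : (x : M) → TangentSpace 𝓘(ℝ, E) x) (τ₂ T : ℝ)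
    (υ : ℝ → ℝ) (Os : Set (Cotangent E M)) (θ : Cotangent E M → ℝ) (O₂ : Set (Cotangent E M))
    (t₂ s₁ : Cotangent E M → ℝ) (Λ : Set (Cotangent E M))
    (Φ : ℝ → Cotangent E M → Cotangent E M) : Prop where
  final : ∀ ℓ ∈ Λ, Φ T ℓ = ℓ
  singular : ∀ ℓ ∈ Λ, MapsTo (fun t => Φ t ℓ) (Icc τ₂ T) Os ∧
    IsCaratheodorySolution (cotModel E)
      (fun t => hamField fun ℓ' => tildeH h₂ h₃ θ ℓ' + υ t * lift (fun x => h₃ x - h₂ x) ℓ')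
      (fun t => Φ t ℓ) τ₂ T
  switch_mem : ∀ ℓ ∈ Λ, Φ τ₂ ℓ ∈ O₂
  corrected : ∀ ℓ ∈ Λ, MapsTo (fun t => Φ t ℓ) (Icc (switch₂ τ₂ t₂ (Φ τ₂ ℓ)) τ₂) Os ∧
    IsMIntegralCurveOn (I := cotModel E) (fun t => Φ t ℓ) (hamField (tildeH h₂ h₃ θ))
      (Icc (switch₂ τ₂ t₂ (Φ τ₂ ℓ)) τ₂)
  bang₂ : ∀ ℓ ∈ Λ, IsMIntegralCurveOn (I := cotModel E) (fun t => Φ t ℓ) (hamField (lift h₂))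
    (Icc (s₁ (Φ τ₂ ℓ)) (switch₂ τ₂ t₂ (Φ τ₂ ℓ)))
  bang₁ : ∀ ℓ ∈ Λ, IsMIntegralCurveOn (I := cotModel E) (fun t => Φ t ℓ) (hamField (lift h₁))
    (Icc 0 (s₁ (Φ τ₂ ℓ)))

/-- The map `(t, ℓ) ∈ [0, T] × Λ ↦ (t, π (Φ t ℓ))` is Lipschitz invertible onto a neighbourhood of
the graph of `ξr` in `[0, T] × M`: it is a bijection from `[0, T] × Λ` onto such a neighbourhood
`U`, and its inverse is locally Lipschitz on `U`. -/
def ProjectedFlowInvertible (T : ℝ) (Φ : ℝ → Cotangent E M → Cotangent E M)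
    (Λ : Set (Cotangent E M)) (ξr : ℝ → M) : Prop :=
  ∃ (U : Set (ℝ × M)) (Ψ : ℝ × M → ℝ × Cotangent E M),
    U ⊆ Icc 0 T ×ˢ univ ∧
    (∀ t ∈ Icc 0 T, U ∈ 𝓝[Icc 0 T ×ˢ univ] (t, ξr t)) ∧
    BijOn (fun z : ℝ × Cotangent E M => (z.1, (Φ z.1 z.2).1)) (Icc 0 T ×ˢ Λ) U ∧
    InvOn Ψ (fun z : ℝ × Cotangent E M => (z.1, (Φ z.1 z.2).1)) (Icc 0 T ×ˢ Λ) U ∧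
    LocLipschitzOn (𝓘(ℝ, ℝ).prod 𝓘(ℝ, E)) (𝓘(ℝ, ℝ).prod (cotModel E)) Ψ U

end Problem

end

end BangBangSingular

namespace BangBangSingular

open Metric

noncomputable section

section CotangentCharts

variable {E : Type*} [NormedAddCommGroup E] [NormedSpace ℝ E]
  {M : Type*} [TopologicalSpace M] [ChartedSpace E M] [IsManifold 𝓘(ℝ, E) ∞ M]

/-- The canonical chart of the cotangent bundle induced by the preferred chart at `x₀`. -/
def cotChart (x₀ : M) : PartialEquiv (Cotangent E M) (E × (E →L[ℝ] ℝ)) :=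
  extChartAt (cotModel E) (⟨x₀, 0⟩ : Cotangent E M)

instance : IsManifold (cotModel E) ∞ (Cotangent E M) := inferInstance
instance isManifold_cotangent_one : IsManifold (cotModel E) 1 (Cotangent E M) :=
  IsManifold.of_le (n := ∞) (by exact_mod_cast le_top)

theorem extChartAt_cotangent (ℓ : Cotangent E M) :
    extChartAt (cotModel E) ℓ = cotChart ℓ.1 := by
  rw [cotChart, FiberBundle.extChartAt, FiberBundle.extChartAt]

theorem cotChart_source (x₀ : M) :
    (cotChart x₀ : PartialEquiv (Cotangent E M) _).source =
      {ℓ | ℓ.1 ∈ (extChartAt 𝓘(ℝ, E) x₀).source} := by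
  rw [cotChart, FiberBundle.extChartAt]
  ext ℓ
  simp only [hom_trivializationAt_source, mfld_simps]
  constructor
  · exact fun h => h.1.1
  · intro h
    refine ⟨⟨h, trivial⟩, ?_⟩
    simpa [hom_trivializationAt_apply] using h

theorem cotChart_target (x₀ : M) :
    (cotChart (E := E) x₀).target =
      (extChartAt 𝓘(ℝ, E) x₀).target ×ˢ univ := by
  rw [cotChart, FiberBundle.extChartAt_target]
  ext z
  simp [mfld_simps]
  intro h
  exact (chartAt E x₀).map_target h

theorem cotChart_fst (x₀ : M) (ℓ : Cotangent E M) :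
    (cotChart x₀ ℓ).1 = extChartAt 𝓘(ℝ, E) x₀ ℓ.1 := by
  rw [cotChart, FiberBundle.extChartAt]
  simp [hom_trivializationAt_apply, mfld_simps]

theorem cotChart_snd {x₀ : M} {ℓ : Cotangent E M}
    (h : ℓ.1 ∈ (extChartAt 𝓘(ℝ, E) x₀).source) (a : E) :
    (cotChart x₀ ℓ).2 a = ℓ.2 (tangentCoordChange 𝓘(ℝ, E) x₀ ℓ.1 ℓ.1 a) := by
  rw [extChartAt_source] at h
  rw [cotChart, FiberBundle.extChartAt]
  simp [hom_trivializationAt_apply, mfld_simps,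
    ContinuousLinearMap.inCoordinates, TangentBundle.symmL_trivializationAt_eq_core h]
  rfl

theorem snd_apply_eq {x₀ : M} {ℓ : Cotangent E M}
    (h : ℓ.1 ∈ (extChartAt 𝓘(ℝ, E) x₀).source) (v : TangentSpace 𝓘(ℝ, E) ℓ.1) :
    ℓ.2 v = (cotChart x₀ ℓ).2 (tangentCoordChange 𝓘(ℝ, E) ℓ.1 x₀ ℓ.1 v) := by
  rw [cotChart_snd h]
  have h1 : tangentCoordChange 𝓘(ℝ, E) x₀ ℓ.1 ℓ.1 (tangentCoordChange 𝓘(ℝ, E) ℓ.1 x₀ ℓ.1 v) = v :=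
    (tangentCoordChange_comp (v := (show E from v)) ⟨⟨mem_extChartAt_source _, h⟩,
      mem_extChartAt_source _⟩).trans (tangentCoordChange_self (mem_extChartAt_source _))
  exact (congrArg (fun w : E => ℓ.2 w) h1).symm

variable {H : Type*} [TopologicalSpace H] {E' : Type*} [NormedAddCommGroup E'] [NormedSpace ℝ E']
  {I : ModelWithCorners ℝ E' H} {N : Type*} [TopologicalSpace N] [ChartedSpace H N]
  [IsManifold I 1 N]

/-- The velocity of a curve in a fixed chart. -/
theorem hasDerivWithinAt_extChartAt_comp {γ : ℝ → N} {s : Set ℝ} {t : ℝ}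
    {v : TangentSpace I (γ t)} {x : N}
    (h : HasMFDerivWithinAt 𝓘(ℝ, ℝ) I γ s t ((1 : ℝ →L[ℝ] ℝ).smulRight v))
    (hx : γ t ∈ (extChartAt I x).source) :
    HasDerivWithinAt (fun t => extChartAt I x (γ t)) (tangentCoordChange I (γ t) x (γ t) v) s t := by
  have hx' := extChartAt_source I x ▸ hx
  have h1 := ((hasMFDerivAt_extChartAt (I := I) hx').comp_hasMFDerivWithinAt t h)
  rw [hasMFDerivWithinAt_iff_hasFDerivWithinAt] at h1
  rw [hasDerivWithinAt_iff_hasFDerivWithinAt]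
  refine h1.congr_fderiv ?_
  ext
  rw [mfderiv_chartAt_eq_tangentCoordChange hx']
  exact map_smul (tangentCoordChange I (γ t) x (γ t)) (1 : ℝ) (show E' from v)

/-- A curve given by its coordinates in a fixed chart. -/
theorem hasMFDerivWithinAt_extChartAt_symm_comp {c : ℝ → E'} {s : Set ℝ} {t : ℝ} {x : N} {w : E'}
    [BoundarylessManifold I N] [I.Boundaryless]
    (h : HasDerivWithinAt c w s t) (hx : c t ∈ (extChartAt I x).target) :
    HasMFDerivWithinAt 𝓘(ℝ, ℝ) I (fun t => (extChartAt I x).symm (c t)) s t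
      ((1 : ℝ →L[ℝ] ℝ).smulRight (show TangentSpace I ((extChartAt I x).symm (c t)) from
        tangentCoordChange I x ((extChartAt I x).symm (c t)) ((extChartAt I x).symm (c t)) w)) := by
  set y := (extChartAt I x).symm (c t) with hy
  have hyx : y ∈ (extChartAt I x).source := (extChartAt I x).map_target hx
  refine ⟨?_, ?_⟩
  · exact ((continuousOn_extChartAt_symm (I := I) x).continuousAt
      ((isOpen_extChartAt_target x).mem_nhds hx)).comp_continuousWithinAt h.continuousWithinAt
  · have h1 := hasFDerivWithinAt_tangentCoordChange (I := I) (x := x) (y := y) (z := y)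
      ⟨hyx, mem_extChartAt_source _⟩
    rw [ModelWithCorners.Boundaryless.range_eq_univ, hasFDerivWithinAt_univ,
      hy, (extChartAt I x).right_inv hx] at h1
    have h2 := h1.comp_hasDerivWithinAt t h
    rw [hasDerivWithinAt_iff_hasFDerivWithinAt] at h2
    simp only [writtenInExtChartAt, mfld_simps]
    exact h2

end CotangentCharts

section Symplectic

variable {E : Type*} [NormedAddCommGroup E] [NormedSpace ℝ E]

instance : NormedAddCommGroup (E × (E →L[ℝ] ℝ) →L[ℝ] ℝ) :=
  ContinuousLinearMap.toNormedAddCommGroup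

instance : SeminormedAddCommGroup (E × (E →L[ℝ] ℝ) →L[ℝ] ℝ) :=
  ContinuousLinearMap.toSeminormedAddCommGroup

instance : SeminormedAddGroup (E × (E →L[ℝ] ℝ) →L[ℝ] ℝ) :=
  SeminormedAddCommGroup.toSeminormedAddGroup

instance : NormedSpace ℝ (E × (E →L[ℝ] ℝ) →L[ℝ] ℝ) :=
  ContinuousLinearMap.toNormedSpace

/-- The canonical symplectic form on `E × E*`. -/
def sform (v w : E × (E →L[ℝ] ℝ)) : ℝ := v.2 w.1 - w.2 v.1

/-- A differentiable map that preserves the Liouville form is symplectic. -/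
theorem sform_fderiv_of_liouville {τ : E × (E →L[ℝ] ℝ) → E × (E →L[ℝ] ℝ)}
    {z : E × (E →L[ℝ] ℝ)} (hτ : ContDiffAt ℝ 2 τ z)
    (h : ∀ᶠ z' in 𝓝 z, ∀ w, (τ z').2 (fderiv ℝ τ z' w).1 = z'.2 w.1)
    (v w : E × (E →L[ℝ] ℝ)) :
    sform (fderiv ℝ τ z v) (fderiv ℝ τ z w) = sform v w := by
  have hτ1 : DifferentiableAt ℝ τ z := hτ.differentiableAt (by norm_num)
  have hτ2 : DifferentiableAt ℝ (fderiv ℝ τ) z :=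
    (hτ.fderiv_right (m := 1) (by norm_num)).differentiableAt (by norm_num)
  have key : ∀ v w : E × (E →L[ℝ] ℝ), (fderiv ℝ τ z v).2 (fderiv ℝ τ z w).1 +
      (τ z).2 (fderiv ℝ (fderiv ℝ τ) z v w).1 = v.2 w.1 := by
    intro v w
    have h1 : HasFDerivAt (fun z' => (τ z').2)
        ((ContinuousLinearMap.snd ℝ E (E →L[ℝ] ℝ)).comp (fderiv ℝ τ z)) z :=
      (ContinuousLinearMap.snd ℝ E (E →L[ℝ] ℝ)).hasFDerivAt.comp z hτ1.hasFDerivAt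
    have h2 : HasFDerivAt (fun z' => (fderiv ℝ τ z' w).1)
        ((ContinuousLinearMap.fst ℝ E (E →L[ℝ] ℝ)).comp
          ((fderiv ℝ (fderiv ℝ τ) z).flip w)) z := by
      refine (ContinuousLinearMap.fst ℝ E (E →L[ℝ] ℝ)).hasFDerivAt.comp z ?_
      have := hτ2.hasFDerivAt.clm_apply (hasFDerivAt_const w z)
      simpa using this
    have h3 := h1.clm_apply h2
    have h4 : HasFDerivAt (fun z' : E × (E →L[ℝ] ℝ) => z'.2 w.1)
        ((ContinuousLinearMap.apply ℝ ℝ w.1).comp (ContinuousLinearMap.snd ℝ E (E →L[ℝ] ℝ))) z :=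
      ((ContinuousLinearMap.apply ℝ ℝ w.1).comp
        (ContinuousLinearMap.snd ℝ E (E →L[ℝ] ℝ))).hasFDerivAt
    have h5 := h3.unique (h4.congr_of_eventuallyEq (h.mono fun z' hz' => hz' w))
    have h6 := congrArg (fun A => A v) h5
    simp at h6
    linarith
  have hs : fderiv ℝ (fderiv ℝ τ) z v w = fderiv ℝ (fderiv ℝ τ) z w v :=
    (hτ.isSymmSndFDerivAt (by simp)) v w
  have h1 := key v w
  have h2 := key w v
  rw [hs] at h1
  unfold sform
  linarith

variable [FiniteDimensional ℝ E]

/-- The symplectic gradient: the vector that represents a linear form through `sform`. -/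
def symGrad (L : E × (E →L[ℝ] ℝ) →L[ℝ] ℝ) : E × (E →L[ℝ] ℝ) :=
  (∑ i, L (0, LinearMap.toContinuousLinearMap ((Module.finBasis ℝ E).coord i)) •
      Module.finBasis ℝ E i, -L.comp (ContinuousLinearMap.inl ℝ E (E →L[ℝ] ℝ)))

theorem apply_symGrad_fst (L : E × (E →L[ℝ] ℝ) →L[ℝ] ℝ) (p : E →L[ℝ] ℝ) :
    p (symGrad L).1 = L (0, p) := by
  have hp : p = ∑ i, p (Module.finBasis ℝ E i) •
      LinearMap.toContinuousLinearMap ((Module.finBasis ℝ E).coord i) := by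
    ext y
    have hy : p y = p (∑ i, (Module.finBasis ℝ E).repr y i • Module.finBasis ℝ E i) := by
      rw [(Module.finBasis ℝ E).sum_repr y]
    rw [hy, map_sum]
    simp [mul_comm]
  have h2 : ∀ r : E →L[ℝ] ℝ, L ((0 : E), r) =
      (L.comp (ContinuousLinearMap.inr ℝ E (E →L[ℝ] ℝ))) r := fun r => rfl
  simp only [symGrad, h2]
  conv_rhs => rw [hp]
  simp [map_sum, mul_comm]

theorem symGrad_snd_apply (L : E × (E →L[ℝ] ℝ) →L[ℝ] ℝ) (a : E) :
    (symGrad L).2 a = -L (a, 0) := rfl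

theorem sform_symGrad (L : E × (E →L[ℝ] ℝ) →L[ℝ] ℝ) (v : E × (E →L[ℝ] ℝ)) :
    sform v (symGrad L) = L v := by
  rw [sform, apply_symGrad_fst, symGrad_snd_apply, sub_neg_eq_add, ← map_add]
  simp

theorem eq_symGrad {L : E × (E →L[ℝ] ℝ) →L[ℝ] ℝ} {u : E × (E →L[ℝ] ℝ)}
    (h : ∀ v, sform v u = L v) : u = symGrad L := by
  refine Prod.ext ?_ ?_
  · refine sub_eq_zero.1 (SeparatingDual.eq_zero_of_forall_dual_eq_zero (R := ℝ) fun p => ?_)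
    have := (h (0, p)).trans (sform_symGrad L (0, p)).symm
    simp only [sform] at this
    simp only [map_sub]
    simpa using sub_eq_zero.2 this
  · ext a
    have := (h (a, 0)).trans (sform_symGrad L (a, 0)).symm
    simp only [sform] at this
    simpa using this

theorem symGrad_sub (L L' : E × (E →L[ℝ] ℝ) →L[ℝ] ℝ) :
    symGrad (L - L') = symGrad L - symGrad L' :=
  (eq_symGrad fun v => by
    have h1 := sform_symGrad L v
    have h2 := sform_symGrad L' v
    simp only [sform] at *
    simp [← h1, ← h2]; ring).symm

theorem symGrad_add (L L' : E × (E →L[ℝ] ℝ) →L[ℝ] ℝ) :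
    symGrad (L + L') = symGrad L + symGrad L' :=
  (eq_symGrad fun v => by
    have h1 := sform_symGrad L v
    have h2 := sform_symGrad L' v
    simp only [sform] at *
    simp [← h1, ← h2]; ring).symm

theorem symGrad_smul (r : ℝ) (L : E × (E →L[ℝ] ℝ) →L[ℝ] ℝ) :
    symGrad (r • L) = r • symGrad L :=
  (eq_symGrad fun v => by
    have h1 := sform_symGrad L v
    simp only [sform] at *
    simp [← h1]; ring).symm

theorem norm_symGrad_le (L : E × (E →L[ℝ] ℝ) →L[ℝ] ℝ) : ‖symGrad L‖ ≤ ‖L‖ := by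
  refine norm_prod_le_iff.2 ⟨?_, ?_⟩
  · refine NormedSpace.norm_le_dual_bound ℝ _ (norm_nonneg _) fun p => ?_
    have : (p : E →L[ℝ] ℝ) (symGrad L).1 = L (0, p) := apply_symGrad_fst L p
    rw [this]
    refine (L.le_opNorm _).trans_eq ?_
    simp [Prod.norm_def]
  · refine ContinuousLinearMap.opNorm_le_bound _ (norm_nonneg _) fun a => ?_
    rw [symGrad_snd_apply, norm_neg]
    refine (L.le_opNorm _).trans_eq ?_
    simp [Prod.norm_def]

/-- The symplectic gradient as a continuous linear map. -/
def symGradL : (E × (E →L[ℝ] ℝ) →L[ℝ] ℝ) →L[ℝ] E × (E →L[ℝ] ℝ) :=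
  LinearMap.mkContinuous ⟨⟨symGrad, symGrad_add⟩, symGrad_smul⟩ 1 fun L => by
    simpa using norm_symGrad_le L

theorem symGradL_apply (L : E × (E →L[ℝ] ℝ) →L[ℝ] ℝ) : symGradL L = symGrad L := rfl

theorem symGrad_comp {D : E × (E →L[ℝ] ℝ) →L[ℝ] E × (E →L[ℝ] ℝ)}
    {D' : E × (E →L[ℝ] ℝ) →L[ℝ] E × (E →L[ℝ] ℝ)} (hD : ∀ v w, sform (D v) (D w) = sform v w)
    (hD' : ∀ v, D (D' v) = v) (L : E × (E →L[ℝ] ℝ) →L[ℝ] ℝ) :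
    D (symGrad L) = symGrad (L.comp D') :=
  eq_symGrad fun v => by
    conv_lhs => rw [← hD' v]
    rw [hD, sform_symGrad]
    rfl

end Symplectic

section ChartFields

variable {E : Type*} [NormedAddCommGroup E] [NormedSpace ℝ E]
  {M : Type*} [TopologicalSpace M] [ChartedSpace E M] [IsManifold 𝓘(ℝ, E) ∞ M]

theorem isOpen_cotChart_source (x₀ : M) :
    IsOpen (cotChart x₀ : PartialEquiv (Cotangent E M) _).source :=
  isOpen_extChartAt_source _

theorem isOpen_cotChart_target (x₀ : M) :
    IsOpen (cotChart (E := E) x₀).target :=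
  isOpen_extChartAt_target _

theorem continuousOn_cotChart (x₀ : M) :
    ContinuousOn (cotChart x₀) (cotChart x₀ : PartialEquiv (Cotangent E M) _).source :=
  continuousOn_extChartAt _

theorem continuousOn_cotChart_symm (x₀ : M) :
    ContinuousOn (cotChart x₀).symm (cotChart (E := E) x₀).target :=
  continuousOn_extChartAt_symm _

theorem mem_cotChart_source (ℓ : Cotangent E M) : ℓ ∈ (cotChart ℓ.1).source := by
  rw [← extChartAt_cotangent]; exact mem_extChartAt_source ℓ

theorem two_le_infty : (2 : WithTop ℕ∞) ≤ ∞ := WithTop.coe_le_coe.2 le_top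

theorem one_le_infty : (1 : WithTop ℕ∞) ≤ ∞ := WithTop.coe_le_coe.2 le_top

/-- The derivative of the change of coordinates from the preferred chart at `ℓ` to `cotChart x₀`. -/
def cotTrans (x₀ : M) (ℓ : Cotangent E M) :
    E × (E →L[ℝ] ℝ) →L[ℝ] E × (E →L[ℝ] ℝ) :=
  tangentCoordChange (cotModel E) ℓ ⟨x₀, 0⟩ ℓ

theorem hasFDerivAt_cotChart_trans' {ℓ₀ ℓ₁ ℓ : Cotangent E M}
    (h₁ : ℓ ∈ (cotChart ℓ₁.1).source) (h₀ : ℓ ∈ (cotChart ℓ₀.1).source) :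
    HasFDerivAt (fun z => cotChart ℓ₀.1 ((cotChart ℓ₁.1).symm z))
      (tangentCoordChange (cotModel E) ℓ₁ ℓ₀ ℓ) (cotChart ℓ₁.1 ℓ) := by
  have h := hasFDerivWithinAt_tangentCoordChange (I := cotModel E) (x := ℓ₁)
    (y := ℓ₀) (z := ℓ) ⟨by rwa [extChartAt_cotangent], by rwa [extChartAt_cotangent]⟩
  rw [ModelWithCorners.Boundaryless.range_eq_univ, hasFDerivWithinAt_univ,
    extChartAt_cotangent ℓ₁, extChartAt_cotangent ℓ₀] at h
  exact h

theorem hasFDerivAt_cotChart_trans {x₀ : M} {ℓ₁ ℓ : Cotangent E M}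
    (h₁ : ℓ ∈ (cotChart ℓ₁.1).source) (h₀ : ℓ ∈ (cotChart x₀).source) :
    HasFDerivAt (fun z => cotChart x₀ ((cotChart ℓ₁.1).symm z))
      (tangentCoordChange (cotModel E) ℓ₁ ⟨x₀, 0⟩ ℓ) (cotChart ℓ₁.1 ℓ) :=
  hasFDerivAt_cotChart_trans' (ℓ₀ := ⟨x₀, 0⟩) h₁ h₀

theorem tangentCoordChange_cotModel_fst {x₀ : M} {ℓ₁ ℓ : Cotangent E M}
    (h₁ : ℓ ∈ (cotChart ℓ₁.1).source) (h₀ : ℓ ∈ (cotChart x₀).source) (w : E × (E →L[ℝ] ℝ)) :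
    (tangentCoordChange (cotModel E) ℓ₁ ⟨x₀, 0⟩ ℓ w).1 =
      tangentCoordChange 𝓘(ℝ, E) ℓ₁.1 x₀ ℓ.1 w.1 := by
  have hd := (ContinuousLinearMap.fst ℝ E (E →L[ℝ] ℝ)).hasFDerivAt.comp _
    (hasFDerivAt_cotChart_trans h₁ h₀)
  have h1' := h₁
  have h0' := h₀
  rw [cotChart_source] at h1' h0'
  have hb := hasFDerivWithinAt_tangentCoordChange (I := 𝓘(ℝ, E)) (x := ℓ₁.1) (y := x₀) (z := ℓ.1)
    ⟨h1', h0'⟩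
  rw [ModelWithCorners.Boundaryless.range_eq_univ, hasFDerivWithinAt_univ, ← cotChart_fst] at hb
  have hc := hb.comp (cotChart ℓ₁.1 ℓ) (ContinuousLinearMap.fst ℝ E (E →L[ℝ] ℝ)).hasFDerivAt
  have heq : (fun z => (cotChart x₀ ((cotChart ℓ₁.1).symm z)).1) =ᶠ[𝓝 (cotChart ℓ₁.1 ℓ)]
      (fun z => extChartAt 𝓘(ℝ, E) x₀ ((extChartAt 𝓘(ℝ, E) ℓ₁.1).symm z.1)) := by
    filter_upwards [(isOpen_cotChart_target ℓ₁.1).mem_nhds ((cotChart ℓ₁.1).map_source h₁)]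
      with z hz
    rw [cotChart_fst]
    have hz1 := (cotChart ℓ₁.1).map_target hz
    rw [cotChart_source] at hz1
    have : (cotChart ℓ₁.1 ((cotChart ℓ₁.1).symm z)).1 = z.1 := by
      rw [(cotChart ℓ₁.1).right_inv hz]
    rw [cotChart_fst] at this
    rw [← this, (extChartAt 𝓘(ℝ, E) ℓ₁.1).left_inv hz1]
  exact congrArg (fun A => A w) (hd.unique (hc.congr_of_eventuallyEq heq))

theorem liouville_tangentCoordChange {x₀ : M} {ℓ₁ ℓ : Cotangent E M}
    (h₁ : ℓ ∈ (cotChart ℓ₁.1).source) (h₀ : ℓ ∈ (cotChart x₀).source) (w : E × (E →L[ℝ] ℝ)) :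
    (cotChart x₀ ℓ).2 (tangentCoordChange (cotModel E) ℓ₁ ⟨x₀, 0⟩ ℓ w).1 =
      (cotChart ℓ₁.1 ℓ).2 w.1 := by
  rw [tangentCoordChange_cotModel_fst h₁ h₀]
  rw [cotChart_source] at h₁ h₀
  rw [cotChart_snd h₀, cotChart_snd h₁]
  have := tangentCoordChange_comp (I := 𝓘(ℝ, E)) (w := ℓ₁.1) (x := x₀) (y := ℓ.1) (z := ℓ.1)
    (v := w.1) ⟨⟨h₁, h₀⟩, mem_extChartAt_source _⟩
  exact congrArg (fun w : E => ℓ.2 w) this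

theorem contDiffAt_cotChart_trans {x₀ : M} {ℓ₁ ℓ : Cotangent E M}
    (h₁ : ℓ ∈ (cotChart ℓ₁.1).source) (h₀ : ℓ ∈ (cotChart x₀).source) :
    ContDiffAt ℝ ∞ (fun z => cotChart x₀ ((cotChart ℓ₁.1).symm z)) (cotChart ℓ₁.1 ℓ) := by
  have h := contDiffOn_ext_coord_change (I := cotModel E) (n := ∞)
    (⟨x₀, 0⟩ : Cotangent E M) ℓ₁
  rw [extChartAt_cotangent ℓ₁, PartialEquiv.trans_source] at h
  refine h.contDiffAt ?_
  have hopen : IsOpen ((cotChart ℓ₁.1).target ∩ (cotChart ℓ₁.1).symm ⁻¹' (cotChart x₀).source) :=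
    (continuousOn_cotChart_symm ℓ₁.1).isOpen_inter_preimage (isOpen_cotChart_target (E := E) _)
      (isOpen_cotChart_source (E := E) _)
  refine hopen.mem_nhds ⟨(cotChart ℓ₁.1).map_source h₁, ?_⟩
  simpa [(cotChart ℓ₁.1).left_inv h₁] using h₀

theorem sform_cotTrans {x₀ : M} {ℓ : Cotangent E M} (h₀ : ℓ ∈ (cotChart x₀).source)
    (v w : E × (E →L[ℝ] ℝ)) :
    sform (cotTrans x₀ ℓ v) (cotTrans x₀ ℓ w) = sform v w := by
  have hs := mem_cotChart_source ℓ
  have hd := hasFDerivAt_cotChart_trans hs h₀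
  rw [cotTrans, ← hd.fderiv]
  refine sform_fderiv_of_liouville
    ((contDiffAt_cotChart_trans hs h₀).of_le two_le_infty) ?_ v w
  have hopen : IsOpen ((cotChart ℓ.1).target ∩ (cotChart ℓ.1).symm ⁻¹' (cotChart x₀).source) :=
    (continuousOn_cotChart_symm ℓ.1).isOpen_inter_preimage (isOpen_cotChart_target (E := E) _)
      (isOpen_cotChart_source (E := E) _)
  filter_upwards [hopen.mem_nhds ⟨(cotChart ℓ.1).map_source hs,
    by simpa [(cotChart ℓ.1).left_inv hs] using h₀⟩] with z hz w
  have h1 := (cotChart ℓ.1).map_target hz.1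
  have h2 := hasFDerivAt_cotChart_trans h1 hz.2
  have h3 := liouville_tangentCoordChange h1 hz.2 w
  rw [(cotChart ℓ.1).right_inv hz.1] at h2 h3
  rw [h2.fderiv]
  exact h3

theorem exists_cotTrans_inv {x₀ : M} {ℓ : Cotangent E M} (h₀ : ℓ ∈ (cotChart x₀).source) :
    let D' := tangentCoordChange (cotModel E) ⟨x₀, 0⟩ ℓ ℓ
    (∀ v, cotTrans x₀ ℓ (D' v) = v) ∧ (∀ v, D' (cotTrans x₀ ℓ v) = v) := by
  constructor
  · intro v
    exact (tangentCoordChange_comp (I := cotModel E) ⟨⟨h₀, mem_extChartAt_source _⟩, h₀⟩).trans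
      (tangentCoordChange_self h₀)
  · intro v
    exact (tangentCoordChange_comp (I := cotModel E) ⟨⟨mem_extChartAt_source _, h₀⟩,
      mem_extChartAt_source _⟩).trans (tangentCoordChange_self (mem_extChartAt_source _))

/-- The differential of a function in the coordinates of `cotChart x₀`. -/
theorem hasFDerivAt_comp_cotChart_symm {F : Cotangent E M → ℝ} {x₀ : M} {ℓ : Cotangent E M}
    (hF : MDifferentiableAt (cotModel E) 𝓘(ℝ, ℝ) F ℓ) (h₀ : ℓ ∈ (cotChart x₀).source) :
    HasFDerivAt (fun z => F ((cotChart x₀).symm z))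
      ((cotDiff F ℓ).comp (tangentCoordChange (cotModel E) ⟨x₀, 0⟩ ℓ ℓ)) (cotChart x₀ ℓ) := by
  have hs := mem_cotChart_source ℓ
  have h1 : HasFDerivAt (fun z => F ((cotChart ℓ.1).symm z)) (cotDiff F ℓ) (cotChart ℓ.1 ℓ) := by
    have h0 : HasFDerivWithinAt (writtenInExtChartAt (cotModel E) 𝓘(ℝ, ℝ) ℓ F) (cotDiff F ℓ)
      (range (cotModel E)) (extChartAt (cotModel E) ℓ ℓ) := hF.hasMFDerivAt.2
    rw [ModelWithCorners.Boundaryless.range_eq_univ, hasFDerivWithinAt_univ] at h0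
    rw [← extChartAt_cotangent]
    exact h0
  have h2 := hasFDerivAt_cotChart_trans' (ℓ₀ := ℓ) (ℓ₁ := ⟨x₀, 0⟩) h₀ hs
  have h3 : HasFDerivAt (fun z => F ((cotChart ℓ.1).symm z)) (cotDiff F ℓ)
      (cotChart ℓ.1 ((cotChart x₀).symm (cotChart x₀ ℓ))) := by
    rw [(cotChart x₀).left_inv h₀]; exact h1
  have h4 := HasFDerivAt.comp (g := fun z => F ((cotChart ℓ.1).symm z)) (cotChart x₀ ℓ) h3 h2
  refine h4.congr_of_eventuallyEq ?_
  have hopen : IsOpen ((cotChart x₀).target ∩ (cotChart x₀).symm ⁻¹' (cotChart ℓ.1).source) :=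
    (continuousOn_cotChart_symm x₀).isOpen_inter_preimage (isOpen_cotChart_target (E := E) _)
      (isOpen_cotChart_source (E := E) _)
  filter_upwards [hopen.mem_nhds ⟨(cotChart x₀).map_source h₀,
    by simpa [(cotChart x₀).left_inv h₀] using hs⟩] with z hz
  simp [(cotChart ℓ.1).left_inv hz.2]

theorem mdifferentiableAt_of_comp_cotChart_symm {F : Cotangent E M → ℝ} {x₀ : M}
    {ℓ : Cotangent E M} (h₀ : ℓ ∈ (cotChart x₀).source)
    (hF : DifferentiableAt ℝ (fun z => F ((cotChart x₀).symm z)) (cotChart x₀ ℓ)) :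
    MDifferentiableAt (cotModel E) 𝓘(ℝ, ℝ) F ℓ := by
  have h1 : MDifferentiableAt (cotModel E) 𝓘(ℝ, E × (E →L[ℝ] ℝ)) (cotChart x₀) ℓ :=
    mdifferentiableAt_extChartAt (by rwa [cotChart, extChartAt_source] at h₀)
  have h2 := hF.mdifferentiableAt.comp ℓ h1
  refine h2.congr_of_eventuallyEq ?_
  filter_upwards [(isOpen_cotChart_source x₀).mem_nhds h₀] with ℓ' hℓ'
  simp [(cotChart x₀).left_inv hℓ']

variable [FiniteDimensional ℝ E]

/-- The Hamiltonian vector field in the coordinates of `cotChart x₀`. -/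
theorem cotTrans_hamField {F : Cotangent E M → ℝ} {x₀ : M} {ℓ : Cotangent E M}
    (hF : MDifferentiableAt (cotModel E) 𝓘(ℝ, ℝ) F ℓ) (h₀ : ℓ ∈ (cotChart x₀).source) :
    cotTrans x₀ ℓ (hamField F ℓ) =
      symGrad (fderiv ℝ (fun z => F ((cotChart x₀).symm z)) (cotChart x₀ ℓ)) := by
  rw [(hasFDerivAt_comp_cotChart_symm hF h₀).fderiv]
  exact symGrad_comp (sform_cotTrans h₀) (exists_cotTrans_inv h₀).1 _

theorem poisson_eq_fderiv {F G : Cotangent E M → ℝ} {x₀ : M} {ℓ : Cotangent E M}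
    (hF : MDifferentiableAt (cotModel E) 𝓘(ℝ, ℝ) F ℓ)
    (hG : MDifferentiableAt (cotModel E) 𝓘(ℝ, ℝ) G ℓ) (h₀ : ℓ ∈ (cotChart x₀).source) :
    poisson F G ℓ = fderiv ℝ (fun z => G ((cotChart x₀).symm z)) (cotChart x₀ ℓ)
      (symGrad (fderiv ℝ (fun z => F ((cotChart x₀).symm z)) (cotChart x₀ ℓ))) := by
  rw [← cotTrans_hamField hF h₀, (hasFDerivAt_comp_cotChart_symm hG h₀).fderiv]
  exact congrArg (fun v : E × (E →L[ℝ] ℝ) => cotDiff G ℓ v)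
    ((exists_cotTrans_inv h₀).2 (hamField F ℓ)).symm

/-- A Hamiltonian curve in the coordinates of `cotChart x₀`. -/
theorem hasDerivWithinAt_cotChart_comp {F : Cotangent E M → ℝ} {x₀ : M} {γ : ℝ → Cotangent E M}
    {s : Set ℝ} {t : ℝ}
    (h : HasMFDerivWithinAt 𝓘(ℝ, ℝ) (cotModel E) γ s t
      ((1 : ℝ →L[ℝ] ℝ).smulRight (hamField F (γ t))))
    (hF : MDifferentiableAt (cotModel E) 𝓘(ℝ, ℝ) F (γ t)) (h₀ : γ t ∈ (cotChart x₀).source) :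
    HasDerivWithinAt (fun t => cotChart x₀ (γ t))
      (symGrad (fderiv ℝ (fun z => F ((cotChart x₀).symm z)) (cotChart x₀ (γ t)))) s t := by
  rw [← cotTrans_hamField hF h₀]
  exact hasDerivWithinAt_extChartAt_comp (I := cotModel E) h h₀

end ChartFields

section SmoothCoordinates

variable {E : Type*} [NormedAddCommGroup E] [NormedSpace ℝ E]
  {M : Type*} [TopologicalSpace M] [ChartedSpace E M] [IsManifold 𝓘(ℝ, E) ∞ M]

/-- A vector field in the coordinates of the preferred chart at `x₀`. -/
def coordField (x₀ : M) (f : (x : M) → TangentSpace 𝓘(ℝ, E) x) (q : E) : E :=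
  tangentCoordChange 𝓘(ℝ, E) ((extChartAt 𝓘(ℝ, E) x₀).symm q) x₀
    ((extChartAt 𝓘(ℝ, E) x₀).symm q) (f ((extChartAt 𝓘(ℝ, E) x₀).symm q))

theorem coordField_apply {x₀ x : M} (hx : x ∈ (extChartAt 𝓘(ℝ, E) x₀).source)
    (f : (x : M) → TangentSpace 𝓘(ℝ, E) x) :
    coordField x₀ f (extChartAt 𝓘(ℝ, E) x₀ x) = tangentCoordChange 𝓘(ℝ, E) x x₀ x (f x) := by
  rw [coordField, (extChartAt 𝓘(ℝ, E) x₀).left_inv hx]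

theorem contDiffOn_coordField {f : (x : M) → TangentSpace 𝓘(ℝ, E) x}
    (hf : ContMDiff 𝓘(ℝ, E) 𝓘(ℝ, E).tangent ∞ (fun x => (⟨x, f x⟩ : TangentBundle 𝓘(ℝ, E) M)))
    (x₀ : M) : ContDiffOn ℝ ∞ (coordField x₀ f) (extChartAt 𝓘(ℝ, E) x₀).target := by
  have h1 := ((trivializationAt E (TangentSpace 𝓘(ℝ, E)) x₀).contMDiffOn_section_baseSet_iff
    (IB := 𝓘(ℝ, E)) (n := ∞)).1 hf.contMDiffOn
  have h2 := h1.comp (contMDiffOn_extChartAt_symm (I := 𝓘(ℝ, E)) (n := ∞) x₀) fun q hq => by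
    have := (extChartAt 𝓘(ℝ, E) x₀).map_target hq
    rw [extChartAt_source] at this
    exact this
  exact contMDiffOn_iff_contDiffOn.1 h2

theorem comb_coordField {m : ℕ} (x₀ : M) (X : Fin m → (x : M) → TangentSpace 𝓘(ℝ, E) x)
    (u : Fin m → ℝ) (q : E) :
    coordField x₀ (comb X u) q = ∑ i, u i • coordField x₀ (X i) q := by
  simp only [coordField, comb]
  have h := map_sum (tangentCoordChange 𝓘(ℝ, E) ((extChartAt 𝓘(ℝ, E) x₀).symm q) x₀
    ((extChartAt 𝓘(ℝ, E) x₀).symm q))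
    (fun i => (show E from u i • X i ((extChartAt 𝓘(ℝ, E) x₀).symm q))) Finset.univ
  refine h.trans (Finset.sum_congr rfl fun i _ => ?_)
  exact map_smul _ (u i) (show E from X i ((extChartAt 𝓘(ℝ, E) x₀).symm q))

/-- A function on the cotangent bundle is smooth in all canonical charts. -/
def CotSmooth (F : Cotangent E M → ℝ) : Prop :=
  ∀ x₀ : M, ContDiffOn ℝ ∞ (fun z => F ((cotChart x₀).symm z))
    (cotChart (E := E) x₀).target

theorem CotSmooth.contDiffAt {F : Cotangent E M → ℝ} (hF : CotSmooth F) {x₀ : M}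
    {z : E × (E →L[ℝ] ℝ)} (hz : z ∈ (cotChart (E := E) x₀).target) :
    ContDiffAt ℝ ∞ (fun z => F ((cotChart x₀).symm z)) z :=
  (hF x₀).contDiffAt ((isOpen_cotChart_target x₀).mem_nhds hz)

theorem CotSmooth.mdifferentiableAt {F : Cotangent E M → ℝ} (hF : CotSmooth F)
    (ℓ : Cotangent E M) : MDifferentiableAt (cotModel E) 𝓘(ℝ, ℝ) F ℓ :=
  mdifferentiableAt_of_comp_cotChart_symm (mem_cotChart_source ℓ)
    ((hF.contDiffAt ((cotChart ℓ.1).map_source (mem_cotChart_source ℓ))).differentiableAt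
      (by simp))

theorem CotSmooth.sub {F G : Cotangent E M → ℝ} (hF : CotSmooth F) (hG : CotSmooth G) :
    CotSmooth fun ℓ => F ℓ - G ℓ := fun x₀ => (hF x₀).sub (hG x₀)

theorem CotSmooth.continuousOn {F : Cotangent E M → ℝ} (hF : CotSmooth F) : Continuous F := by
  refine continuous_iff_continuousAt.2 fun ℓ => ?_
  exact (hF.mdifferentiableAt ℓ).continuousAt

variable [FiniteDimensional ℝ E]

theorem lift_eq_coord {x₀ : M} {ℓ : Cotangent E M} (h : ℓ ∈ (cotChart x₀).source)
    (f : (x : M) → TangentSpace 𝓘(ℝ, E) x) :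
    lift f ℓ = (cotChart x₀ ℓ).2 (coordField x₀ f (cotChart x₀ ℓ).1) := by
  rw [cotChart_source] at h
  rw [cotChart_fst, coordField_apply h, lift, snd_apply_eq h]

theorem lift_cotChart_symm {x₀ : M} {z : E × (E →L[ℝ] ℝ)}
    (hz : z ∈ (cotChart (E := E) x₀).target)
    (f : (x : M) → TangentSpace 𝓘(ℝ, E) x) :
    lift f ((cotChart x₀).symm z) = z.2 (coordField x₀ f z.1) := by
  rw [lift_eq_coord ((cotChart x₀).map_target hz), (cotChart x₀).right_inv hz]

theorem cotSmooth_lift {f : (x : M) → TangentSpace 𝓘(ℝ, E) x}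
    (hf : ContMDiff 𝓘(ℝ, E) 𝓘(ℝ, E).tangent ∞ (fun x => (⟨x, f x⟩ : TangentBundle 𝓘(ℝ, E) M))) :
    CotSmooth (lift f) := by
  intro x₀
  have h : ContDiffOn ℝ ∞ (fun z : E × (E →L[ℝ] ℝ) => z.2 (coordField x₀ f z.1))
      (cotChart (E := E) x₀).target := by
    refine contDiffOn_snd.clm_apply ((contDiffOn_coordField hf x₀).comp contDiffOn_fst ?_)
    intro z hz
    rw [cotChart_target] at hz
    exact hz.1
  exact h.congr fun z hz => lift_cotChart_symm hz f

theorem lift_sub (f g : (x : M) → TangentSpace 𝓘(ℝ, E) x) (ℓ : Cotangent E M) :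
    lift (fun x => f x - g x) ℓ = lift f ℓ - lift g ℓ := map_sub _ _ _

theorem CotSmooth.poisson_cotChart_symm {F G : Cotangent E M → ℝ} (hF : CotSmooth F)
    (hG : CotSmooth G) {x₀ : M} {z : E × (E →L[ℝ] ℝ)}
    (hz : z ∈ (cotChart (E := E) x₀).target) :
    poisson F G ((cotChart x₀).symm z) = fderiv ℝ (fun z => G ((cotChart x₀).symm z)) z
      (symGrad (fderiv ℝ (fun z => F ((cotChart x₀).symm z)) z)) := by
  rw [poisson_eq_fderiv (hF.mdifferentiableAt _) (hG.mdifferentiableAt _)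
    ((cotChart x₀).map_target hz), (cotChart x₀).right_inv hz]

theorem CotSmooth.poisson {F G : Cotangent E M → ℝ} (hF : CotSmooth F)
    (hG : CotSmooth G) : CotSmooth (poisson F G) := by
  intro x₀
  have ho := isOpen_cotChart_target (E := E) x₀
  have h : ContDiffOn ℝ ∞ (fun z => fderiv ℝ (fun z => G ((cotChart x₀).symm z)) z
      (symGradL (fderiv ℝ (fun z => F ((cotChart x₀).symm z)) z)))
      (cotChart (E := E) x₀).target :=
    ((hG x₀).fderiv_of_isOpen ho (by simp)).clm_apply
      (symGradL.contDiff.comp_contDiffOn ((hF x₀).fderiv_of_isOpen ho (by simp)))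
  exact h.congr fun z hz => hF.poisson_cotChart_symm hG hz

theorem poisson_sub_right {F G G' : Cotangent E M → ℝ}
    (hG : CotSmooth G) (hG' : CotSmooth G') (ℓ : Cotangent E M) :
    poisson F (fun ℓ => G ℓ - G' ℓ) ℓ = poisson F G ℓ - poisson F G' ℓ := by
  have := mfderiv_sub (hG.mdifferentiableAt ℓ) (hG'.mdifferentiableAt ℓ)
  exact congrArg (fun A : E × (E →L[ℝ] ℝ) →L[ℝ] ℝ => A (hamField F ℓ)) this

theorem poisson_neg_symm {F G : Cotangent E M → ℝ} (ℓ : Cotangent E M) :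
    poisson F G ℓ = -poisson G F ℓ := by
  have h1 := symplecticForm_hamField F ℓ (hamField G ℓ)
  have h2 := symplecticForm_hamField G ℓ (hamField F ℓ)
  have h3 : symplecticForm ℓ (hamField G ℓ) (hamField F ℓ) =
    -symplecticForm ℓ (hamField F ℓ) (hamField G ℓ) := by simp [symplecticForm]
  unfold BangBangSingular.poisson
  linarith

end SmoothCoordinates

section AbsolutelyContinuous

theorem absolutelyContinuous_comp_lipschitz {X Y : Type*} [PseudoMetricSpace X]
    [PseudoMetricSpace Y] {f : ℝ → X} {g : X → Y} {K : ℝ≥0} {S : Set X} {a b : ℝ}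
    (hf : AbsolutelyContinuousOnInterval f a b) (hg : LipschitzOnWith K g S)
    (hS : MapsTo f (uIcc a b) S) : AbsolutelyContinuousOnInterval (fun t => g (f t)) a b := by
  rw [absolutelyContinuousOnInterval_iff] at hf ⊢
  intro ε hε
  obtain ⟨δ, hδ, h⟩ := hf (ε / (K + 1)) (by positivity)
  refine ⟨δ, hδ, fun P hP hPδ => ?_⟩
  have h1 := h P hP hPδ
  rw [lt_div_iff₀ (by positivity)] at h1
  refine lt_of_le_of_lt ?_ h1
  rw [Finset.sum_mul]
  refine Finset.sum_le_sum fun i hi => ?_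
  have h2 := hg.dist_le_mul _ (hS (hP.1 i hi).1) _ (hS (hP.1 i hi).2)
  have h3 : 0 ≤ dist (f (P.2 i).1) (f (P.2 i).2) := dist_nonneg
  nlinarith

theorem lipschitzOnWith_of_norm_sub_le {F : Type*} [NormedAddCommGroup F] {f : ℝ → F} {a b C : ℝ}
    (h : ∀ s ∈ Icc a b, ∀ t ∈ Icc a b, ‖f s - f t‖ ≤ C * |s - t|) :
    LipschitzOnWith C.toNNReal f (Icc a b) := by
  refine LipschitzOnWith.of_dist_le_mul fun s hs t ht => ?_
  rw [dist_eq_norm, Real.dist_eq]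
  exact (h s hs t ht).trans (by gcongr; exact Real.le_coe_toNNReal C)

theorem absolutelyContinuous_of_norm_sub_le {F : Type*} [NormedAddCommGroup F] [NormedSpace ℝ F]
    {f : ℝ → F} {a b C : ℝ} (hab : a ≤ b)
    (h : ∀ s ∈ Icc a b, ∀ t ∈ Icc a b, ‖f s - f t‖ ≤ C * |s - t|) :
    AbsolutelyContinuousOnInterval f a b := by
  refine LipschitzOnWith.absolutelyContinuousOnInterval (K := C.toNNReal) ?_
  rw [uIcc_of_le hab]
  exact lipschitzOnWith_of_norm_sub_le h

/-- The increment of an absolutely continuous curve is bounded by the integral of any bound of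
its speed. -/
theorem norm_sub_le_integral_of_ac {F : Type*} [NormedAddCommGroup F] [NormedSpace ℝ F]
    {f : ℝ → F} {g : ℝ → ℝ} {a b : ℝ} (hab : a ≤ b) (hf : AbsolutelyContinuousOnInterval f a b)
    (hg : IntervalIntegrable g volume a b)
    (h : ∀ᵐ t ∂volume.restrict (Icc a b), ∃ v, HasDerivAt f v t ∧ ‖v‖ ≤ g t) :
    ‖f b - f a‖ ≤ ∫ t in a..b, g t := by
  obtain ⟨φ, hφ1, hφ2⟩ := exists_dual_vector'' ℝ (f b - f a)
  have hac : AbsolutelyContinuousOnInterval (fun t => φ (f t)) a b :=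
    absolutelyContinuous_comp_lipschitz hf (φ.lipschitz.lipschitzOnWith (s := univ))
      (mapsTo_univ _ _)
  have h1 := hac.integral_deriv_eq_sub
  have h2 : ‖∫ t in a..b, deriv (fun t => φ (f t)) t‖ ≤ ∫ t in a..b, g t := by
    refine intervalIntegral.norm_integral_le_of_norm_le hab ?_ hg
    rw [ae_restrict_iff' measurableSet_Icc] at h
    filter_upwards [h] with t ht hts
    obtain ⟨v, hv, hvg⟩ := ht (Ioc_subset_Icc_self hts)
    have : HasDerivAt (fun t => φ (f t)) (φ v) t := φ.hasFDerivAt.comp_hasDerivAt t hv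
    rw [this.deriv]
    calc ‖φ v‖ ≤ ‖φ‖ * ‖v‖ := φ.le_opNorm v
      _ ≤ 1 * ‖v‖ := by gcongr
      _ ≤ g t := by simpa using hvg
  rw [h1, ← map_sub, hφ2] at h2
  simpa using h2

theorem norm_sub_le_of_ac {F : Type*} [NormedAddCommGroup F] [NormedSpace ℝ F]
    {f : ℝ → F} {a b C : ℝ} (hab : a ≤ b) (hf : AbsolutelyContinuousOnInterval f a b)
    (h : ∀ᵐ t ∂volume.restrict (Icc a b), ∃ v, HasDerivAt f v t ∧ ‖v‖ ≤ C) :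
    ‖f b - f a‖ ≤ C * (b - a) := by
  have := norm_sub_le_integral_of_ac (g := fun _ => C) hab hf (by simp) h
  simpa [mul_comm] using this

theorem ae_restrict_Icc_mono {p : ℝ → Prop} {a b s t : ℝ}
    (h : ∀ᵐ u ∂volume.restrict (Icc a b), p u) (hs : a ≤ s) (ht : t ≤ b) :
    ∀ᵐ u ∂volume.restrict (Icc s t), p u :=
  ae_mono (Measure.restrict_mono (Icc_subset_Icc hs ht) le_rfl) h

theorem norm_sub_le_abs_of_ac {F : Type*} [NormedAddCommGroup F] [NormedSpace ℝ F]
    {f : ℝ → F} {a b C : ℝ} (hf : AbsolutelyContinuousOnInterval f a b)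
    (h : ∀ᵐ t ∂volume.restrict (Icc a b), ∃ v, HasDerivAt f v t ∧ ‖v‖ ≤ C) :
    ∀ s ∈ Icc a b, ∀ t ∈ Icc a b, ‖f s - f t‖ ≤ C * |s - t| := by
  have key : ∀ s ∈ Icc a b, ∀ t ∈ Icc a b, s ≤ t → ‖f t - f s‖ ≤ C * (t - s) := by
    intro s hs t ht hst
    refine norm_sub_le_of_ac hst (hf.mono ?_) (ae_restrict_Icc_mono h hs.1 ht.2)
    rw [uIcc_of_le hst, uIcc_of_le (hs.1.trans hs.2)]
    exact Icc_subset_Icc hs.1 ht.2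
  intro s hs t ht
  rcases le_total s t with hst | hst
  · rw [norm_sub_rev, abs_sub_comm, abs_of_nonneg (sub_nonneg.2 hst)]
    exact key s hs t ht hst
  · rw [abs_of_nonneg (sub_nonneg.2 hst)]
    exact key t ht s hs hst

/-- A bound of an increment when the speed is bounded by `c₀`, except on `[α, β]` where it is
bounded by `c₀ + c₁`. -/
theorem norm_sub_le_of_ac_two {F : Type*} [NormedAddCommGroup F] [NormedSpace ℝ F]
    {f : ℝ → F} {a b c₀ c₁ α β : ℝ} (hf : AbsolutelyContinuousOnInterval f a b)
    (hαβ : α ≤ β) (hc₁ : 0 ≤ c₁)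
    (h : ∀ᵐ t ∂volume.restrict (Icc a b), ∃ v, HasDerivAt f v t ∧ ‖v‖ ≤ c₀ + c₁ ∧
      (t ∉ Icc α β → ‖v‖ ≤ c₀)) :
    ∀ s ∈ Icc a b, ∀ t ∈ Icc a b, ‖f s - f t‖ ≤ c₀ * |s - t| + c₁ * (β - α) := by
  classical
  have key : ∀ s ∈ Icc a b, ∀ t ∈ Icc a b, s ≤ t → ‖f t - f s‖ ≤ c₀ * (t - s) + c₁ * (β - α) := by
    intro s hs t ht hst
    have hi : IntegrableOn ((Icc α β).indicator fun _ => c₁) univ volume := by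
      rw [integrableOn_univ, integrable_indicator_iff measurableSet_Icc]
      simp
    have hac : AbsolutelyContinuousOnInterval f s t := hf.mono (by
      rw [uIcc_of_le hst, uIcc_of_le (hs.1.trans hs.2)]
      exact Icc_subset_Icc hs.1 ht.2)
    have hi' : IntervalIntegrable ((Icc α β).indicator fun _ => c₁) volume s t :=
      (integrableOn_univ.1 hi).intervalIntegrable
    have h1 := norm_sub_le_integral_of_ac (g := fun u => c₀ + (Icc α β).indicator (fun _ => c₁) u)
      hst hac (intervalIntegrable_const.add hi') (by
        filter_upwards [ae_restrict_Icc_mono h hs.1 ht.2] with u ⟨v, hv, h1, h2⟩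
        refine ⟨v, hv, ?_⟩
        by_cases hu : u ∈ Icc α β
        · simpa [hu] using h1
        · simpa [hu] using h2 hu)
    refine h1.trans ?_
    rw [intervalIntegral.integral_add intervalIntegrable_const hi']
    have h2 : ∫ u in s..t, (Icc α β).indicator (fun _ => c₁) u ≤ c₁ * (β - α) := by
      rw [intervalIntegral.integral_of_le hst]
      refine (setIntegral_mono_set hi (ae_of_all _ fun u => ?_)
        (subset_univ _).eventuallyLE).trans ?_
      · exact indicator_nonneg (fun _ _ => hc₁) u
      · rw [setIntegral_univ, integral_indicator measurableSet_Icc]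
        simp [hαβ, mul_comm]
    simp only [intervalIntegral.integral_const, smul_eq_mul]
    linarith
  intro s hs t ht
  rcases le_total s t with hst | hst
  · rw [norm_sub_rev, abs_sub_comm, abs_of_nonneg (sub_nonneg.2 hst)]
    exact key s hs t ht hst
  · rw [abs_of_nonneg (sub_nonneg.2 hst)]
    exact key t ht s hs hst

theorem norm_sub_le_glue {F : Type*} [NormedAddCommGroup F] {f : ℝ → F} {a m b C : ℝ}
    (h1 : ∀ s ∈ Icc a m, ∀ t ∈ Icc a m, ‖f s - f t‖ ≤ C * |s - t|)
    (h2 : ∀ s ∈ Icc m b, ∀ t ∈ Icc m b, ‖f s - f t‖ ≤ C * |s - t|) :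
    ∀ s ∈ Icc a b, ∀ t ∈ Icc a b, ‖f s - f t‖ ≤ C * |s - t| := by
  have key : ∀ s ∈ Icc a b, ∀ t ∈ Icc a b, s ≤ m → m ≤ t → ‖f s - f t‖ ≤ C * |s - t| := by
    intro s hs t ht hsm hmt
    have e1 := h1 s ⟨hs.1, hsm⟩ m ⟨hs.1.trans hsm, le_rfl⟩
    have e2 := h2 m ⟨le_rfl, hmt.trans ht.2⟩ t ⟨hmt, ht.2⟩
    have e3 : f s - f t = (f s - f m) + (f m - f t) := by abel
    rw [e3]
    refine (norm_add_le _ _).trans ((add_le_add e1 e2).trans_eq ?_)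
    rw [abs_sub_comm, abs_of_nonneg (sub_nonneg.2 hsm), abs_sub_comm,
      abs_of_nonneg (sub_nonneg.2 hmt), abs_sub_comm, abs_of_nonneg (by linarith)]
    ring
  intro s hs t ht
  rcases le_total s m with hs' | hs' <;> rcases le_total t m with ht' | ht'
  · exact h1 s ⟨hs.1, hs'⟩ t ⟨ht.1, ht'⟩
  · exact key s hs t ht hs' ht'
  · rw [norm_sub_rev, abs_sub_comm]
    exact key t ht s hs ht' hs'
  · exact h2 s ⟨hs', hs.2⟩ t ⟨ht', ht.2⟩

end AbsolutelyContinuous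

section HamiltonianCurves

variable {E : Type*} [NormedAddCommGroup E] [NormedSpace ℝ E]

/-- A function on `E × E*` that is homogeneous of degree one in the second variable and has a
bounded Lipschitz differential on `D`. -/
structure NiceHam (h : E × (E →L[ℝ] ℝ) → ℝ) (D : Set (E × (E →L[ℝ] ℝ))) (C : ℝ) : Prop where
  diff : ∀ z ∈ D, DifferentiableAt ℝ h z
  bound : ∀ z ∈ D, ‖fderiv ℝ h z‖ ≤ C
  lip : ∀ z ∈ D, ∀ z' ∈ D, ‖fderiv ℝ h z' - fderiv ℝ h z‖ ≤ C * ‖z' - z‖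
  euler : ∀ z ∈ D, fderiv ℝ h z (0, z.2) = h z

variable {D : Set (E × (E →L[ℝ] ℝ))} {C C' : ℝ} {h h' : E × (E →L[ℝ] ℝ) → ℝ}

theorem NiceHam.mono {D' : Set (E × (E →L[ℝ] ℝ))} (H : NiceHam h D C) (hD : D' ⊆ D)
    (hC : C ≤ C') : NiceHam h D' C' where
  diff z hz := H.diff z (hD hz)
  bound z hz := (H.bound z (hD hz)).trans hC
  lip z hz z' hz' := (H.lip z (hD hz) z' (hD hz')).trans (by gcongr)
  euler z hz := H.euler z (hD hz)

theorem NiceHam.add_smul (H : NiceHam h D C) (H' : NiceHam h' D C') {w : ℝ} (hw : |w| ≤ 1) :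
    NiceHam (fun z => h z + w * h' z) D (C + C') := by
  have hf : ∀ z ∈ D, fderiv ℝ (fun z => h z + w * h' z) z = fderiv ℝ h z + w • fderiv ℝ h' z := by
    intro z hz
    exact ((H.diff z hz).hasFDerivAt.add ((H'.diff z hz).hasFDerivAt.const_mul w)).fderiv
  refine ⟨fun z hz => (H.diff z hz).add ((H'.diff z hz).const_mul w), fun z hz => ?_,
    fun z hz z' hz' => ?_, fun z hz => ?_⟩
  · rw [hf z hz]
    refine (norm_add_le _ _).trans (add_le_add (H.bound z hz) ?_)
    rw [norm_smul, Real.norm_eq_abs]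
    exact (mul_le_of_le_one_left (norm_nonneg _) hw).trans (H'.bound z hz)
  · rw [hf z hz, hf z' hz']
    have e : fderiv ℝ h z' + w • fderiv ℝ h' z' - (fderiv ℝ h z + w • fderiv ℝ h' z) =
      (fderiv ℝ h z' - fderiv ℝ h z) + w • (fderiv ℝ h' z' - fderiv ℝ h' z) := by
      rw [smul_sub]; abel
    rw [e, add_mul]
    refine (norm_add_le _ _).trans (add_le_add (H.lip z hz z' hz') ?_)
    rw [norm_smul, Real.norm_eq_abs]
    exact (mul_le_of_le_one_left (norm_nonneg _) hw).trans (H'.lip z hz z' hz')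
  · rw [hf z hz]
    simp [H.euler z hz, H'.euler z hz]

theorem NiceHam.taylor (H : NiceHam h D C) (hD : Convex ℝ D) {z z' : E × (E →L[ℝ] ℝ)}
    (hz : z ∈ D) (hz' : z' ∈ D) :
    |h z' - h z - fderiv ℝ h z (z' - z)| ≤ C * ‖z' - z‖ ^ 2 := by
  have hseg : segment ℝ z z' ⊆ D := hD.segment_subset hz hz'
  have h1 := (convex_segment z z').norm_image_sub_le_of_norm_hasFDerivWithin_le
    (f := fun y => h y - fderiv ℝ h z y) (f' := fun y => fderiv ℝ h y - fderiv ℝ h z)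
    (C := C * ‖z' - z‖) (fun y hy => ((H.diff y (hseg hy)).hasFDerivAt.sub
      (fderiv ℝ h z).hasFDerivAt).hasFDerivWithinAt) (fun y hy => ?_)
    (left_mem_segment ℝ z z') (right_mem_segment ℝ z z')
  · rw [Real.norm_eq_abs] at h1
    rw [sq, ← mul_assoc]
    convert h1 using 2
    rw [map_sub]; ring
  · have hC : 0 ≤ C := (norm_nonneg _).trans (H.bound z hz)
    refine (H.lip z hz y (hseg hy)).trans ?_
    gcongr
    have := norm_sub_le_of_mem_segment hy
    simpa using this

theorem NiceHam.lipschitz (H : NiceHam h D C) (hD : Convex ℝ D) {z z' : E × (E →L[ℝ] ℝ)}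
    (hz : z ∈ D) (hz' : z' ∈ D) : |h z' - h z| ≤ C * ‖z' - z‖ :=
  hD.norm_image_sub_le_of_norm_fderiv_le H.diff H.bound hz hz'

theorem exists_niceHam_ball {z₀ : E × (E →L[ℝ] ℝ)} (hh : ContDiffAt ℝ 2 h z₀)
    (heul : ∀ᶠ z in 𝓝 z₀, fderiv ℝ h z (0, z.2) = h z) :
    ∃ r > 0, ∃ C, NiceHam h (ball z₀ r) C := by
  have h1 : ∀ᶠ z in 𝓝 z₀, DifferentiableAt ℝ h z :=
    (hh.eventually (by simp)).mono fun z hz => hz.differentiableAt (by norm_num)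
  have h2 : ContDiffAt ℝ 1 (fderiv ℝ h) z₀ := hh.fderiv_right (by norm_num)
  obtain ⟨K, t, ht, hK⟩ := h2.exists_lipschitzOnWith
  have h3 : ∀ᶠ z in 𝓝 z₀, ‖fderiv ℝ h z‖ < ‖fderiv ℝ h z₀‖ + 1 :=
    h2.continuousAt.norm.eventually_lt continuousAt_const (by linarith)
  obtain ⟨r, hr, hb⟩ := eventually_nhds_iff_ball.1 (h1.and ((heul.and h3).and ht))
  refine ⟨r, hr, max (K : ℝ) (‖fderiv ℝ h z₀‖ + 1), fun z hz => (hb z hz).1,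
    fun z hz => (hb z hz).2.1.2.le.trans (le_max_right _ _), fun z hz z' hz' => ?_,
    fun z hz => (hb z hz).2.1.1⟩
  have := hK.dist_le_mul z' (hb z' hz').2.2 z (hb z hz).2.2
  rw [dist_eq_norm, dist_eq_norm] at this
  exact this.trans (by gcongr; exact le_max_left _ _)

variable [FiniteDimensional ℝ E]

/-- `z` is a Lipschitz solution on `[a, b]` of the Hamiltonian equations of the time-dependent
Hamiltonian `h`. -/
structure HamCurve (h : ℝ → E × (E →L[ℝ] ℝ) → ℝ) (z : ℝ → E × (E →L[ℝ] ℝ)) (a b C : ℝ) :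
    Prop where
  lip : ∀ s ∈ Icc a b, ∀ t ∈ Icc a b, ‖z s - z t‖ ≤ C * |s - t|
  deriv : ∀ᵐ t ∂volume.restrict (Icc a b), HasDerivAt z (symGrad (fderiv ℝ (h t) (z t))) t

theorem HamCurve.mono {h : ℝ → E × (E →L[ℝ] ℝ) → ℝ} {z : ℝ → E × (E →L[ℝ] ℝ)} {a b a' b' C : ℝ}
    (H : HamCurve h z a b C) (ha : a ≤ a') (hb : b' ≤ b) : HamCurve h z a' b' C :=
  ⟨fun s hs t ht => H.lip s (Icc_subset_Icc ha hb hs) t (Icc_subset_Icc ha hb ht),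
    ae_restrict_Icc_mono H.deriv ha hb⟩

theorem HamCurve.glue {h : ℝ → E × (E →L[ℝ] ℝ) → ℝ} {z : ℝ → E × (E →L[ℝ] ℝ)} {a m b C : ℝ}
    (H : HamCurve h z a m C) (H' : HamCurve h z m b C) : HamCurve h z a b C := by
  refine ⟨norm_sub_le_glue H.lip H'.lip, ?_⟩
  have h1 := ae_restrict_union_iff (μ := volume) (Icc a m) (Icc m b)
    fun t => HasDerivAt z (symGrad (fderiv ℝ (h t) (z t))) t
  have h2 := h1.2 ⟨H.deriv, H'.deriv⟩
  exact ae_mono (Measure.restrict_mono Icc_subset_Icc_union_Icc le_rfl) h2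

theorem HamCurve.congr {h h' : ℝ → E × (E →L[ℝ] ℝ) → ℝ} {z : ℝ → E × (E →L[ℝ] ℝ)} {a b C : ℝ}
    (H : HamCurve h z a b C) (hh : ∀ᵐ t ∂volume.restrict (Icc a b), h t = h' t) :
    HamCurve h' z a b C := by
  refine ⟨H.lip, ?_⟩
  filter_upwards [H.deriv, hh] with t ht hht
  rwa [← hht]

theorem HamCurve.ac {h : ℝ → E × (E →L[ℝ] ℝ) → ℝ} {z : ℝ → E × (E →L[ℝ] ℝ)} {a b C : ℝ}
    (H : HamCurve h z a b C) (hab : a ≤ b) : AbsolutelyContinuousOnInterval z a b :=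
  absolutelyContinuous_of_norm_sub_le hab H.lip

theorem HamCurve.continuousOn {h : ℝ → E × (E →L[ℝ] ℝ) → ℝ} {z : ℝ → E × (E →L[ℝ] ℝ)} {a b C : ℝ}
    (H : HamCurve h z a b C) : ContinuousOn z (Icc a b) :=
  (lipschitzOnWith_of_norm_sub_le H.lip).continuousOn

variable {A B : ℝ → E × (E →L[ℝ] ℝ) → ℝ} {z z' : ℝ → E × (E →L[ℝ] ℝ)} {a b L α β : ℝ}

/-- Two Hamiltonian curves whose Hamiltonians agree except on the short interval `[α, β]` stay
close on a short time interval. -/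
theorem norm_sub_le_of_hamCurve (hA : HamCurve A z a b L) (hB : HamCurve B z' a b L)
    (hz : ∀ t ∈ Icc a b, z t ∈ D) (hz' : ∀ t ∈ Icc a b, z' t ∈ D)
    (hAn : ∀ᵐ t ∂volume.restrict (Icc a b), NiceHam (A t) D C)
    (hBn : ∀ᵐ t ∂volume.restrict (Icc a b), NiceHam (B t) D C)
    (hαβ : α ≤ β) (hAB : ∀ t, t ∉ Icc α β → A t = B t) (hC : 0 ≤ C) (hCab : C * (b - a) ≤ 1 / 2)
    {s : ℝ} (hs : s ∈ Icc a b) :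
    ∀ t ∈ Icc a b, ‖z' t - z t‖ ≤ 2 * ‖z' s - z s‖ + 4 * C * (β - α) := by
  have hab : a ≤ b := hs.1.trans hs.2
  have hcont : ContinuousOn (fun t => ‖z' t - z t‖) (Icc a b) :=
    (hB.continuousOn.sub hA.continuousOn).norm
  obtain ⟨t₀, ht₀, hmax⟩ := isCompact_Icc.exists_isMaxOn (nonempty_Icc.2 hab) hcont
  set m := ‖z' t₀ - z t₀‖
  have hac : AbsolutelyContinuousOnInterval (fun t => z' t - z t) a b := (hB.ac hab).sub (hA.ac hab)
  have h1 := norm_sub_le_of_ac_two (c₀ := C * m) (c₁ := 2 * C) hac hαβ (by positivity) (by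
    filter_upwards [hA.deriv, hB.deriv, hAn, hBn, ae_restrict_mem measurableSet_Icc]
      with t h1 h2 h3 h4 ht
    refine ⟨_, h2.sub h1, ?_, fun hu => ?_⟩
    · refine (norm_sub_le _ _).trans ?_
      have e1 := (norm_symGrad_le _).trans (h4.bound _ (hz' t ht))
      have e2 := (norm_symGrad_le _).trans (h3.bound _ (hz t ht))
      have : 0 ≤ C * m := by positivity
      linarith
    · rw [hAB t hu, ← symGrad_sub]
      refine (norm_symGrad_le _).trans ((h4.lip _ (hz t ht) _ (hz' t ht)).trans ?_)
      gcongr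
      exact hmax ht) t₀ ht₀ s hs
  have h2 : m ≤ ‖z' s - z s‖ + ‖(z' t₀ - z t₀) - (z' s - z s)‖ := by
    have := norm_add_le (z' s - z s) ((z' t₀ - z t₀) - (z' s - z s))
    simpa using this
  have h3 : |t₀ - s| ≤ b - a := abs_sub_le_iff.2 ⟨by linarith [ht₀.2, hs.1], by linarith [ht₀.1, hs.2]⟩
  have h4 : C * m * |t₀ - s| ≤ 1 / 2 * m := by
    calc C * m * |t₀ - s| ≤ C * m * (b - a) := by gcongr
      _ = (C * (b - a)) * m := by ring
      _ ≤ 1 / 2 * m := by gcongr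
  intro t ht
  have h5 : ‖z' t - z t‖ ≤ m := hmax ht
  linarith

omit [FiniteDimensional ℝ E] in
theorem abs_apply_inl_le (G : E × (E →L[ℝ] ℝ) →L[ℝ] ℝ) (v : E) : |G (v, 0)| ≤ ‖G‖ * ‖v‖ :=
  (G.le_opNorm _).trans_eq (by simp [Prod.norm_def])

omit [FiniteDimensional ℝ E] in
theorem abs_apply_inr_le (G : E × (E →L[ℝ] ℝ) →L[ℝ] ℝ) (v : E →L[ℝ] ℝ) :
    |G (0, v)| ≤ ‖G‖ * ‖v‖ :=
  (G.le_opNorm _).trans_eq (by simp [Prod.norm_def])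

omit [FiniteDimensional ℝ E] in
theorem NiceHam.abs_pairing_le {x x' : E × (E →L[ℝ] ℝ)} (H : NiceHam h D C) (hD : Convex ℝ D)
    (hC : 0 ≤ C) (hx : x ∈ D) (hx' : x' ∈ D) {m : ℝ} (hm : ‖x' - x‖ ≤ m) :
    |-fderiv ℝ h x (x'.1 - x.1, 0) + fderiv ℝ h x' (0, x.2) - h x| ≤ 2 * C * m ^ 2 := by
  have hm0 : 0 ≤ m := (norm_nonneg _).trans hm
  have e1 := H.euler _ hx'
  have e2 : fderiv ℝ h x' (0, x.2) = h x' - fderiv ℝ h x' (0, x'.2 - x.2) := by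
    rw [← e1, ← map_sub]; simp
  have e3 : fderiv ℝ h x (x' - x) = fderiv ℝ h x (x'.1 - x.1, 0) +
      fderiv ℝ h x (0, x'.2 - x.2) := by
    rw [← map_add]; congr 1; ext <;> simp
  have e4 := (H.taylor hD hx hx').trans (show C * ‖x' - x‖ ^ 2 ≤ C * m ^ 2 by gcongr)
  have e5 : |(fderiv ℝ h x' - fderiv ℝ h x) (0, x'.2 - x.2)| ≤ C * m * m := by
    refine (abs_apply_inr_le _ _).trans ?_
    have h6 : C * ‖x' - x‖ ≤ C * m := by gcongr
    exact mul_le_mul ((H.lip _ hx _ hx').trans h6) ((norm_snd_le (x' - x)).trans hm)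
      (norm_nonneg _) (by positivity)
  rw [sub_apply] at e5
  have e6 : -fderiv ℝ h x (x'.1 - x.1, 0) + fderiv ℝ h x' (0, x.2) - h x =
      (h x' - h x - fderiv ℝ h x (x' - x)) -
        (fderiv ℝ h x' (0, x'.2 - x.2) - fderiv ℝ h x (0, x'.2 - x.2)) := by
    rw [e2, e3]; ring
  rw [e6]
  refine (abs_sub _ _).trans ((add_le_add e4 e5).trans_eq ?_)
  ring

omit [FiniteDimensional ℝ E] in
theorem abs_pairing_le_of_ne {x x' : E × (E →L[ℝ] ℝ)} (H : NiceHam h D C) (H' : NiceHam h' D C)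
    (hC : 0 ≤ C) (hx : x ∈ D) (hx' : x' ∈ D) {m R K : ℝ} (hm : ‖x' - x‖ ≤ m) (hR : ‖x‖ ≤ R)
    (hK : |h' x - h x| ≤ K) :
    |-fderiv ℝ h x (x'.1 - x.1, 0) + fderiv ℝ h' x' (0, x.2) - h x| ≤ C * m * (1 + R) + K := by
  have hm0 : 0 ≤ m := (norm_nonneg _).trans hm
  have e1 : |fderiv ℝ h x (x'.1 - x.1, 0)| ≤ C * m :=
    (abs_apply_inl_le _ _).trans
      (mul_le_mul (H.bound _ hx) ((norm_fst_le (x' - x)).trans hm) (norm_nonneg _) hC)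
  have e2 : |(fderiv ℝ h' x' - fderiv ℝ h' x) (0, x.2)| ≤ C * m * R := by
    refine (abs_apply_inr_le _ _).trans ?_
    have h6 : C * ‖x' - x‖ ≤ C * m := by gcongr
    exact mul_le_mul ((H'.lip _ hx _ hx').trans h6) ((norm_snd_le x).trans hR) (norm_nonneg _)
      (by positivity)
  rw [sub_apply, H'.euler _ hx] at e2
  have e6 : -fderiv ℝ h x (x'.1 - x.1, 0) + fderiv ℝ h' x' (0, x.2) - h x =
      -fderiv ℝ h x (x'.1 - x.1, 0) + (fderiv ℝ h' x' (0, x.2) - h' x) + (h' x - h x) := by ring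
  rw [e6]
  refine (abs_add_le _ _).trans ((add_le_add ((abs_add_le _ _).trans
    (add_le_add ((abs_neg _).trans_le e1) e2)) hK).trans_eq ?_)
  ring

omit [FiniteDimensional ℝ E] in
theorem norm_pairing_sub_le {p p' : E →L[ℝ] ℝ} {d d' : E} {m R δ δ' : ℝ} (hd : ‖d‖ ≤ m)
    (hp' : ‖p'‖ ≤ R) (h1 : ‖p - p'‖ ≤ δ) (h2 : ‖d - d'‖ ≤ δ') :
    ‖p d - p' d'‖ ≤ δ * m + R * δ' := by
  have e : p d - p' d' = (p - p') d + p' (d - d') := by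
    rw [sub_apply, map_sub]; ring
  rw [e]
  refine (norm_add_le _ _).trans (add_le_add ?_ ?_)
  · exact ((p - p').le_opNorm d).trans
      (mul_le_mul h1 hd (norm_nonneg _) ((norm_nonneg _).trans h1))
  · exact (p'.le_opNorm _).trans (mul_le_mul hp' h2 (norm_nonneg _) ((norm_nonneg _).trans hp'))

/-- Almost conservation of `p · (q' - q)` along two Hamiltonian curves whose Hamiltonians agree
except on the short interval `[α, β]`. -/
theorem abs_pairing_sub_le_of_hamCurve (hA : HamCurve A z a b L) (hB : HamCurve B z' a b L)
    (hD : Convex ℝ D) (hz : ∀ t ∈ Icc a b, z t ∈ D) (hz' : ∀ t ∈ Icc a b, z' t ∈ D)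
    (hAn : ∀ᵐ t ∂volume.restrict (Icc a b), NiceHam (A t) D C)
    (hBn : ∀ᵐ t ∂volume.restrict (Icc a b), NiceHam (B t) D C)
    (hαβ : α ≤ β) (hAB : ∀ t, t ∉ Icc α β → A t = B t) (hC : 0 ≤ C)
    {m R K : ℝ} (hm : ∀ t ∈ Icc a b, ‖z' t - z t‖ ≤ m) (hR : ∀ t ∈ Icc a b, ‖z t‖ ≤ R)
    (hK0 : 0 ≤ K)
    (hK : ∀ᵐ t ∂volume.restrict (Icc a b), t ∈ Icc α β → |B t (z t) - A t (z t)| ≤ K)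
    {s : ℝ} (hs : s ∈ Icc a b) : ∀ t ∈ Icc a b,
    |(z t).2 ((z' t).1 - (z t).1) - (z s).2 ((z' s).1 - (z s).1)| ≤
      2 * C * m ^ 2 * |t - s| + (C * m * (1 + R) + K) * (β - α) := by
  intro t ht
  have hab : a ≤ b := hs.1.trans hs.2
  have hm0 : 0 ≤ m := (norm_nonneg _).trans (hm s hs)
  have hR0 : 0 ≤ R := (norm_nonneg _).trans (hR s hs)
  have hac : AbsolutelyContinuousOnInterval (fun t => (z t).2 ((z' t).1 - (z t).1)) a b := by
    refine absolutelyContinuous_of_norm_sub_le (C := L * m + R * (L + L)) hab fun s hs t ht => ?_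
    refine (norm_pairing_sub_le ((norm_fst_le (z' s - z s)).trans (hm s hs))
      ((norm_snd_le (z t)).trans (hR t ht)) ((norm_snd_le (z s - z t)).trans (hA.lip s hs t ht))
      (δ' := L * |s - t| + L * |s - t|) ?_).trans_eq (by ring)
    change ‖(z' s).1 - (z s).1 - ((z' t).1 - (z t).1)‖ ≤ _
    have e : (z' s).1 - (z s).1 - ((z' t).1 - (z t).1) = (z' s - z' t).1 - (z s - z t).1 := by
      simp only [Prod.fst_sub]; abel
    rw [e]
    exact (norm_sub_le _ _).trans (add_le_add ((norm_fst_le _).trans (hB.lip s hs t ht))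
      ((norm_fst_le _).trans (hA.lip s hs t ht)))
  have h1 := norm_sub_le_of_ac_two (c₀ := 2 * C * m ^ 2) (c₁ := C * m * (1 + R) + K) hac hαβ
    (by positivity) ?_ t ht s hs
  · exact h1
  filter_upwards [hA.deriv, hB.deriv, hAn, hBn, hK, ae_restrict_mem measurableSet_Icc]
    with t h1 h2 h3 h4 h5 ht
  have hp : HasDerivAt (fun t => (z t).2) (symGrad (fderiv ℝ (A t) (z t))).2 t :=
    (ContinuousLinearMap.snd ℝ E (E →L[ℝ] ℝ)).hasFDerivAt.comp_hasDerivAt t h1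
  have hq : HasDerivAt (fun t => (z t).1) (symGrad (fderiv ℝ (A t) (z t))).1 t :=
    (ContinuousLinearMap.fst ℝ E (E →L[ℝ] ℝ)).hasFDerivAt.comp_hasDerivAt t h1
  have hq' : HasDerivAt (fun t => (z' t).1) (symGrad (fderiv ℝ (B t) (z' t))).1 t :=
    (ContinuousLinearMap.fst ℝ E (E →L[ℝ] ℝ)).hasFDerivAt.comp_hasDerivAt t h2
  have hd := hp.clm_apply (hq'.fun_sub hq)
  refine ⟨_, hd, ?_⟩
  have hval : (symGrad (fderiv ℝ (A t) (z t))).2 ((z' t).1 - (z t).1) +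
      (z t).2 ((symGrad (fderiv ℝ (B t) (z' t))).1 - (symGrad (fderiv ℝ (A t) (z t))).1) =
      -fderiv ℝ (A t) (z t) ((z' t).1 - (z t).1, 0) + fderiv ℝ (B t) (z' t) (0, (z t).2)
        - A t (z t) := by
    rw [map_sub (z t).2, apply_symGrad_fst, apply_symGrad_fst, symGrad_snd_apply,
      h3.euler _ (hz t ht)]
    ring
  have hsame : A t = B t → |-fderiv ℝ (A t) (z t) ((z' t).1 - (z t).1, 0) +
      fderiv ℝ (B t) (z' t) (0, (z t).2) - A t (z t)| ≤ 2 * C * m ^ 2 := fun heq => by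
    rw [← heq]
    exact h3.abs_pairing_le hD hC (hz t ht) (hz' t ht) (hm t ht)
  have hbd : |-fderiv ℝ (A t) (z t) ((z' t).1 - (z t).1, 0) +
      fderiv ℝ (B t) (z' t) (0, (z t).2) - A t (z t)| ≤
      2 * C * m ^ 2 + (C * m * (1 + R) + K) := by
    by_cases hu : t ∈ Icc α β
    · have := abs_pairing_le_of_ne h3 h4 hC (hz t ht) (hz' t ht) (hm t ht) (hR t ht) (h5 hu)
      have : 0 ≤ 2 * C * m ^ 2 := by positivity
      linarith
    · have := hsame (hAB t hu)
      have : 0 ≤ C * m * (1 + R) + K := by positivity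
      linarith
  rw [← hval, ← Real.norm_eq_abs] at hbd hsame
  exact ⟨hbd, fun hu => hsame (hAB t hu)⟩

end HamiltonianCurves

section Flow

variable {F : Type*} [NormedAddCommGroup F] [NormedSpace ℝ F]

/-- A short time Grönwall estimate, in both directions of time. -/
theorem norm_le_of_norm_deriv_le {r r' : ℝ → F} {a b K e s : ℝ}
    (hr : ∀ t ∈ Icc a b, HasDerivWithinAt r (r' t) (Icc a b) t)
    (hb : ∀ t ∈ Icc a b, ‖r' t‖ ≤ K * ‖r t‖ + e) (hK : 0 ≤ K) (he : 0 ≤ e)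
    (hab : K * (b - a) ≤ 1 / 2) (hs : s ∈ Icc a b) :
    ∀ t ∈ Icc a b, ‖r t‖ ≤ 2 * ‖r s‖ + 2 * e * (b - a) := by
  have hle : a ≤ b := hs.1.trans hs.2
  have hrc : ContinuousOn r (Icc a b) := fun t ht => (hr t ht).continuousWithinAt
  have hc : ContinuousOn (fun t => ‖r t‖) (Icc a b) := hrc.norm
  obtain ⟨t₀, ht₀, hmax⟩ := isCompact_Icc.exists_isMaxOn (nonempty_Icc.2 hle) hc
  have h1 := (convex_Icc a b).norm_image_sub_le_of_norm_hasDerivWithin_le hr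
    (C := K * ‖r t₀‖ + e) (fun t ht => (hb t ht).trans (by gcongr; exact hmax ht)) hs ht₀
  have h2 : ‖t₀ - s‖ ≤ b - a :=
    abs_sub_le_iff.2 ⟨by linarith [ht₀.2, hs.1], by linarith [ht₀.1, hs.2]⟩
  have h3 : (K * ‖r t₀‖ + e) * ‖t₀ - s‖ ≤ 1 / 2 * ‖r t₀‖ + e * (b - a) := by
    calc (K * ‖r t₀‖ + e) * ‖t₀ - s‖ ≤ (K * ‖r t₀‖ + e) * (b - a) := by gcongr
      _ = (K * (b - a)) * ‖r t₀‖ + e * (b - a) := by ring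
      _ ≤ _ := by gcongr
  have h4 : ‖r t₀‖ ≤ ‖r s‖ + ‖r t₀ - r s‖ := by
    have := norm_add_le (r s) (r t₀ - r s); simpa using this
  intro t ht
  have h5 : ‖r t‖ ≤ ‖r t₀‖ := hmax ht
  linarith

theorem norm_sub_sub_fderiv_le {G : Type*} [NormedAddCommGroup G] [NormedSpace ℝ G] {f : F → G}
    {D : Set F} {C : ℝ} (hD : Convex ℝ D) (hf : ∀ x ∈ D, DifferentiableAt ℝ f x)
    (hl : ∀ x ∈ D, ∀ y ∈ D, ‖fderiv ℝ f y - fderiv ℝ f x‖ ≤ C * ‖y - x‖) (hC : 0 ≤ C) {x y : F}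
    (hx : x ∈ D) (hy : y ∈ D) : ‖f y - f x - fderiv ℝ f x (y - x)‖ ≤ C * ‖y - x‖ ^ 2 := by
  have hseg : segment ℝ x y ⊆ D := hD.segment_subset hx hy
  have h1 := (convex_segment x y).norm_image_sub_le_of_norm_hasFDerivWithin_le
    (f := fun z => f z - fderiv ℝ f x z) (f' := fun z => fderiv ℝ f z - fderiv ℝ f x)
    (C := C * ‖y - x‖) (fun z hz => ((hf z (hseg hz)).hasFDerivAt.sub
      (fderiv ℝ f x).hasFDerivAt).hasFDerivWithinAt) (fun z hz => ?_)
    (left_mem_segment ℝ x y) (right_mem_segment ℝ x y)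
  · rw [sq, ← mul_assoc]
    convert h1 using 2
    rw [map_sub]; abel
  · refine (hl x hx z (hseg hz)).trans ?_
    gcongr
    have := norm_sub_le_of_mem_segment hz
    simpa using this

theorem exists_ball_fderiv_bounds {G : Type*} [NormedAddCommGroup G] [NormedSpace ℝ G]
    {f : F → G} {x₀ : F} (hf : ContDiffAt ℝ 2 f x₀) : ∃ R > 0, ∃ C ≥ 0,
      (∀ x ∈ ball x₀ R, DifferentiableAt ℝ f x ∧ ‖f x‖ ≤ C ∧ ‖fderiv ℝ f x‖ ≤ C) ∧
      ∀ x ∈ ball x₀ R, ∀ y ∈ ball x₀ R,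
        ‖fderiv ℝ f y - fderiv ℝ f x‖ ≤ C * ‖y - x‖ := by
  have h1 : ∀ᶠ z in 𝓝 x₀, DifferentiableAt ℝ f z :=
    (hf.eventually (by simp)).mono fun z hz => hz.differentiableAt (by norm_num)
  have h2 : ContDiffAt ℝ 1 (fderiv ℝ f) x₀ := hf.fderiv_right (by norm_num)
  obtain ⟨K, t, ht, hK⟩ := h2.exists_lipschitzOnWith
  have h3 : ∀ᶠ z in 𝓝 x₀, ‖fderiv ℝ f z‖ < ‖fderiv ℝ f x₀‖ + 1 :=
    h2.continuousAt.norm.eventually_lt continuousAt_const (by linarith)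
  have h4 : ∀ᶠ z in 𝓝 x₀, ‖f z‖ < ‖f x₀‖ + 1 :=
    hf.continuousAt.norm.eventually_lt continuousAt_const (by linarith)
  obtain ⟨r, hr, hb⟩ := eventually_nhds_iff_ball.1 ((h1.and h4).and (h3.and ht))
  refine ⟨r, hr, max (K : ℝ) (max (‖fderiv ℝ f x₀‖ + 1) (‖f x₀‖ + 1)), by positivity,
    fun z hz => ⟨(hb z hz).1.1, (hb z hz).1.2.le.trans ?_, (hb z hz).2.1.le.trans ?_⟩,
    fun z hz z' hz' => ?_⟩
  · exact (le_max_right _ _).trans (le_max_right _ _)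
  · exact (le_max_left _ _).trans (le_max_right _ _)
  have := hK.dist_le_mul z' (hb z' hz').2.2 z (hb z hz).2.2
  rw [dist_eq_norm, dist_eq_norm] at this
  exact this.trans (by gcongr; exact le_max_left _ _)

/-- The local flow of a vector field together with its derivative. -/
structure FlowBox (f : F → F) (x₀ : F) (U : Set F) (ε r C : ℝ) (ψ : ℝ → F → F)
    (V : ℝ → F → F →L[ℝ] F) : Prop where
  ψ_zero : ∀ x ∈ ball x₀ r, ψ 0 x = x
  V_zero : ∀ x ∈ ball x₀ r, V 0 x = ContinuousLinearMap.id ℝ F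
  mem : ∀ x ∈ ball x₀ r, ∀ s ∈ Icc (-ε) ε, ψ s x ∈ U
  norm_V : ∀ x ∈ ball x₀ r, ∀ s ∈ Icc (-ε) ε, ‖V s x‖ ≤ C
  deriv_ψ : ∀ x ∈ ball x₀ r, ∀ s ∈ Icc (-ε) ε,
    HasDerivWithinAt (fun s => ψ s x) (f (ψ s x)) (Icc (-ε) ε) s
  deriv_V : ∀ x ∈ ball x₀ r, ∀ s ∈ Icc (-ε) ε,
    HasDerivWithinAt (fun s => V s x) ((fderiv ℝ f (ψ s x)).comp (V s x)) (Icc (-ε) ε) s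
  lip_ψ : ∀ x ∈ ball x₀ r, ∀ y ∈ ball x₀ r, ∀ s ∈ Icc (-ε) ε,
    ‖ψ s y - ψ s x‖ ≤ C * ‖y - x‖
  lip_V : ∀ x ∈ ball x₀ r, ∀ y ∈ ball x₀ r, ∀ s ∈ Icc (-ε) ε,
    ‖V s y - V s x‖ ≤ C * ‖y - x‖
  taylor : ∀ x ∈ ball x₀ r, ∀ y ∈ ball x₀ r, ∀ s ∈ Icc (-ε) ε,
    ‖ψ s y - ψ s x - V s x (y - x)‖ ≤ C * ‖y - x‖ ^ 2

theorem FlowBox.mono {f : F → F} {x₀ : F} {U : Set F} {ε r C ε' r' : ℝ} {ψ : ℝ → F → F}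
    {V : ℝ → F → F →L[ℝ] F} (h : FlowBox f x₀ U ε r C ψ V) (hε : ε' ≤ ε) (hr : r' ≤ r) :
    FlowBox f x₀ U ε' r' C ψ V :=
  have hs : Icc (-ε') ε' ⊆ Icc (-ε) ε := Icc_subset_Icc (neg_le_neg hε) hε
  have hb : ball x₀ r' ⊆ ball x₀ r := ball_subset_ball hr
  { ψ_zero := fun x hx => h.ψ_zero x (hb hx)
    V_zero := fun x hx => h.V_zero x (hb hx)
    mem := fun x hx s h' => h.mem x (hb hx) s (hs h')
    norm_V := fun x hx s h' => h.norm_V x (hb hx) s (hs h')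
    deriv_ψ := fun x hx s h' => (h.deriv_ψ x (hb hx) s (hs h')).mono hs
    deriv_V := fun x hx s h' => (h.deriv_V x (hb hx) s (hs h')).mono hs
    lip_ψ := fun x hx y hy s h' => h.lip_ψ x (hb hx) y (hb hy) s (hs h')
    lip_V := fun x hx y hy s h' => h.lip_V x (hb hx) y (hb hy) s (hs h')
    taylor := fun x hx y hy s h' => h.taylor x (hb hx) y (hb hy) s (hs h') }

variable [CompleteSpace F]

theorem exists_flowBox {f : F → F} {x₀ : F} (hf : ContDiffAt ℝ 2 f x₀) {U : Set F}
    (hU : U ∈ 𝓝 x₀) : ∃ ε > 0, ∃ r > 0, ∃ C ≥ 0, ∃ ψ V, FlowBox f x₀ U ε r C ψ V := by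
  obtain ⟨R, hR, C₀, hC₀, hb, hl⟩ := exists_ball_fderiv_bounds hf
  set g : F × (F →L[ℝ] F) → F × (F →L[ℝ] F) := fun p => (f p.1, (fderiv ℝ f p.1).comp p.2)
  have hgd : ContDiffAt ℝ 1 g (x₀, ContinuousLinearMap.id ℝ F) := by
    refine ContDiffAt.prodMk ?_ ?_
    · exact (hf.of_le (by norm_num)).comp (f := Prod.fst) (x₀, ContinuousLinearMap.id ℝ F)
        contDiffAt_fst
    · refine ContDiffAt.clm_comp ?_ contDiffAt_snd
      exact (hf.fderiv_right (m := 1) (by norm_num)).comp (f := Prod.fst)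
        (x₀, ContinuousLinearMap.id ℝ F) contDiffAt_fst
  obtain ⟨ε₀, hε₀, a, ρ, L, K, hρ, hPL⟩ := IsPicardLindelof.of_contDiffAt_one hgd
  obtain ⟨α, hα, L', hL'⟩ :=
    (hPL 0).exists_forall_mem_closedBall_eq_hasDerivWithinAt_lipschitzOnWith
  set z₀ : F × (F →L[ℝ] F) := (x₀, ContinuousLinearMap.id ℝ F) with hz₀
  have hz₀m : z₀ ∈ closedBall z₀ (ρ : ℝ) := mem_closedBall_self (by positivity)
  obtain ⟨R', hR', hRU⟩ := Metric.mem_nhds_iff.1 (inter_mem hU (ball_mem_nhds x₀ hR))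
  set R₁ := min R' 1
  have hR₁0 : 0 < R₁ := by positivity
  have h0 : (0 : ℝ) ∈ Icc (0 - ε₀) (0 + ε₀) := by constructor <;> linarith
  have hcont := ((hα z₀ hz₀m).2 0 h0).continuousWithinAt
  have hev : ∀ᶠ t in 𝓝[Icc (0 - ε₀) (0 + ε₀)] (0 : ℝ), dist (α z₀ t) z₀ < R₁ / 2 := by
    have := Metric.tendsto_nhds.1 hcont (R₁ / 2) (by positivity)
    simpa only [(hα z₀ hz₀m).1] using this
  rw [nhdsWithin_eq_nhds.2 (Icc_mem_nhds (by linarith) (by linarith))] at hev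
  obtain ⟨ε₁, hε₁, hev⟩ := eventually_nhds_iff_ball.1 hev
  set ε := min (min (ε₀ / 2) (ε₁ / 2)) (1 / (4 * (C₀ + 1)))
  have hε0 : 0 < ε := by positivity
  have hεε₀ : ε ≤ ε₀ / 2 := (min_le_left _ _).trans (min_le_left _ _)
  have hεε₁ : ε ≤ ε₁ / 2 := (min_le_left _ _).trans (min_le_right _ _)
  have hεC : C₀ * (ε - -ε) ≤ 1 / 2 := by
    have h1 : ε ≤ 1 / (4 * (C₀ + 1)) := min_le_right _ _
    have h2 : C₀ * (ε - -ε) ≤ (C₀ + 1) * (2 * (1 / (4 * (C₀ + 1)))) := by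
      have : ε - -ε ≤ 2 * (1 / (4 * (C₀ + 1))) := by linarith
      gcongr <;> linarith
    refine h2.trans (le_of_eq ?_)
    field_simp
    norm_num
  set r : ℝ := min (ρ : ℝ) (R₁ / (2 * (L' + 1)))
  have hr0 : 0 < r := by positivity
  have hsub : Icc (-ε) ε ⊆ Icc (0 - ε₀) (0 + ε₀) := Icc_subset_Icc (by linarith) (by linarith)
  have hball : ∀ x ∈ ball x₀ r,
      (x, ContinuousLinearMap.id ℝ F) ∈ closedBall z₀ (ρ : ℝ) := by
    intro x hx
    rw [mem_closedBall, Prod.dist_eq]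
    simp only [hz₀, dist_self]
    have : dist x x₀ < r := hx
    have : dist x x₀ ≤ ρ := this.le.trans (min_le_left _ _)
    simpa using this
  have hdist : ∀ x ∈ ball x₀ r, ∀ y ∈ ball x₀ r, ∀ s ∈ Icc (-ε) ε,
      dist (α (y, ContinuousLinearMap.id ℝ F) s) (α (x, ContinuousLinearMap.id ℝ F) s) ≤
        L' * ‖y - x‖ := by
    intro x hx y hy s hs
    refine ((hL' s (hsub hs)).dist_le_mul _ (hball y hy) _ (hball x hx)).trans_eq ?_
    rw [Prod.dist_eq, dist_self, dist_eq_norm]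
    simp
  have hx₀ : x₀ ∈ ball x₀ r := mem_ball_self hr0
  have hin : ∀ x ∈ ball x₀ r, ∀ s ∈ Icc (-ε) ε,
      dist (α (x, ContinuousLinearMap.id ℝ F) s) z₀ < R₁ := by
    intro x hx s hs
    have h1 := hdist x₀ hx₀ x hx s hs
    have h2 : dist (α z₀ s) z₀ < R₁ / 2 := by
      refine hev s ?_
      rw [mem_ball, Real.dist_eq, sub_zero]
      have := abs_le.2 ⟨hs.1, hs.2⟩
      linarith
    have h3 : ‖x - x₀‖ < R₁ / (2 * (L' + 1)) := by
      have h : dist x x₀ < r := hx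
      rw [dist_eq_norm] at h
      exact h.trans_le (min_le_right _ _)
    have h4 : L' * ‖x - x₀‖ ≤ (L' + 1) * (R₁ / (2 * (L' + 1))) := by gcongr; simp
    have h5 : ((L' : ℝ) + 1) * (R₁ / (2 * (L' + 1))) = R₁ / 2 := by field_simp
    have := dist_triangle (α (x, ContinuousLinearMap.id ℝ F) s) (α z₀ s) z₀
    linarith
  have hin1 : ∀ x ∈ ball x₀ r, ∀ s ∈ Icc (-ε) ε,
      (α (x, ContinuousLinearMap.id ℝ F) s).1 ∈ U ∩ ball x₀ R := by
    intro x hx s hs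
    refine hRU ?_
    have h1 := hin x hx s hs
    rw [Prod.dist_eq] at h1
    exact (le_max_left _ _).trans_lt (h1.trans_le (min_le_left _ _))
  have hder : ∀ x ∈ ball x₀ r, ∀ s ∈ Icc (-ε) ε,
      HasDerivWithinAt (α (x, ContinuousLinearMap.id ℝ F))
        (g (α (x, ContinuousLinearMap.id ℝ F) s)) (Icc (-ε) ε) s :=
    fun x hx s hs => ((hα _ (hball x hx)).2 s (hsub hs)).mono hsub
  have hn1 : ‖ContinuousLinearMap.id ℝ F‖ ≤ 1 := ContinuousLinearMap.norm_id_le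
  have hV : ∀ x ∈ ball x₀ r, ∀ s ∈ Icc (-ε) ε,
      ‖(α (x, ContinuousLinearMap.id ℝ F) s).2‖ ≤ 2 := by
    intro x hx s hs
    have h1 := hin x hx s hs
    rw [Prod.dist_eq] at h1
    have h2 : dist (α (x, ContinuousLinearMap.id ℝ F) s).2 (ContinuousLinearMap.id ℝ F) < 1 :=
      (le_max_right _ _).trans_lt (h1.trans_le (min_le_right _ _))
    rw [dist_eq_norm] at h2
    have := norm_le_norm_sub_add (α (x, ContinuousLinearMap.id ℝ F) s).2
      (ContinuousLinearMap.id ℝ F)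
    linarith
  have hψ : ∀ x ∈ ball x₀ r, ∀ s ∈ Icc (-ε) ε,
      HasDerivWithinAt (fun s => (α (x, ContinuousLinearMap.id ℝ F) s).1)
        (f (α (x, ContinuousLinearMap.id ℝ F) s).1) (Icc (-ε) ε) s := fun x hx s hs =>
    (ContinuousLinearMap.fst ℝ F (F →L[ℝ] F)).hasFDerivAt.comp_hasDerivWithinAt s (hder x hx s hs)
  have hVd : ∀ x ∈ ball x₀ r, ∀ s ∈ Icc (-ε) ε,
      HasDerivWithinAt (fun s => (α (x, ContinuousLinearMap.id ℝ F) s).2)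
        ((fderiv ℝ f (α (x, ContinuousLinearMap.id ℝ F) s).1).comp
          (α (x, ContinuousLinearMap.id ℝ F) s).2) (Icc (-ε) ε) s := fun x hx s hs =>
    (ContinuousLinearMap.snd ℝ F (F →L[ℝ] F)).hasFDerivAt.comp_hasDerivWithinAt s (hder x hx s hs)
  have hlip : ∀ x ∈ ball x₀ r, ∀ y ∈ ball x₀ r, ∀ s ∈ Icc (-ε) ε,
      ‖(α (y, ContinuousLinearMap.id ℝ F) s).1 - (α (x, ContinuousLinearMap.id ℝ F) s).1‖ ≤
        L' * ‖y - x‖ := by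
    intro x hx y hy s hs
    have h := hdist x hx y hy s hs
    rw [Prod.dist_eq, dist_eq_norm, dist_eq_norm] at h
    exact (le_max_left _ _).trans h
  refine ⟨ε, hε0, r, hr0, max (max 2 L') (2 * (C₀ * L' ^ 2) * (ε - -ε)), by positivity,
    fun s x => (α (x, ContinuousLinearMap.id ℝ F) s).1,
    fun s x => (α (x, ContinuousLinearMap.id ℝ F) s).2, ?_, ?_, fun x hx s hs => (hin1 x hx s hs).1,
    fun x hx s hs => (hV x hx s hs).trans ((le_max_left _ _).trans (le_max_left _ _)),
    hψ, hVd, fun x hx y hy s hs => (hlip x hx y hy s hs).trans ?_,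
    fun x hx y hy s hs => ?_, fun x hx y hy s hs => ?_⟩
  · intro x hx
    exact congrArg Prod.fst (hα _ (hball x hx)).1
  · intro x hx
    exact congrArg Prod.snd (hα _ (hball x hx)).1
  · gcongr
    exact (le_max_right _ _).trans (le_max_left _ _)
  · have h := hdist x hx y hy s hs
    rw [Prod.dist_eq, dist_eq_norm, dist_eq_norm] at h
    refine ((le_max_right _ _).trans h).trans ?_
    gcongr
    exact (le_max_right _ _).trans (le_max_left _ _)
  · have h0' : (0 : ℝ) ∈ Icc (-ε) ε := by constructor <;> linarith
    have h1 := norm_le_of_norm_deriv_le (K := C₀) (e := C₀ * (L' * ‖y - x‖) ^ 2)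
      (r := fun s => (α (y, ContinuousLinearMap.id ℝ F) s).1 -
        (α (x, ContinuousLinearMap.id ℝ F) s).1 - (α (x, ContinuousLinearMap.id ℝ F) s).2 (y - x))
      (fun t ht => ((hψ y hy t ht).sub (hψ x hx t ht)).sub
        ((hVd x hx t ht).clm_apply (hasDerivWithinAt_const t _ (y - x))))
      (fun t ht => ?_) hC₀ (by positivity) hεC h0' s hs
    · refine h1.trans ?_
      have e1 : (α (y, ContinuousLinearMap.id ℝ F) 0).1 = y :=
        congrArg Prod.fst (hα _ (hball y hy)).1
      have e2 := (hα _ (hball x hx)).1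
      change α (x, ContinuousLinearMap.id ℝ F) 0 = _ at e2
      rw [e1, e2]
      have e3 : ‖y - x - ContinuousLinearMap.id ℝ F (y - x)‖ = 0 := by simp
      rw [e3]
      have : 2 * 0 + 2 * (C₀ * (L' * ‖y - x‖) ^ 2) * (ε - -ε) =
        (2 * (C₀ * L' ^ 2) * (ε - -ε)) * ‖y - x‖ ^ 2 := by ring
      rw [this]
      gcongr
      exact le_max_right _ _
    · set A := (α (y, ContinuousLinearMap.id ℝ F) t).1
      set B := (α (x, ContinuousLinearMap.id ℝ F) t).1
      set W := (α (x, ContinuousLinearMap.id ℝ F) t).2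
      have e : f A - f B - (((fderiv ℝ f B).comp W) (y - x) + W 0) =
          (f A - f B - fderiv ℝ f B (A - B)) + fderiv ℝ f B (A - B - W (y - x)) := by
        simp only [map_sub, ContinuousLinearMap.comp_apply, map_zero]
        abel
      rw [e]
      refine (norm_add_le _ _).trans ?_
      rw [add_comm]
      refine add_le_add ?_ ?_
      · exact ((fderiv ℝ f B).le_opNorm _).trans (by
          gcongr; exact (hb B (hin1 x hx t ht).2).2.2)
      · refine (norm_sub_sub_fderiv_le (convex_ball x₀ R) (fun x hx => (hb x hx).1) hl hC₀
          (hin1 x hx t ht).2 (hin1 y hy t ht).2).trans ?_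
        gcongr
        exact hlip x hx y hy t ht

end Flow

theorem hasFDerivAt_of_norm_sub_le_sq {F G : Type*} [NormedAddCommGroup F] [NormedSpace ℝ F]
    [NormedAddCommGroup G] [NormedSpace ℝ G] {f : F → G} {L : F →L[ℝ] G} {x : F} {U : Set F}
    (hU : U ∈ 𝓝 x) {C : ℝ} (h : ∀ y ∈ U, ‖f y - f x - L (y - x)‖ ≤ C * ‖y - x‖ ^ 2) :
    HasFDerivAt f L x := by
  refine HasFDerivAt.of_isLittleO ?_
  have h1 : (fun y => f y - f x - L (y - x)) =O[𝓝 x] fun y => ‖y - x‖ ^ 2 :=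
    Asymptotics.IsBigO.of_bound C (by
      filter_upwards [hU] with y hy
      rw [norm_pow, norm_norm]
      exact h y hy)
  refine h1.trans_isLittleO ?_
  exact Asymptotics.isLittleO_pow_sub_sub x (by norm_num)

section Overmaximised

variable {F : Type*} [NormedAddCommGroup F] [NormedSpace ℝ F]

/-- The data for maximising `H` along the flow `ψ` of `f`, the critical time being `θ`. -/
structure CriticalFlow (f : F → F) (H Q θ : F → ℝ) (z₀ : F) (U : Set F) (ε r C : ℝ)
    (ψ : ℝ → F → F) (V : ℝ → F → F →L[ℝ] F) : Prop where
  box : FlowBox f z₀ U ε r C ψ V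
  convex : Convex ℝ U
  small : C * (ε - -ε) ≤ 1 / 2
  diff_f : ∀ z ∈ U, DifferentiableAt ℝ f z
  norm_f : ∀ z ∈ U, ‖f z‖ ≤ C
  norm_Df : ∀ z ∈ U, ‖fderiv ℝ f z‖ ≤ C
  diff_H : ∀ z ∈ U, DifferentiableAt ℝ H z
  norm_DH : ∀ z ∈ U, ‖fderiv ℝ H z‖ ≤ C
  lip_DH : ∀ x ∈ U, ∀ y ∈ U, ‖fderiv ℝ H y - fderiv ℝ H x‖ ≤ C * ‖y - x‖
  DH_f : ∀ z ∈ U, fderiv ℝ H z (f z) = -Q z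
  diff_Q : ∀ z ∈ U, DifferentiableAt ℝ Q z
  DQ_pos : ∀ z ∈ U, 0 < fderiv ℝ Q z (f z)
  DQ_le : ∀ z ∈ U, fderiv ℝ Q z (f z) ≤ C
  θ_mem : ∀ z ∈ ball z₀ r, θ z ∈ Icc (-ε) ε
  lip_θ : ∀ x ∈ ball z₀ r, ∀ y ∈ ball z₀ r, |θ y - θ x| ≤ C * ‖y - x‖
  solves : ∀ z ∈ ball z₀ r, Q (ψ (θ z) z) = 0
  θ_zero : ∀ z ∈ ball z₀ r, Q z = 0 → θ z = 0

namespace CriticalFlow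

variable {f : F → F} {H Q θ : F → ℝ} {z₀ : F} {U : Set F} {ε r C : ℝ} {ψ : ℝ → F → F}
  {V : ℝ → F → F →L[ℝ] F} (h : CriticalFlow f H Q θ z₀ U ε r C ψ V) {z z' : F}

include h

theorem zero_mem (hz : z ∈ ball z₀ r) : (0 : ℝ) ∈ Icc (-ε) ε := by
  have := h.θ_mem z hz
  constructor <;> linarith [this.1, this.2]

theorem deriv_H (hz : z ∈ ball z₀ r) {s : ℝ} (hs : s ∈ Icc (-ε) ε) :
    HasDerivWithinAt (fun s => H (ψ s z)) (-Q (ψ s z)) (Icc (-ε) ε) s := by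
  have hU := h.box.mem z hz s hs
  rw [← h.DH_f _ hU]
  exact (h.diff_H _ hU).hasFDerivAt.comp_hasDerivWithinAt s (h.box.deriv_ψ z hz s hs)

theorem deriv_Q (hz : z ∈ ball z₀ r) {s : ℝ} (hs : s ∈ Icc (-ε) ε) :
    HasDerivWithinAt (fun s => Q (ψ s z)) (fderiv ℝ Q (ψ s z) (f (ψ s z))) (Icc (-ε) ε) s :=
  (h.diff_Q _ (h.box.mem z hz s hs)).hasFDerivAt.comp_hasDerivWithinAt s (h.box.deriv_ψ z hz s hs)

theorem strictMonoOn_Q (hz : z ∈ ball z₀ r) :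
    StrictMonoOn (fun s => Q (ψ s z)) (Icc (-ε) ε) := by
  refine strictMonoOn_of_hasDerivWithinAt_pos (convex_Icc _ _)
    (fun s hs => (h.deriv_Q hz hs).continuousWithinAt)
    (f' := fun s => fderiv ℝ Q (ψ s z) (f (ψ s z))) (fun s hs => ?_) fun s hs => ?_
  · exact (h.deriv_Q hz (interior_subset hs)).mono interior_subset
  · exact h.DQ_pos _ (h.box.mem z hz s (interior_subset hs))

theorem abs_Q_le (hz : z ∈ ball z₀ r) {s : ℝ} (hs : s ∈ Icc (-ε) ε) :
    |Q (ψ s z)| ≤ C * |s - θ z| := by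
  have h1 := (convex_Icc (-ε) ε).norm_image_sub_le_of_norm_hasDerivWithin_le
    (fun s hs => h.deriv_Q hz hs) (C := C) (fun s hs => by
      have hU := h.box.mem z hz s hs
      rw [Real.norm_eq_abs, abs_of_pos (h.DQ_pos _ hU)]
      exact h.DQ_le _ hU) (h.θ_mem z hz) hs
  simpa [h.solves z hz] using h1

theorem nonneg (hz : z ∈ ball z₀ r) : 0 ≤ C :=
  (norm_nonneg _).trans (h.norm_f _ (h.box.mem z hz 0 (h.zero_mem hz)))

theorem abs_H_sub_le (hz : z ∈ ball z₀ r) {s : ℝ} (hs : s ∈ Icc (-ε) ε) :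
    |H (ψ (θ z) z) - H (ψ s z)| ≤ C * |θ z - s| ^ 2 := by
  have hsub : uIcc s (θ z) ⊆ Icc (-ε) ε := uIcc_subset_Icc hs (h.θ_mem z hz)
  have h1 := (convex_uIcc s (θ z)).norm_image_sub_le_of_norm_hasDerivWithin_le
    (fun s hs => (h.deriv_H hz (hsub hs)).mono hsub) (C := C * |θ z - s|) (fun t ht => by
      rw [norm_neg, Real.norm_eq_abs]
      refine (h.abs_Q_le hz (hsub ht)).trans ?_
      have := h.nonneg hz
      refine mul_le_mul_of_nonneg_left ?_ this
      rw [abs_sub_comm]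
      exact abs_sub_right_of_mem_uIcc ht) left_mem_uIcc right_mem_uIcc
  rw [Real.norm_eq_abs, Real.norm_eq_abs] at h1
  rwa [sq, ← mul_assoc]

theorem ψ_zero (hz : z ∈ ball z₀ r) : ψ 0 z = z := h.box.ψ_zero z hz

theorem le_value (hz : z ∈ ball z₀ r) :
    H z ≤ H (ψ (θ z) z) ∧ (H (ψ (θ z) z) = H z → Q z = 0) := by
  have h0 := h.zero_mem hz
  have hθ := h.θ_mem z hz
  have hm := h.strictMonoOn_Q hz
  have hsol := h.solves z hz
  have hc : ContinuousOn (fun s => H (ψ s z)) (Icc (-ε) ε) :=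
    fun s hs => (h.deriv_H hz hs).continuousWithinAt
  have hH0 : H (ψ 0 z) = H z := by rw [h.ψ_zero hz]
  rcases lt_trichotomy (θ z) 0 with hlt | heq | hgt
  · have hsub : Icc (θ z) 0 ⊆ Icc (-ε) ε := Icc_subset_Icc hθ.1 h0.2
    have h1 : StrictAntiOn (fun s => H (ψ s z)) (Icc (θ z) 0) := by
      refine strictAntiOn_of_hasDerivWithinAt_neg (convex_Icc _ _) (hc.mono hsub)
        (f' := fun s => -Q (ψ s z))
        (fun s hs => (h.deriv_H hz (hsub (interior_subset hs))).mono
          (interior_subset.trans hsub)) fun s hs => ?_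
      rw [interior_Icc] at hs
      have := hm hθ (hsub ⟨hs.1.le, hs.2.le⟩) hs.1
      simp only [hsol] at this
      linarith
    have h2 := h1 ⟨le_rfl, hlt.le⟩ ⟨hlt.le, le_rfl⟩ hlt
    simp only [hH0] at h2
    exact ⟨h2.le, fun h3 => absurd h3 h2.ne'⟩
  · rw [heq, h.ψ_zero hz]
    rw [heq, h.ψ_zero hz] at hsol
    exact ⟨le_rfl, fun _ => hsol⟩
  · have hsub : Icc 0 (θ z) ⊆ Icc (-ε) ε := Icc_subset_Icc h0.1 hθ.2
    have h1 : StrictMonoOn (fun s => H (ψ s z)) (Icc 0 (θ z)) := by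
      refine strictMonoOn_of_hasDerivWithinAt_pos (convex_Icc _ _) (hc.mono hsub)
        (f' := fun s => -Q (ψ s z))
        (fun s hs => (h.deriv_H hz (hsub (interior_subset hs))).mono
          (interior_subset.trans hsub)) fun s hs => ?_
      rw [interior_Icc] at hs
      have := hm (hsub ⟨hs.1.le, hs.2.le⟩) hθ hs.2
      simp only [hsol] at this
      linarith
    have h2 := h1 ⟨le_rfl, hgt.le⟩ ⟨hgt.le, le_rfl⟩ hgt
    simp only [hH0] at h2
    exact ⟨h2.le, fun h3 => absurd h3 h2.ne'⟩

theorem taylor_value (hz : z ∈ ball z₀ r) (hz' : z' ∈ ball z₀ r) :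
    ‖H (ψ (θ z') z') - H (ψ (θ z) z) -
      ((fderiv ℝ H (ψ (θ z) z)).comp (V (θ z) z)) (z' - z)‖ ≤
        (3 * C ^ 3 + C ^ 2) * ‖z' - z‖ ^ 2 := by
  have hC := h.nonneg hz
  have hθ := h.θ_mem z hz
  have hU := h.box.mem z hz _ hθ
  have hU' := h.box.mem z' hz' _ hθ
  have e1 := (h.abs_H_sub_le hz' hθ).trans
    (show _ ≤ C * (C * ‖z' - z‖) ^ 2 by gcongr; exact h.lip_θ z hz z' hz')
  have e2 := (norm_sub_sub_fderiv_le h.convex h.diff_H h.lip_DH hC hU hU').trans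
    (show _ ≤ C * (C * ‖z' - z‖) ^ 2 by gcongr; exact h.box.lip_ψ z hz z' hz' _ hθ)
  have e3 : ‖fderiv ℝ H (ψ (θ z) z) (ψ (θ z) z' - ψ (θ z) z - V (θ z) z (z' - z))‖ ≤
      C * (C * ‖z' - z‖ ^ 2) := by
    refine ((fderiv ℝ H (ψ (θ z) z)).le_opNorm _).trans ?_
    gcongr
    · exact h.norm_DH _ hU
    · exact h.box.taylor z hz z' hz' _ hθ
  have e : H (ψ (θ z') z') - H (ψ (θ z) z) -
      ((fderiv ℝ H (ψ (θ z) z)).comp (V (θ z) z)) (z' - z) =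
      (H (ψ (θ z') z') - H (ψ (θ z) z')) +
        (H (ψ (θ z) z') - H (ψ (θ z) z) - fderiv ℝ H (ψ (θ z) z) (ψ (θ z) z' - ψ (θ z) z)) +
        fderiv ℝ H (ψ (θ z) z) (ψ (θ z) z' - ψ (θ z) z - V (θ z) z (z' - z)) := by
    simp only [map_sub, ContinuousLinearMap.comp_apply]; ring
  rw [e]
  refine (norm_add_le _ _).trans ((add_le_add ((norm_add_le _ _).trans (add_le_add e1 e2))
    e3).trans ?_)
  have : 0 ≤ C ^ 3 * ‖z' - z‖ ^ 2 := by positivity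
  nlinarith

theorem hasFDerivAt_value (hz : z ∈ ball z₀ r) :
    HasFDerivAt (fun z => H (ψ (θ z) z)) ((fderiv ℝ H (ψ (θ z) z)).comp (V (θ z) z)) z :=
  hasFDerivAt_of_norm_sub_le_sq (isOpen_ball.mem_nhds hz)
    fun _ hz' => h.taylor_value hz hz'

theorem norm_fderiv_value_le (hz : z ∈ ball z₀ r) :
    ‖fderiv ℝ (fun z => H (ψ (θ z) z)) z‖ ≤ C * C := by
  rw [(h.hasFDerivAt_value hz).fderiv]
  have hC := h.nonneg hz
  refine (ContinuousLinearMap.opNorm_comp_le _ _).trans ?_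
  gcongr
  · exact h.norm_DH _ (h.box.mem z hz _ (h.θ_mem z hz))
  · exact h.box.norm_V z hz _ (h.θ_mem z hz)

theorem norm_ψ_sub_le (hz : z ∈ ball z₀ r) {s t : ℝ} (hs : s ∈ Icc (-ε) ε)
    (ht : t ∈ Icc (-ε) ε) : ‖ψ s z - ψ t z‖ ≤ C * |s - t| :=
  (convex_Icc (-ε) ε).norm_image_sub_le_of_norm_hasDerivWithin_le
    (fun s hs => h.box.deriv_ψ z hz s hs) (fun s hs => h.norm_f _ (h.box.mem z hz s hs)) ht hs

theorem norm_V_sub_le (hz : z ∈ ball z₀ r) {s t : ℝ} (hs : s ∈ Icc (-ε) ε)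
    (ht : t ∈ Icc (-ε) ε) : ‖V s z - V t z‖ ≤ C * C * |s - t| :=
  (convex_Icc (-ε) ε).norm_image_sub_le_of_norm_hasDerivWithin_le
    (fun s hs => h.box.deriv_V z hz s hs) (fun s hs => by
      have hC := h.nonneg hz
      refine (ContinuousLinearMap.opNorm_comp_le _ _).trans ?_
      gcongr
      · exact h.norm_Df _ (h.box.mem z hz s hs)
      · exact h.box.norm_V z hz s hs) ht hs

theorem norm_fderiv_value_sub_le (hz : z ∈ ball z₀ r) (hz' : z' ∈ ball z₀ r) :
    ‖fderiv ℝ (fun z => H (ψ (θ z) z)) z' - fderiv ℝ (fun z => H (ψ (θ z) z)) z‖ ≤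
      (C ^ 4 * 2 + C ^ 3 + C ^ 2) * ‖z' - z‖ := by
  rw [(h.hasFDerivAt_value hz).fderiv, (h.hasFDerivAt_value hz').fderiv]
  have hC := h.nonneg hz
  have hθ := h.θ_mem z hz
  have hθ' := h.θ_mem z' hz'
  have hl := h.lip_θ z hz z' hz'
  have e1 : ‖ψ (θ z') z' - ψ (θ z) z‖ ≤ C * (C * ‖z' - z‖) + C * ‖z' - z‖ := by
    have := norm_add_le (ψ (θ z') z' - ψ (θ z) z') (ψ (θ z) z' - ψ (θ z) z)
    rw [sub_add_sub_cancel] at this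
    refine this.trans (add_le_add ((h.norm_ψ_sub_le hz' hθ' hθ).trans ?_)
      (h.box.lip_ψ z hz z' hz' _ hθ))
    gcongr
  have e2 : ‖V (θ z') z' - V (θ z) z‖ ≤ C * C * (C * ‖z' - z‖) + C * ‖z' - z‖ := by
    have := norm_add_le (V (θ z') z' - V (θ z) z') (V (θ z) z' - V (θ z) z)
    rw [sub_add_sub_cancel] at this
    refine this.trans (add_le_add ((h.norm_V_sub_le hz' hθ' hθ).trans ?_)
      (h.box.lip_V z hz z' hz' _ hθ))
    gcongr
  have hU := h.box.mem z hz _ hθ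
  have hU' := h.box.mem z' hz' _ hθ'
  have e : (fderiv ℝ H (ψ (θ z') z')).comp (V (θ z') z') -
      (fderiv ℝ H (ψ (θ z) z)).comp (V (θ z) z) =
      (fderiv ℝ H (ψ (θ z') z') - fderiv ℝ H (ψ (θ z) z)).comp (V (θ z') z') +
        (fderiv ℝ H (ψ (θ z) z)).comp (V (θ z') z' - V (θ z) z) := by
    rw [ContinuousLinearMap.sub_comp, ContinuousLinearMap.comp_sub]; abel
  rw [e]
  have e3 : ‖(fderiv ℝ H (ψ (θ z') z') - fderiv ℝ H (ψ (θ z) z)).comp (V (θ z') z')‖ ≤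
      C * (C * (C * ‖z' - z‖) + C * ‖z' - z‖) * C := by
    refine (ContinuousLinearMap.opNorm_comp_le _ _).trans ?_
    gcongr
    · refine (h.lip_DH _ hU _ hU').trans ?_
      gcongr
    · exact h.box.norm_V z' hz' _ hθ'
  have e4 : ‖(fderiv ℝ H (ψ (θ z) z)).comp (V (θ z') z' - V (θ z) z)‖ ≤
      C * (C * C * (C * ‖z' - z‖) + C * ‖z' - z‖) := by
    refine (ContinuousLinearMap.opNorm_comp_le _ _).trans ?_
    gcongr
    exact h.norm_DH _ hU
  exact (norm_add_le _ _).trans ((add_le_add e3 e4).trans_eq (by ring))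

theorem V_apply_field (hz : z ∈ ball z₀ r) {s : ℝ} (hs : s ∈ Icc (-ε) ε) :
    V s z (f z) = f (ψ s z) := by
  have h0 := h.zero_mem hz
  have h1 := norm_le_of_norm_deriv_le (K := C) (e := 0) (s := 0)
    (r := fun s => V s z (f z) - f (ψ s z))
    (fun t ht => ((h.box.deriv_V z hz t ht).clm_apply
      (hasDerivWithinAt_const t (Icc (-ε) ε) (f z))).sub
        ((h.diff_f _ (h.box.mem z hz t ht)).hasFDerivAt.comp_hasDerivWithinAt t
          (h.box.deriv_ψ z hz t ht)))
    (fun t ht => ?_) (h.nonneg hz) le_rfl h.small h0 s hs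
  · simp only [h.box.V_zero z hz, h.ψ_zero hz] at h1
    simp only [ContinuousLinearMap.id_apply, sub_self, norm_zero, mul_zero, zero_mul,
      add_zero] at h1
    exact sub_eq_zero.1 (norm_le_zero_iff.1 h1)
  · simp only [ContinuousLinearMap.comp_apply, map_zero, add_zero]
    rw [← map_sub]
    refine (ContinuousLinearMap.le_opNorm _ _).trans ?_
    gcongr
    exact h.norm_Df _ (h.box.mem z hz t ht)

theorem fderiv_value_field (hz : z ∈ ball z₀ r) :
    fderiv ℝ (fun z => H (ψ (θ z) z)) z (f z) = 0 := by
  rw [(h.hasFDerivAt_value hz).fderiv, ContinuousLinearMap.comp_apply,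
    h.V_apply_field hz (h.θ_mem z hz), h.DH_f _ (h.box.mem z hz _ (h.θ_mem z hz)),
    h.solves z hz, neg_zero]

theorem value_of_Q_eq_zero (hz : z ∈ ball z₀ r) (hQ : Q z = 0) :
    H (ψ (θ z) z) = H z ∧ fderiv ℝ (fun z => H (ψ (θ z) z)) z = fderiv ℝ H z := by
  rw [(h.hasFDerivAt_value hz).fderiv, h.θ_zero z hz hQ, h.ψ_zero hz, h.box.V_zero z hz]
  exact ⟨rfl, ContinuousLinearMap.comp_id _⟩

end CriticalFlow

end Overmaximised

section Homogeneous

variable {E : Type*} [NormedAddCommGroup E] [NormedSpace ℝ E] [FiniteDimensional ℝ E]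

/-- The Euler relation for a function that is homogeneous of degree one in the momentum implies
the corresponding relation for its Hamiltonian vector field. -/
theorem fderiv_symGrad_inr {G : E × (E →L[ℝ] ℝ) → ℝ} {z : E × (E →L[ℝ] ℝ)}
    (hG : ContDiffAt ℝ 2 G z) (heul : ∀ᶠ y in 𝓝 z, fderiv ℝ G y (0, y.2) = G y) :
    fderiv ℝ (fun y => symGrad (fderiv ℝ G y)) z (0, z.2) = (0, (symGrad (fderiv ℝ G z)).2) := by
  have hd : DifferentiableAt ℝ (fderiv ℝ G) z :=
    (hG.fderiv_right (m := 1) (by norm_num)).differentiableAt (by norm_num)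
  have h1 : HasFDerivAt (fun y => symGrad (fderiv ℝ G y))
      (symGradL.comp (fderiv ℝ (fderiv ℝ G) z)) z := by
    have h0 := HasFDerivAt.comp z ((symGradL (E := E)).hasFDerivAt (x := fderiv ℝ G z))
      hd.hasFDerivAt
    exact h0
  rw [h1.fderiv, ContinuousLinearMap.comp_apply, symGradL_apply]
  have h2 : ∀ w, fderiv ℝ (fderiv ℝ G) z (0, z.2) w = fderiv ℝ G z (w.1, 0) := by
    intro w
    have hin : HasFDerivAt (fun y : E × (E →L[ℝ] ℝ) => ((0 : E), y.2))
        ((ContinuousLinearMap.inr ℝ E (E →L[ℝ] ℝ)).comp (ContinuousLinearMap.snd ℝ E (E →L[ℝ] ℝ)))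
        z := ((ContinuousLinearMap.inr ℝ E (E →L[ℝ] ℝ)).comp
          (ContinuousLinearMap.snd ℝ E (E →L[ℝ] ℝ))).hasFDerivAt
    have h3 := hd.hasFDerivAt.clm_apply hin
    have h4 := (hG.differentiableAt (by norm_num)).hasFDerivAt.congr_of_eventuallyEq heul
    have h5 := congrArg (fun A => A w) (h3.unique h4)
    simp at h5
    have hs : fderiv ℝ (fderiv ℝ G) z (0, z.2) w = fderiv ℝ (fderiv ℝ G) z w (0, z.2) :=
      (hG.isSymmSndFDerivAt (by simp)) _ _
    have h6 : fderiv ℝ G z w = fderiv ℝ G z (w.1, 0) + fderiv ℝ G z (0, w.2) := by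
      rw [← map_add]; simp
    rw [hs]
    linarith
  symm
  refine eq_symGrad fun v => ?_
  rw [h2 v, sform]
  simp [symGrad_snd_apply]

end Homogeneous

section

/-- A curve that cannot leave the closed set `K` before leaving the neighbourhood `V` of `K`
stays in `K`. -/
theorem mapsTo_of_stay_right {X : Type*} [TopologicalSpace X] {γ : ℝ → X} {a b : ℝ} {K V : Set X}
    (hc : ContinuousOn γ (Icc a b)) (hK : IsClosed K) (hV : IsOpen V) (hKV : K ⊆ V) (ha : γ a ∈ K)
    (hstep : ∀ t ∈ Icc a b, MapsTo γ (Icc a t) V → γ t ∈ K) : MapsTo γ (Icc a b) K := by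
  by_contra hcon
  obtain ⟨t₁, ht₁, ht₁K⟩ : ∃ t ∈ Icc a b, γ t ∉ K := by
    simpa [MapsTo, and_assoc] using hcon
  set B := {t | t ∈ Icc a b ∧ γ t ∉ K}
  have hbdd : BddBelow B := ⟨a, fun t ht => ht.1.1⟩
  have hne : B.Nonempty := ⟨t₁, ht₁, ht₁K⟩
  set σ := sInf B
  have hσa : a ≤ σ := le_csInf hne fun t ht => ht.1.1
  have hσb : σ ≤ b := (csInf_le hbdd ⟨ht₁, ht₁K⟩).trans ht₁.2
  have hlt : ∀ t ∈ Ico a σ, γ t ∈ K := fun t ht => by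
    by_contra h
    exact absurd (csInf_le hbdd ⟨⟨ht.1, ht.2.le.trans hσb⟩, h⟩) (not_le.2 ht.2)
  have hσK : γ σ ∈ K := by
    rcases hσa.eq_or_lt with h | h
    · rwa [← h]
    · have hcl := hc.preimage_isClosed_of_isClosed isClosed_Icc hK
      have h1 : Ico a σ ⊆ Icc a b ∩ γ ⁻¹' K := fun t ht => ⟨⟨ht.1, ht.2.le.trans hσb⟩, hlt t ht⟩
      have h2 := closure_minimal h1 hcl
      rw [closure_Ico h.ne] at h2
      exact (h2 ⟨hσa, le_rfl⟩).2
  have hnear : ∀ᶠ t in 𝓝[Icc a b] σ, γ t ∈ V := hc σ ⟨hσa, hσb⟩ (hV.mem_nhds (hKV hσK))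
  obtain ⟨δ, hδ, hball⟩ := mem_nhdsWithin_iff.1 hnear
  obtain ⟨t₂, ht₂B, ht₂⟩ := exists_lt_of_csInf_lt hne (show sInf B < σ + δ by linarith)
  refine ht₂B.2 (hstep t₂ ht₂B.1 fun t ht => ?_)
  rcases lt_or_ge t σ with h | h
  · exact hKV (hlt t ⟨ht.1, h⟩)
  · refine hball ⟨?_, ht.1, ht.2.trans ht₂B.1.2⟩
    rw [mem_ball, Real.dist_eq, abs_of_nonneg (by linarith)]
    linarith [ht.2]

theorem mapsTo_of_stay_left {X : Type*} [TopologicalSpace X] {γ : ℝ → X} {a b : ℝ} {K V : Set X}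
    (hc : ContinuousOn γ (Icc a b)) (hK : IsClosed K) (hV : IsOpen V) (hKV : K ⊆ V) (hb : γ b ∈ K)
    (hstep : ∀ t ∈ Icc a b, MapsTo γ (Icc t b) V → γ t ∈ K) : MapsTo γ (Icc a b) K := by
  have h1 := mapsTo_of_stay_right (γ := fun t => γ (-t)) (a := -b) (b := -a) (K := K) (V := V)
    (hc.comp continuousOn_neg fun t ht => ⟨by linarith [ht.2], by linarith [ht.1]⟩) hK hV hKV
    (by simpa using hb) fun t ht hm => hstep (-t) ⟨by linarith [ht.2], by linarith [ht.1]⟩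
      fun s hs => by
        have := hm (x := -s) ⟨by linarith [hs.2], by linarith [hs.1]⟩
        simpa using this
  intro t ht
  have := h1 (x := -t) ⟨by linarith [ht.2], by linarith [ht.1]⟩
  simpa using this

section CotangentCurves

variable {E : Type*} [NormedAddCommGroup E] [NormedSpace ℝ E]
  {M : Type*} [TopologicalSpace M] [ChartedSpace E M] [IsManifold 𝓘(ℝ, E) ∞ M]

instance t2Space_cotangent [T2Space M] : T2Space (Cotangent E M) := by
  refine ⟨fun ℓ ℓ' hne => ?_⟩
  by_cases hb : ℓ.1 = ℓ'.1
  · have h1 := mem_cotChart_source ℓ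
    have h2 : ℓ' ∈ (cotChart ℓ.1).source := by rw [hb]; exact mem_cotChart_source ℓ'
    have h3 : cotChart ℓ.1 ℓ ≠ cotChart ℓ.1 ℓ' := fun h => hne ((cotChart ℓ.1).injOn h1 h2 h)
    obtain ⟨u, v, hu, hv, hxu, hyv, huv⟩ := t2_separation h3
    have hc := continuousOn_cotChart (E := E) ℓ.1
    have ho := isOpen_cotChart_source (E := E) ℓ.1
    refine ⟨_, _, hc.isOpen_inter_preimage ho hu, hc.isOpen_inter_preimage ho hv, ⟨h1, hxu⟩,
      ⟨h2, hyv⟩, ?_⟩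
    exact (huv.preimage _).mono inter_subset_right inter_subset_right
  · obtain ⟨u, v, hu, hv, hxu, hyv, huv⟩ := t2_separation hb
    have hc : Continuous (fun ℓ : Cotangent E M => ℓ.1) :=
      FiberBundle.continuous_proj (E →L[ℝ] ℝ)
        (fun x : M => TangentSpace 𝓘(ℝ, E) x →L[ℝ] Bundle.Trivial M ℝ x)
    exact ⟨_, _, hu.preimage hc, hv.preimage hc, hxu, hyv, huv.preimage _⟩

variable [FiniteDimensional ℝ E]

/-- `γ` follows the time-dependent Hamiltonian `h` wherever that is regular: on each time interval
on which the coordinates of `γ` stay in a set on which `h` is a `NiceHam`, they form a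
`HamCurve`. -/
def FollowsHam (h : ℝ → Cotangent E M → ℝ) (γ : ℝ → Cotangent E M) (a b : ℝ) : Prop :=
  ContinuousOn γ (Icc a b) ∧ ∀ (x : M) (a' b' : ℝ) (D : Set (E × (E →L[ℝ] ℝ))) (C : ℝ),
    a ≤ a' → a' ≤ b' → b' ≤ b →
    (∀ t ∈ Icc a' b', γ t ∈ (cotChart x).source ∧ cotChart x (γ t) ∈ D) →
    (∀ᵐ t ∂volume.restrict (Icc a' b'), NiceHam (fun z => h t ((cotChart x).symm z)) D C) →
    HamCurve (fun t z => h t ((cotChart x).symm z)) (fun t => cotChart x (γ t)) a' b' C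

theorem NiceHam.mdifferentiableAt {F : Cotangent E M → ℝ} {x : M} {ℓ : Cotangent E M}
    {D : Set (E × (E →L[ℝ] ℝ))} {C : ℝ} (h : NiceHam (fun z => F ((cotChart x).symm z)) D C)
    (hℓ : ℓ ∈ (cotChart x).source) (hD : cotChart x ℓ ∈ D) :
    MDifferentiableAt (cotModel E) 𝓘(ℝ, ℝ) F ℓ :=
  mdifferentiableAt_of_comp_cotChart_symm hℓ (h.diff _ hD)

variable {h h' : ℝ → Cotangent E M → ℝ} {γ γ' : ℝ → Cotangent E M} {a b : ℝ}

theorem IsCaratheodorySolution.followsHam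
    (H : IsCaratheodorySolution (cotModel E) (fun t => hamField (h t)) γ a b) :
    FollowsHam h γ a b := by
  refine ⟨H.1.1, fun x a' b' D C ha hab hb hD hn => ?_⟩
  have hd : ∀ᵐ t ∂volume.restrict (Icc a' b'), HasDerivAt (fun t => cotChart x (γ t))
      (symGrad (fderiv ℝ (fun z => h t ((cotChart x).symm z)) (cotChart x (γ t)))) t := by
    filter_upwards [ae_restrict_Icc_mono H.2 ha hb, hn, ae_restrict_mem measurableSet_Icc]
      with t h1 h2 ht
    rw [← hasDerivWithinAt_univ]
    exact hasDerivWithinAt_cotChart_comp h1.hasMFDerivWithinAt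
      (h2.mdifferentiableAt (hD t ht).1 (hD t ht).2) (hD t ht).1
  refine ⟨norm_sub_le_abs_of_ac (H.1.2 ⟨x, 0⟩ a' b' ha hab hb fun t ht => (hD t ht).1) ?_, hd⟩
  filter_upwards [hd, hn, ae_restrict_mem measurableSet_Icc] with t h1 h2 ht
  exact ⟨_, h1, (norm_symGrad_le _).trans (h2.bound _ (hD t ht).2)⟩

theorem ae_mem_Ioo (a b : ℝ) : ∀ᵐ t ∂volume.restrict (Icc a b), t ∈ Ioo a b := by
  rw [← restrict_Ioo_eq_restrict_Icc]
  exact ae_restrict_mem measurableSet_Ioo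

theorem ae_restrict_const {p : Prop} (hab : a < b)
    (h : ∀ᵐ _t ∂volume.restrict (Icc a b), p) : p := by
  by_contra hp
  have h1 : volume.restrict (Icc a b) = 0 := by
    rw [← ae_eq_bot, ← eventually_false_iff_eq_bot]
    exact h.mono fun _ h => hp h
  rw [Measure.restrict_eq_zero, Real.volume_Icc] at h1
  simp only [ENNReal.ofReal_eq_zero] at h1
  linarith

theorem hamCurve_self {h : ℝ → E × (E →L[ℝ] ℝ) → ℝ} {z : ℝ → E × (E →L[ℝ] ℝ)} {a C : ℝ} :
    HamCurve h z a a C := by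
  refine ⟨fun s hs t ht => ?_, ?_⟩
  · rw [Icc_self] at hs ht
    rw [mem_singleton_iff.1 hs, mem_singleton_iff.1 ht]; simp
  · simp

theorem _root_.IsMIntegralCurveOn.followsHam {F : Cotangent E M → ℝ}
    (H : IsMIntegralCurveOn (I := cotModel E) γ (hamField F) (Icc a b)) :
    FollowsHam (fun _ => F) γ a b := by
  refine ⟨fun t ht => (H t ht).continuousWithinAt, fun x a' b' D C ha hab hb hD hn => ?_⟩
  rcases hab.eq_or_lt with rfl | hab
  · exact hamCurve_self
  have hn := ae_restrict_const hab hn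
  have hd : ∀ t ∈ Icc a' b', HasDerivWithinAt (fun t => cotChart x (γ t))
      (symGrad (fderiv ℝ (fun z => F ((cotChart x).symm z)) (cotChart x (γ t)))) (Icc a' b') t :=
    fun t ht => (hasDerivWithinAt_cotChart_comp (H t ⟨ha.trans ht.1, ht.2.trans hb⟩)
      (hn.mdifferentiableAt (hD t ht).1 (hD t ht).2) (hD t ht).1).mono (Icc_subset_Icc ha hb)
  refine ⟨fun s hs t ht => ?_, ?_⟩
  · exact (convex_Icc a' b').norm_image_sub_le_of_norm_hasDerivWithin_le hd
      (fun t ht => (norm_symGrad_le _).trans (hn.bound _ (hD t ht).2)) ht hs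
  · filter_upwards [ae_mem_Ioo a' b'] with t ht
    exact (hd t (Ioo_subset_Icc_self ht)).hasDerivAt (Icc_mem_nhds ht.1 ht.2)

theorem FollowsHam.mono {a' b' : ℝ} (H : FollowsHam h γ a b) (ha : a ≤ a') (hb : b' ≤ b) :
    FollowsHam h γ a' b' :=
  ⟨H.1.mono (Icc_subset_Icc ha hb), fun x a'' b'' D C ha'' hab hb'' =>
    H.2 x a'' b'' D C (ha.trans ha'') hab (hb''.trans hb)⟩

theorem FollowsHam.congr (H : FollowsHam h γ a b)
    (hh : ∀ᵐ t ∂volume.restrict (Icc a b), h t = h' t) : FollowsHam h' γ a b := by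
  refine ⟨H.1, fun x a' b' D C ha hab hb hD hn => ?_⟩
  have hh' := ae_restrict_Icc_mono hh ha hb
  refine HamCurve.congr (H.2 x a' b' D C ha hab hb hD ?_) ?_
  · filter_upwards [hn, hh'] with t h1 h2
    rwa [h2]
  · filter_upwards [hh'] with t h2
    rw [h2]

theorem FollowsHam.glue {m : ℝ} (H : FollowsHam h γ a m) (H' : FollowsHam h γ m b)
    (ham : a ≤ m) (hmb : m ≤ b) : FollowsHam h γ a b := by
  refine ⟨?_, fun x a' b' D C ha hab hb hD hn => ?_⟩
  · rw [← Icc_union_Icc_eq_Icc ham hmb]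
    exact H.1.union_of_isClosed H'.1 isClosed_Icc isClosed_Icc
  rcases le_total b' m with h1 | h1
  · exact H.2 x a' b' D C ha hab h1 hD hn
  rcases le_total m a' with h2 | h2
  · exact H'.2 x a' b' D C h2 hab hb hD hn
  exact (H.2 x a' m D C ha h2 le_rfl (fun t ht => hD t ⟨ht.1, ht.2.trans h1⟩)
      (ae_restrict_Icc_mono hn le_rfl h1)).glue
    (H'.2 x m b' D C le_rfl h1 hb (fun t ht => hD t ⟨h2.trans ht.1, ht.2⟩)
      (ae_restrict_Icc_mono hn h2 le_rfl))

/-- The local bounds on `h` near `ℓ₀` in the preferred chart. -/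
def NiceAt (F : Cotangent E M → ℝ) (ℓ₀ : Cotangent E M) : Prop :=
  ∃ R > 0, ∃ C ≥ 0, NiceHam (fun z => F ((cotChart ℓ₀.1).symm z))
    (ball (cotChart ℓ₀.1 ℓ₀) R) C

theorem cotSmooth_euler_lift {f : (x : M) → TangentSpace 𝓘(ℝ, E) x}
    (hf : ContMDiff 𝓘(ℝ, E) 𝓘(ℝ, E).tangent ∞ (fun x => (⟨x, f x⟩ : TangentBundle 𝓘(ℝ, E) M)))
    {x : M} {z : E × (E →L[ℝ] ℝ)}
    (hz : z ∈ (cotChart x : PartialEquiv (Cotangent E M) _).target) :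
    fderiv ℝ (fun z => lift f ((cotChart x).symm z)) z (0, z.2) =
      lift f ((cotChart x).symm z) := by
  have hd : HasFDerivAt (fun z => lift f ((cotChart x).symm z)) _ z :=
    (((cotSmooth_lift hf).contDiffAt hz).differentiableAt (by simp)).hasFDerivAt
  have hl : HasDerivAt (fun s : ℝ => ((z.1, s • z.2) : E × (E →L[ℝ] ℝ)))
      (0, z.2) 1 := by
    have h1 : HasDerivAt (fun s : ℝ => s • z.2) z.2 1 := by
      simpa using (hasDerivAt_id (1 : ℝ)).smul_const z.2
    exact (hasDerivAt_const (1 : ℝ) z.1).prodMk h1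
  have hz1 : ((z.1, (1 : ℝ) • z.2) : E × (E →L[ℝ] ℝ)) = z := by simp
  have hcomp := HasFDerivAt.comp_hasDerivAt (f := fun s : ℝ => ((z.1, s • z.2) : E × (E →L[ℝ] ℝ)))
    (1 : ℝ) (by rw [hz1]; exact hd) hl
  have hz' : ∀ s : ℝ, ((z.1, s • z.2) : E × (E →L[ℝ] ℝ)) ∈
      (cotChart x : PartialEquiv (Cotangent E M) _).target := fun s => by
    rw [cotChart_target] at hz ⊢
    exact ⟨hz.1, mem_univ _⟩
  have heq : ((fun z => lift f ((cotChart x).symm z)) ∘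
      fun s : ℝ => ((z.1, s • z.2) : E × (E →L[ℝ] ℝ))) =
      fun s => s * (z.2 (coordField x f z.1)) := by
    funext s
    simp only [Function.comp_apply]
    rw [lift_cotChart_symm (hz' s)]
    simp
  rw [heq] at hcomp
  have h2 : HasDerivAt (fun s : ℝ => s * (z.2 (coordField x f z.1)))
      (z.2 (coordField x f z.1)) 1 := by
    simpa using (hasDerivAt_id (1 : ℝ)).mul_const (z.2 (coordField x f z.1))
  rw [hcomp.unique h2, lift_cotChart_symm hz]

theorem niceAt_lift {f : (x : M) → TangentSpace 𝓘(ℝ, E) x}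
    (hf : ContMDiff 𝓘(ℝ, E) 𝓘(ℝ, E).tangent ∞ (fun x => (⟨x, f x⟩ : TangentBundle 𝓘(ℝ, E) M)))
    (ℓ₀ : Cotangent E M) : NiceAt (lift f) ℓ₀ := by
  have hz := (cotChart ℓ₀.1).map_source (mem_cotChart_source ℓ₀)
  obtain ⟨R, hR, C, hC⟩ := exists_niceHam_ball
    (((cotSmooth_lift hf).contDiffAt hz).of_le two_le_infty)
    (Filter.eventually_of_mem ((isOpen_cotChart_target ℓ₀.1).mem_nhds hz)
      fun z hz => cotSmooth_euler_lift hf hz)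
  exact ⟨R, hR, C, (norm_nonneg _).trans (hC.bound _ (mem_ball_self hR)), hC⟩

variable [T2Space M]

/-- A curve that follows a Hamiltonian for a short time stays in a coordinate ball. -/
theorem FollowsHam.mem_closedBall (H : FollowsHam h γ a b) {x : M} {z₀ : E × (E →L[ℝ] ℝ)}
    {R C : ℝ} (hR : 0 < R)
    (hball : ball z₀ (3 * R) ⊆ (cotChart x : PartialEquiv (Cotangent E M) _).target)
    (hn : ∀ᵐ t ∂volume.restrict (Icc a b),
      NiceHam (fun z => h t ((cotChart x).symm z)) (ball z₀ (3 * R)) C)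
    (hC : 0 ≤ C) (hCab : C * (b - a) ≤ R) {s : ℝ} (hs : s ∈ Icc a b)
    (hsx : γ s ∈ (cotChart x).source) (hsR : cotChart x (γ s) ∈ closedBall z₀ R) :
    ∀ t ∈ Icc a b, γ t ∈ (cotChart x).source ∧
      cotChart x (γ t) ∈ closedBall z₀ (2 * R) := by
  set K : Set (Cotangent E M) := (cotChart x).symm '' closedBall z₀ (2 * R)
  set V : Set (Cotangent E M) := (cotChart x).source ∩ cotChart x ⁻¹' ball z₀ (3 * R)

  have hsub : closedBall z₀ (2 * R) ⊆ ball z₀ (3 * R) :=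
    closedBall_subset_ball (by linarith)
  have hK : IsClosed K := by
    have : ProperSpace (E × (E →L[ℝ] ℝ)) := FiniteDimensional.proper ℝ _
    exact ((isCompact_closedBall z₀ (2 * R)).image_of_continuousOn
      ((continuousOn_cotChart_symm x).mono (hsub.trans hball))).isClosed
  have hV : IsOpen V :=
    (continuousOn_cotChart x).isOpen_inter_preimage (isOpen_cotChart_source x) isOpen_ball
  have hKmem : ∀ ℓ : Cotangent E M, ℓ ∈ K ↔
      ℓ ∈ (cotChart x).source ∧ cotChart x ℓ ∈ closedBall z₀ (2 * R) := by
    intro ℓ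
    constructor
    · rintro ⟨z, hz, rfl⟩
      have hzt := hball (hsub hz)
      exact ⟨(cotChart x).map_target hzt, by rwa [(cotChart x).right_inv hzt]⟩
    · rintro ⟨h1, h2⟩
      exact ⟨_, h2, (cotChart x).left_inv h1⟩
  have hKV : K ⊆ V := fun ℓ hℓ => ⟨((hKmem ℓ).1 hℓ).1, hsub ((hKmem ℓ).1 hℓ).2⟩
  have hsK : γ s ∈ K := (hKmem _).2 ⟨hsx, closedBall_subset_closedBall (by linarith) hsR⟩
  have key : ∀ a' b', a ≤ a' → b' ≤ b → s ∈ Icc a' b' → MapsTo γ (Icc a' b') V →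
      ∀ t ∈ Icc a' b', γ t ∈ K := by
    intro a' b' ha hb hs' hm t ht
    have hc := H.2 x a' b' _ C ha (hs'.1.trans hs'.2) hb (fun t ht => hm ht)
      (ae_restrict_Icc_mono hn ha hb)
    refine (hKmem _).2 ⟨(hm ht).1, ?_⟩
    have h1 := hc.lip t ht s hs'
    have h2 : |t - s| ≤ b - a :=
      abs_sub_le_iff.2 ⟨by linarith [ht.2, hs'.1], by linarith [ht.1, hs'.2]⟩
    rw [Metric.mem_closedBall] at hsR ⊢
    have h3 := dist_triangle (cotChart x (γ t)) (cotChart x (γ s)) z₀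
    rw [← dist_eq_norm] at h1
    have h4 : C * |t - s| ≤ C * (b - a) := by gcongr
    linarith
  have hr := mapsTo_of_stay_right (H.1.mono (Icc_subset_Icc hs.1 le_rfl)) hK hV hKV hsK
    fun t ht hm => key s t hs.1 ht.2 ⟨le_rfl, ht.1⟩ hm t ⟨ht.1, le_rfl⟩
  have hl := mapsTo_of_stay_left (H.1.mono (Icc_subset_Icc le_rfl hs.2)) hK hV hKV hsK
    fun t ht hm => key t s ht.1 hs.2 ⟨ht.2, le_rfl⟩ hm t ⟨le_rfl, ht.2⟩
  intro t ht
  rw [← hKmem]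
  rcases le_total t s with h | h
  · exact hl ⟨ht.1, h⟩
  · exact hr ⟨h, ht.2⟩

omit [T2Space M] in
theorem FollowsHam.eqOn_of_mem (H : FollowsHam h γ a b) (H' : FollowsHam h γ' a b) {x : M}
    {D : Set (E × (E →L[ℝ] ℝ))} {C : ℝ}
    (hD : ∀ t ∈ Icc a b, γ t ∈ (cotChart x).source ∧ cotChart x (γ t) ∈ D)
    (hD' : ∀ t ∈ Icc a b, γ' t ∈ (cotChart x).source ∧ cotChart x (γ' t) ∈ D)
    (hn : ∀ᵐ t ∂volume.restrict (Icc a b), NiceHam (fun z => h t ((cotChart x).symm z)) D C)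
    (hC : 0 ≤ C) (hCab : C * (b - a) ≤ 1 / 2) {s : ℝ} (hs : s ∈ Icc a b) (hss : γ s = γ' s) :
    EqOn γ γ' (Icc a b) := by
  have hab := hs.1.trans hs.2
  have hc := H.2 x a b D C le_rfl hab le_rfl hD hn
  have hc' := H'.2 x a b D C le_rfl hab le_rfl hD' hn
  intro t ht
  have h1 := norm_sub_le_of_hamCurve (α := 0) (β := 0) hc hc' (fun t ht => (hD t ht).2)
    (fun t ht => (hD' t ht).2) hn hn le_rfl (fun _ _ => rfl) hC hCab hs t ht
  rw [hss] at h1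
  simp only [sub_self, norm_zero, mul_zero, add_zero] at h1
  exact (cotChart x).injOn (hD t ht).1 (hD' t ht).1
    (sub_eq_zero.1 (norm_le_zero_iff.1 h1)).symm

/-- Two curves that follow the same Hamiltonian, which is regular along the first one, and that
meet, are equal. -/
theorem FollowsHam.eqOn (H : FollowsHam h γ a b) (H' : FollowsHam h γ' a b)
    (hn : ∀ t₀ ∈ Icc a b, ∃ R > 0, ∃ C ≥ 0, ∃ ε > 0,
      ∀ᵐ t ∂volume.restrict (Icc a b), t ∈ Icc (t₀ - ε) (t₀ + ε) →
        NiceHam (fun z => h t ((cotChart (γ t₀).1).symm z))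
          (ball (cotChart (γ t₀).1 (γ t₀)) R) C)
    {s : ℝ} (hs : s ∈ Icc a b) (hss : γ s = γ' s) : EqOn γ γ' (Icc a b) := by
  have hconn : PreconnectedSpace (Icc a b) := Subtype.preconnectedSpace isPreconnected_Icc
  set S : Set (Icc a b) := {t | γ t = γ' t}
  have hcl : IsClosed S := isClosed_eq (continuousOn_iff_continuous_domRestrict.1 H.1)
    (continuousOn_iff_continuous_domRestrict.1 H'.1)
  have hop : IsOpen S := by
    rw [isOpen_iff_mem_nhds]
    rintro ⟨t₀, ht₀⟩ (heq : γ t₀ = γ' t₀)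
    obtain ⟨R, hR, C, hC, ε, hε, hnice⟩ := hn t₀ ht₀
    set x := (γ t₀).1
    have hV : IsOpen ((cotChart x).source ∩ cotChart x ⁻¹' ball (cotChart x (γ t₀)) R) :=
      (continuousOn_cotChart x).isOpen_inter_preimage (isOpen_cotChart_source x)
        isOpen_ball
    have hmem : γ t₀ ∈ (cotChart x).source ∩ cotChart x ⁻¹' ball (cotChart x (γ t₀)) R :=
      ⟨mem_cotChart_source _, mem_ball_self hR⟩
    have e1 := H.1 t₀ ht₀ (hV.mem_nhds hmem)
    have e2 := H'.1 t₀ ht₀ (hV.mem_nhds (heq ▸ hmem))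
    obtain ⟨δ, hδ, hball⟩ := mem_nhdsWithin_iff.1 (inter_mem e1 e2)
    set η := min (min (δ / 2) ε) (1 / (4 * (C + 1)))
    have hη0 : 0 < η := by positivity
    have hηδ : η ≤ δ / 2 := (min_le_left _ _).trans (min_le_left _ _)
    have hηε : η ≤ ε := (min_le_left _ _).trans (min_le_right _ _)
    have hηC : C * (2 * η) ≤ 1 / 2 := by
      have h1 : η ≤ 1 / (4 * (C + 1)) := min_le_right _ _
      have h2 : C * (2 * η) ≤ (C + 1) * (2 * (1 / (4 * (C + 1)))) := by gcongr; linarith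
      refine h2.trans (le_of_eq ?_)
      field_simp
      norm_num
    set a' := max a (t₀ - η)
    set b' := min b (t₀ + η)
    have ha' : a ≤ a' := le_max_left _ _
    have hb' : b' ≤ b := min_le_left _ _
    have hta : a' ≤ t₀ := max_le ht₀.1 (by linarith)
    have htb : t₀ ≤ b' := le_min ht₀.2 (by linarith)
    have ha2 : t₀ - η ≤ a' := le_max_right _ _
    have hb2 : b' ≤ t₀ + η := min_le_right _ _
    have hin : ∀ t ∈ Icc a' b', t ∈ ball t₀ δ ∩ Icc a b := fun t ht => by
      refine ⟨?_, ha'.trans ht.1, ht.2.trans hb'⟩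
      rw [mem_ball, Real.dist_eq, abs_lt]
      constructor <;> linarith [ht.1, ht.2]
    have hEq := (H.mono ha' hb').eqOn_of_mem (H'.mono ha' hb') (C := C)
      (fun t ht => (hball (hin t ht)).1) (fun t ht => (hball (hin t ht)).2)
      (by
        filter_upwards [ae_restrict_Icc_mono hnice ha' hb', ae_restrict_mem measurableSet_Icc]
          with t h1 ht
        exact h1 ⟨by linarith [ht.1], by linarith [ht.2]⟩) hC
      (le_trans (by gcongr; linarith) hηC) ⟨hta, htb⟩ heq
    refine _root_.mem_nhds_iff.2 ⟨Subtype.val ⁻¹' Ioo (t₀ - η) (t₀ + η), ?_,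
      isOpen_Ioo.preimage continuous_subtype_val, ⟨by simpa using hη0, by simpa using hη0⟩⟩
    rintro ⟨t, ht⟩ ⟨h1, h2⟩
    exact hEq ⟨max_le ht.1 h1.le, le_min ht.2 h2.le⟩
  have huniv := IsClopen.eq_univ ⟨hcl, hop⟩ ⟨⟨s, hs⟩, hss⟩
  intro t ht
  have : (⟨t, ht⟩ : Icc a b) ∈ S := huniv ▸ mem_univ _
  exact this

end CotangentCurves

end

section TildeH

variable {E : Type*} [NormedAddCommGroup E] [NormedSpace ℝ E]
  {M : Type*} [TopologicalSpace M] [ChartedSpace E M] [IsManifold 𝓘(ℝ, E) ∞ M]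

/-- Smoothness of a vector field. -/
def SmoothField (f : (x : M) → TangentSpace 𝓘(ℝ, E) x) : Prop :=
  ContMDiff 𝓘(ℝ, E) 𝓘(ℝ, E).tangent ∞ (fun x => (⟨x, f x⟩ : TangentBundle 𝓘(ℝ, E) M))

theorem SmoothField.sub {f g : (x : M) → TangentSpace 𝓘(ℝ, E) x} (hf : SmoothField f)
    (hg : SmoothField g) : SmoothField fun x => f x - g x :=
  ContMDiff.sub_section hf hg

variable [FiniteDimensional ℝ E]

/-- A Hamiltonian curve given by its coordinates. -/
theorem isMIntegralCurveOn_of_coord {F : Cotangent E M → ℝ} (hF : CotSmooth F) {x : M}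
    {z : ℝ → E × (E →L[ℝ] ℝ)} {s : Set ℝ}
    (hz : ∀ t ∈ s, z t ∈ (cotChart x : PartialEquiv (Cotangent E M) _).target)
    (hd : ∀ t ∈ s, HasDerivWithinAt z
      (symGrad (fderiv ℝ (fun z => F ((cotChart x).symm z)) (z t))) s t) :
    IsMIntegralCurveOn (I := cotModel E) (fun t => (cotChart x).symm (z t)) (hamField F) s := by
  intro t ht
  have h1 := hasMFDerivWithinAt_extChartAt_symm_comp (I := cotModel E)
    (x := (⟨x, 0⟩ : Cotangent E M)) (hd t ht) (hz t ht)
  have hm : (cotChart x).symm (z t) ∈ (cotChart x).source := (cotChart x).map_target (hz t ht)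
  have h2 := cotTrans_hamField (x₀ := x) (hF.mdifferentiableAt ((cotChart x).symm (z t))) hm
  rw [(cotChart x).right_inv (hz t ht)] at h2
  have h3 := (exists_cotTrans_inv hm).2 (hamField F ((cotChart x).symm (z t)))
  rw [h2] at h3
  have h4 : (hamField F ((cotChart x).symm (z t)) : E × (E →L[ℝ] ℝ)) =
    tangentCoordChange (cotModel E) ⟨x, 0⟩ ((cotChart x).symm (z t)) ((cotChart x).symm (z t))
      (symGrad (fderiv ℝ (fun z => F ((cotChart x).symm z)) (z t))) := h3.symm
  have h5 := congrArg (fun v : E × (E →L[ℝ] ℝ) => (1 : ℝ →L[ℝ] ℝ).smulRight v) h4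
  exact h1.congr_mfderiv h5.symm

variable [T2Space M]

theorem FollowsHam.eqOn_of_niceAt {F : Cotangent E M → ℝ} {γ γ' : ℝ → Cotangent E M} {a b : ℝ}
    (H : FollowsHam (fun _ => F) γ a b) (H' : FollowsHam (fun _ => F) γ' a b)
    (hn : ∀ t ∈ Icc a b, NiceAt F (γ t)) {s : ℝ} (hs : s ∈ Icc a b) (hss : γ s = γ' s) :
    EqOn γ γ' (Icc a b) := by
  refine H.eqOn H' (fun t₀ ht₀ => ?_) hs hss
  obtain ⟨R, hR, C, hC, h⟩ := hn t₀ ht₀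
  exact ⟨R, hR, C, hC, 1, one_pos, ae_of_all _ fun t _ => h⟩

theorem ExpTo.unique_of_niceAt {F : Cotangent E M → ℝ} {S S' : Set (Cotangent E M)} {s : ℝ}
    {ℓ ℓ' ℓ'' : Cotangent E M} (hF : ∀ ℓ, NiceAt F ℓ) (h : ExpTo F S s ℓ ℓ')
    (h' : ExpTo F S' s ℓ ℓ'') : ℓ' = ℓ'' := by
  obtain ⟨γ, h0, hs, -, hγ⟩ := h
  obtain ⟨γ', h0', hs', -, hγ'⟩ := h'
  have := FollowsHam.eqOn_of_niceAt (a := min 0 s) (b := max 0 s) hγ.followsHam hγ'.followsHam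
    (fun t _ => hF _) ⟨min_le_left _ _, le_max_left _ _⟩ (h0.trans h0'.symm)
    ⟨min_le_right _ _, le_max_right _ _⟩
  rw [← hs, ← hs', this]

theorem hamExp_eq {F : Cotangent E M → ℝ} {s : ℝ} {ℓ ℓ' : Cotangent E M}
    (hF : ∀ ℓ, NiceAt F ℓ) (h : ExpTo F univ s ℓ ℓ') : hamExp F s ℓ = ℓ' := by
  classical
  have hex : ∃ ℓ', ExpTo F univ s ℓ ℓ' := ⟨ℓ', h⟩
  rw [hamExp, dif_pos hex]
  exact hex.choose_spec.unique_of_niceAt hF h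

omit [T2Space M] in
theorem FlowBox.expTo {F : Cotangent E M → ℝ} (hF : CotSmooth F) {x : M}
    {z₀ z : E × (E →L[ℝ] ℝ)} {U : Set (E × (E →L[ℝ] ℝ))} {ε r C : ℝ} {ψ V}
    (h : FlowBox (fun z => symGrad (fderiv ℝ (fun z => F ((cotChart x).symm z)) z)) z₀ U ε r C ψ V)
    (hU : U ⊆ (cotChart x : PartialEquiv (Cotangent E M) _).target)
    (hz : z ∈ ball z₀ r) {s : ℝ} (hs : s ∈ Icc (-ε) ε) :
    ExpTo F univ s ((cotChart x).symm z) ((cotChart x).symm (ψ s z)) := by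
  have h0 : (0 : ℝ) ∈ Icc (-ε) ε := by constructor <;> linarith [hs.1, hs.2]
  have hsub : uIcc 0 s ⊆ Icc (-ε) ε := uIcc_subset_Icc h0 hs
  refine ⟨fun t => (cotChart x).symm (ψ t z), by simp only [h.ψ_zero z hz], rfl,
    mapsTo_univ _ _, ?_⟩
  exact isMIntegralCurveOn_of_coord hF (fun t ht => hU (h.mem z hz t (hsub ht)))
    fun t ht => (h.deriv_ψ z hz t (hsub ht)).mono hsub

omit [T2Space M] in
theorem poisson_lift_sub {h₂ h₃ : (x : M) → TangentSpace 𝓘(ℝ, E) x} (hh₂ : SmoothField h₂)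
    (hh₃ : SmoothField h₃) (ℓ : Cotangent E M) :
    poisson (lift h₂) (lift fun x => h₃ x - h₂ x) ℓ = poisson (lift h₂) (lift h₃) ℓ := by
  have e : lift (fun x => h₃ x - h₂ x) = fun ℓ : Cotangent E M => lift h₃ ℓ - lift h₂ ℓ :=
    funext fun ℓ => lift_sub h₃ h₂ ℓ
  have h0 := poisson_neg_symm (F := lift h₂) (G := lift h₂) ℓ
  rw [e, poisson_sub_right (cotSmooth_lift hh₃) (cotSmooth_lift hh₂)]
  linarith

omit [T2Space M] in
theorem V_inr_eq {G : E × (E →L[ℝ] ℝ) → ℝ} {H Q θ : E × (E →L[ℝ] ℝ) → ℝ}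
    {z₀ z : E × (E →L[ℝ] ℝ)} {U : Set (E × (E →L[ℝ] ℝ))} {ε r C : ℝ} {ψ V}
    (h : CriticalFlow (fun z => symGrad (fderiv ℝ G z)) H Q θ z₀ U ε r C ψ V)
    (hG : ∀ z ∈ U, ContDiffAt ℝ 2 G z ∧ ∀ᶠ y in 𝓝 z, fderiv ℝ G y (0, y.2) = G y)
    (hz : z ∈ ball z₀ r) {s : ℝ} (hs : s ∈ Icc (-ε) ε) :
    V s z (0, z.2) = (0, (ψ s z).2) := by
  have h0 := h.zero_mem hz
  have h1 := norm_le_of_norm_deriv_le (K := C) (e := 0) (s := 0)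
    (r := fun s => V s z (0, z.2) - (ContinuousLinearMap.inr ℝ E (E →L[ℝ] ℝ))
      (ContinuousLinearMap.snd ℝ E (E →L[ℝ] ℝ) (ψ s z)))
    (fun t ht => ((h.box.deriv_V z hz t ht).clm_apply
      (hasDerivWithinAt_const t (Icc (-ε) ε) ((0 : E), z.2))).sub
        (((ContinuousLinearMap.inr ℝ E (E →L[ℝ] ℝ)).comp
          (ContinuousLinearMap.snd ℝ E (E →L[ℝ] ℝ))).hasFDerivAt.comp_hasDerivWithinAt t
          (h.box.deriv_ψ z hz t ht)))
    (fun t ht => ?_) (h.nonneg hz) le_rfl h.small h0 s hs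
  · simp only [h.box.V_zero z hz, h.ψ_zero hz] at h1
    simp only [ContinuousLinearMap.id_apply, ContinuousLinearMap.inr_apply,
      ContinuousLinearMap.coe_snd', sub_self, norm_zero, mul_zero, zero_mul, add_zero] at h1
    exact sub_eq_zero.1 (norm_le_zero_iff.1 h1)
  · have hU := h.box.mem z hz t ht
    have e := fderiv_symGrad_inr (hG _ hU).1 (hG _ hU).2
    simp only [ContinuousLinearMap.comp_apply, map_zero, add_zero,
      ContinuousLinearMap.inr_apply, ContinuousLinearMap.coe_snd']
    rw [← e, ← map_sub]
    refine (ContinuousLinearMap.le_opNorm _ _).trans ?_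
    gcongr
    exact h.norm_Df _ hU

/-- The local properties of the overmaximised Hamiltonian. -/
structure TildeHLocal (h₂ h₃ : (x : M) → TangentSpace 𝓘(ℝ, E) x) (θ : Cotangent E M → ℝ)
    (Os : Set (Cotangent E M)) (x : M) (D : Set (E × (E →L[ℝ] ℝ))) (C : ℝ) : Prop where
  mem : ∀ z ∈ D, z ∈ (cotChart x : PartialEquiv (Cotangent E M) _).target ∧
    (cotChart x).symm z ∈ Os
  nice : NiceHam (fun z => tildeH h₂ h₃ θ ((cotChart x).symm z)) D C
  le : ∀ z ∈ D, lift h₂ ((cotChart x).symm z) ≤ tildeH h₂ h₃ θ ((cotChart x).symm z)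
  eq_imp : ∀ z ∈ D, tildeH h₂ h₃ θ ((cotChart x).symm z) = lift h₂ ((cotChart x).symm z) →
    poisson (lift h₂) (lift h₃) ((cotChart x).symm z) = 0
  eq_of : ∀ z ∈ D, poisson (lift h₂) (lift h₃) ((cotChart x).symm z) = 0 →
    tildeH h₂ h₃ θ ((cotChart x).symm z) = lift h₂ ((cotChart x).symm z) ∧
    fderiv ℝ (fun z => tildeH h₂ h₃ θ ((cotChart x).symm z)) z =
      fderiv ℝ (fun z => lift h₂ ((cotChart x).symm z)) z
  bracket : ∀ z ∈ D, fderiv ℝ (fun z => tildeH h₂ h₃ θ ((cotChart x).symm z)) z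
    (symGrad (fderiv ℝ (fun z => lift (fun x => h₃ x - h₂ x) ((cotChart x).symm z)) z)) = 0

theorem exists_tildeHLocal {h₂ h₃ : (x : M) → TangentSpace 𝓘(ℝ, E) x} (hh₂ : SmoothField h₂)
    (hh₃ : SmoothField h₃) {τ₂ T : ℝ} {lam : ℝ → Cotangent E M} {Os : Set (Cotangent E M)}
    {θ : Cotangent E M → ℝ} (hθ : IsTheta h₂ h₃ τ₂ T lam Os θ) {ℓ₀ : Cotangent E M}
    (hℓ : ℓ₀ ∈ Os) (hQ : poisson (lift h₂) (lift h₃) ℓ₀ = 0)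
    (hpos : 0 < poisson (lift fun x => h₃ x - h₂ x)
      (poisson (lift h₂) (lift fun x => h₃ x - h₂ x)) ℓ₀) :
    ∃ R > 0, ∃ C ≥ 0, TildeHLocal h₂ h₃ θ Os ℓ₀.1 (ball (cotChart ℓ₀.1 ℓ₀) R) C := by
  have hf := hh₃.sub hh₂
  set f₁ : (x : M) → TangentSpace 𝓘(ℝ, E) x := fun x => h₃ x - h₂ x
  have cF := cotSmooth_lift hf
  have cH := cotSmooth_lift hh₂
  have cQ := CotSmooth.poisson cH (cotSmooth_lift hh₃)
  have eQ : poisson (lift h₂) (lift f₁) = poisson (lift h₂) (lift h₃) :=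
    funext fun ℓ => poisson_lift_sub hh₂ hh₃ ℓ
  rw [eQ] at hpos
  set x := ℓ₀.1 with hx
  set z₀ := cotChart x ℓ₀
  have hsrc : ℓ₀ ∈ (cotChart x).source := mem_cotChart_source ℓ₀
  have hz₀t : z₀ ∈ (cotChart x : PartialEquiv (Cotangent E M) _).target :=
    (cotChart x).map_source hsrc
  have hz₀s : (cotChart x).symm z₀ = ℓ₀ := (cotChart x).left_inv hsrc
  have hto := isOpen_cotChart_target (E := E) x
  set F : E × (E →L[ℝ] ℝ) → ℝ := fun z => lift f₁ ((cotChart x).symm z) with hF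
  set H : E × (E →L[ℝ] ℝ) → ℝ := fun z => lift h₂ ((cotChart x).symm z)
  set Q : E × (E →L[ℝ] ℝ) → ℝ := fun z => poisson (lift h₂) (lift h₃) ((cotChart x).symm z) with hQd
  set f : E × (E →L[ℝ] ℝ) → E × (E →L[ℝ] ℝ) := fun z => symGrad (fderiv ℝ F z) with hfd
  have dF : ∀ z ∈ (cotChart x : PartialEquiv (Cotangent E M) _).target, ContDiffAt ℝ ∞ F z :=
    fun z hz => cF.contDiffAt hz
  have df : ContDiffAt ℝ 2 f z₀ := by
    have h1 : ContDiffAt ℝ 2 (fderiv ℝ F) z₀ := (dF z₀ hz₀t).fderiv_right (m := 2)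
      (WithTop.coe_le_coe.2 (le_top : (2 + 1 : ℕ∞) ≤ ⊤))
    exact (symGradL (E := E)).contDiff.contDiffAt.comp z₀ h1
  have dQ := cQ.contDiffAt hz₀t
  obtain ⟨Rf, hRf, Cf, hCf, bf, lf⟩ := exists_ball_fderiv_bounds df
  obtain ⟨RH, hRH, CH, hCH, bH, lH⟩ := exists_ball_fderiv_bounds
    ((cH.contDiffAt hz₀t).of_le two_le_infty)
  obtain ⟨RQ, hRQ, CQ, hCQ, bQ, lQ⟩ := exists_ball_fderiv_bounds (dQ.of_le two_le_infty)
  have hposc : ∀ᶠ z in 𝓝 z₀, 0 < fderiv ℝ Q z (f z) := by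
    have hc : ContinuousAt (fun z => fderiv ℝ Q z (f z)) z₀ :=
      ((dQ.of_le two_le_infty).fderiv_right (m := 1) (by norm_num)).continuousAt.clm_apply
        df.continuousAt
    refine hc.eventually (lt_mem_nhds ?_)
    have h1 := poisson_eq_fderiv (cF.mdifferentiableAt ℓ₀) (cQ.mdifferentiableAt ℓ₀) hsrc
    rw [h1] at hpos
    exact hpos
  obtain ⟨RU, hRU, hUsub⟩ := Metric.mem_nhds_iff.1 (inter_mem (inter_mem hposc
    (hto.mem_nhds hz₀t)) (inter_mem (ball_mem_nhds z₀ hRf)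
      (inter_mem (ball_mem_nhds z₀ hRH) (ball_mem_nhds z₀ hRQ))))
  set U := ball z₀ RU
  obtain ⟨ε₀, hε₀, r₀, hr₀, C₀, hC₀, ψ, V, box⟩ :=
    exists_flowBox df (ball_mem_nhds z₀ hRU)
  have hθd : ContDiffAt ℝ 1 (fun z => θ ((cotChart x).symm z)) z₀ := by
    have h1 : ContMDiffAt (cotModel E) 𝓘(ℝ, ℝ) ∞ θ ((cotChart x).symm z₀) := by
      rw [hz₀s]; exact (hθ.smooth ℓ₀ hℓ).contMDiffAt (hθ.isOpen.mem_nhds hℓ)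
    have h2 : ContMDiffAt 𝓘(ℝ, E × (E →L[ℝ] ℝ)) (cotModel E) ∞ (cotChart x).symm z₀ :=
      (contMDiffOn_extChartAt_symm (I := cotModel E) (n := ∞) (⟨x, 0⟩ : Cotangent E M)).contMDiffAt
        (hto.mem_nhds hz₀t)
    have h3 := (h1.comp z₀ h2).contDiffAt
    exact h3.of_le one_le_infty
  obtain ⟨Kθ, tθ, htθ, hKθ⟩ := hθd.exists_lipschitzOnWith
  have hθ0 : θ ((cotChart x).symm z₀) = 0 := by
    rw [hz₀s]; exact hθ.zero ℓ₀ hℓ hQ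
  set C := max (max (max Cf CH) (max C₀ Kθ)) (CQ * Cf)
  have hCfC : Cf ≤ C := ((le_max_left _ _).trans (le_max_left _ _)).trans (le_max_left _ _)
  have hCHC : CH ≤ C := ((le_max_right _ _).trans (le_max_left _ _)).trans (le_max_left _ _)
  have hC₀C : C₀ ≤ C := ((le_max_left _ _).trans (le_max_right _ _)).trans (le_max_left _ _)
  have hKθC : (Kθ : ℝ) ≤ C :=
    ((le_max_right _ _).trans (le_max_right _ _)).trans (le_max_left _ _)
  have hCQC : CQ * Cf ≤ C := le_max_right _ _
  have hC0 : 0 ≤ C := hC₀.trans hC₀C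
  set ε := min ε₀ (1 / (4 * (C + 1)))
  have hε0 : 0 < ε := by positivity
  have hsmall : C * (ε - -ε) ≤ 1 / 2 := by
    have h1 : ε ≤ 1 / (4 * (C + 1)) := min_le_right _ _
    have h2 : C * (ε - -ε) ≤ (C + 1) * (2 * (1 / (4 * (C + 1)))) := by
      have : ε - -ε ≤ 2 * (1 / (4 * (C + 1))) := by linarith
      gcongr <;> linarith
    refine h2.trans (le_of_eq ?_)
    field_simp
    norm_num
  have hθε : ∀ᶠ z in 𝓝 z₀, θ ((cotChart x).symm z) ∈ Ioo (-ε) ε := by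
    refine hθd.continuousAt.eventually (Ioo_mem_nhds ?_ ?_) <;> simp only [hθ0] <;> linarith
  have hOs : ∀ᶠ z in 𝓝 z₀, (cotChart x).symm z ∈ Os :=
    ((continuousOn_cotChart_symm x).continuousAt (hto.mem_nhds hz₀t)).eventually
      (by rw [hz₀s]; exact hθ.isOpen.mem_nhds hℓ)
  obtain ⟨ρ, hρ, hρsub⟩ := Metric.mem_nhds_iff.1 (inter_mem (inter_mem hθε hOs)
    (inter_mem htθ (inter_mem (ball_mem_nhds z₀ hr₀) (ball_mem_nhds z₀ hRU))))
  have hUt : U ⊆ (cotChart x : PartialEquiv (Cotangent E M) _).target :=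
    fun z hz => (hUsub hz).1.2
  have nice₁ : ∀ ℓ : Cotangent E M, NiceAt (lift f₁) ℓ := fun ℓ => niceAt_lift hf ℓ
  have key : ∀ z ∈ ball z₀ ρ,
      hamExp (lift f₁) (θ ((cotChart x).symm z)) ((cotChart x).symm z) =
        (cotChart x).symm (ψ (θ ((cotChart x).symm z)) z) ∧
      Q (ψ (θ ((cotChart x).symm z)) z) = 0 := by
    intro z hz
    have hz' := hρsub hz
    obtain ⟨ℓ', h1, h2⟩ := hθ.solves _ hz'.1.2
    have h3 := (box.mono (min_le_left _ _) le_rfl).expTo cF hUt hz'.2.2.1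
      (Ioo_subset_Icc_self hz'.1.1)
    have h4 := h1.unique_of_niceAt nice₁ h3
    exact ⟨hamExp_eq nice₁ h3, by rw [h4] at h2; exact h2⟩
  have hballr : ball z₀ ρ ⊆ ball z₀ r₀ := fun z hz => (hρsub hz).2.2.1
  have hballU : ball z₀ ρ ⊆ U := fun z hz => (hρsub hz).2.2.2
  have hεε₀ : Icc (-ε) ε ⊆ Icc (-ε₀) ε₀ :=
    Icc_subset_Icc (neg_le_neg (min_le_left _ _)) (min_le_left _ _)
  have CF : CriticalFlow f H Q (fun z => θ ((cotChart x).symm z)) z₀ U ε ρ C ψ V :=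
    { box :=
        { ψ_zero := fun z hz => box.ψ_zero z (hballr hz)
          V_zero := fun z hz => box.V_zero z (hballr hz)
          mem := fun z hz s hs => box.mem z (hballr hz) s (hεε₀ hs)
          norm_V := fun z hz s hs => (box.norm_V z (hballr hz) s (hεε₀ hs)).trans hC₀C
          deriv_ψ := fun z hz s hs => (box.deriv_ψ z (hballr hz) s (hεε₀ hs)).mono hεε₀
          deriv_V := fun z hz s hs => (box.deriv_V z (hballr hz) s (hεε₀ hs)).mono hεε₀
          lip_ψ := fun z hz y hy s hs =>
            (box.lip_ψ z (hballr hz) y (hballr hy) s (hεε₀ hs)).trans (by gcongr)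
          lip_V := fun z hz y hy s hs =>
            (box.lip_V z (hballr hz) y (hballr hy) s (hεε₀ hs)).trans (by gcongr)
          taylor := fun z hz y hy s hs =>
            (box.taylor z (hballr hz) y (hballr hy) s (hεε₀ hs)).trans (by gcongr) }
      convex := convex_ball _ _
      small := hsmall
      diff_f := fun z hz => (bf z (hUsub hz).2.1).1
      norm_f := fun z hz => (bf z (hUsub hz).2.1).2.1.trans hCfC
      norm_Df := fun z hz => (bf z (hUsub hz).2.1).2.2.trans hCfC
      diff_H := fun z hz => (bH z (hUsub hz).2.2.1).1
      norm_DH := fun z hz => (bH z (hUsub hz).2.2.1).2.2.trans hCHC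
      lip_DH := fun z hz y hy => (lH z (hUsub hz).2.2.1 y (hUsub hy).2.2.1).trans (by gcongr)
      DH_f := fun z hz => by
        have h1 := cF.poisson_cotChart_symm cH (hUt hz)
        have h2 := poisson_neg_symm (F := lift f₁) (G := lift h₂) ((cotChart x).symm z)
        rw [h2, eQ] at h1
        exact h1.symm
      diff_Q := fun z hz => (bQ z (hUsub hz).2.2.2).1
      DQ_pos := fun z hz => (hUsub hz).1.1
      DQ_le := fun z hz => by
        refine (le_abs_self _).trans (((fderiv ℝ Q z).le_opNorm (f z)).trans
          (le_trans ?_ hCQC))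
        exact mul_le_mul (bQ z (hUsub hz).2.2.2).2.2 (bf z (hUsub hz).2.1).2.1 (norm_nonneg _) hCQ
      θ_mem := fun z hz => Ioo_subset_Icc_self (hρsub hz).1.1
      lip_θ := fun z hz y hy => by
        have h1 := hKθ.dist_le_mul y (hρsub hy).2.1 z (hρsub hz).2.1
        rw [Real.dist_eq, dist_eq_norm] at h1
        exact h1.trans (by gcongr)
      solves := fun z hz => (key z hz).2
      θ_zero := fun z hz h => hθ.zero _ (hρsub hz).1.2 h }
  have heqOn : ∀ z ∈ ball z₀ ρ, tildeH h₂ h₃ θ ((cotChart x).symm z) =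
      H (ψ (θ ((cotChart x).symm z)) z) := fun z hz => congrArg (lift h₂) (key z hz).1
  have hfd : ∀ z ∈ ball z₀ ρ,
      fderiv ℝ (fun z => tildeH h₂ h₃ θ ((cotChart x).symm z)) z =
        fderiv ℝ (fun z => H (ψ (θ ((cotChart x).symm z)) z)) z := fun z hz =>
    Filter.EventuallyEq.fderiv_eq
      (Filter.eventually_of_mem (isOpen_ball.mem_nhds hz) heqOn)
  have heulF : ∀ z ∈ U, ContDiffAt ℝ 2 F z ∧ ∀ᶠ y in 𝓝 z, fderiv ℝ F y (0, y.2) = F y :=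
    fun z hz => ⟨(dF z (hUt hz)).of_le two_le_infty,
      Filter.eventually_of_mem (hto.mem_nhds (hUt hz)) fun y hy => cotSmooth_euler_lift hf hy⟩
  refine ⟨ρ, hρ, max (C * C) (C ^ 4 * 2 + C ^ 3 + C ^ 2), by positivity, ?_, ?_, ?_, ?_, ?_, ?_⟩
  · exact fun z hz => ⟨hUt (hballU hz), (hρsub hz).1.2⟩
  · refine ⟨fun z hz => ?_, fun z hz => ?_, fun z hz y hy => ?_, fun z hz => ?_⟩
    · exact ((CF.hasFDerivAt_value hz).congr_of_eventuallyEq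
        (Filter.eventually_of_mem (isOpen_ball.mem_nhds hz) heqOn)).differentiableAt
    · rw [hfd z hz]
      exact (CF.norm_fderiv_value_le hz).trans (le_max_left _ _)
    · rw [hfd z hz, hfd y hy]
      exact (CF.norm_fderiv_value_sub_le hz hy).trans (by gcongr; exact le_max_right _ _)
    · rw [hfd z hz, heqOn z hz, (CF.hasFDerivAt_value hz).fderiv, ContinuousLinearMap.comp_apply,
        V_inr_eq CF heulF hz (CF.θ_mem z hz)]
      exact cotSmooth_euler_lift hh₂ (hUt (CF.box.mem z hz _ (CF.θ_mem z hz)))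
  · intro z hz
    rw [heqOn z hz]
    exact (CF.le_value hz).1
  · intro z hz h
    rw [heqOn z hz] at h
    exact (CF.le_value hz).2 h
  · intro z hz h
    rw [heqOn z hz, hfd z hz]
    exact CF.value_of_Q_eq_zero hz h
  · intro z hz
    rw [hfd z hz]
    exact CF.fderiv_value_field hz

end TildeH

section

theorem sub_le_of_ac {f : ℝ → ℝ} {a b C : ℝ} (hab : a ≤ b)
    (hf : AbsolutelyContinuousOnInterval f a b)
    (h : ∀ᵐ t ∂volume.restrict (Icc a b), ∃ v, HasDerivAt f v t ∧ v ≤ C) :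
    f b - f a ≤ C * (b - a) := by
  rw [← hf.integral_deriv_eq_sub]
  have h1 : ∫ t in a..b, deriv f t ≤ ∫ _t in a..b, C := by
    refine intervalIntegral.integral_mono_ae_restrict hab hf.intervalIntegrable_deriv
      (by simp) ?_
    filter_upwards [h] with t ht
    obtain ⟨v, hv, hvC⟩ := ht
    rwa [hv.deriv]
  simpa [mul_comm] using h1

section Coordinates

variable {E : Type*} [NormedAddCommGroup E] [NormedSpace ℝ E] [FiniteDimensional ℝ E]

/-- The action along a Hamiltonian curve is bounded below by the value of the Hamiltonian. -/
theorem HamCurve.energy_le {h : ℝ → E × (E →L[ℝ] ℝ) → ℝ} {z : ℝ → E × (E →L[ℝ] ℝ)}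
    {t s C K e : ℝ} {D : Set (E × (E →L[ℝ] ℝ))} (H : HamCurve h z t s C)
    (hD : ∀ r ∈ Icc t s, z r ∈ D) (hn : ∀ᵐ r ∂volume.restrict (Icc t s), NiceHam (h r) D C)
    (hC : 0 ≤ C) (hts : t ≤ s)
    (he : ∀ᵐ r ∂volume.restrict (Icc t s), e ≤ h r (z r) + K * (s - t)) :
    e * (s - t) ≤ (z t).2 ((z s).1 - (z t).1) + (K + C * C) * (s - t) ^ 2 := by
  have hac : AbsolutelyContinuousOnInterval (fun r => e * r - (z t).2 (z r).1) t s := by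
    refine absolutelyContinuous_of_norm_sub_le (C := |e| + ‖(z t).2‖ * C) hts
      fun r hr r' hr' => ?_
    have e1 : e * r - (z t).2 (z r).1 - (e * r' - (z t).2 (z r').1) =
      e * (r - r') - (z t).2 ((z r - z r').1) := by rw [Prod.fst_sub, map_sub]; ring
    rw [e1, add_mul]
    refine (norm_sub_le _ _).trans (add_le_add ?_ ?_)
    · rw [norm_mul]; rfl
    · refine ((z t).2.le_opNorm _).trans ?_
      rw [mul_assoc]
      gcongr
      exact (norm_fst_le _).trans (H.lip r hr r' hr')
  have h1 := sub_le_of_ac (C := (K + C * C) * (s - t)) hts hac ?_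
  · have e2 : (z t).2 ((z s).1 - (z t).1) = (z t).2 (z s).1 - (z t).2 (z t).1 := map_sub _ _ _
    rw [e2]
    nlinarith
  filter_upwards [H.deriv, hn, he, ae_restrict_mem measurableSet_Icc] with r h1 h2 h3 hr
  have hq : HasDerivAt (fun r => (z r).1) (symGrad (fderiv ℝ (h r) (z r))).1 r :=
    (ContinuousLinearMap.fst ℝ E (E →L[ℝ] ℝ)).hasFDerivAt.comp_hasDerivAt r h1
  have hd := ((hasDerivAt_id r).const_mul e).sub
    ((z t).2.hasFDerivAt.comp_hasDerivAt r hq)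
  refine ⟨_, hd, ?_⟩
  rw [apply_symGrad_fst, mul_one]
  have e3 := h2.euler _ (hD r hr)
  have e4 : fderiv ℝ (h r) (z r) (0, (z t).2) =
      h r (z r) - fderiv ℝ (h r) (z r) (0, (z r).2 - (z t).2) := by
    rw [← e3, ← map_sub]; simp
  have e5 : |fderiv ℝ (h r) (z r) (0, (z r).2 - (z t).2)| ≤ C * (C * (s - t)) := by
    refine (abs_apply_inr_le _ _).trans ?_
    have h6 := H.lip r hr t ⟨le_rfl, hts⟩
    have h7 : |r - t| ≤ s - t := by
      rw [abs_of_nonneg (by linarith [hr.1])]; linarith [hr.2]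
    have h8 : C * |r - t| ≤ C * (s - t) := by gcongr
    exact mul_le_mul (h2.bound _ (hD r hr)) ((norm_snd_le (z r - z t)).trans (h6.trans h8))
      (norm_nonneg _) hC
  rw [e4]
  have := le_abs_self (fderiv ℝ (h r) (z r) (0, (z r).2 - (z t).2))
  linarith

end Coordinates

section Estimates

variable {E : Type*} [NormedAddCommGroup E] [NormedSpace ℝ E]
  {M : Type*} [TopologicalSpace M] [ChartedSpace E M] [IsManifold 𝓘(ℝ, E) ∞ M]

/-- In the chart at `x`, the map `W` from `N ⊆ E` to the cotangent bundle is Lipschitz and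
pulls the Liouville form back to the differential of `cf`, with a quadratic error. -/
def EstAt (x : M) (W : E → Cotangent E M) (cf : E → ℝ) (N : Set E) (C : ℝ) : Prop :=
  ∀ η ∈ N, W η ∈ (cotChart x).source ∧ ∀ η' ∈ N,
    ‖cotChart x (W η') - cotChart x (W η)‖ ≤ C * ‖η' - η‖ ∧
    |(cotChart x (W η)).2 ((cotChart x (W η')).1 - (cotChart x (W η)).1) - (cf η' - cf η)| ≤
      C * ‖η' - η‖ ^ 2

variable {x : M} {W : E → Cotangent E M} {cf : E → ℝ} {N : Set E} {C : ℝ} {η₀ : E}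

theorem EstAt.mono {N' : Set E} {C' : ℝ} (h : EstAt x W cf N C) (hN : N' ⊆ N) (hC : C ≤ C') :
    EstAt x W cf N' C' := fun η hη => ⟨(h η (hN hη)).1, fun η' hη' =>
  ⟨((h η (hN hη)).2 η' (hN hη')).1.trans (by gcongr),
    ((h η (hN hη)).2 η' (hN hη')).2.trans (by gcongr)⟩⟩

theorem EstAt.continuousAt (h : EstAt x W cf N C) (hN : N ∈ 𝓝 η₀) :
    ContinuousAt (fun η => cotChart x (W η)) η₀ := by
  refine tendsto_iff_norm_sub_tendsto_zero.2 ?_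
  have h1 : Tendsto (fun η => C * ‖η - η₀‖) (𝓝 η₀) (𝓝 0) := by
    have : ContinuousAt (fun η => C * ‖η - η₀‖) η₀ := by fun_prop
    simpa [ContinuousAt] using this
  refine squeeze_zero' (Eventually.of_forall fun _ => norm_nonneg _) ?_ h1
  filter_upwards [hN] with η hη
  exact ((h η₀ (mem_of_mem_nhds hN)).2 η hη).1

theorem EstAt.change_chart {y : M} (h : EstAt x W cf N C) (hN : N ∈ 𝓝 η₀) (hC : 0 ≤ C)
    (hy : W η₀ ∈ (cotChart y).source) : ∃ N' ∈ 𝓝 η₀, N' ⊆ N ∧ ∃ C' ≥ 0, EstAt y W cf N' C' := by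
  have hη₀ := mem_of_mem_nhds hN
  have hx : W η₀ ∈ (cotChart x).source := (h η₀ hη₀).1
  set z₀ := cotChart x (W η₀) with hz₀
  set τ : E × (E →L[ℝ] ℝ) → E × (E →L[ℝ] ℝ) := fun z => cotChart y ((cotChart x).symm z) with hτ
  have hτd : ContDiffAt ℝ 2 τ z₀ :=
    (contDiffAt_cotChart_trans (ℓ₁ := (⟨x, 0⟩ : Cotangent E M)) hx hy).of_le two_le_infty
  obtain ⟨R, hR, K, hK, hb, hl⟩ := exists_ball_fderiv_bounds hτd
  have hz₀t := (cotChart x).map_source hx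
  have hys : ∀ᶠ z in 𝓝 z₀, (cotChart x).symm z ∈ (cotChart y : PartialEquiv (Cotangent E M) _).source :=
    ((continuousOn_cotChart_symm x).continuousAt
      ((isOpen_cotChart_target x).mem_nhds hz₀t)).eventually
      (by rw [(cotChart x).left_inv hx]; exact (isOpen_cotChart_source y).mem_nhds hy)
  have hcont := h.continuousAt hN
  have hev := hcont.eventually (hys.and (ball_mem_nhds z₀ hR))
  set N' := N ∩ {η | (cotChart x).symm (cotChart x (W η)) ∈
    (cotChart y : PartialEquiv (Cotangent E M) _).source ∧ cotChart x (W η) ∈ ball z₀ R}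
    with hN'
  have hτW : ∀ η ∈ N', cotChart y (W η) = τ (cotChart x (W η)) := fun η hη => by
    simp only [hτ]; rw [(cotChart x).left_inv (h η hη.1).1]
  refine ⟨N', inter_mem hN hev, inter_subset_left,
    max (K * C) (K * (K * C ^ 2) + C), by positivity, fun η hη => ⟨?_, fun η' hη' => ?_⟩⟩
  · have := hη.2.1
    rwa [(cotChart x).left_inv (h η hη.1).1] at this
  rw [hτW η hη, hτW η' hη']
  set z := cotChart x (W η) with hz
  set z' := cotChart x (W η')
  have hzz := ((h η hη.1).2 η' hη'.1).1
  have hpair := ((h η hη.1).2 η' hη'.1).2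
  have hlip : ‖τ z' - τ z‖ ≤ K * ‖z' - z‖ :=
    (convex_ball z₀ R).norm_image_sub_le_of_norm_fderiv_le (fun w hw => (hb w hw).1)
      (fun w hw => (hb w hw).2.2) hη.2.2 hη'.2.2
  refine ⟨?_, ?_⟩
  · refine (hlip.trans (mul_le_mul_of_nonneg_left hzz hK)).trans ?_
    rw [← mul_assoc]
    gcongr
    exact le_max_left _ _
  · have htay := norm_sub_sub_fderiv_le (convex_ball z₀ R) (fun w hw => (hb w hw).1) hl hK
      hη.2.2 hη'.2.2
    have hsy : W η ∈ (cotChart y).source := by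
      have := hη.2.1
      rwa [(cotChart x).left_inv (h η hη.1).1] at this
    have hdτ := hasFDerivAt_cotChart_trans (x₀ := y) (ℓ₁ := (⟨x, 0⟩ : Cotangent E M))
      (h η hη.1).1 hsy
    have hL := liouville_tangentCoordChange (x₀ := y) (ℓ₁ := (⟨x, 0⟩ : Cotangent E M))
      (h η hη.1).1 hsy (z' - z)
    rw [← hdτ.fderiv] at hL
    have hW : cotChart y (W η) = τ z := hτW η hη
    rw [hW] at hL
    have e1 : (τ z).2 ((τ z').1 - (τ z).1) =
        (τ z).2 ((τ z' - τ z - fderiv ℝ τ z (z' - z)).1) + z.2 (z'.1 - z.1) := by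
      have hL' : z.2 (z'.1 - z.1) = (τ z).2 (fderiv ℝ τ z (z' - z)).1 := hL.symm
      rw [hL', ← map_add]
      simp only [Prod.fst_sub]
      congr 1
      abel
    have e2 : |(τ z).2 ((τ z' - τ z - fderiv ℝ τ z (z' - z)).1)| ≤ K * (K * ‖z' - z‖ ^ 2) := by
      refine ((τ z).2.le_opNorm _).trans ?_
      exact mul_le_mul ((norm_snd_le _).trans (hb z hη.2.2).2.1)
        ((norm_fst_le _).trans htay) (norm_nonneg _) hK
    have e3 : K * (K * ‖z' - z‖ ^ 2) ≤ K * (K * (C * ‖η' - η‖) ^ 2) := by gcongr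
    rw [e1, add_sub_assoc]
    refine (abs_add_le _ _).trans ((add_le_add (e2.trans e3) hpair).trans ?_)
    have e4 : K * (K * (C * ‖η' - η‖) ^ 2) + C * ‖η' - η‖ ^ 2 =
      (K * (K * C ^ 2) + C) * ‖η' - η‖ ^ 2 := by ring
    rw [e4]
    gcongr
    exact le_max_right _ _

variable [FiniteDimensional ℝ E]

/-- Transport of the estimates of `EstAt` along a short time interval, for curves that follow the
Hamiltonian `A` after the switching time `σ` and `B` before it. -/
theorem EstAt.transport {W : ℝ → E → Cotangent E M} {A B : ℝ → Cotangent E M → ℝ} {σ : E → ℝ}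
    {a b C C₁ K R : ℝ} {D : Set (E × (E →L[ℝ] ℝ))} (hab : a ≤ b) (hD : Convex ℝ D)
    (hDR : ∀ z ∈ D, ‖z‖ ≤ R)
    (hmem : ∀ η ∈ N, ∀ t ∈ Icc a b, W t η ∈ (cotChart x).source ∧ cotChart x (W t η) ∈ D)
    (hF : ∀ η ∈ N, FollowsHam (fun t => if σ η ≤ t then A t else B t) (fun t => W t η) a b)
    (hA : ∀ᵐ t ∂volume.restrict (Icc a b), NiceHam (fun z => A t ((cotChart x).symm z)) D C)
    (hB : ∀ᵐ t ∂volume.restrict (Icc a b), NiceHam (fun z => B t ((cotChart x).symm z)) D C)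
    (hC : 0 ≤ C) (hC₁ : 0 ≤ C₁) (hK : 0 ≤ K) (hR : 0 ≤ R) (hCab : C * (b - a) ≤ 1 / 2)
    (hσ : ∀ η ∈ N, ∀ η' ∈ N, |σ η' - σ η| ≤ K * ‖η' - η‖)
    (hgap : ∀ η ∈ N, ∀ η' ∈ N, ∀ᵐ t ∂volume.restrict (Icc a b),
      t ∈ Icc (min (σ η) (σ η')) (max (σ η) (σ η')) → |A t (W t η) - B t (W t η)| ≤ K * ‖η' - η‖)
    (hb : EstAt x (W b) cf N C₁) :
    ∃ C' ≥ 0, ∀ t ∈ Icc a b, EstAt x (W t) cf N C' := by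
  set m₀ := 2 * C₁ + 4 * C * K with hm₀
  refine ⟨max m₀ (2 * C * m₀ ^ 2 * (b - a) + (C * m₀ * (1 + R) + K) * K + C₁), ?_,
    fun t ht η hη => ⟨(hmem η hη t ht).1, fun η' hη' => ?_⟩⟩
  · exact (show 0 ≤ m₀ by positivity).trans (le_max_left _ _)
  have hnice : ∀ η, ∀ᵐ t ∂volume.restrict (Icc a b),
      NiceHam (fun z => (if σ η ≤ t then A t else B t) ((cotChart x).symm z)) D C := fun η => by
    filter_upwards [hA, hB] with t h1 h2
    split_ifs
    · exact h1
    · exact h2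
  have hcurve : ∀ η ∈ N, HamCurve (fun t z => (if σ η ≤ t then A t else B t) ((cotChart x).symm z))
      (fun t => cotChart x (W t η)) a b C := fun η hη =>
    (hF η hη).2 x a b D C le_rfl hab le_rfl (hmem η hη) (hnice η)
  have hbI : b ∈ Icc a b := ⟨hab, le_rfl⟩
  set α := min (σ η) (σ η') with hα
  set β := max (σ η) (σ η') with hβ
  have hβα : β - α ≤ K * ‖η' - η‖ := by
    rw [hβ, hα, max_sub_min_eq_abs]
    exact hσ η hη η' hη'
  have hAB : ∀ t, t ∉ Icc α β →
      (fun z => (if σ η ≤ t then A t else B t) ((cotChart x).symm z)) =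
      fun z => (if σ η' ≤ t then A t else B t) ((cotChart x).symm z) := by
    intro t ht
    have h1 : (σ η ≤ t) ↔ (σ η' ≤ t) := by
      rw [mem_Icc, not_and_or, not_le, not_le] at ht
      rcases ht with ht | ht
      · have h1 := ht.trans_le (min_le_left (σ η) (σ η'))
        have h2 := ht.trans_le (min_le_right (σ η) (σ η'))
        exact ⟨fun h => absurd h (not_le.2 h1), fun h => absurd h (not_le.2 h2)⟩
      · have h1 := (le_max_left (σ η) (σ η')).trans_lt ht
        have h2 := (le_max_right (σ η) (σ η')).trans_lt ht
        exact ⟨fun _ => h2.le, fun _ => h1.le⟩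
    simp only [h1]
  have hdist := norm_sub_le_of_hamCurve (hcurve η hη) (hcurve η' hη')
    (fun t ht => (hmem η hη t ht).2) (fun t ht => (hmem η' hη' t ht).2) (hnice η) (hnice η')
    min_le_max hAB hC hCab hbI
  have hm : ∀ t ∈ Icc a b, ‖cotChart x (W t η') - cotChart x (W t η)‖ ≤ m₀ * ‖η' - η‖ := by
    intro t ht
    refine (hdist t ht).trans ?_
    have e1 := ((hb η hη).2 η' hη').1
    have e2 : 4 * C * (β - α) ≤ 4 * C * (K * ‖η' - η‖) := by gcongr
    calc 2 * ‖cotChart x (W b η') - cotChart x (W b η)‖ + 4 * C * (β - α) ≤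
        2 * (C₁ * ‖η' - η‖) + 4 * C * (K * ‖η' - η‖) := by gcongr
      _ = m₀ * ‖η' - η‖ := by rw [hm₀]; ring
  refine ⟨(hm t ht).trans (by gcongr; exact le_max_left _ _), ?_⟩
  have hpair := abs_pairing_sub_le_of_hamCurve (hcurve η hη) (hcurve η' hη') hD
    (fun t ht => (hmem η hη t ht).2) (fun t ht => (hmem η' hη' t ht).2) (hnice η) (hnice η')
    min_le_max hAB hC hm (fun t ht => hDR _ (hmem η hη t ht).2)
    (K := K * ‖η' - η‖) (by positivity) (by
      filter_upwards [hgap η hη η' hη', ae_restrict_mem measurableSet_Icc] with t h1 h2 h3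
      rw [(cotChart x).left_inv (hmem η hη t h2).1]
      have h4 := h1 h3
      have h5 : 0 ≤ K * ‖η' - η‖ := by positivity
      split_ifs
      · simpa using h5
      · exact h4
      · rw [abs_sub_comm]; exact h4
      · simpa using h5) hbI t ht
  have hfin := ((hb η hη).2 η' hη').2
  have htb : |t - b| ≤ b - a := by
    rw [abs_of_nonpos (by linarith [ht.2])]; linarith [ht.1]
  set P := (cotChart x (W t η)).2 ((cotChart x (W t η')).1 - (cotChart x (W t η)).1)
  set P' := (cotChart x (W b η)).2 ((cotChart x (W b η')).1 - (cotChart x (W b η)).1)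
  have e3 : P - (cf η' - cf η) = (P - P') + (P' - (cf η' - cf η)) := by ring
  have hm₀0 : 0 ≤ m₀ := by positivity
  have e4 : 2 * C * (m₀ * ‖η' - η‖) ^ 2 * |t - b| +
      (C * (m₀ * ‖η' - η‖) * (1 + R) + K * ‖η' - η‖) * (β - α) ≤
      2 * C * (m₀ * ‖η' - η‖) ^ 2 * (b - a) +
      (C * (m₀ * ‖η' - η‖) * (1 + R) + K * ‖η' - η‖) * (K * ‖η' - η‖) := by gcongr
  rw [e3]
  refine (abs_add_le _ _).trans ((add_le_add (hpair.trans e4) hfin).trans ?_)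
  have e5 : 2 * C * (m₀ * ‖η' - η‖) ^ 2 * (b - a) +
      (C * (m₀ * ‖η' - η‖) * (1 + R) + K * ‖η' - η‖) * (K * ‖η' - η‖) + C₁ * ‖η' - η‖ ^ 2 =
      (2 * C * m₀ ^ 2 * (b - a) + (C * m₀ * (1 + R) + K) * K + C₁) * ‖η' - η‖ ^ 2 := by ring
  rw [e5]
  gcongr
  exact le_max_right _ _

variable [T2Space M]

/-- Curves that follow regular Hamiltonians and end near the centre of a coordinate ball stay in
that ball for a short time. -/
theorem EstAt.exists_stay {W : ℝ → E → Cotangent E M} {h : E → ℝ → Cotangent E M → ℝ}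
    {a b C C₁ R : ℝ} {z₀ : E × (E →L[ℝ] ℝ)} (hab : a ≤ b) (hR : 0 < R)
    (hball : ball z₀ (3 * R) ⊆ (cotChart x : PartialEquiv (Cotangent E M) _).target)
    (hb : EstAt x (W b) cf N C₁) (hN : N ∈ 𝓝 η₀)
    (hF : ∀ η ∈ N, FollowsHam (h η) (fun t => W t η) a b)
    (hn : ∀ η ∈ N, ∀ᵐ t ∂volume.restrict (Icc a b),
      NiceHam (fun z => h η t ((cotChart x).symm z)) (ball z₀ (3 * R)) C)
    (hC : 0 ≤ C) (hCab : C * (b - a) ≤ R) (h0 : cotChart x (W b η₀) ∈ ball z₀ R) :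
    ∃ N' ∈ 𝓝 η₀, N' ⊆ N ∧ ∀ η ∈ N', ∀ t ∈ Icc a b, W t η ∈ (cotChart x).source ∧
      cotChart x (W t η) ∈ closedBall z₀ (2 * R) := by
  have hev := (hb.continuousAt hN).eventually (isOpen_ball.mem_nhds h0)
  refine ⟨_, inter_mem hN hev, inter_subset_left, fun η hη => ?_⟩
  exact (hF η hη.1).mem_closedBall hR hball (hn η hη.1) hC hCab ⟨hab, le_rfl⟩ (hb η hη.1).1
    (ball_subset_closedBall hη.2)

end Estimates

end

section ModifiedCost

variable {E : Type*} [NormedAddCommGroup E] [NormedSpace ℝ E]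
  {M : Type*} [TopologicalSpace M] [ChartedSpace E M] [IsManifold 𝓘(ℝ, E) ∞ M]

theorem contDiffAt_comp_symm {a : M → ℝ} {O : Set M} (ha : ContMDiffOn 𝓘(ℝ, E) 𝓘(ℝ, ℝ) ∞ a O)
    (hO : IsOpen O) {x₀ : M} {y : E} (hy : y ∈ (extChartAt 𝓘(ℝ, E) x₀).target)
    (hyO : (extChartAt 𝓘(ℝ, E) x₀).symm y ∈ O) :
    ContDiffAt ℝ ∞ (fun y => a ((extChartAt 𝓘(ℝ, E) x₀).symm y)) y := by
  have h2 : ContMDiffAt 𝓘(ℝ, E) 𝓘(ℝ, E) ∞ (extChartAt 𝓘(ℝ, E) x₀).symm y :=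
    (contMDiffOn_extChartAt_symm (I := 𝓘(ℝ, E)) (n := ∞) x₀).contMDiffAt
      ((isOpen_extChartAt_target x₀).mem_nhds hy)
  exact ((ha.contMDiffAt (hO.mem_nhds hyO)).comp y h2).contDiffAt

theorem hasFDerivAt_comp_extChartAt_symm {a : M → ℝ} {x₀ x : M}
    (hx : x ∈ (extChartAt 𝓘(ℝ, E) x₀).source) (ha : MDifferentiableAt 𝓘(ℝ, E) 𝓘(ℝ, ℝ) a x) :
    DifferentiableAt ℝ (fun y => a ((extChartAt 𝓘(ℝ, E) x₀).symm y))
      (extChartAt 𝓘(ℝ, E) x₀ x) := by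
  have h2 : MDifferentiableAt 𝓘(ℝ, E) 𝓘(ℝ, E) (extChartAt 𝓘(ℝ, E) x₀).symm
      (extChartAt 𝓘(ℝ, E) x₀ x) :=
    ((contMDiffOn_extChartAt_symm (I := 𝓘(ℝ, E)) (n := ∞) x₀).contMDiffAt
      ((isOpen_extChartAt_target x₀).mem_nhds
        ((extChartAt 𝓘(ℝ, E) x₀).map_source hx))).mdifferentiableAt (by simp)
  have h3 : MDifferentiableAt 𝓘(ℝ, E) 𝓘(ℝ, ℝ) (a ∘ (extChartAt 𝓘(ℝ, E) x₀).symm)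
      (extChartAt 𝓘(ℝ, E) x₀ x) := by
    refine MDifferentiableAt.comp _ ?_ h2
    rwa [(extChartAt 𝓘(ℝ, E) x₀).left_inv hx]
  exact h3.differentiableAt

/-- The differential of a function in the preferred chart at `x₀`. -/
theorem mfderiv_eq_fderiv_comp_symm {a : M → ℝ} {x₀ x : M}
    (hx : x ∈ (extChartAt 𝓘(ℝ, E) x₀).source) (ha : MDifferentiableAt 𝓘(ℝ, E) 𝓘(ℝ, ℝ) a x)
    (v : TangentSpace 𝓘(ℝ, E) x) :
    (mfderiv 𝓘(ℝ, E) 𝓘(ℝ, ℝ) a x : E →L[ℝ] ℝ) v =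
      fderiv ℝ (fun y => a ((extChartAt 𝓘(ℝ, E) x₀).symm y)) (extChartAt 𝓘(ℝ, E) x₀ x)
        (tangentCoordChange 𝓘(ℝ, E) x x₀ x v) := by
  have hx' : x ∈ (chartAt E x₀).source := by rwa [extChartAt_source] at hx
  have h1 := hasMFDerivAt_extChartAt (I := 𝓘(ℝ, E)) hx'
  have h2 := (hasFDerivAt_comp_extChartAt_symm hx ha).hasFDerivAt.hasMFDerivAt
  have h3 := HasMFDerivAt.comp x h2 h1
  have h4 : a =ᶠ[𝓝 x] (fun y => a ((extChartAt 𝓘(ℝ, E) x₀).symm y)) ∘ extChartAt 𝓘(ℝ, E) x₀ := by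
    filter_upwards [(isOpen_extChartAt_source (I := 𝓘(ℝ, E)) x₀).mem_nhds hx] with y hy
    simp only [Function.comp_apply]
    rw [(extChartAt 𝓘(ℝ, E) x₀).left_inv hy]
  have h5 := (h3.congr_of_eventuallyEq h4).mfderiv
  rw [mfderiv_chartAt_eq_tangentCoordChange hx'] at h5
  exact congrArg (fun A : E →L[ℝ] ℝ => A v) h5

theorem lieD_eq_fderiv {f : (x : M) → TangentSpace 𝓘(ℝ, E) x} {a : M → ℝ} {x₀ : M} {y : E}
    (hy : y ∈ (extChartAt 𝓘(ℝ, E) x₀).target)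
    (ha : MDifferentiableAt 𝓘(ℝ, E) 𝓘(ℝ, ℝ) a ((extChartAt 𝓘(ℝ, E) x₀).symm y)) :
    lieD f a ((extChartAt 𝓘(ℝ, E) x₀).symm y) =
      fderiv ℝ (fun y => a ((extChartAt 𝓘(ℝ, E) x₀).symm y)) y (coordField x₀ f y) := by
  have hx := (extChartAt 𝓘(ℝ, E) x₀).map_target hy
  rw [lieD, mfderiv_eq_fderiv_comp_symm hx ha, (extChartAt 𝓘(ℝ, E) x₀).right_inv hy]
  rfl

theorem cotChart_differential_snd {a : M → ℝ} {x₀ x : M}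
    (hx : x ∈ (extChartAt 𝓘(ℝ, E) x₀).source) (ha : MDifferentiableAt 𝓘(ℝ, E) 𝓘(ℝ, ℝ) a x) :
    (cotChart x₀ (differential a x)).2 =
      fderiv ℝ (fun y => a ((extChartAt 𝓘(ℝ, E) x₀).symm y)) (extChartAt 𝓘(ℝ, E) x₀ x) := by
  ext w
  rw [cotChart_snd (ℓ := differential a x) hx]
  have h1 := mfderiv_eq_fderiv_comp_symm hx ha (tangentCoordChange 𝓘(ℝ, E) x₀ x x w)
  refine h1.trans ?_
  congr 1
  exact (tangentCoordChange_comp (I := 𝓘(ℝ, E)) ⟨⟨hx, mem_extChartAt_source _⟩, hx⟩).trans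
    (tangentCoordChange_self hx)

/-- An integral curve given by its coordinates. -/
theorem isMIntegralCurveOn_of_coordField {f : (x : M) → TangentSpace 𝓘(ℝ, E) x} {x : M}
    {z : ℝ → E} {s : Set ℝ} (hz : ∀ t ∈ s, z t ∈ (extChartAt 𝓘(ℝ, E) x).target)
    (hd : ∀ t ∈ s, HasDerivWithinAt z (coordField x f (z t)) s t) :
    IsMIntegralCurveOn (I := 𝓘(ℝ, E)) (fun t => (extChartAt 𝓘(ℝ, E) x).symm (z t)) f s := by
  intro t ht
  have h1 := hasMFDerivWithinAt_extChartAt_symm_comp (I := 𝓘(ℝ, E)) (x := x) (hd t ht) (hz t ht)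
  set y := (extChartAt 𝓘(ℝ, E) x).symm (z t)
  have hm : y ∈ (extChartAt 𝓘(ℝ, E) x).source := (extChartAt 𝓘(ℝ, E) x).map_target (hz t ht)
  have h4 : (f y : E) = tangentCoordChange 𝓘(ℝ, E) x y y (coordField x f (z t)) :=
    ((tangentCoordChange_comp (I := 𝓘(ℝ, E)) (v := (show E from f y))
      ⟨⟨mem_extChartAt_source _, hm⟩, mem_extChartAt_source _⟩).trans
      (tangentCoordChange_self (mem_extChartAt_source _))).symm
  have h5 := congrArg (fun v : E => (1 : ℝ →L[ℝ] ℝ).smulRight v) h4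
  exact h1.congr_mfderiv h5.symm

theorem contMDiffOn_modifiedCost {f : (x : M) → TangentSpace 𝓘(ℝ, E) x} {c ct : M → ℝ} {xf : M}
    {O : Set M} (hc : ContMDiff 𝓘(ℝ, E) 𝓘(ℝ, ℝ) ∞ c) (hct : IsModifiedCost f c xf O ct) :
    ContMDiffOn 𝓘(ℝ, E) 𝓘(ℝ, ℝ) ∞ ct O := by
  rcases hct.2.2 with h | h
  · exact h.2.1
  · exact hc.contMDiffOn.congr h.2

theorem lieD_eq_zero_of_curve {f : (x : M) → TangentSpace 𝓘(ℝ, E) x} {a : M → ℝ} {γ : ℝ → M}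
    {r s : ℝ} {k : ℝ} (hrs : r ≠ s) (hγ : IsMIntegralCurveOn (I := 𝓘(ℝ, E)) γ f (uIcc s r))
    (ha : MDifferentiableAt 𝓘(ℝ, E) 𝓘(ℝ, ℝ) a (γ r)) (hk : ∀ t ∈ uIcc s r, a (γ t) = k) :
    lieD f a (γ r) = 0 := by
  have h1 := ha.hasMFDerivAt.comp_hasMFDerivWithinAt r (hγ r right_mem_uIcc)
  have h2 := h1.hasFDerivWithinAt
  have h3 : HasFDerivWithinAt (fun t => a (γ t)) (0 : ℝ →L[ℝ] ℝ) (uIcc s r) r :=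
    (hasFDerivWithinAt_const k r _).congr hk (hk r right_mem_uIcc)
  have hu : UniqueDiffWithinAt ℝ (uIcc s r) r :=
    uniqueDiffOn_Icc (by simpa using hrs) r right_mem_uIcc
  have h4 := congrArg (fun A : ℝ →L[ℝ] ℝ => A 1) (hu.eq h2 h3)
  have h5 : (mfderiv 𝓘(ℝ, E) 𝓘(ℝ, ℝ) a (γ r) : E →L[ℝ] ℝ) ((1 : ℝ) • (show E from f (γ r))) = 0 := h4
  rw [one_smul] at h5
  exact h5

variable [CompleteSpace E]

theorem lieD_modifiedCost {f : (x : M) → TangentSpace 𝓘(ℝ, E) x} {c ct : M → ℝ} {xf : M}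
    {O : Set M} (hf : SmoothField f) (hc : ContMDiff 𝓘(ℝ, E) 𝓘(ℝ, ℝ) ∞ c)
    (hct : IsModifiedCost f c xf O ct) : ∀ x ∈ O, lieD f ct x = 0 := by
  intro x hx
  have hd : MDifferentiableAt 𝓘(ℝ, E) 𝓘(ℝ, ℝ) ct x :=
    ((contMDiffOn_modifiedCost hc hct).contMDiffAt (hct.1.mem_nhds hx)).mdifferentiableAt (by simp)
  rcases hct.2.2 with ⟨-, -, h1, h2⟩ | ⟨h1, h2⟩
  · obtain ⟨r, γ, hγ0, hγr, hγO, hγ⟩ := h1 x hx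
    rcases eq_or_ne r 0 with rfl | hr
    · obtain ⟨γ', hγ'0, hγ'⟩ := exists_isMIntegralCurveAt_of_contMDiffAt_boundaryless (t₀ := 0)
        ((hf x).of_le one_le_infty)
      rw [isMIntegralCurveAt_iff'] at hγ'
      obtain ⟨ε, hε, hγ'⟩ := hγ'
      have hcont : ContinuousAt γ' 0 :=
        (hγ' 0 (mem_ball_self hε)).continuousWithinAt.continuousAt
          (ball_mem_nhds 0 hε)
      have hev := hcont.eventually (hct.1.mem_nhds (by rwa [hγ'0]))
      obtain ⟨δ, hδ, hball⟩ := Metric.mem_nhds_iff.1 (inter_mem hev (ball_mem_nhds 0 hε))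
      have hsub : uIcc (δ / 2) 0 ⊆ ball 0 δ := by
        intro t ht
        rw [uIcc_of_ge (by linarith)] at ht
        rw [mem_ball, Real.dist_eq, sub_zero, abs_of_nonneg ht.1]
        linarith [ht.2]
      have hl0 : lieD f c (γ' 0) = 0 := by rw [hγ'0, ← hγr]; exact hγ0
      rw [← hγ'0]
      refine lieD_eq_zero_of_curve (r := 0) (s := δ / 2) (k := c (γ' 0)) (by linarith)
        (fun t ht => (hγ' t (hball (hsub ht)).2).mono fun u hu => (hball (hsub hu)).2)
        (by rwa [hγ'0]) fun t ht => ?_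
      have hsub' : uIcc 0 t ⊆ uIcc (δ / 2) 0 := by
        rw [uIcc_comm (δ / 2)]; exact uIcc_subset_uIcc_left (by rwa [uIcc_comm])
      exact h2 t γ' hl0 (fun u hu => (hball (hsub (hsub' hu))).1)
        (fun u hu => (hγ' u (hball (hsub (hsub' hu))).2).mono
          fun w hw => (hball (hsub (hsub' hw))).2)
    · rw [← hγr] at hd ⊢
      refine lieD_eq_zero_of_curve (k := c (γ 0)) hr hγ hd fun t ht => ?_
      have hsub : uIcc 0 t ⊆ uIcc 0 r := uIcc_subset_uIcc_left ht
      exact h2 t γ hγ0 (fun u hu => hγO (hsub hu)) fun u hu => (hγ u (hsub hu)).mono hsub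
  · rw [← h1 x hx, lieD, lieD]
    have : ct =ᶠ[𝓝 x] c := Filter.eventually_of_mem (hct.1.mem_nhds hx) h2
    rw [this.mfderiv_eq]
    rfl

theorem mfderiv_modifiedCost {f : (x : M) → TangentSpace 𝓘(ℝ, E) x} {c ct : M → ℝ} {xf : M}
    {O : Set M} (hf : SmoothField f) (hc : ContMDiff 𝓘(ℝ, E) 𝓘(ℝ, ℝ) ∞ c)
    (hct : IsModifiedCost f c xf O ct) (h0 : lieD f c xf = 0) :
    (mfderiv 𝓘(ℝ, E) 𝓘(ℝ, ℝ) ct xf : E →L[ℝ] ℝ) = mfderiv 𝓘(ℝ, E) 𝓘(ℝ, ℝ) c xf := by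
  have hcts := contMDiffOn_modifiedCost hc hct
  obtain ⟨hO, hxO, hcase⟩ := hct
  rcases hcase with ⟨hpos, -, -, hcurve⟩ | ⟨-, h2⟩
  swap
  · have h3 : ct =ᶠ[𝓝 xf] c := Filter.eventually_of_mem (hO.mem_nhds hxO) h2
    exact h3.mfderiv_eq
  set φ := extChartAt 𝓘(ℝ, E) xf with hφ
  set y₀ := φ xf
  have hxs : xf ∈ φ.source := mem_extChartAt_source xf
  have hy₀t : y₀ ∈ φ.target := φ.map_source hxs
  have hy₀s : φ.symm y₀ = xf := φ.left_inv hxs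
  have hto : IsOpen φ.target := isOpen_extChartAt_target xf
  have hcd : ∀ y ∈ φ.target, ContDiffAt ℝ ∞ (fun y => c (φ.symm y)) y := fun y hy =>
    contDiffAt_comp_symm hc.contMDiffOn isOpen_univ hy (mem_univ _)
  have hfd : ∀ y ∈ φ.target, ContDiffAt ℝ ∞ (coordField xf f) y := fun y hy =>
    (contDiffOn_coordField hf xf).contDiffAt (hto.mem_nhds hy)
  set g : E → ℝ := fun y => fderiv ℝ (fun y => c (φ.symm y)) y (coordField xf f y)
  have hgl : ∀ y ∈ φ.target, lieD f c (φ.symm y) = g y := fun y hy =>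
    lieD_eq_fderiv hy (hc.mdifferentiable (by simp) _)
  have hgd : ContDiffAt ℝ 2 g y₀ :=
    ((hcd y₀ hy₀t).fderiv_right (m := 2) (WithTop.coe_le_coe.2 (le_top : (2 + 1 : ℕ∞) ≤ ⊤))).clm_apply
      ((hfd y₀ hy₀t).of_le two_le_infty)
  have hg0 : g y₀ = 0 := by rw [← hgl y₀ hy₀t, hy₀s]; exact h0
  have hm : 0 < fderiv ℝ g y₀ (coordField xf f y₀) := by
    have hmd : MDifferentiableAt 𝓘(ℝ, E) 𝓘(ℝ, ℝ) (lieD f c) (φ.symm y₀) := by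
      by_contra hcon
      rw [hy₀s] at hcon
      rw [lieD, mfderiv_zero_of_not_mdifferentiableAt hcon] at hpos
      exact lt_irrefl _ hpos
    have h1 := lieD_eq_fderiv (f := f) hy₀t hmd
    rw [hy₀s] at h1
    rw [h1] at hpos
    have h3 : (fun y => lieD f c (φ.symm y)) =ᶠ[𝓝 y₀] g :=
      Filter.eventually_of_mem (hto.mem_nhds hy₀t) hgl
    rw [h3.fderiv_eq] at hpos
    exact hpos
  set m := fderiv ℝ g y₀ (coordField xf f y₀) with hmdef
  obtain ⟨Rg, hRg, Cg, hCg, bg, -⟩ := exists_ball_fderiv_bounds hgd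
  obtain ⟨Rf, hRf, Cf, hCf, bf, -⟩ := exists_ball_fderiv_bounds ((hfd y₀ hy₀t).of_le two_le_infty)
  have hmc : ∀ᶠ y in 𝓝 y₀, m / 2 < fderiv ℝ g y (coordField xf f y) :=
    ((hgd.fderiv_right (m := 1) (by norm_num)).continuousAt.clm_apply
      (hfd y₀ hy₀t).continuousAt).eventually (lt_mem_nhds (by simp only [← hmdef]; linarith))
  have hOc : ∀ᶠ y in 𝓝 y₀, φ.symm y ∈ O :=
    ((continuousOn_extChartAt_symm (I := 𝓘(ℝ, E)) xf).continuousAt (hto.mem_nhds hy₀t)).eventually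
      (hO.mem_nhds (by rw [← hφ, hy₀s]; exact hxO))
  set U : Set E := {y | m / 2 < fderiv ℝ g y (coordField xf f y)} ∩ {y | φ.symm y ∈ O} ∩
    (φ.target ∩ (ball y₀ Rg ∩ ball y₀ Rf))
  have hUn : U ∈ 𝓝 y₀ := inter_mem (inter_mem hmc hOc) (inter_mem (hto.mem_nhds hy₀t)
    (inter_mem (ball_mem_nhds y₀ hRg) (ball_mem_nhds y₀ hRf)))
  obtain ⟨ε, hε, r, hr, C, hC, ψ, V, box⟩ :=
    exists_flowBox ((hfd y₀ hy₀t).of_le two_le_infty) hUn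
  set K := (Cg * Cf) * (2 * Cg / m) ^ 2 with hK
  set ρ := min (min r Rg) (m * ε / (2 * (Cg + 1)))
  have hρ0 : 0 < ρ := by positivity
  have key : ∀ y ∈ ball y₀ ρ, |ct (φ.symm y) - c (φ.symm y)| ≤ K * ‖y - y₀‖ ^ 2 := by
    intro y hy
    have hyr : y ∈ ball y₀ r :=
      ball_subset_ball ((min_le_left _ _).trans (min_le_left _ _)) hy
    have hyg : y ∈ ball y₀ Rg :=
      ball_subset_ball ((min_le_left _ _).trans (min_le_right _ _)) hy
    have hgy : |g y| ≤ Cg * ‖y - y₀‖ := by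
      have := (convex_ball y₀ Rg).norm_image_sub_le_of_norm_fderiv_le (fun w hw => (bg w hw).1)
        (fun w hw => (bg w hw).2.2) (mem_ball_self hRg) hyg
      simpa [hg0] using this
    set s₀ := 2 * (Cg * ‖y - y₀‖) / m with hs₀
    have hs₀0 : 0 ≤ s₀ := by positivity
    have hs₀ε : s₀ ≤ ε := by
      have h1 : ‖y - y₀‖ < m * ε / (2 * (Cg + 1)) := by
        have : dist y y₀ < ρ := hy
        rw [dist_eq_norm] at this
        exact this.trans_le (min_le_right _ _)
      rw [hs₀, div_le_iff₀ hm]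
      have h2 : Cg * ‖y - y₀‖ ≤ (Cg + 1) * (m * ε / (2 * (Cg + 1))) := by gcongr; linarith
      have h3 : (Cg + 1) * (m * ε / (2 * (Cg + 1))) = m * ε / 2 := by field_simp
      linarith
    have hkd : ∀ s ∈ Icc (-ε) ε, HasDerivWithinAt (fun s => g (ψ s y))
        (fderiv ℝ g (ψ s y) (coordField xf f (ψ s y))) (Icc (-ε) ε) s := fun s hs => by
      have h1 := (bg _ (box.mem y hyr s hs).2.2.1).1.hasFDerivAt
      exact h1.comp_hasDerivWithinAt s (box.deriv_ψ y hyr s hs)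
    have hmono : MonotoneOn (fun s => g (ψ s y) - m / 2 * s) (Icc (-ε) ε) := by
      have hd : ∀ s ∈ Icc (-ε) ε, HasDerivWithinAt (fun s => g (ψ s y) - m / 2 * s)
          (fderiv ℝ g (ψ s y) (coordField xf f (ψ s y)) - m / 2 * 1) (Icc (-ε) ε) s :=
        fun s hs => (hkd s hs).sub ((hasDerivWithinAt_id s _).const_mul (m / 2))
      refine monotoneOn_of_hasDerivWithinAt_nonneg (convex_Icc _ _)
        (fun s hs => (hd s hs).continuousWithinAt)
        (fun s hs => (hd s (interior_subset hs)).mono interior_subset) fun s hs => ?_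
      have h1 : m / 2 < _ := (box.mem y hyr s (interior_subset hs)).1.1
      linarith
    have h0I : (0 : ℝ) ∈ Icc (-ε) ε := ⟨by linarith, hε.le⟩
    have hpI : s₀ ∈ Icc (-ε) ε := ⟨by linarith, hs₀ε⟩
    have hnI : -s₀ ∈ Icc (-ε) ε := ⟨by linarith, by linarith⟩
    have hgy' := abs_le.1 hgy
    have hms : m / 2 * s₀ = Cg * ‖y - y₀‖ := by rw [hs₀]; field_simp
    have hp : 0 ≤ g (ψ s₀ y) := by
      have := hmono h0I hpI hs₀0
      simp only [box.ψ_zero y hyr] at this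
      linarith
    have hn : g (ψ (-s₀) y) ≤ 0 := by
      have := hmono hnI h0I (by linarith)
      simp only [box.ψ_zero y hyr] at this
      linarith
    obtain ⟨s, hs, hgs⟩ := intermediate_value_Icc (f := fun s => g (ψ s y))
      (show -s₀ ≤ s₀ by linarith)
      (fun t ht => ((hkd t ⟨by linarith [ht.1], by linarith [ht.2]⟩).continuousWithinAt).mono
        (Icc_subset_Icc hnI.1 hpI.2)) ⟨hn, hp⟩
    have hsI : s ∈ Icc (-ε) ε := ⟨by linarith [hs.1], by linarith [hs.2]⟩
    have hsabs : |s| ≤ s₀ := abs_le.2 hs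
    have hsub : uIcc 0 s ⊆ Icc (-ε) ε := uIcc_subset_Icc h0I hsI
    have hgb : ∀ u ∈ Icc (-ε) ε, |g (ψ u y)| ≤ Cg * Cf * |u - s| := fun u hu => by
      have := (convex_Icc (-ε) ε).norm_image_sub_le_of_norm_hasDerivWithin_le hkd
        (C := Cg * Cf) (fun t ht => by
          have hUt := box.mem y hyr t ht
          exact ((fderiv ℝ g (ψ t y)).le_opNorm _).trans
            (mul_le_mul (bg _ hUt.2.2.1).2.2 (bf _ hUt.2.2.2).2.1 (norm_nonneg _) hCg)) hsI hu
      simp only at hgs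
      rw [hgs] at this
      simpa using this
    have hcdiff := (convex_uIcc 0 s).norm_image_sub_le_of_norm_hasDerivWithin_le
      (f := fun u => c (φ.symm (ψ u y))) (f' := fun u => g (ψ u y)) (C := Cg * Cf * |s|)
      (fun u hu => by
        have h1 := ((hcd _ (box.mem y hyr u (hsub hu)).2.1).differentiableAt
          (by simp)).hasFDerivAt
        exact h1.comp_hasDerivWithinAt u ((box.deriv_ψ y hyr u (hsub hu)).mono hsub))
      (fun u hu => by
        refine (hgb u (hsub hu)).trans ?_
        refine mul_le_mul_of_nonneg_left ?_ (by positivity)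
        have := abs_sub_right_of_mem_uIcc hu
        rwa [abs_sub_comm, sub_zero] at this) left_mem_uIcc right_mem_uIcc
    simp only [box.ψ_zero y hyr, sub_zero, Real.norm_eq_abs] at hcdiff
    have hcty : ct (φ.symm y) = c (φ.symm (ψ s y)) := by
      have hmaps : ∀ u ∈ uIcc 0 (-s), u + s ∈ Icc (-ε) ε := fun u hu => by
        refine hsub ?_
        rcases le_total 0 s with h | h
        · rw [uIcc_of_ge (by linarith)] at hu
          rw [uIcc_of_le h]; constructor <;> linarith [hu.1, hu.2]
        · rw [uIcc_of_le (by linarith)] at hu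
          rw [uIcc_of_ge h]; constructor <;> linarith [hu.1, hu.2]
      have hγ := isMIntegralCurveOn_of_coordField (f := f) (x := xf)
        (z := fun u => ψ (u + s) y) (s := uIcc 0 (-s))
        (fun u hu => (box.mem y hyr _ (hmaps u hu)).2.1)
        (fun u hu => by
          have h1 := box.deriv_ψ y hyr _ (hmaps u hu)
          have h2 : HasDerivWithinAt (fun u => u + s) 1 (uIcc 0 (-s)) u :=
            (hasDerivWithinAt_id u _).add_const s
          have h3 := h1.scomp u h2 hmaps
          rw [one_smul] at h3
          exact h3)
      have := hcurve (-s) (fun u => φ.symm (ψ (u + s) y))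
        (by
          simp only [zero_add]
          rw [hgl _ (box.mem y hyr s hsI).2.1]; exact hgs)
        (fun u hu => (box.mem y hyr _ (hmaps u hu)).1.2) hγ
      simpa [box.ψ_zero y hyr] using this
    rw [hcty]
    refine hcdiff.trans ?_
    have e1 : Cg * Cf * |s| * |s| ≤ Cg * Cf * s₀ * s₀ := by gcongr
    refine e1.trans (le_of_eq ?_)
    rw [hs₀, hK]; field_simp
  have hcf0 : ct (φ.symm y₀) = c (φ.symm y₀) := by
    have := key y₀ (mem_ball_self hρ0)
    rw [sub_self, norm_zero] at this
    simp only [ne_eq, OfNat.ofNat_ne_zero, not_false_eq_true, zero_pow, mul_zero] at this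
    exact sub_eq_zero.1 (abs_nonpos_iff.1 this)
  have hzero : HasFDerivAt (fun y => ct (φ.symm y) - c (φ.symm y)) (0 : E →L[ℝ] ℝ) y₀ :=
    hasFDerivAt_of_norm_sub_le_sq (ball_mem_nhds y₀ hρ0) (C := K) fun y hy => by
      rw [hcf0]
      simpa using key y hy
  have hctd := (contDiffAt_comp_symm hcts hO hy₀t (by rw [← hφ, hy₀s]; exact hxO)).differentiableAt
    (by simp)
  have heq := hzero.unique (hctd.hasFDerivAt.sub
    ((hcd y₀ hy₀t).differentiableAt (by simp)).hasFDerivAt)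
  have heq' := sub_eq_zero.1 heq.symm
  ext v
  refine (mfderiv_eq_fderiv_comp_symm hxs
    ((hcts.contMDiffAt (hO.mem_nhds hxO)).mdifferentiableAt (by simp)) v).trans (Eq.trans ?_
    (mfderiv_eq_fderiv_comp_symm hxs (hc.mdifferentiable (by simp) _) v).symm)
  exact congrArg (fun A : E →L[ℝ] ℝ => A (tangentCoordChange 𝓘(ℝ, E) xf xf xf v)) heq'

end ModifiedCost

section

section Velocity

variable {E : Type*} [NormedAddCommGroup E] [NormedSpace ℝ E]
  {M : Type*} [TopologicalSpace M] [ChartedSpace E M] [IsManifold 𝓘(ℝ, E) ∞ M]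
  [FiniteDimensional ℝ E]

theorem HasVelocityAt.hasDerivAt_comp {F G : Cotangent E M → ℝ} {γ : ℝ → Cotangent E M} {t : ℝ}
    (h : HasVelocityAt (cotModel E) γ t (hamField F (γ t)))
    (hG : MDifferentiableAt (cotModel E) 𝓘(ℝ, ℝ) G (γ t)) :
    HasDerivAt (fun t => G (γ t)) (poisson F G (γ t)) t := by
  have h0 : HasFDerivAt (fun t => G (γ t)) ((cotDiff G (γ t)).comp
      ((1 : ℝ →L[ℝ] ℝ).smulRight (show E × (E →L[ℝ] ℝ) from hamField F (γ t)))) t :=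
    (HasMFDerivAt.comp t hG.hasMFDerivAt h).hasFDerivAt
  have h1 := h0.hasDerivAt
  have h2 : poisson F G (γ t) = cotDiff G (γ t) ((1 : ℝ) • (show E × (E →L[ℝ] ℝ) from
    hamField F (γ t))) := by rw [one_smul]; rfl
  rw [h2]
  exact h1

theorem hamField_eq_of_fderiv_eq {F G : Cotangent E M → ℝ} {ℓ : Cotangent E M}
    (hF : MDifferentiableAt (cotModel E) 𝓘(ℝ, ℝ) F ℓ)
    (hG : MDifferentiableAt (cotModel E) 𝓘(ℝ, ℝ) G ℓ)
    (h : fderiv ℝ (fun z => F ((cotChart ℓ.1).symm z)) (cotChart ℓ.1 ℓ) =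
      fderiv ℝ (fun z => G ((cotChart ℓ.1).symm z)) (cotChart ℓ.1 ℓ)) :
    hamField F ℓ = hamField G ℓ := by
  have hs := mem_cotChart_source ℓ
  have h1 := cotTrans_hamField hF hs
  rw [h, ← cotTrans_hamField hG hs] at h1
  have h2 := (exists_cotTrans_inv hs).2 (hamField F ℓ)
  rw [h1] at h2
  exact h2.symm.trans ((exists_cotTrans_inv hs).2 (hamField G ℓ))

end Velocity

variable (E : Type*) [NormedAddCommGroup E] [NormedSpace ℝ E] [FiniteDimensional ℝ E]
  (M : Type*) [TopologicalSpace M] [ChartedSpace E M] [IsManifold 𝓘(ℝ, E) ∞ M]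

/-- A bang-bang-singular reference extremal together with its overmaximised flow. -/
structure Extremal where
  m : ℕ
  X : Fin m → (x : M) → TangentSpace 𝓘(ℝ, E) x
  hX : ∀ i, SmoothField (X i)
  c : M → ℝ
  hc : ContMDiff 𝓘(ℝ, E) 𝓘(ℝ, ℝ) ∞ c
  T : ℝ
  τ₁ : ℝ
  τ₂ : ℝ
  hτ₁ : 0 < τ₁
  hτ₁₂ : τ₁ < τ₂
  hτ₂ : τ₂ < T
  h₁ : (x : M) → TangentSpace 𝓘(ℝ, E) x
  h₂ : (x : M) → TangentSpace 𝓘(ℝ, E) x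
  h₃ : (x : M) → TangentSpace 𝓘(ℝ, E) x
  hh₁ : ∃ i, h₁ = X i
  hh₂ : ∃ i, h₂ = X i
  hh₃ : ∃ i, h₃ = X i
  υ : ℝ → ℝ
  hυ : ∀ᵐ t ∂volume.restrict (Icc τ₂ T), υ t ∈ Ioo 0 1
  ξr : ℝ → M
  hξ : IsCaratheodorySolution 𝓘(ℝ, E) (refField h₁ h₂ h₃ τ₁ τ₂ υ) ξr 0 T
  lam : ℝ → Cotangent E M
  hPMP : PMP X c T (refField h₁ h₂ h₃ τ₁ τ₂ υ) ξr lam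
  hbang : RegularBang X h₁ h₂ τ₁ τ₂ lam
  hsing : ∀ t ∈ Icc τ₂ T, OnlyEdgeMaximises X h₂ h₃ (lam t)
  hsimple : OnlyEdgeMaximises X h₁ h₂ (lam τ₁)
  hswitch : RegularSwitch h₁ h₂ h₃ τ₁ τ₂ lam
  hSGLC : StrongLegendre h₂ h₃ τ₂ T lam
  O : Set M
  ct : M → ℝ
  hct : IsModifiedCost (fun x => h₃ x - h₂ x) c (ξr T) O ct
  V : Set M
  hV : IsOpen V
  hxV : ξr T ∈ V
  hVO : V ⊆ O
  Os : Set (Cotangent E M)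
  θ : Cotangent E M → ℝ
  hθ : IsTheta h₂ h₃ τ₂ T lam Os θ
  O₂ : Set (Cotangent E M)
  t₂ : Cotangent E M → ℝ
  s₁ : Cotangent E M → ℝ
  hsw : AreSwitchingTimes h₁ h₂ h₃ τ₁ τ₂ lam Os θ O₂ t₂ s₁
  Φ : ℝ → Cotangent E M → Cotangent E M
  hΦ : IsOvermaximisedFlow h₁ h₂ h₃ τ₂ T υ Os θ O₂ t₂ s₁
    (differential (fun x => -ct x) '' V) Φ

namespace Extremal

variable {E M} (S : Extremal E M)

/-- The Hamiltonian of `h₁`. -/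
abbrev H₁ : Cotangent E M → ℝ := lift S.h₁
/-- The Hamiltonian of `h₂`. -/
abbrev H₂ : Cotangent E M → ℝ := lift S.h₂
/-- The Hamiltonian of `h₃ - h₂`. -/
abbrev F₁ : Cotangent E M → ℝ := lift fun x => S.h₃ x - S.h₂ x
/-- The bracket of the Hamiltonians of `h₂` and `h₃`. -/
abbrev Q : Cotangent E M → ℝ := poisson (lift S.h₂) (lift S.h₃)
/-- The overmaximised Hamiltonian. -/
abbrev tH : Cotangent E M → ℝ := tildeH S.h₂ S.h₃ S.θ

/-- The preferred chart at the final point. -/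
abbrev φ : PartialEquiv M E := extChartAt 𝓘(ℝ, E) (S.ξr S.T)
/-- The coordinates of the final point. -/
def η₀ : E := S.φ (S.ξr S.T)
/-- The opposite of the cost, in coordinates. -/
def cf (η : E) : ℝ := -S.ct (S.φ.symm η)
/-- The overmaximised flow, parametrised by the coordinates of its end point. -/
def W (t : ℝ) (η : E) : Cotangent E M := S.Φ t (differential (fun x => -S.ct x) (S.φ.symm η))
/-- The domain of `W`. -/
def N₀ : Set E := S.φ.target ∩ S.φ.symm ⁻¹' S.V
/-- The second switching time. -/
def σ₂ (η : E) : ℝ := switch₂ S.τ₂ S.t₂ (S.W S.τ₂ η)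
/-- The first switching time. -/
def σ₁ (η : E) : ℝ := S.s₁ (S.W S.τ₂ η)

/-- The Hamiltonian that governs the flow at time `t`. -/
def mode (η : E) (t : ℝ) (ℓ : Cotangent E M) : ℝ :=
  if S.τ₂ ≤ t then S.tH ℓ + S.υ t * S.F₁ ℓ
  else if S.σ₂ η ≤ t then S.tH ℓ else if S.σ₁ η ≤ t then S.H₂ ℓ else S.H₁ ℓ

theorem smooth₁ : SmoothField S.h₁ := by
  obtain ⟨i, hi⟩ := S.hh₁; rw [hi]; exact S.hX i
theorem smooth₂ : SmoothField S.h₂ := by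
  obtain ⟨i, hi⟩ := S.hh₂; rw [hi]; exact S.hX i
theorem smooth₃ : SmoothField S.h₃ := by
  obtain ⟨i, hi⟩ := S.hh₃; rw [hi]; exact S.hX i
theorem smoothF : SmoothField fun x => S.h₃ x - S.h₂ x := S.smooth₃.sub S.smooth₂

theorem cotSmoothF : CotSmooth S.F₁ := cotSmooth_lift S.smoothF
theorem cotSmooth₁ : CotSmooth S.H₁ := cotSmooth_lift S.smooth₁
theorem cotSmooth₂ : CotSmooth S.H₂ := cotSmooth_lift S.smooth₂
theorem cotSmoothQ : CotSmooth S.Q := S.cotSmooth₂.poisson (cotSmooth_lift S.smooth₃)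

theorem τ₂_pos : 0 < S.τ₂ := S.hτ₁.trans S.hτ₁₂
theorem T_pos : 0 < S.T := S.τ₂_pos.trans S.hτ₂

theorem poissonF : poisson S.H₂ S.F₁ = S.Q :=
  funext fun ℓ => poisson_lift_sub S.smooth₂ S.smooth₃ ℓ

theorem continuousOn_lam : ContinuousOn S.lam (Icc 0 S.T) := S.hPMP.adjoint.1.1

theorem η₀_mem_target : S.η₀ ∈ S.φ.target := S.φ.map_source (mem_extChartAt_source _)
theorem symm_η₀ : S.φ.symm S.η₀ = S.ξr S.T := S.φ.left_inv (mem_extChartAt_source _)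

theorem N₀_mem : S.N₀ ∈ 𝓝 S.η₀ :=
  ((continuousOn_extChartAt_symm (I := 𝓘(ℝ, E)) (S.ξr S.T)).isOpen_inter_preimage
    (isOpen_extChartAt_target _) S.hV).mem_nhds
    ⟨S.η₀_mem_target, by rw [mem_preimage, symm_η₀]; exact S.hxV⟩

theorem single_mem (i : Fin S.m) : S.X i = comb S.X (Pi.single i 1) := by
  funext x
  rw [comb, Finset.sum_eq_single i]
  · rw [Pi.single_eq_same, one_smul]
  · intro j _ hj
    rw [Pi.single_eq_of_ne hj, zero_smul]
  · simp

theorem lift_le_max {t : ℝ} (ht : t ∈ Icc 0 S.T) (i : Fin S.m) :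
    lift (S.X i) (S.lam t) ≤ lift (refField S.h₁ S.h₂ S.h₃ S.τ₁ S.τ₂ S.υ t) (S.lam t) :=
  (S.hPMP.maximum t ht).2 ⟨S.X i (S.lam t).1,
    ⟨Pi.single i 1, single_mem_stdSimplex ℝ i, congrFun (S.single_mem i) _⟩, rfl⟩

theorem lift_refField {t : ℝ} (ht : S.τ₂ ≤ t) (ℓ : Cotangent E M) :
    lift (refField S.h₁ S.h₂ S.h₃ S.τ₁ S.τ₂ S.υ t) ℓ = S.H₂ ℓ + S.υ t * S.F₁ ℓ := by
  have h1 : ¬ t < S.τ₁ := not_lt.2 (S.hτ₁₂.le.trans ht)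
  have h2 : ¬ t < S.τ₂ := not_lt.2 ht
  simp only [lift, refField, if_neg h1, if_neg h2]
  refine (map_add (show TangentSpace 𝓘(ℝ, E) ℓ.1 →L[ℝ] ℝ from ℓ.2) _ _).trans ?_
  congr 1
  exact map_smul (show TangentSpace 𝓘(ℝ, E) ℓ.1 →L[ℝ] ℝ from ℓ.2) (S.υ t) _

theorem F₁_eq (ℓ : Cotangent E M) : S.F₁ ℓ = lift S.h₃ ℓ - lift S.h₂ ℓ := lift_sub _ _ ℓ

theorem F₁_lam : ∀ t ∈ Icc S.τ₂ S.T, S.F₁ (S.lam t) = 0 := by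
  have hsub : Icc S.τ₂ S.T ⊆ Icc 0 S.T := Icc_subset_Icc_left S.τ₂_pos.le
  have h := Measure.eqOn_Icc_of_ae_eq (μ := volume) S.hτ₂.ne
    (f := fun t => S.F₁ (S.lam t)) (g := fun _ => 0) ?_
    (S.cotSmoothF.continuousOn.comp_continuousOn (S.continuousOn_lam.mono hsub)) continuousOn_const
  · exact h
  filter_upwards [S.hυ, ae_restrict_mem measurableSet_Icc] with t hu ht
  obtain ⟨i, hi⟩ := S.hh₂
  obtain ⟨j, hj⟩ := S.hh₃
  have h1 := S.lift_le_max (hsub ht) i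
  have h2 := S.lift_le_max (hsub ht) j
  rw [lift_refField S ht.1, ← hi] at h1
  rw [lift_refField S ht.1, ← hj] at h2
  have h3 := S.F₁_eq (S.lam t)
  have e1 : 0 ≤ S.υ t * S.F₁ (S.lam t) := by simp only [H₂] at h1; linarith
  have e2 : (1 - S.υ t) * S.F₁ (S.lam t) ≤ 0 := by simp only [H₂] at h2; linarith
  exact le_antisymm (nonpos_of_mul_nonpos_right e2 (by linarith [hu.2]))
    (nonneg_of_mul_nonneg_right e1 hu.1)

theorem mdiff_mode_add (w : ℝ) (ℓ : Cotangent E M) :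
    MDifferentiableAt (cotModel E) 𝓘(ℝ, ℝ) (fun ℓ => S.H₂ ℓ + w * S.F₁ ℓ) ℓ := by
  have h1 := S.cotSmooth₂.contDiffAt ((cotChart ℓ.1).map_source (mem_cotChart_source ℓ))
  have h2 := S.cotSmoothF.contDiffAt ((cotChart ℓ.1).map_source (mem_cotChart_source ℓ))
  exact mdifferentiableAt_of_comp_cotChart_symm (mem_cotChart_source ℓ)
    ((h1.differentiableAt (by simp)).add ((h2.differentiableAt (by simp)).const_mul w))

theorem poisson_add_self (w : ℝ) (ℓ : Cotangent E M) :
    poisson (fun ℓ => S.H₂ ℓ + w * S.F₁ ℓ) S.F₁ ℓ = S.Q ℓ := by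
  have hs := mem_cotChart_source ℓ
  have h1 := (S.cotSmooth₂.contDiffAt ((cotChart ℓ.1).map_source hs)).differentiableAt (by simp)
  have h2 := (S.cotSmoothF.contDiffAt ((cotChart ℓ.1).map_source hs)).differentiableAt (by simp)
  have e : fderiv ℝ (fun z => S.H₂ ((cotChart ℓ.1).symm z) + w * S.F₁ ((cotChart ℓ.1).symm z))
      (cotChart ℓ.1 ℓ) = fderiv ℝ (fun z => S.H₂ ((cotChart ℓ.1).symm z)) (cotChart ℓ.1 ℓ) +
        w • fderiv ℝ (fun z => S.F₁ ((cotChart ℓ.1).symm z)) (cotChart ℓ.1 ℓ) :=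
    (h1.hasFDerivAt.add (h2.hasFDerivAt.const_mul w)).fderiv
  rw [poisson_eq_fderiv (S.mdiff_mode_add w ℓ) (S.cotSmoothF.mdifferentiableAt ℓ) hs, e,
    symGrad_add, symGrad_smul, map_add, map_smul,
    ← poisson_eq_fderiv (S.cotSmooth₂.mdifferentiableAt ℓ) (S.cotSmoothF.mdifferentiableAt ℓ) hs,
    ← poisson_eq_fderiv (S.cotSmoothF.mdifferentiableAt ℓ) (S.cotSmoothF.mdifferentiableAt ℓ) hs,
    S.poissonF]
  have h0 := poisson_neg_symm (F := S.F₁) (G := S.F₁) ℓ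
  have h00 : poisson S.F₁ S.F₁ ℓ = 0 := by linarith
  rw [h00, smul_zero, add_zero]

theorem Q_lam : ∀ t ∈ Icc S.τ₂ S.T, S.Q (S.lam t) = 0 := by
  have hsub : Icc S.τ₂ S.T ⊆ Icc 0 S.T := Icc_subset_Icc_left S.τ₂_pos.le
  have h := Measure.eqOn_Icc_of_ae_eq (μ := volume) S.hτ₂.ne
    (f := fun t => S.Q (S.lam t)) (g := fun _ => 0) ?_
    (S.cotSmoothQ.continuousOn.comp_continuousOn (S.continuousOn_lam.mono hsub)) continuousOn_const
  · exact h
  filter_upwards [ae_restrict_Icc_mono S.hPMP.adjoint.2 S.τ₂_pos.le le_rfl, ae_mem_Ioo S.τ₂ S.T]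
    with t h1 ht
  have e : lift (refField S.h₁ S.h₂ S.h₃ S.τ₁ S.τ₂ S.υ t) =
      fun ℓ : Cotangent E M => S.H₂ ℓ + S.υ t * S.F₁ ℓ := funext fun ℓ => S.lift_refField ht.1.le ℓ
  rw [e] at h1
  have h2 := h1.hasDerivAt_comp (S.cotSmoothF.mdifferentiableAt _)
  rw [poisson_add_self] at h2
  have h3 : (fun t => S.F₁ (S.lam t)) =ᶠ[𝓝 t] fun _ => 0 :=
    Filter.eventually_of_mem (Ioo_mem_nhds ht.1 ht.2) fun u hu => S.F₁_lam u (Ioo_subset_Icc_self hu)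
  exact h2.unique ((hasDerivAt_const t (0 : ℝ)).congr_of_eventuallyEq h3)

theorem legendre_pos : ∀ t ∈ Icc S.τ₂ S.T, 0 < poisson S.F₁ S.Q (S.lam t) := fun t ht => by
  have h := S.hSGLC t ht
  rwa [S.poissonF] at h

variable [T2Space M]

theorem exists_tildeH {t : ℝ} (ht : t ∈ Icc S.τ₂ S.T) : ∃ R > 0, ∃ C ≥ 0,
    TildeHLocal S.h₂ S.h₃ S.θ S.Os (S.lam t).1 (ball (cotChart (S.lam t).1 (S.lam t)) R) C :=
  exists_tildeHLocal S.smooth₂ S.smooth₃ S.hθ (S.hθ.arc t ht) (S.Q_lam t ht) (S.hSGLC t ht)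

theorem lam_singular : FollowsHam (fun t ℓ => S.tH ℓ + S.υ t * S.F₁ ℓ) S.lam S.τ₂ S.T := by
  refine IsCaratheodorySolution.followsHam ⟨⟨S.continuousOn_lam.mono
    (Icc_subset_Icc_left S.τ₂_pos.le), fun x a' b' ha hab hb =>
      S.hPMP.adjoint.1.2 x a' b' (S.τ₂_pos.le.trans ha) hab hb⟩, ?_⟩
  filter_upwards [ae_restrict_Icc_mono S.hPMP.adjoint.2 S.τ₂_pos.le le_rfl,
    ae_restrict_mem measurableSet_Icc] with t h1 ht
  have e : lift (refField S.h₁ S.h₂ S.h₃ S.τ₁ S.τ₂ S.υ t) =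
      fun ℓ : Cotangent E M => S.H₂ ℓ + S.υ t * S.F₁ ℓ := funext fun ℓ => S.lift_refField ht.1 ℓ
  rw [e] at h1
  obtain ⟨R, hR, C, hC, hl⟩ := S.exists_tildeH ht
  have hs := mem_cotChart_source (S.lam t)
  have hz := mem_ball_self (x := cotChart (S.lam t).1 (S.lam t)) hR
  have d1 := hl.nice.diff _ hz
  have d2 := (S.cotSmoothF.contDiffAt ((cotChart (S.lam t).1).map_source hs)).differentiableAt
    (by simp)
  have d3 := (S.cotSmooth₂.contDiffAt ((cotChart (S.lam t).1).map_source hs)).differentiableAt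
    (by simp)
  have d4 : DifferentiableAt ℝ (fun z => S.tH ((cotChart (S.lam t).1).symm z) +
    S.υ t * S.F₁ ((cotChart (S.lam t).1).symm z)) (cotChart (S.lam t).1 (S.lam t)) :=
    d1.add (d2.const_mul (S.υ t))
  have heq : hamField (fun ℓ => S.H₂ ℓ + S.υ t * S.F₁ ℓ) (S.lam t) =
      hamField (fun ℓ => S.tH ℓ + S.υ t * S.F₁ ℓ) (S.lam t) := by
    refine hamField_eq_of_fderiv_eq (S.mdiff_mode_add _ _)
      (mdifferentiableAt_of_comp_cotChart_symm hs d4) ?_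
    have e1 : fderiv ℝ (fun z => S.tH ((cotChart (S.lam t).1).symm z)) (cotChart (S.lam t).1 (S.lam t)) =
        fderiv ℝ (fun z => S.H₂ ((cotChart (S.lam t).1).symm z)) (cotChart (S.lam t).1 (S.lam t)) :=
      (hl.eq_of _ hz (by
        rw [(cotChart (S.lam t).1).left_inv hs]; exact S.Q_lam t ht)).2
    have e2 : fderiv ℝ (fun z => S.tH ((cotChart (S.lam t).1).symm z) +
        S.υ t * S.F₁ ((cotChart (S.lam t).1).symm z)) (cotChart (S.lam t).1 (S.lam t)) = _ :=
      (d1.hasFDerivAt.add (d2.hasFDerivAt.const_mul (S.υ t))).fderiv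
    rw [e2]
    refine (d3.hasFDerivAt.add (d2.hasFDerivAt.const_mul (S.υ t))).fderiv.trans ?_
    rw [← e1]
  rw [heq] at h1
  exact h1

end Extremal

end

section

variable {E : Type*} [NormedAddCommGroup E] [NormedSpace ℝ E] [FiniteDimensional ℝ E]
  {M : Type*} [TopologicalSpace M] [ChartedSpace E M] [IsManifold 𝓘(ℝ, E) ∞ M]

theorem TildeHLocal.mono {h₂ h₃ : (x : M) → TangentSpace 𝓘(ℝ, E) x} {θ : Cotangent E M → ℝ}
    {Os : Set (Cotangent E M)} {x : M} {D D' : Set (E × (E →L[ℝ] ℝ))} {C C' : ℝ}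
    (h : TildeHLocal h₂ h₃ θ Os x D C) (hD : D' ⊆ D) (hC : C ≤ C') :
    TildeHLocal h₂ h₃ θ Os x D' C' where
  mem z hz := h.mem z (hD hz)
  nice := h.nice.mono hD hC
  le z hz := h.le z (hD hz)
  eq_imp z hz := h.eq_imp z (hD hz)
  eq_of z hz := h.eq_of z (hD hz)
  bracket z hz := h.bracket z (hD hz)

namespace Extremal

variable (S : Extremal E M)

theorem differential_mem {η : E} (hη : η ∈ S.N₀) : differential (fun x => -S.ct x) (S.φ.symm η) ∈
    (differential (fun x => -S.ct x) '' S.V : Set (Cotangent E M)) := mem_image_of_mem _ hη.2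

theorem W_T {η : E} (hη : η ∈ S.N₀) :
    S.W S.T η = differential (fun x => -S.ct x) (S.φ.symm η) :=
  S.hΦ.final _ (S.differential_mem hη)

theorem order {η : E} (hη : η ∈ S.N₀) :
    0 < S.σ₁ η ∧ S.σ₁ η < S.σ₂ η ∧ S.σ₂ η ≤ S.τ₂ :=
  have h := S.hsw.order _ (S.hΦ.switch_mem _ (S.differential_mem hη))
  ⟨h.1, h.2, min_le_right _ _⟩

theorem W_singular {η : E} (hη : η ∈ S.N₀) :
    FollowsHam (fun t ℓ => S.tH ℓ + S.υ t * S.F₁ ℓ) (fun t => S.W t η) S.τ₂ S.T :=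
  (S.hΦ.singular _ (S.differential_mem hη)).2.followsHam

theorem W_corrected {η : E} (hη : η ∈ S.N₀) :
    FollowsHam (fun _ => S.tH) (fun t => S.W t η) (S.σ₂ η) S.τ₂ :=
  IsMIntegralCurveOn.followsHam (S.hΦ.corrected _ (S.differential_mem hη)).2

theorem W_bang₂ {η : E} (hη : η ∈ S.N₀) :
    FollowsHam (fun _ => S.H₂) (fun t => S.W t η) (S.σ₁ η) (S.σ₂ η) :=
  IsMIntegralCurveOn.followsHam (S.hΦ.bang₂ _ (S.differential_mem hη))

theorem W_bang₁ {η : E} (hη : η ∈ S.N₀) :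
    FollowsHam (fun _ => S.H₁) (fun t => S.W t η) 0 (S.σ₁ η) :=
  IsMIntegralCurveOn.followsHam (S.hΦ.bang₁ _ (S.differential_mem hη))

theorem W_follows {η : E} (hη : η ∈ S.N₀) :
    FollowsHam (S.mode η) (fun t => S.W t η) 0 S.T := by
  obtain ⟨h0, h1, h2⟩ := S.order hη
  have e1 : FollowsHam (S.mode η) (fun t => S.W t η) S.τ₂ S.T := by
    refine (S.W_singular hη).congr ?_
    filter_upwards [ae_restrict_mem measurableSet_Icc] with t ht
    funext ℓ
    rw [mode, if_pos ht.1]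
  have e2 : FollowsHam (S.mode η) (fun t => S.W t η) (S.σ₂ η) S.τ₂ := by
    refine (S.W_corrected hη).congr ?_
    filter_upwards [ae_mem_Ioo (S.σ₂ η) S.τ₂] with t ht
    funext ℓ
    rw [mode, if_neg (not_le.2 ht.2), if_pos ht.1.le]
  have e3 : FollowsHam (S.mode η) (fun t => S.W t η) (S.σ₁ η) (S.σ₂ η) := by
    refine (S.W_bang₂ hη).congr ?_
    filter_upwards [ae_mem_Ioo (S.σ₁ η) (S.σ₂ η)] with t ht
    funext ℓ
    rw [mode, if_neg (not_le.2 (ht.2.trans_le h2)), if_neg (not_le.2 ht.2), if_pos ht.1.le]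
  have e4 : FollowsHam (S.mode η) (fun t => S.W t η) 0 (S.σ₁ η) := by
    refine (S.W_bang₁ hη).congr ?_
    filter_upwards [ae_mem_Ioo 0 (S.σ₁ η)] with t ht
    funext ℓ
    rw [mode, if_neg (not_le.2 (ht.2.trans (h1.trans_le h2))),
      if_neg (not_le.2 (ht.2.trans h1)), if_neg (not_le.2 ht.2)]
  exact ((e4.glue e3 h0.le h1.le).glue e2 (h0.trans h1).le h2).glue e1
    ((h0.trans h1).le.trans h2) S.hτ₂.le

theorem mdiff_ct {x : M} (hx : x ∈ S.V) : MDifferentiableAt 𝓘(ℝ, E) 𝓘(ℝ, ℝ) S.ct x :=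
  ((contMDiffOn_modifiedCost S.hc S.hct).contMDiffAt
    (S.hct.1.mem_nhds (S.hVO hx))).mdifferentiableAt (by simp)

theorem lift_differential_neg (f : (x : M) → TangentSpace 𝓘(ℝ, E) x) {a : M → ℝ} {x : M} :
    lift f (differential (fun x => -a x) x) = -lieD f a x := by
  have h1 : (mfderiv 𝓘(ℝ, E) 𝓘(ℝ, ℝ) (fun x => -a x) x : E →L[ℝ] ℝ) =
      -(mfderiv 𝓘(ℝ, E) 𝓘(ℝ, ℝ) a x : E →L[ℝ] ℝ) := mfderiv_neg
  exact congrArg (fun A : E →L[ℝ] ℝ => A (f x)) h1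

theorem F₁_W_T {η : E} (hη : η ∈ S.N₀) : S.F₁ (S.W S.T η) = 0 := by
  rw [S.W_T hη, F₁, lift_differential_neg, neg_eq_zero]
  exact lieD_modifiedCost S.smoothF S.hc S.hct _ (S.hVO hη.2)

theorem T_mem : S.T ∈ Icc 0 S.T := ⟨S.T_pos.le, le_rfl⟩

theorem W_T_η₀ : S.W S.T S.η₀ = S.lam S.T := by
  have h0 : lieD (fun x => S.h₃ x - S.h₂ x) S.c (S.ξr S.T) = 0 := by
    have h := S.F₁_lam S.T ⟨S.hτ₂.le, le_rfl⟩
    rw [S.hPMP.final, F₁, lift_differential_neg, neg_eq_zero] at h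
    exact h
  have h1 := mfderiv_modifiedCost S.smoothF S.hc S.hct h0
  rw [S.W_T (mem_of_mem_nhds S.N₀_mem), S.hPMP.final, symm_η₀]
  have h2 : (mfderiv 𝓘(ℝ, E) 𝓘(ℝ, ℝ) (fun x => -S.ct x) (S.ξr S.T) : E →L[ℝ] ℝ) =
      mfderiv 𝓘(ℝ, E) 𝓘(ℝ, ℝ) (fun x => -S.c x) (S.ξr S.T) :=
    mfderiv_neg.trans ((congrArg Neg.neg h1).trans mfderiv_neg.symm)
  exact congrArg (fun A : E →L[ℝ] ℝ => (⟨S.ξr S.T, A⟩ : Cotangent E M)) h2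

theorem contDiffAt_cf {η : E} (hη : η ∈ S.N₀) : ContDiffAt ℝ ∞ S.cf η :=
  (contDiffAt_comp_symm (contMDiffOn_modifiedCost S.hc S.hct) S.hct.1 hη.1 (S.hVO hη.2)).neg

/-- The estimates at the final time. -/
theorem estAt_T : ∃ N ∈ 𝓝 S.η₀, N ⊆ S.N₀ ∧ ∃ C ≥ 0, EstAt (S.lam S.T).1 (S.W S.T) S.cf N C := by
  rw [S.hPMP.proj S.T S.T_mem]
  obtain ⟨R, hR, C, hC, hb, hl⟩ := exists_ball_fderiv_bounds
    ((S.contDiffAt_cf (mem_of_mem_nhds S.N₀_mem)).of_le two_le_infty)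
  obtain ⟨r, hr, hrs⟩ := Metric.mem_nhds_iff.1 (inter_mem S.N₀_mem (ball_mem_nhds S.η₀ hR))
  have hcoord : ∀ η ∈ S.N₀, S.W S.T η ∈ (cotChart (S.ξr S.T)).source ∧
      cotChart (S.ξr S.T) (S.W S.T η) = (η, fderiv ℝ S.cf η) := by
    intro η hη
    have hsrc : S.φ.symm η ∈ S.φ.source := S.φ.map_target hη.1
    refine ⟨?_, Prod.ext ?_ ?_⟩
    · rw [cotChart_source, S.W_T hη]; exact hsrc
    · rw [cotChart_fst, S.W_T hη]; exact S.φ.right_inv hη.1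
    · rw [S.W_T hη, cotChart_differential_snd (a := fun x => -S.ct x) hsrc (S.mdiff_ct hη.2).neg]
      have : S.φ (S.φ.symm η) = η := S.φ.right_inv hη.1
      rw [this]
      rfl
  refine ⟨ball S.η₀ r, ball_mem_nhds _ hr, fun η hη => (hrs hη).1, max 1 C,
    by positivity, fun η hη => ⟨(hcoord η (hrs hη).1).1, fun η' hη' => ?_⟩⟩
  rw [(hcoord η (hrs hη).1).2, (hcoord η' (hrs hη').1).2]
  constructor
  · rw [Prod.mk_sub_mk]
    refine norm_prod_le_iff.2 ⟨?_, ?_⟩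
    · exact le_mul_of_one_le_left (norm_nonneg _) (le_max_left _ _)
    · exact (hl η (hrs hη).2 η' (hrs hη').2).trans (by gcongr; exact le_max_right _ _)
  · have := norm_sub_sub_fderiv_le (convex_ball S.η₀ R) (fun w hw => (hb w hw).1) hl hC
      (hrs hη).2 (hrs hη').2
    rw [Real.norm_eq_abs, abs_sub_comm] at this
    exact this.trans (by gcongr; exact le_max_right _ _)

/-- A coordinate ball around `lam t` on which all the Hamiltonians of the problem are regular. -/
structure NiceBall (t R C : ℝ) : Prop where
  pos : 0 < R
  nonneg : 0 ≤ C
  sub : ball (cotChart (S.lam t).1 (S.lam t)) R ⊆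
    (cotChart (S.lam t).1 : PartialEquiv (Cotangent E M) _).target
  niceX : ∀ i, NiceHam (fun z => lift (S.X i) ((cotChart (S.lam t).1).symm z))
    (ball (cotChart (S.lam t).1 (S.lam t)) R) C
  niceF : NiceHam (fun z => S.F₁ ((cotChart (S.lam t).1).symm z))
    (ball (cotChart (S.lam t).1 (S.lam t)) R) C
  diffQ : ∀ z ∈ ball (cotChart (S.lam t).1 (S.lam t)) R,
    DifferentiableAt ℝ (fun z => S.Q ((cotChart (S.lam t).1).symm z)) z ∧
    ‖fderiv ℝ (fun z => S.Q ((cotChart (S.lam t).1).symm z)) z‖ ≤ C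
  tilde : t ∈ Icc S.τ₂ S.T → TildeHLocal S.h₂ S.h₃ S.θ S.Os (S.lam t).1
    (ball (cotChart (S.lam t).1 (S.lam t)) R) C
  sing : t ∈ Icc S.τ₂ S.T → ∀ w : ℝ, |w| ≤ 1 →
    NiceHam (fun z => S.tH ((cotChart (S.lam t).1).symm z) + w * S.F₁ ((cotChart (S.lam t).1).symm z))
      (ball (cotChart (S.lam t).1 (S.lam t)) R) C

variable {S}

theorem NiceBall.mono {t R R' C : ℝ} (h : S.NiceBall t R C) (hR : 0 < R') (hRR : R' ≤ R) :
    S.NiceBall t R' C where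
  pos := hR
  nonneg := h.nonneg
  sub := (ball_subset_ball hRR).trans h.sub
  niceX i := (h.niceX i).mono (ball_subset_ball hRR) le_rfl
  niceF := h.niceF.mono (ball_subset_ball hRR) le_rfl
  diffQ z hz := h.diffQ z (ball_subset_ball hRR hz)
  tilde ht := (h.tilde ht).mono (ball_subset_ball hRR) le_rfl
  sing ht w hw := (h.sing ht w hw).mono (ball_subset_ball hRR) le_rfl

theorem NiceBall.nice₁ {t R C : ℝ} (h : S.NiceBall t R C) :
    NiceHam (fun z => S.H₁ ((cotChart (S.lam t).1).symm z))
      (ball (cotChart (S.lam t).1 (S.lam t)) R) C := by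
  obtain ⟨i, hi⟩ := S.hh₁
  have := h.niceX i
  rwa [← hi] at this

theorem NiceBall.nice₂ {t R C : ℝ} (h : S.NiceBall t R C) :
    NiceHam (fun z => S.H₂ ((cotChart (S.lam t).1).symm z))
      (ball (cotChart (S.lam t).1 (S.lam t)) R) C := by
  obtain ⟨i, hi⟩ := S.hh₂
  have := h.niceX i
  rwa [← hi] at this

variable (S) [T2Space M]

theorem exists_niceBall (t : ℝ) : ∃ R C, S.NiceBall t R C := by
  have hX : ∀ i, ∃ R > 0, ∃ C ≥ 0, NiceHam (fun z => lift (S.X i) ((cotChart (S.lam t).1).symm z))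
      (ball (cotChart (S.lam t).1 (S.lam t)) R) C := fun i => niceAt_lift (S.hX i) _
  choose RX hRX CX hCX hX using hX
  obtain ⟨RF, hRF, CF, hCF, hF⟩ := niceAt_lift S.smoothF (S.lam t)
  have hT : ∃ R > 0, ∃ C ≥ 0, t ∈ Icc S.τ₂ S.T → TildeHLocal S.h₂ S.h₃ S.θ S.Os (S.lam t).1
      (ball (cotChart (S.lam t).1 (S.lam t)) R) C := by
    by_cases ht : t ∈ Icc S.τ₂ S.T
    · obtain ⟨R, hR, C, hC, h⟩ := S.exists_tildeH ht
      exact ⟨R, hR, C, hC, fun _ => h⟩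
    · exact ⟨1, one_pos, 0, le_rfl, fun h => absurd h ht⟩
  obtain ⟨RT, hRT, CT, hCT, hT⟩ := hT
  obtain ⟨RQ, hRQ, CQ, hCQ, hQ, -⟩ := exists_ball_fderiv_bounds ((S.cotSmoothQ.contDiffAt
    ((cotChart (S.lam t).1).map_source (mem_cotChart_source (S.lam t)))).of_le two_le_infty)
  obtain ⟨R₀, hR₀, hsub⟩ := Metric.mem_nhds_iff.1 ((isOpen_cotChart_target (E := E) (S.lam t).1).mem_nhds
    ((cotChart (S.lam t).1).map_source (mem_cotChart_source (S.lam t))))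
  have hfin : ∃ R > 0, ∀ i, R ≤ RX i := by
    obtain ⟨i, -⟩ := S.hh₁
    have hne : (Finset.univ : Finset (Fin S.m)).Nonempty := ⟨i, Finset.mem_univ _⟩
    exact ⟨Finset.univ.inf' hne RX, (Finset.lt_inf'_iff _).2 fun j _ => hRX j,
      fun j => Finset.inf'_le _ (Finset.mem_univ j)⟩
  obtain ⟨RXm, hRXm, hRXle⟩ := hfin
  set R := min (min RXm RF) (min (min RT RQ) R₀) with hR
  have r1 : R ≤ RXm := (min_le_left _ _).trans (min_le_left _ _)
  have r2 : R ≤ RF := (min_le_left _ _).trans (min_le_right _ _)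
  have r3 : R ≤ RT := ((min_le_right _ _).trans (min_le_left _ _)).trans (min_le_left _ _)
  have r5 : R ≤ RQ := ((min_le_right _ _).trans (min_le_left _ _)).trans (min_le_right _ _)
  have r4 : R ≤ R₀ := (min_le_right _ _).trans (min_le_right _ _)
  have hs0 : 0 ≤ ∑ i, CX i := Finset.sum_nonneg fun i _ => hCX i
  refine ⟨R, ∑ i, CX i + (CT + CF) + CQ, by positivity, by positivity,
    (ball_subset_ball r4).trans hsub,
    fun i => (hX i).mono (ball_subset_ball (r1.trans (hRXle i))) ?_,
    hF.mono (ball_subset_ball r2) (by linarith),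
    fun z hz => ⟨(hQ z (ball_subset_ball r5 hz)).1,
      (hQ z (ball_subset_ball r5 hz)).2.2.trans (by linarith)⟩,
    fun ht => (hT ht).mono (ball_subset_ball r3) (by linarith), fun ht w hw => ?_⟩
  · have := Finset.single_le_sum (fun i _ => hCX i) (Finset.mem_univ i)
    linarith
  · exact (((hT ht).nice.mono (ball_subset_ball r3) le_rfl).add_smul
      (hF.mono (ball_subset_ball r2) le_rfl) hw).mono le_rfl (by linarith)

theorem υ_abs : ∀ᵐ t ∂volume.restrict (Icc S.τ₂ S.T), |S.υ t| ≤ 1 :=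
  S.hυ.mono fun t ht => abs_le.2 ⟨by linarith [ht.1], ht.2.le⟩

theorem lam_bang : FollowsHam (fun t => if S.τ₁ ≤ t then S.H₂ else S.H₁) S.lam 0 S.τ₂ := by
  have h : FollowsHam (fun t => lift (refField S.h₁ S.h₂ S.h₃ S.τ₁ S.τ₂ S.υ t)) S.lam 0 S.T :=
    S.hPMP.adjoint.followsHam
  refine (h.mono le_rfl S.hτ₂.le).congr ?_
  filter_upwards [ae_mem_Ioo 0 S.τ₂] with t ht
  split_ifs with h1
  · have : refField S.h₁ S.h₂ S.h₃ S.τ₁ S.τ₂ S.υ t = S.h₂ := by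
      funext x; rw [refField, if_neg (not_lt.2 h1), if_pos ht.2]
    rw [this]
  · have : refField S.h₁ S.h₂ S.h₃ S.τ₁ S.τ₂ S.υ t = S.h₁ := by
      funext x; rw [refField, if_pos (not_le.1 h1)]
    rw [this]

theorem η₀_mem : S.η₀ ∈ S.N₀ := mem_of_mem_nhds S.N₀_mem

theorem W_η₀_singular : ∀ t ∈ Icc S.τ₂ S.T, S.W t S.η₀ = S.lam t := by
  have h := S.lam_singular.eqOn (S.W_singular S.η₀_mem) (fun t₀ ht₀ => ?_)
    (right_mem_Icc.2 S.hτ₂.le) S.W_T_η₀.symm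
  · exact fun t ht => (h ht).symm
  · obtain ⟨R, C, hb⟩ := S.exists_niceBall t₀
    refine ⟨R, hb.pos, C, hb.nonneg, 1, one_pos, ?_⟩
    filter_upwards [S.υ_abs] with t ht _
    exact hb.sing ht₀ _ ht

theorem σ₂_η₀ : S.σ₂ S.η₀ = S.τ₂ := by
  have hm : S.τ₂ ∈ Icc S.τ₂ S.T := left_mem_Icc.2 S.hτ₂.le
  rw [σ₂, S.W_η₀_singular _ hm, switch₂, S.hsw.eq_t₂ _ S.hsw.mem (S.Q_lam _ hm), min_self]

theorem σ₁_η₀ : S.σ₁ S.η₀ = S.τ₁ := by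
  rw [σ₁, S.W_η₀_singular _ (left_mem_Icc.2 S.hτ₂.le), S.hsw.eq_s₁]

/-- The overmaximised flow extends the reference extremal. -/
theorem W_η₀ : ∀ t ∈ Icc 0 S.T, S.W t S.η₀ = S.lam t := by
  have h1 : FollowsHam (fun t => if S.τ₁ ≤ t then S.H₂ else S.H₁) (fun t => S.W t S.η₀) 0 S.τ₂ := by
    refine ((S.W_follows S.η₀_mem).mono le_rfl S.hτ₂.le).congr ?_
    filter_upwards [ae_mem_Ioo 0 S.τ₂] with t ht
    funext ℓ
    rw [mode, if_neg (not_le.2 ht.2), σ₂_η₀, if_neg (not_le.2 ht.2), σ₁_η₀]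
    split_ifs <;> rfl
  have h2 := S.lam_bang.eqOn h1 (fun t₀ ht₀ => ?_) (right_mem_Icc.2 S.τ₂_pos.le)
    (S.W_η₀_singular _ (left_mem_Icc.2 S.hτ₂.le)).symm
  · intro t ht
    rcases le_total t S.τ₂ with h | h
    · exact (h2 ⟨ht.1, h⟩).symm
    · exact S.W_η₀_singular t ⟨h, ht.2⟩
  · obtain ⟨R, C, hb⟩ := S.exists_niceBall t₀
    refine ⟨R, hb.pos, C, hb.nonneg, 1, one_pos, ae_of_all _ fun t _ => ?_⟩
    by_cases h : S.τ₁ ≤ t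
    · simp only [if_pos h]; exact hb.nice₂
    · simp only [if_neg h]; exact hb.nice₁

end Extremal

end

section

variable {E : Type*} [NormedAddCommGroup E] [NormedSpace ℝ E] [FiniteDimensional ℝ E]

/-- A function whose derivative along a Hamiltonian curve is bounded below. -/
theorem HamCurve.mul_sub_le_comp {h : ℝ → E × (E →L[ℝ] ℝ) → ℝ} {z : ℝ → E × (E →L[ℝ] ℝ)}
    {K : E × (E →L[ℝ] ℝ) → ℝ} {a b C CK κ : ℝ} {D : Set (E × (E →L[ℝ] ℝ))}
    (H : HamCurve h z a b C) (hab : a ≤ b) (hD : Convex ℝ D) (hz : ∀ t ∈ Icc a b, z t ∈ D)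
    (hK : ∀ z ∈ D, DifferentiableAt ℝ K z ∧ ‖fderiv ℝ K z‖ ≤ CK)
    (hκ : ∀ᵐ t ∂volume.restrict (Icc a b),
      κ ≤ fderiv ℝ K (z t) (symGrad (fderiv ℝ (h t) (z t)))) :
    κ * (b - a) ≤ K (z b) - K (z a) := by
  have hCK : 0 ≤ CK := (norm_nonneg _).trans (hK _ (hz a ⟨le_rfl, hab⟩)).2
  have hac : AbsolutelyContinuousOnInterval (fun t => -K (z t)) a b := by
    refine absolutelyContinuous_of_norm_sub_le (C := CK * C) hab fun s hs t ht => ?_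
    have h1 := hD.norm_image_sub_le_of_norm_fderiv_le (fun w hw => (hK w hw).1)
      (fun w hw => (hK w hw).2) (hz s hs) (hz t ht)
    rw [neg_sub_neg, mul_assoc]
    refine h1.trans (mul_le_mul_of_nonneg_left ?_ hCK)
    rw [norm_sub_rev]
    exact H.lip s hs t ht
  have h1 := sub_le_of_ac (C := -κ) hab hac ?_
  · linarith
  filter_upwards [H.deriv, hκ, ae_restrict_mem measurableSet_Icc] with t h1 h2 ht
  have h3 := ((hK _ (hz t ht)).1.hasFDerivAt.comp_hasDerivAt t h1).neg
  exact ⟨_, h3, neg_le_neg h2⟩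

variable {M : Type*} [TopologicalSpace M] [ChartedSpace E M] [IsManifold 𝓘(ℝ, E) ∞ M]

namespace Extremal

variable (S : Extremal E M)

/-- The flow at time `t` satisfies the estimates `EstAt` near the reference point. -/
def Good (t : ℝ) : Prop :=
  ∃ N ∈ 𝓝 S.η₀, N ⊆ S.N₀ ∧ ∃ C ≥ 0, EstAt (S.lam t).1 (S.W t) S.cf N C ∧
    (S.τ₂ ≤ t → ∀ η ∈ N, S.F₁ (S.W t η) = 0)

/-- Uniform estimates for the flow on the time interval `[a, b]`, in the chart at `lam t₀`. -/
structure LocalEst (t₀ a b R : ℝ) (N : Set E) (C : ℝ) : Prop where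
  mem : ∀ η ∈ N, ∀ t ∈ Icc a b, cotChart (S.lam t₀).1 (S.W t η) ∈
    ball (cotChart (S.lam t₀).1 (S.lam t₀)) R
  est : ∀ t ∈ Icc a b, EstAt (S.lam t₀).1 (S.W t) S.cf N C
  lip : ∀ η ∈ N, ∀ s ∈ Icc a b, ∀ t ∈ Icc a b,
    ‖cotChart (S.lam t₀).1 (S.W s η) - cotChart (S.lam t₀).1 (S.W t η)‖ ≤ C * |s - t|
  energy : ∀ i, ∀ η ∈ N, ∀ t ∈ Icc a b, ∀ s ∈ Icc a b, t ≤ s →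
    lift (S.X i) (S.W t η) * (s - t) ≤ (cotChart (S.lam t₀).1 (S.W t η)).2
      ((cotChart (S.lam t₀).1 (S.W s η)).1 - (cotChart (S.lam t₀).1 (S.W t η)).1) +
      C * (s - t) ^ 2
  F₁_eq_zero : ∀ η ∈ N, ∀ t ∈ Icc a b, S.τ₂ ≤ t → S.F₁ (S.W t η) = 0

variable {S}

theorem LocalEst.nonneg {t₀ a b R C : ℝ} {N : Set E} (h : S.LocalEst t₀ a b R N C) (hab : a < b)
    (hN : N.Nonempty) : 0 ≤ C := by
  obtain ⟨η, hη⟩ := hN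
  have h1 := (norm_nonneg _).trans (h.lip η hη b ⟨hab.le, le_rfl⟩ a ⟨le_rfl, hab.le⟩)
  exact nonneg_of_mul_nonneg_left h1 (by rw [abs_pos]; linarith)

theorem NiceBall.nice_mode {t₀ R C a b : ℝ} {η : E} (hb : S.NiceBall t₀ R C) (hbT : b ≤ S.T)
    (hη : η ∈ S.N₀) (h : t₀ ∈ Icc S.τ₂ S.T ∨ b < S.σ₂ η) :
    ∀ᵐ t ∂volume.restrict (Icc a b), NiceHam (fun z => S.mode η t ((cotChart (S.lam t₀).1).symm z))
      (ball (cotChart (S.lam t₀).1 (S.lam t₀)) R) C := by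
  have h1 : ∀ᵐ t, t ∈ Icc S.τ₂ S.T → S.υ t ∈ Ioo 0 1 :=
    (ae_restrict_iff' measurableSet_Icc).1 S.hυ
  filter_upwards [ae_restrict_of_ae h1, ae_restrict_mem measurableSet_Icc] with t hu ht
  have ho := (S.order hη).2.2
  rcases h with h | h
  · by_cases h2 : S.τ₂ ≤ t
    · have hu' := hu ⟨h2, ht.2.trans hbT⟩
      simp only [mode, if_pos h2]
      exact hb.sing h _ (abs_le.2 ⟨by linarith [hu'.1], hu'.2.le⟩)
    · simp only [mode, if_neg h2]
      split_ifs
      · exact (hb.tilde h).nice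
      · exact hb.nice₂
      · exact hb.nice₁
  · have h2 : t < S.σ₂ η := ht.2.trans_lt h
    simp only [mode, if_neg (not_le.2 (h2.trans_le ho)), if_neg (not_le.2 h2)]
    split_ifs
    · exact hb.nice₂
    · exact hb.nice₁

/-- The estimates follow from the transport lemma and the maximality of the governing
Hamiltonian. -/
theorem NiceBall.localEst {t₀ R C C₁ K a b : ℝ} {N : Set E} {A B : ℝ → Cotangent E M → ℝ}
    {σ : E → ℝ} (hball : S.NiceBall t₀ R C) (ha : 0 ≤ a) (hab : a ≤ b) (hbT : b ≤ S.T)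
    (hCab : C * (b - a) ≤ 1 / 2) (hN : N ⊆ S.N₀)
    (hmem : ∀ η ∈ N, ∀ t ∈ Icc a b, S.W t η ∈ (cotChart (S.lam t₀).1).source ∧
      cotChart (S.lam t₀).1 (S.W t η) ∈ ball (cotChart (S.lam t₀).1 (S.lam t₀)) R)
    (hmode : ∀ η ∈ N, ∀ᵐ t ∂volume.restrict (Icc a b),
      S.mode η t = if σ η ≤ t then A t else B t)
    (hnm : ∀ η ∈ N, t₀ ∈ Icc S.τ₂ S.T ∨ b < S.σ₂ η)
    (hA : ∀ᵐ t ∂volume.restrict (Icc a b),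
      NiceHam (fun z => A t ((cotChart (S.lam t₀).1).symm z))
        (ball (cotChart (S.lam t₀).1 (S.lam t₀)) R) C)
    (hB : ∀ᵐ t ∂volume.restrict (Icc a b),
      NiceHam (fun z => B t ((cotChart (S.lam t₀).1).symm z))
        (ball (cotChart (S.lam t₀).1 (S.lam t₀)) R) C)
    (hC₁ : 0 ≤ C₁) (hK : 0 ≤ K)
    (hσ : ∀ η ∈ N, ∀ η' ∈ N, |σ η' - σ η| ≤ K * ‖η' - η‖)
    (hgap : ∀ η ∈ N, ∀ η' ∈ N, ∀ᵐ t ∂volume.restrict (Icc a b),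
      t ∈ Icc (min (σ η) (σ η')) (max (σ η) (σ η')) →
        |A t (S.W t η) - B t (S.W t η)| ≤ K * ‖η' - η‖)
    (hb : EstAt (S.lam t₀).1 (S.W b) S.cf N C₁)
    (hF : ∀ η ∈ N, ∀ t ∈ Icc a b, S.τ₂ ≤ t → S.F₁ (S.W t η) = 0)
    (hover : ∀ i, ∀ η ∈ N, ∀ᵐ t ∂volume.restrict (Icc a b),
      lift (S.X i) (S.W t η) ≤ S.mode η t (S.W t η)) :
    ∃ C', S.LocalEst t₀ a b R N C' := by
  set x := (S.lam t₀).1 with hx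
  set z₀ := cotChart x (S.lam t₀)
  have hC := hball.nonneg
  have hR := hball.pos
  have hfol : ∀ η ∈ N, FollowsHam (S.mode η) (fun t => S.W t η) a b := fun η hη =>
    (S.W_follows (hN hη)).mono ha hbT
  have hnice : ∀ η ∈ N, ∀ᵐ t ∂volume.restrict (Icc a b),
      NiceHam (fun z => S.mode η t ((cotChart x).symm z)) (ball z₀ R) C := fun η hη =>
    hball.nice_mode hbT (hN hη) (hnm η hη)
  have hcurve : ∀ η ∈ N, HamCurve (fun t z => S.mode η t ((cotChart x).symm z))
      (fun t => cotChart x (S.W t η)) a b C := fun η hη =>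
    (hfol η hη).2 x a b _ C le_rfl hab le_rfl (hmem η hη) (hnice η hη)
  obtain ⟨C', hC', hest⟩ := EstAt.transport (R := ‖z₀‖ + R) hab (convex_ball z₀ R)
    (fun z hz => by
      have h1 : ‖z - z₀‖ < R := by rw [← dist_eq_norm]; exact hz
      have h2 := norm_sub_norm_le z z₀
      linarith) hmem
    (fun η hη => (hfol η hη).congr (hmode η hη)) hA hB hC hC₁ hK (by positivity) hCab hσ hgap hb
  set CC := max (max C' C) (C * C + C * C)
  refine ⟨CC, fun η hη t ht => (hmem η hη t ht).2, fun t ht => (hest t ht).mono le_rfl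
    ((le_max_left _ _).trans (le_max_left _ _)), fun η hη s hs t ht =>
    ((hcurve η hη).lip s hs t ht).trans
      (by gcongr; exact (le_max_right _ _).trans (le_max_left _ _)),
    fun i η hη t ht s hs hts => ?_, hF⟩
  have hsq : (C * C + C * C) * (s - t) ^ 2 ≤ CC * (s - t) ^ 2 := by
    gcongr; exact le_max_right _ _
  refine (((hcurve η hη).mono ht.1 hs.2).energy_le (D := ball z₀ R)
    (fun r hr => (hmem η hη r ⟨ht.1.trans hr.1, hr.2.trans hs.2⟩).2)
    (ae_restrict_Icc_mono (hnice η hη) ht.1 hs.2) hC hts ?_).trans (by gcongr)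
  filter_upwards [ae_restrict_Icc_mono (hover i η hη) ht.1 hs.2,
    ae_restrict_mem measurableSet_Icc] with r h1 hr
  have hrI : r ∈ Icc a b := ⟨ht.1.trans hr.1, hr.2.trans hs.2⟩
  rw [(cotChart x).left_inv (hmem η hη r hrI).1]
  have h2 := (hball.niceX i).lipschitz (convex_ball z₀ R) (hmem η hη r hrI).2 (hmem η hη t ht).2
  rw [(cotChart x).left_inv (hmem η hη r hrI).1, (cotChart x).left_inv (hmem η hη t ht).1] at h2
  have h3 := (hcurve η hη).lip t ht r hrI
  have h4 : |t - r| ≤ s - t := by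
    rw [abs_of_nonpos (by linarith [hr.1])]; linarith [hr.2]
  have h5 : C * ‖cotChart x (S.W t η) - cotChart x (S.W r η)‖ ≤ C * (C * (s - t)) := by
    gcongr
    exact h3.trans (by gcongr)
  have h6 := le_abs_self (lift (S.X i) (S.W t η) - lift (S.X i) (S.W r η))
  linarith

theorem LocalEst.good {t₀ a b R C t : ℝ} {N : Set E} [T2Space M] (h : S.LocalEst t₀ a b R N C)
    (hN : N ∈ 𝓝 S.η₀) (hN' : N ⊆ S.N₀) (hC : 0 ≤ C) (ha : 0 ≤ a) (hb : b ≤ S.T)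
    (ht : t ∈ Icc a b) : S.Good t := by
  obtain ⟨N', hN'n, hNN, C', hC', hest⟩ := (h.est t ht).change_chart hN hC (y := (S.lam t).1) (by
    rw [S.W_η₀ t ⟨ha.trans ht.1, ht.2.trans hb⟩]; exact mem_cotChart_source _)
  exact ⟨N', hN'n, hNN.trans hN', C', hC', hest, fun hτ η hη => h.F₁_eq_zero η (hNN hη) t ht hτ⟩

variable (S)

theorem good_T : S.Good S.T := by
  obtain ⟨N, hN, hN₀, C, hC, h⟩ := S.estAt_T
  exact ⟨N, hN, hN₀, C, hC, h, fun _ η hη => S.F₁_W_T (hN₀ hη)⟩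

variable {S}

theorem Good.continuousAt {t : ℝ} (h : S.Good t) :
    ContinuousAt (fun η => cotChart (S.lam t).1 (S.W t η)) S.η₀ := by
  obtain ⟨N, hN, -, C, -, h, -⟩ := h
  exact h.continuousAt hN

theorem Good.continuousAt_W [T2Space M] {t : ℝ} (h : S.Good t) (ht : t ∈ Icc 0 S.T) :
    ContinuousAt (S.W t) S.η₀ := by
  have hc := h.continuousAt
  obtain ⟨N, hN, -, C, -, h, -⟩ := h
  have hs : S.W t S.η₀ ∈ (cotChart (S.lam t).1).source := (h S.η₀ (mem_of_mem_nhds hN)).1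
  have h1 := ((continuousOn_cotChart_symm (S.lam t).1).continuousAt
    ((isOpen_cotChart_target (S.lam t).1).mem_nhds ((cotChart (S.lam t).1).map_source hs))).comp
      (f := fun η => cotChart (S.lam t).1 (S.W t η)) hc
  refine h1.congr ?_
  filter_upwards [hN] with η hη
  exact (cotChart (S.lam t).1).left_inv (h η hη).1

theorem Good.continuousAt_σ₂ [T2Space M] (h : S.Good S.τ₂) : ContinuousAt S.σ₂ S.η₀ := by
  have hτ : S.τ₂ ∈ Icc 0 S.T := ⟨S.τ₂_pos.le, S.hτ₂.le⟩
  have h1 : ContinuousAt S.t₂ (S.W S.τ₂ S.η₀) := by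
    rw [S.W_η₀ _ hτ]
    exact S.hsw.smooth_t₂.continuousOn.continuousAt (S.hsw.isOpen.mem_nhds S.hsw.mem)
  exact (h1.comp (h.continuousAt_W hτ)).min continuousAt_const

theorem Good.continuousAt_σ₁ [T2Space M] (h : S.Good S.τ₂) : ContinuousAt S.σ₁ S.η₀ := by
  have hτ : S.τ₂ ∈ Icc 0 S.T := ⟨S.τ₂_pos.le, S.hτ₂.le⟩
  have h1 : ContinuousAt S.s₁ (S.W S.τ₂ S.η₀) := by
    rw [S.W_η₀ _ hτ]
    exact S.hsw.continuous_s₁.continuousAt (S.hsw.isOpen.mem_nhds S.hsw.mem)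
  exact h1.comp (h.continuousAt_W hτ)

variable (S) [T2Space M]

/-- Near each point of the reference extremal, the flow stays in a small coordinate ball for a
short time. -/
theorem exists_frame {t₀ : ℝ} (ht₀ : t₀ ∈ Icc 0 S.T) {U : Set (E × (E →L[ℝ] ℝ))}
    (hU : U ∈ 𝓝 (cotChart (S.lam t₀).1 (S.lam t₀))) {ε₀ : ℝ} (hε₀ : 0 < ε₀) :
    ∃ R C ε, S.NiceBall t₀ (3 * R) C ∧ 0 < ε ∧ ε ≤ ε₀ ∧ C * (2 * ε) ≤ R ∧ C * (2 * ε) ≤ 1 / 2 ∧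
      ball (cotChart (S.lam t₀).1 (S.lam t₀)) (3 * R) ⊆ U ∧
      ∀ a b, t₀ - ε ≤ a → 0 ≤ a → a ≤ b → b ≤ S.T → t₀ ≤ b → b ≤ t₀ + ε → S.Good b →
        (t₀ < S.τ₂ → ∀ᶠ η in 𝓝 S.η₀, b < S.σ₂ η) →
        ∃ N ∈ 𝓝 S.η₀, N ⊆ S.N₀ ∧ (∃ C₁ ≥ 0, EstAt (S.lam t₀).1 (S.W b) S.cf N C₁) ∧
          (S.τ₂ ≤ b → ∀ η ∈ N, S.F₁ (S.W b η) = 0) ∧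
          (∀ η ∈ N, t₀ ∈ Icc S.τ₂ S.T ∨ b < S.σ₂ η) ∧
          ∀ η ∈ N, ∀ t ∈ Icc a b, S.W t η ∈ (cotChart (S.lam t₀).1).source ∧
            cotChart (S.lam t₀).1 (S.W t η) ∈
              closedBall (cotChart (S.lam t₀).1 (S.lam t₀)) (2 * R) := by
  set x := (S.lam t₀).1 with hx
  set z₀ := cotChart x (S.lam t₀)
  obtain ⟨R₁, C, hb⟩ := S.exists_niceBall t₀
  obtain ⟨R₂, hR₂, hR₂U⟩ := Metric.mem_nhds_iff.1 hU
  set R := min R₁ R₂ / 3 with hR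
  have hR0 : 0 < R := by have := hb.pos; positivity
  have h3R : 3 * R = min R₁ R₂ := by rw [hR]; ring
  have hC := hb.nonneg
  have hVo : IsOpen ((cotChart x).source ∩ cotChart x ⁻¹' ball z₀ R) :=
    (continuousOn_cotChart x).isOpen_inter_preimage (isOpen_cotChart_source x) isOpen_ball
  have hev := S.continuousOn_lam t₀ ht₀ (hVo.mem_nhds ⟨mem_cotChart_source _,
    mem_ball_self hR0⟩)
  obtain ⟨δ, hδ, hδs⟩ := mem_nhdsWithin_iff.1 hev
  set ε := min (min (δ / 2) ε₀) (min (R / (2 * (C + 1))) (1 / (4 * (C + 1))))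
  have hε0 : 0 < ε := by positivity
  have e1 : ε ≤ δ / 2 := (min_le_left _ _).trans (min_le_left _ _)
  have e2 : ε ≤ ε₀ := (min_le_left _ _).trans (min_le_right _ _)
  have e3 : C * (2 * ε) ≤ R := by
    have h1 : ε ≤ R / (2 * (C + 1)) := (min_le_right _ _).trans (min_le_left _ _)
    have h2 : C * (2 * ε) ≤ (C + 1) * (2 * (R / (2 * (C + 1)))) := by gcongr; linarith
    refine h2.trans (le_of_eq ?_)
    field_simp
  have e4 : C * (2 * ε) ≤ 1 / 2 := by
    have h1 : ε ≤ 1 / (4 * (C + 1)) := (min_le_right _ _).trans (min_le_right _ _)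
    have h2 : C * (2 * ε) ≤ (C + 1) * (2 * (1 / (4 * (C + 1)))) := by gcongr; linarith
    refine h2.trans (le_of_eq ?_)
    field_simp
    norm_num
  have hball : S.NiceBall t₀ (3 * R) C := hb.mono (by positivity) (h3R ▸ min_le_left _ _)
  refine ⟨R, C, ε, hball, hε0, e2, e3, e4,
    (ball_subset_ball (h3R ▸ min_le_right _ _)).trans hR₂U,
    fun a b hεa ha hab hbT htb hbε hgood hσ => ?_⟩
  have hbI : b ∈ Icc 0 S.T := ⟨ha.trans hab, hbT⟩
  have hlamb : S.lam b ∈ (cotChart x).source ∩ cotChart x ⁻¹' ball z₀ R := by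
    refine hδs ⟨?_, hbI⟩
    rw [mem_ball, Real.dist_eq, abs_of_nonneg (by linarith)]
    linarith
  obtain ⟨N, hN, hN₀, C₁, hC₁, hest, hF⟩ := hgood
  obtain ⟨N', hN'n, hN'N, C₂, hC₂, hest'⟩ := hest.change_chart hN hC₁ (y := x)
    (by rw [S.W_η₀ b hbI]; exact hlamb.1)
  have hmode : ∀ᶠ η in 𝓝 S.η₀, t₀ ∈ Icc S.τ₂ S.T ∨ b < S.σ₂ η := by
    rcases lt_or_ge t₀ S.τ₂ with h | h
    · exact (hσ h).mono fun η hη => Or.inr hη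
    · exact Eventually.of_forall fun η => Or.inl ⟨h, ht₀.2⟩
  set N₁ := N' ∩ {η | t₀ ∈ Icc S.τ₂ S.T ∨ b < S.σ₂ η}
  have hN₁n : N₁ ∈ 𝓝 S.η₀ := inter_mem hN'n hmode
  have hN₁₀ : N₁ ⊆ S.N₀ := fun η hη => hN₀ (hN'N hη.1)
  obtain ⟨N₂, hN₂n, hN₂s, hstay⟩ := EstAt.exists_stay (R := R) (C := C) (x := x) (z₀ := z₀)
    (h := S.mode) hab hR0 hball.sub (hest'.mono inter_subset_left le_rfl) hN₁n
    (fun η hη => (S.W_follows (hN₁₀ hη)).mono ha hbT)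
    (fun η hη => hball.nice_mode hbT (hN₁₀ hη) hη.2) hC
    (le_trans (by gcongr; linarith) e3) (by rw [S.W_η₀ b hbI]; exact hlamb.2)
  exact ⟨N₂, hN₂n, hN₂s.trans hN₁₀, ⟨C₂, hC₂, hest'.mono (fun η hη => (hN₂s hη).1) le_rfl⟩,
    fun h η hη => hF h η (hN'N (hN₂s hη).1), fun η hη => (hN₂s hη).2, hstay⟩

end Extremal

end

section

variable {E : Type*} [NormedAddCommGroup E] [NormedSpace ℝ E] [FiniteDimensional ℝ E]

theorem apply_symGrad_swap (L L' : E × (E →L[ℝ] ℝ) →L[ℝ] ℝ) :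
    L (symGrad L') = -L' (symGrad L) := by
  rw [← sform_symGrad L, ← sform_symGrad L', sform, sform]
  ring

variable {M : Type*} [TopologicalSpace M] [ChartedSpace E M] [IsManifold 𝓘(ℝ, E) ∞ M]

theorem eventually_symm_lt {F G : Cotangent E M → ℝ} (hF : Continuous F) (hG : Continuous G)
    {ℓ : Cotangent E M} (h : F ℓ < G ℓ) : ∀ᶠ z in 𝓝 (cotChart ℓ.1 ℓ),
      F ((cotChart ℓ.1).symm z) < G ((cotChart ℓ.1).symm z) := by
  have hs := mem_cotChart_source ℓ
  have hc : ContinuousAt (cotChart ℓ.1).symm (cotChart ℓ.1 ℓ) :=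
    (continuousOn_cotChart_symm ℓ.1).continuousAt
      ((isOpen_cotChart_target ℓ.1).mem_nhds ((cotChart ℓ.1).map_source hs))
  refine (hF.continuousAt.comp hc).eventually_lt (hG.continuousAt.comp hc) ?_
  simpa [(cotChart ℓ.1).left_inv hs] using h

theorem lift_add_smul_sub (h k : (x : M) → TangentSpace 𝓘(ℝ, E) x) (s : ℝ) (ℓ : Cotangent E M) :
    lift (fun x => h x + s • (k x - h x)) ℓ = lift h ℓ + s * (lift k ℓ - lift h ℓ) := by
  refine (map_add (show TangentSpace 𝓘(ℝ, E) ℓ.1 →L[ℝ] ℝ from ℓ.2) _ _).trans ?_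
  congr 1
  refine (map_smul (show TangentSpace 𝓘(ℝ, E) ℓ.1 →L[ℝ] ℝ from ℓ.2) s _).trans ?_
  rw [smul_eq_mul]
  congr 1
  exact map_sub (show TangentSpace 𝓘(ℝ, E) ℓ.1 →L[ℝ] ℝ from ℓ.2) _ _

namespace Extremal

variable (S : Extremal E M)

theorem eventually_edge {h k : (x : M) → TangentSpace 𝓘(ℝ, E) x} (hh : SmoothField h)
    {ℓ : Cotangent E M} (hℓ : OnlyEdgeMaximises S.X h k ℓ) : ∀ᶠ z in 𝓝 (cotChart ℓ.1 ℓ), ∀ i,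
      (∃ s ∈ Icc (0 : ℝ) 1, S.X i = fun x => h x + s • (k x - h x)) ∨
      lift (S.X i) ((cotChart ℓ.1).symm z) < lift h ((cotChart ℓ.1).symm z) := by
  rw [eventually_all]
  intro i
  by_cases hi : ∃ s ∈ Icc (0 : ℝ) 1, S.X i = fun x => h x + s • (k x - h x)
  · exact Eventually.of_forall fun _ => Or.inl hi
  · have h1 := hℓ (Pi.single i 1) (single_mem_stdSimplex ℝ i)
      (fun s hs he => hi ⟨s, hs, (S.single_mem i).trans he⟩) 0 ⟨le_rfl, zero_le_one⟩
    rw [← S.single_mem i, zero_mul, add_zero] at h1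
    exact (eventually_symm_lt (cotSmooth_lift (S.hX i)).continuousOn
      (cotSmooth_lift hh).continuousOn h1).mono fun _ h => Or.inr h

variable {S}

theorem fderiv_F₁_tH {t₀ R C w : ℝ} (hb : S.NiceBall t₀ R C) (ht₀ : t₀ ∈ Icc S.τ₂ S.T)
    {z : E × (E →L[ℝ] ℝ)} (hz : z ∈ ball (cotChart (S.lam t₀).1 (S.lam t₀)) R) :
    fderiv ℝ (fun z => S.F₁ ((cotChart (S.lam t₀).1).symm z)) z (symGrad (fderiv ℝ
      (fun z => S.tH ((cotChart (S.lam t₀).1).symm z) +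
        w * S.F₁ ((cotChart (S.lam t₀).1).symm z)) z)) = 0 := by
  have h1 : fderiv ℝ (fun z => S.tH ((cotChart (S.lam t₀).1).symm z) +
        w * S.F₁ ((cotChart (S.lam t₀).1).symm z)) z =
      fderiv ℝ (fun z => S.tH ((cotChart (S.lam t₀).1).symm z)) z +
        w • fderiv ℝ (fun z => S.F₁ ((cotChart (S.lam t₀).1).symm z)) z :=
    (((hb.tilde ht₀).nice.diff z hz).hasFDerivAt.add
      ((hb.niceF.diff z hz).hasFDerivAt.const_mul w)).fderiv
  have h2 := (hb.tilde ht₀).bracket z hz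
  have h3 := apply_symGrad_swap (fderiv ℝ (fun z => S.F₁ ((cotChart (S.lam t₀).1).symm z)) z)
    (fderiv ℝ (fun z => S.F₁ ((cotChart (S.lam t₀).1).symm z)) z)
  have h4 := apply_symGrad_swap (fderiv ℝ (fun z => S.F₁ ((cotChart (S.lam t₀).1).symm z)) z)
    (fderiv ℝ (fun z => S.tH ((cotChart (S.lam t₀).1).symm z)) z)
  rw [h2, neg_zero] at h4
  rw [h1, symGrad_add, symGrad_smul, map_add, map_smul, h4, zero_add, smul_eq_mul]
  have h5 : fderiv ℝ (fun z => S.F₁ ((cotChart (S.lam t₀).1).symm z)) z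
    (symGrad (fderiv ℝ (fun z => S.F₁ ((cotChart (S.lam t₀).1).symm z)) z)) = 0 := by linarith
  rw [h5, mul_zero]

theorem F₁_eq_of_follows {t₀ R C a b : ℝ} {γ : ℝ → Cotangent E M} {h : ℝ → Cotangent E M → ℝ}
    (hb : S.NiceBall t₀ R C) (ht₀ : t₀ ∈ Icc S.τ₂ S.T) (hγ : FollowsHam h γ a b) (hab : a ≤ b)
    (hmem : ∀ t ∈ Icc a b, γ t ∈ (cotChart (S.lam t₀).1).source ∧
      cotChart (S.lam t₀).1 (γ t) ∈ ball (cotChart (S.lam t₀).1 (S.lam t₀)) R)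
    (hn : ∀ᵐ t ∂volume.restrict (Icc a b), ∃ w : ℝ, |w| ≤ 1 ∧
      h t = fun ℓ => S.tH ℓ + w * S.F₁ ℓ) : S.F₁ (γ a) = S.F₁ (γ b) := by
  set x := (S.lam t₀).1 with hx
  set z₀ := cotChart x (S.lam t₀)
  have hnice : ∀ᵐ t ∂volume.restrict (Icc a b),
      NiceHam (fun z => h t ((cotChart x).symm z)) (ball z₀ R) C := by
    filter_upwards [hn] with t ht
    obtain ⟨w, hw, h1⟩ := ht
    rw [h1]
    exact hb.sing ht₀ w hw
  have hcurve := hγ.2 x a b _ C le_rfl hab le_rfl hmem hnice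
  have hzero : ∀ᵐ t ∂volume.restrict (Icc a b),
      fderiv ℝ (fun z => S.F₁ ((cotChart x).symm z)) (cotChart x (γ t))
        (symGrad (fderiv ℝ (fun z => h t ((cotChart x).symm z)) (cotChart x (γ t)))) = 0 := by
    filter_upwards [hn, ae_restrict_mem measurableSet_Icc] with t h1 ht
    obtain ⟨w, -, h1⟩ := h1
    rw [h1]
    exact fderiv_F₁_tH hb ht₀ (hmem t ht).2
  have h1 := hcurve.mul_sub_le_comp (κ := 0) hab (convex_ball z₀ R) (fun t ht => (hmem t ht).2)
    (fun z hz => ⟨hb.niceF.diff z hz, hb.niceF.bound z hz⟩) (hzero.mono fun t ht => ht.ge)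
  have hneg : ∀ z ∈ ball z₀ R, HasFDerivAt (fun z => -S.F₁ ((cotChart x).symm z))
      (-fderiv ℝ (fun z => S.F₁ ((cotChart x).symm z)) z) z := fun z hz =>
    (hb.niceF.diff z hz).hasFDerivAt.neg
  have h2 := hcurve.mul_sub_le_comp (κ := 0) (K := fun z => -S.F₁ ((cotChart x).symm z)) (CK := C)
    hab (convex_ball z₀ R) (fun t ht => (hmem t ht).2)
    (fun z hz => ⟨(hneg z hz).differentiableAt, by
      rw [(hneg z hz).fderiv, norm_neg]; exact hb.niceF.bound z hz⟩) (by
      filter_upwards [hzero, ae_restrict_mem measurableSet_Icc] with t h1 ht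
      rw [(hneg _ (hmem t ht).2).fderiv, neg_apply, h1, neg_zero])
  have h1' : 0 * (b - a) ≤ S.F₁ ((cotChart x).symm (cotChart x (γ b))) -
    S.F₁ ((cotChart x).symm (cotChart x (γ a))) := h1
  have h2' : 0 * (b - a) ≤ -S.F₁ ((cotChart x).symm (cotChart x (γ b))) -
    -S.F₁ ((cotChart x).symm (cotChart x (γ a))) := h2
  rw [(cotChart x).left_inv (hmem a ⟨le_rfl, hab⟩).1,
    (cotChart x).left_inv (hmem b ⟨hab, le_rfl⟩).1, zero_mul] at h1' h2'
  linarith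

theorem lift_le_tH {t₀ R C : ℝ} (hb : S.NiceBall t₀ R C) (ht₀ : t₀ ∈ Icc S.τ₂ S.T) {i : Fin S.m}
    {ℓ : Cotangent E M} (hs : ℓ ∈ (cotChart (S.lam t₀).1).source)
    (hz : cotChart (S.lam t₀).1 ℓ ∈ ball (cotChart (S.lam t₀).1 (S.lam t₀)) R)
    (hF : S.F₁ ℓ = 0)
    (hi : (∃ s ∈ Icc (0 : ℝ) 1, S.X i = fun x => S.h₂ x + s • (S.h₃ x - S.h₂ x)) ∨
      lift (S.X i) ℓ < lift S.h₂ ℓ) : lift (S.X i) ℓ ≤ S.tH ℓ := by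
  have h1 := (hb.tilde ht₀).le _ hz
  rw [(cotChart (S.lam t₀).1).left_inv hs] at h1
  rcases hi with ⟨s, -, hi⟩ | hi
  · rw [hi, lift_add_smul_sub, ← S.F₁_eq, hF, mul_zero, add_zero]
    exact h1
  · exact hi.le.trans h1

variable (S) [T2Space M]

theorem exists_window_singular {t₀ : ℝ} (ht₀ : t₀ ∈ Icc S.τ₂ S.T) {U : Set (E × (E →L[ℝ] ℝ))}
    (hU : U ∈ 𝓝 (cotChart (S.lam t₀).1 (S.lam t₀))) {ε₀ : ℝ} (hε₀ : 0 < ε₀) :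
    ∃ R C ε, S.NiceBall t₀ R C ∧ 0 < ε ∧ ε ≤ ε₀ ∧
      ball (cotChart (S.lam t₀).1 (S.lam t₀)) R ⊆ U ∧
      ∀ a b, t₀ - ε ≤ a → S.τ₂ ≤ a → a ≤ b → b ≤ S.T → t₀ ≤ b → b ≤ t₀ + ε → S.Good b →
        ∃ N ∈ 𝓝 S.η₀, N ⊆ S.N₀ ∧ ∃ C', S.LocalEst t₀ a b R N C' := by
  have ht₀' : t₀ ∈ Icc 0 S.T := ⟨S.τ₂_pos.le.trans ht₀.1, ht₀.2⟩
  obtain ⟨R, C, ε, hball, hε, hεε₀, -, hCε, hsub, hframe⟩ := S.exists_frame ht₀'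
    (inter_mem hU (S.eventually_edge S.smooth₂ (S.hsing t₀ ht₀))) hε₀
  refine ⟨3 * R, C, ε, hball, hε, hεε₀, hsub.trans inter_subset_left,
    fun a b hεa ha hab hbT htb hbε hgood => ?_⟩
  have ha0 := S.τ₂_pos.le.trans ha
  obtain ⟨N, hN, hN₀, ⟨C₁, hC₁, hest⟩, hF, hnm, hstay⟩ := hframe a b hεa ha0 hab hbT htb hbε hgood
    fun h => absurd ht₀.1 (not_le.2 h)
  have hR : 0 < R := by have := hball.pos; linarith
  have hmem : ∀ η ∈ N, ∀ t ∈ Icc a b, S.W t η ∈ (cotChart (S.lam t₀).1).source ∧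
      cotChart (S.lam t₀).1 (S.W t η) ∈
        ball (cotChart (S.lam t₀).1 (S.lam t₀)) (3 * R) := fun η hη t ht =>
    ⟨(hstay η hη t ht).1, closedBall_subset_ball (by linarith) (hstay η hη t ht).2⟩
  have hυ : ∀ᵐ t ∂volume.restrict (Icc a b), |S.υ t| ≤ 1 :=
    ae_restrict_Icc_mono S.υ_abs ha hbT
  have hF' : ∀ η ∈ N, ∀ t ∈ Icc a b, S.τ₂ ≤ t → S.F₁ (S.W t η) = 0 := by
    intro η hη t ht htτ
    rw [← hF (ha.trans hab) η hη]
    refine F₁_eq_of_follows (a := t) (b := b) hball ht₀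
      ((S.W_follows (hN₀ hη)).mono (ha0.trans ht.1) hbT) ht.2
      (fun s hs => hmem η hη s ⟨ht.1.trans hs.1, hs.2⟩) ?_
    filter_upwards [ae_restrict_Icc_mono hυ ht.1 le_rfl, ae_restrict_mem measurableSet_Icc]
      with s h1 hs
    exact ⟨S.υ s, h1, funext fun ℓ => by rw [mode, if_pos (htτ.trans hs.1)]⟩
  have hA : ∀ᵐ t ∂volume.restrict (Icc a b),
      NiceHam (fun z => (fun t ℓ => S.tH ℓ + S.υ t * S.F₁ ℓ) t ((cotChart (S.lam t₀).1).symm z))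
        (ball (cotChart (S.lam t₀).1 (S.lam t₀)) (3 * R)) C := by
    filter_upwards [hυ] with t ht
    exact hball.sing ht₀ _ ht
  refine ⟨N, hN, hN₀, NiceBall.localEst (A := fun t ℓ => S.tH ℓ + S.υ t * S.F₁ ℓ)
    (B := fun t ℓ => S.tH ℓ + S.υ t * S.F₁ ℓ) (σ := fun _ => 0) (K := 0) hball ha0 hab hbT
    (le_trans (mul_le_mul_of_nonneg_left (by linarith) hball.nonneg) hCε) hN₀ hmem
    (fun η hη => ?_) hnm hA hA hC₁ le_rfl (by simp) (fun η _ η' _ => by simp) hest hF'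
    fun i η hη => ?_⟩
  · filter_upwards [ae_restrict_mem measurableSet_Icc] with t ht
    funext ℓ
    rw [mode, if_pos (ha.trans ht.1)]
    simp
  · filter_upwards [ae_restrict_mem measurableSet_Icc] with t ht
    have hzm := hmem η hη t ht
    have hF0 := hF' η hη t ht (ha.trans ht.1)
    rw [mode, if_pos (ha.trans ht.1), hF0, mul_zero, add_zero]
    refine lift_le_tH hball ht₀ hzm.1 hzm.2 hF0 ?_
    have := (hsub hzm.2).2 i
    rwa [(cotChart (S.lam t₀).1).left_inv hzm.1] at this

/-- Windows around the interior points of a bang arc. -/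
theorem exists_window_bang {t₀ : ℝ} (ht₀ : t₀ ∈ Icc 0 S.T) {h : (x : M) → TangentSpace 𝓘(ℝ, E) x}
    (hh : ∃ j, h = S.X j)
    (hmax : ∀ u ∈ stdSimplex ℝ (Fin S.m), comb S.X u ≠ h → lift (comb S.X u) (S.lam t₀) <
      lift h (S.lam t₀)) {α β : ℝ} (hαt : α < t₀) (hβ : t₀ < β) (hβτ : β ≤ S.τ₂)
    (hmode : ∀ᶠ η in 𝓝 S.η₀, ∀ t ∈ Ioo α β, 0 ≤ t → t < S.σ₂ η ∧ S.mode η t = lift h)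
    {U : Set (E × (E →L[ℝ] ℝ))}
    (hU : U ∈ 𝓝 (cotChart (S.lam t₀).1 (S.lam t₀))) :
    ∃ R C ε, S.NiceBall t₀ R C ∧ 0 < ε ∧
      ball (cotChart (S.lam t₀).1 (S.lam t₀)) R ⊆ U ∧
      ∀ a b, t₀ - ε ≤ a → 0 ≤ a → a ≤ b → t₀ ≤ b → b ≤ t₀ + ε → S.Good b →
        ∃ N ∈ 𝓝 S.η₀, N ⊆ S.N₀ ∧ ∃ C', S.LocalEst t₀ a b R N C' := by
  have hev : ∀ᶠ z in 𝓝 (cotChart (S.lam t₀).1 (S.lam t₀)), ∀ i,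
      lift (S.X i) ((cotChart (S.lam t₀).1).symm z) ≤ lift h ((cotChart (S.lam t₀).1).symm z) := by
    rw [eventually_all]
    intro i
    by_cases hi : S.X i = h
    · exact Eventually.of_forall fun z => by rw [hi]
    · have h1 := hmax (Pi.single i 1) (single_mem_stdSimplex ℝ i) (by rwa [← S.single_mem i])
      rw [← S.single_mem i] at h1
      obtain ⟨j, hj⟩ := hh
      exact (eventually_symm_lt (cotSmooth_lift (S.hX i)).continuousOn
        (hj ▸ (cotSmooth_lift (S.hX j)).continuousOn) h1).mono fun _ h => h.le
  obtain ⟨R, C, ε, hball, hε, hεε₀, -, hCε, hsub, hframe⟩ := S.exists_frame ht₀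
    (inter_mem hU hev) (ε₀ := min (t₀ - α) (β - t₀) / 2)
    (by have := sub_pos.2 hαt; have := sub_pos.2 hβ; positivity)
  have hεα : ε < t₀ - α := by
    have := min_le_left (t₀ - α) (β - t₀); linarith
  have hεβ : ε < β - t₀ := by
    have := min_le_right (t₀ - α) (β - t₀); linarith
  refine ⟨3 * R, C, ε, hball, hε, hsub.trans inter_subset_left,
    fun a b hεa ha0 hab htb hbε hgood => ?_⟩
  have hbβ : b < β := by linarith
  have hbT : b ≤ S.T := hbβ.le.trans (hβτ.trans S.hτ₂.le)
  obtain ⟨N', hN', hN₀', ⟨C₁, hC₁, hest⟩, hF, hnm, hstay⟩ := hframe a b hεa ha0 hab hbT htb hbε hgood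
    fun _ => hmode.mono fun η hη => (hη b ⟨by linarith, hbβ⟩ (ha0.trans hab)).1
  obtain ⟨N'', hN'', hmode'⟩ := hmode.exists_mem
  set N := N' ∩ N''
  have hN : N ∈ 𝓝 S.η₀ := inter_mem hN' hN''
  have hR : 0 < R := by have := hball.pos; linarith
  have hmem : ∀ η ∈ N, ∀ t ∈ Icc a b, S.W t η ∈ (cotChart (S.lam t₀).1).source ∧
      cotChart (S.lam t₀).1 (S.W t η) ∈
        ball (cotChart (S.lam t₀).1 (S.lam t₀)) (3 * R) := fun η hη t ht =>
    ⟨(hstay η hη.1 t ht).1, closedBall_subset_ball (by linarith) (hstay η hη.1 t ht).2⟩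
  have hm : ∀ η ∈ N, ∀ t ∈ Icc a b, S.mode η t = lift h := fun η hη t ht =>
    (hmode' η hη.2 t ⟨by linarith [ht.1], ht.2.trans_lt hbβ⟩ (ha0.trans ht.1)).2
  have hA : ∀ᵐ t ∂volume.restrict (Icc a b),
      NiceHam (fun z => (fun (_ : ℝ) (ℓ : Cotangent E M) => lift h ℓ) t
        ((cotChart (S.lam t₀).1).symm z))
        (ball (cotChart (S.lam t₀).1 (S.lam t₀)) (3 * R)) C := by
    obtain ⟨j, hj⟩ := hh
    exact ae_of_all _ fun t => by rw [hj]; exact hball.niceX j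
  refine ⟨N, hN, fun η hη => hN₀' hη.1, NiceBall.localEst (A := fun _ ℓ => lift h ℓ)
    (B := fun _ ℓ => lift h ℓ) (σ := fun _ => 0) (K := 0) hball ha0 hab
    hbT (le_trans (mul_le_mul_of_nonneg_left (by linarith) hball.nonneg) hCε)
    (fun η hη => hN₀' hη.1) hmem (fun η hη => ?_) (fun η hη => hnm η hη.1) hA hA hC₁ le_rfl (by simp)
    (fun η _ η' _ => by simp) (hest.mono inter_subset_left le_rfl)
    (fun η _ t ht h1 => absurd (h1.trans ht.2) (not_le.2 (hbβ.trans_le hβτ))) fun i η hη => ?_⟩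
  · filter_upwards [ae_restrict_mem measurableSet_Icc] with t ht
    rw [hm η hη t ht]
    simp
  · filter_upwards [ae_restrict_mem measurableSet_Icc] with t ht
    rw [hm η hη t ht]
    have := (hsub (hmem η hη t ht).2).2 i
    rwa [(cotChart (S.lam t₀).1).left_inv (hmem η hη t ht).1] at this

end Extremal

end

section

variable {E : Type*} [NormedAddCommGroup E] [NormedSpace ℝ E] [FiniteDimensional ℝ E]
  {M : Type*} [TopologicalSpace M] [ChartedSpace E M] [IsManifold 𝓘(ℝ, E) ∞ M]

namespace Extremal

variable {S : Extremal E M}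

theorem abs_sub_sub_le_of_nice {G G' : Cotangent E M → ℝ} {x : M} {z₀ : E × (E →L[ℝ] ℝ)} {R C δ : ℝ}
    (hG : NiceHam (fun z => G ((cotChart x).symm z)) (ball z₀ R) C)
    (hG' : NiceHam (fun z => G' ((cotChart x).symm z)) (ball z₀ R) C) (hC : 0 ≤ C)
    {ℓ ℓ' : Cotangent E M} (hℓ : ℓ ∈ (cotChart x).source ∧ cotChart x ℓ ∈ ball z₀ R)
    (hℓ' : ℓ' ∈ (cotChart x).source ∧ cotChart x ℓ' ∈ ball z₀ R)
    (hδ : ‖cotChart x ℓ' - cotChart x ℓ‖ ≤ δ) :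
    |(G ℓ' - G' ℓ') - (G ℓ - G' ℓ)| ≤ 2 * C * δ := by
  have h1 := hG.lipschitz (convex_ball z₀ R) hℓ.2 hℓ'.2
  have h2 := hG'.lipschitz (convex_ball z₀ R) hℓ.2 hℓ'.2
  simp only [(cotChart x).left_inv hℓ.1, (cotChart x).left_inv hℓ'.1] at h1 h2
  have e : (G ℓ' - G' ℓ') - (G ℓ - G' ℓ) = (G ℓ' - G ℓ) - (G' ℓ' - G' ℓ) := by ring
  have h3 : C * ‖cotChart x ℓ' - cotChart x ℓ‖ ≤ C * δ := by gcongr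
  rw [e]
  refine (abs_sub _ _).trans ?_
  linarith

variable [T2Space M]

theorem NiceBall.expTo_stay {R C d : ℝ} {ℓ ℓ' : Cotangent E M}
    {P : Set (Cotangent E M)} (hb : S.NiceBall S.τ₂ (3 * R) C) (h : ExpTo S.tH P d ℓ ℓ')
    (hs : ℓ ∈ (cotChart (S.lam S.τ₂).1).source)
    (hz : cotChart (S.lam S.τ₂).1 ℓ ∈
      closedBall (cotChart (S.lam S.τ₂).1 (S.lam S.τ₂)) R) (hd : C * |d| ≤ R) :
    ∃ γ : ℝ → Cotangent E M, γ 0 = ℓ ∧ γ d = ℓ' ∧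
      FollowsHam (fun _ => S.tH) γ (min 0 d) (max 0 d) ∧ ∀ t ∈ Icc (min 0 d) (max 0 d),
        γ t ∈ (cotChart (S.lam S.τ₂).1).source ∧ cotChart (S.lam S.τ₂).1 (γ t) ∈
          ball (cotChart (S.lam S.τ₂).1 (S.lam S.τ₂)) (3 * R) := by
  obtain ⟨γ, h0, h1, -, hγ⟩ := h
  have hf : FollowsHam (fun _ => S.tH) γ (min 0 d) (max 0 d) := hγ.followsHam
  have hR : 0 < R := by have := hb.pos; linarith
  have hm : S.τ₂ ∈ Icc S.τ₂ S.T := ⟨le_rfl, S.hτ₂.le⟩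
  have hl : max 0 d - min 0 d = |d| := by rw [max_sub_min_eq_abs, sub_zero]
  refine ⟨γ, h0, h1, hf, fun t ht => ?_⟩
  have := hf.mem_closedBall hR hb.sub (ae_of_all _ fun _ => (hb.tilde hm).nice) hb.nonneg
    (by rwa [hl]) (s := 0) ⟨min_le_left _ _, le_max_left _ _⟩ (by rwa [h0]) (by rwa [h0]) t ht
  exact ⟨this.1, closedBall_subset_ball (by linarith) this.2⟩

theorem NiceBall.expTo_unique {R C d : ℝ} {ℓ ℓ' ℓ'' : Cotangent E M}
    {P P' : Set (Cotangent E M)} (hb : S.NiceBall S.τ₂ (3 * R) C) (h : ExpTo S.tH P d ℓ ℓ')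
    (h' : ExpTo S.tH P' d ℓ ℓ'') (hs : ℓ ∈ (cotChart (S.lam S.τ₂).1).source)
    (hz : cotChart (S.lam S.τ₂).1 ℓ ∈
      closedBall (cotChart (S.lam S.τ₂).1 (S.lam S.τ₂)) R) (hd : C * |d| ≤ R)
    (hd' : C * |d| ≤ 1 / 2) : ℓ' = ℓ'' := by
  obtain ⟨γ, h0, h1, hγ, hm⟩ := hb.expTo_stay h hs hz hd
  obtain ⟨γ', h0', h1', hγ', hm'⟩ := hb.expTo_stay h' hs hz hd
  have hτ : S.τ₂ ∈ Icc S.τ₂ S.T := ⟨le_rfl, S.hτ₂.le⟩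
  have hl : max 0 d - min 0 d = |d| := by rw [max_sub_min_eq_abs, sub_zero]
  have := hγ.eqOn_of_mem hγ' hm hm' (ae_of_all _ fun _ => (hb.tilde hτ).nice) hb.nonneg
    (by rwa [hl]) (s := 0) ⟨min_le_left _ _, le_max_left _ _⟩ (h0.trans h0'.symm)
  rw [← h1, ← h1', this ⟨min_le_right _ _, le_max_right _ _⟩]

theorem _root_.IsMIntegralCurveOn.expTo {F : Cotangent E M → ℝ} {γ : ℝ → Cotangent E M} {a b : ℝ}
    (hab : a ≤ b) (h : IsMIntegralCurveOn (I := cotModel E) γ (hamField F) (Icc a b)) :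
    ExpTo F univ (a - b) (γ b) (γ a) := by
  refine ⟨fun t => γ (t + b), by simp, by simp, mapsTo_univ _ _, ?_⟩
  have h1 := h.comp_add b
  refine h1.mono fun t ht => ?_
  rw [uIcc_of_ge (by linarith)] at ht
  exact ⟨by linarith [ht.1], by linarith [ht.2]⟩

/-- Properties of the two switching times near the reference extremal. -/
theorem exists_switch_facts (hg : S.Good S.τ₂) {R C ε : ℝ} (hb : S.NiceBall S.τ₂ (3 * R) C)
    (hε : 0 < ε) (hCε : C * ε ≤ R) (hCε' : C * ε ≤ 1 / 2)
    (hQ : ∀ z ∈ ball (cotChart (S.lam S.τ₂).1 (S.lam S.τ₂)) (3 * R),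
      fderiv ℝ (fun z => S.Q ((cotChart (S.lam S.τ₂).1).symm z)) z
        (symGrad (fderiv ℝ (fun z => S.tH ((cotChart (S.lam S.τ₂).1).symm z)) z)) ≤ 0) :
    ∃ N ∈ 𝓝 S.η₀, N ⊆ S.N₀ ∧ ∃ L ≥ 0, (∀ η ∈ N, ∀ η' ∈ N,
        |S.t₂ (S.W S.τ₂ η') - S.t₂ (S.W S.τ₂ η)| ≤ L * ‖η' - η‖) ∧
      ∀ η ∈ N, |S.tH (S.W (S.σ₂ η) η) - S.H₂ (S.W (S.σ₂ η) η)| ≤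
          L * max (S.t₂ (S.W S.τ₂ η) - S.τ₂) 0 ∧
        0 ≤ S.Q (S.W (S.σ₂ η) η) ∧ S.H₂ (S.W (S.σ₁ η) η) = S.H₁ (S.W (S.σ₁ η) η) := by
  have hτ : S.τ₂ ∈ Icc S.τ₂ S.T := ⟨le_rfl, S.hτ₂.le⟩
  have hτ' : S.τ₂ ∈ Icc 0 S.T := ⟨S.τ₂_pos.le, S.hτ₂.le⟩
  have hR : 0 < R := by have := hb.pos; linarith
  set x := (S.lam S.τ₂).1 with hx
  set z₀ := cotChart x (S.lam S.τ₂)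
  have hW₀ : S.W S.τ₂ S.η₀ = S.lam S.τ₂ := S.W_η₀ _ hτ'
  have hcW := hg.continuousAt_W hτ'
  have hcκ : ContinuousAt (fun η => cotChart x (S.W S.τ₂ η)) S.η₀ := hg.continuousAt
  obtain ⟨N₁, hN₁, hN₁₀, C₁, hC₁, hest, -⟩ := hg
  have hsrc : S.lam S.τ₂ ∈ (cotChart x).source := mem_cotChart_source _
  have hz₀t := (cotChart x).map_source hsrc
  have ht₂d : ContDiffAt ℝ 1 (fun z => S.t₂ ((cotChart x).symm z)) z₀ := by
    have h1 : ContMDiffAt (cotModel E) 𝓘(ℝ, ℝ) ∞ S.t₂ ((cotChart x).symm z₀) := by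
      rw [(cotChart x).left_inv hsrc]
      exact (S.hsw.smooth_t₂ _ S.hsw.mem).contMDiffAt (S.hsw.isOpen.mem_nhds S.hsw.mem)
    have h2 : ContMDiffAt 𝓘(ℝ, E × (E →L[ℝ] ℝ)) (cotModel E) ∞ (cotChart x).symm z₀ :=
      (contMDiffOn_extChartAt_symm (I := cotModel E) (n := ∞) (⟨x, 0⟩ : Cotangent E M)).contMDiffAt
        ((isOpen_cotChart_target x).mem_nhds hz₀t)
    exact (h1.comp z₀ h2).contDiffAt.of_le one_le_infty
  obtain ⟨L₂, P₂, hP₂, hL₂⟩ := ht₂d.exists_lipschitzOnWith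
  have hz₀' : cotChart x (S.W S.τ₂ S.η₀) = z₀ := by rw [hW₀]
  have ev1 : ∀ᶠ η in 𝓝 S.η₀, cotChart x (S.W S.τ₂ η) ∈ P₂ := hcκ.eventually (by simp only [hz₀']; exact hP₂)
  have ev2 : ∀ᶠ η in 𝓝 S.η₀, cotChart x (S.W S.τ₂ η) ∈ ball z₀ R :=
    hcκ.eventually (by simp only [hz₀']; exact ball_mem_nhds _ hR)
  have ht₂c : ContinuousAt S.t₂ (S.W S.τ₂ S.η₀) := by
    rw [hW₀]
    exact S.hsw.smooth_t₂.continuousOn.continuousAt (S.hsw.isOpen.mem_nhds S.hsw.mem)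
  have ht₂₀ : S.t₂ (S.W S.τ₂ S.η₀) = S.τ₂ := by
    rw [hW₀]; exact S.hsw.eq_t₂ _ S.hsw.mem (S.Q_lam _ hτ)
  have ev3 : ∀ᶠ η in 𝓝 S.η₀, S.t₂ (S.W S.τ₂ η) ∈ Ioo (S.τ₂ - ε) (S.τ₂ + ε) :=
    (ht₂c.comp hcW).eventually (by
      simp only [Function.comp_apply, ht₂₀]
      exact Ioo_mem_nhds (by linarith) (by linarith))
  refine ⟨_, inter_mem (inter_mem hN₁ ev1) (inter_mem ev2 ev3), fun η hη => hN₁₀ hη.1.1,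
    L₂ * C₁ + 2 * C * C, by have := hb.nonneg; positivity, fun η hη η' hη' => ?_, fun η hη => ?_⟩
  · have h1 := hL₂.dist_le_mul _ hη'.1.2 _ hη.1.2
    rw [Real.dist_eq, dist_eq_norm, (cotChart x).left_inv (hest η hη.1.1).1,
      (cotChart x).left_inv (hest η' hη'.1.1).1] at h1
    have h2 := ((hest η hη.1.1).2 η' hη'.1.1).1
    refine h1.trans ((mul_le_mul_of_nonneg_left h2 L₂.2).trans ?_)
    rw [← mul_assoc]
    have := hb.nonneg
    gcongr
    have : 0 ≤ 2 * C * C := by positivity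
    exact le_add_of_nonneg_right this
  · have hη₀ := hN₁₀ hη.1.1
    have hs : S.W S.τ₂ η ∈ (cotChart x).source := (hest η hη.1.1).1
    have hz : cotChart x (S.W S.τ₂ η) ∈ closedBall z₀ R := ball_subset_closedBall hη.2.1
    have hT := hη.2.2
    have hO₂ : S.W S.τ₂ η ∈ S.O₂ := S.hΦ.switch_mem _ (S.differential_mem hη₀)
    have hC := hb.nonneg
    have hdε : |S.t₂ (S.W S.τ₂ η) - S.τ₂| ≤ ε := abs_le.2 ⟨by linarith [hT.1], by linarith [hT.2]⟩
    have hsmall : ∀ d : ℝ, |d| ≤ ε → C * |d| ≤ R ∧ C * |d| ≤ 1 / 2 := fun d hd =>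
      ⟨le_trans (by gcongr) hCε, le_trans (by gcongr) hCε'⟩
    have hσd : |S.σ₂ η - S.τ₂| ≤ ε := by
      rw [σ₂, switch₂, abs_le]
      refine ⟨?_, ?_⟩
      · have : S.τ₂ - ε ≤ min (S.t₂ (S.W S.τ₂ η)) S.τ₂ := le_min hT.1.le (by linarith)
        linarith
      · have := min_le_right (S.t₂ (S.W S.τ₂ η)) S.τ₂; linarith
    have hWc : ExpTo S.tH univ (S.σ₂ η - S.τ₂) (S.W S.τ₂ η) (S.W (S.σ₂ η) η) :=
      IsMIntegralCurveOn.expTo (S.order hη₀).2.2 (S.hΦ.corrected _ (S.differential_mem hη₀)).2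
    have hW₂ : ExpTo S.H₂ univ (S.σ₁ η - S.σ₂ η) (S.W (S.σ₂ η) η) (S.W (S.σ₁ η) η) :=
      IsMIntegralCurveOn.expTo (S.order hη₀).2.1.le (S.hΦ.bang₂ _ (S.differential_mem hη₀))
    obtain ⟨ℓ', ℓ'', e1, e2, e3⟩ := S.hsw.solves_s₁ _ hO₂
    have hu1 : S.W (S.σ₂ η) η = ℓ' := hb.expTo_unique hWc e1 hs hz (hsmall _ hσd).1 (hsmall _ hσd).2
    rw [← hu1] at e2
    have hu2 : S.W (S.σ₁ η) η = ℓ'' := hW₂.unique_of_niceAt (fun ℓ => niceAt_lift S.smooth₂ ℓ) e2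
    obtain ⟨ℓt, f1, f2⟩ := S.hsw.solves_t₂ _ hO₂
    rw [hu2]
    refine ⟨?_, ?_, e3⟩
    all_goals rcases le_total (S.t₂ (S.W S.τ₂ η)) S.τ₂ with hle | hle
    · have hσ : S.σ₂ η = S.t₂ (S.W S.τ₂ η) := min_eq_left hle
      rw [← hσ] at f1
      have hu : S.W (S.σ₂ η) η = ℓt := hb.expTo_unique hWc f1 hs hz (hsmall _ hσd).1 (hsmall _ hσd).2
      obtain ⟨γ, g0, g1, -, gm⟩ := hb.expTo_stay f1 hs hz (hsmall _ hσd).1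
      have hm := gm _ ⟨min_le_right _ _, le_max_right _ _⟩
      rw [g1] at hm
      have := ((hb.tilde hτ).eq_of _ hm.2 (by rw [(cotChart x).left_inv hm.1]; exact f2)).1
      rw [(cotChart x).left_inv hm.1] at this
      rw [hu, tH, this, sub_self, abs_zero]
      positivity
    · have hσ : S.σ₂ η = S.τ₂ := min_eq_right hle
      obtain ⟨γ, g0, g1, gf, gm⟩ := hb.expTo_stay f1 hs hz (hsmall _ hdε).1
      set d := S.t₂ (S.W S.τ₂ η) - S.τ₂ with hd
      have hd0 : 0 ≤ d := sub_nonneg.2 hle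
      rw [min_eq_left hd0, max_eq_right hd0] at gf gm
      have hm := gm d ⟨hd0, le_rfl⟩
      have hm0 := gm 0 ⟨le_rfl, hd0⟩
      have hcv := gf.2 x 0 d _ C le_rfl hd0 le_rfl gm (ae_of_all _ fun _ => (hb.tilde hτ).nice)
      have hlip := hcv.lip 0 ⟨le_rfl, hd0⟩ d ⟨hd0, le_rfl⟩
      have hgp := abs_sub_sub_le_of_nice (hb.tilde hτ).nice hb.nice₂ hC hm hm0 hlip
      rw [g1] at hm hgp
      have := ((hb.tilde hτ).eq_of _ hm.2 (by rw [(cotChart x).left_inv hm.1]; exact f2)).1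
      rw [(cotChart x).left_inv hm.1] at this
      have h0 : tildeH S.h₂ S.h₃ S.θ ℓt - S.H₂ ℓt = 0 := sub_eq_zero.2 this
      rw [h0, sub_zero, g0, zero_sub, abs_neg, abs_of_nonneg hd0] at hgp
      rw [hσ, max_eq_left hd0]
      refine hgp.trans ?_
      have : 0 ≤ (L₂ : ℝ) * C₁ * d := by positivity
      linarith
    · have hσ : S.σ₂ η = S.t₂ (S.W S.τ₂ η) := min_eq_left hle
      rw [← hσ] at f1
      have hu : S.W (S.σ₂ η) η = ℓt := hb.expTo_unique hWc f1 hs hz (hsmall _ hσd).1 (hsmall _ hσd).2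
      rw [hu]; exact f2.ge
    · have hσ : S.σ₂ η = S.τ₂ := min_eq_right hle
      obtain ⟨γ, g0, g1, gf, gm⟩ := hb.expTo_stay f1 hs hz (hsmall _ hdε).1
      set d := S.t₂ (S.W S.τ₂ η) - S.τ₂ with hd
      have hd0 : 0 ≤ d := sub_nonneg.2 hle
      rw [min_eq_left hd0, max_eq_right hd0] at gf gm
      have hcv := gf.2 x 0 d _ C le_rfl hd0 le_rfl gm (ae_of_all _ fun _ => (hb.tilde hτ).nice)
      have hneg : ∀ z ∈ ball z₀ (3 * R), HasFDerivAt (fun z => -S.Q ((cotChart x).symm z))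
        (-fderiv ℝ (fun z => S.Q ((cotChart x).symm z)) z) z := fun z hz =>
        (hb.diffQ z hz).1.hasFDerivAt.neg
      have h1 := hcv.mul_sub_le_comp (κ := 0) (K := fun z => -S.Q ((cotChart x).symm z)) (CK := C)
        hd0 (convex_ball z₀ (3 * R)) (fun t ht => (gm t ht).2)
        (fun z hz => ⟨(hneg z hz).differentiableAt, by
          rw [(hneg z hz).fderiv, norm_neg]; exact (hb.diffQ z hz).2⟩) (by
          filter_upwards [ae_restrict_mem measurableSet_Icc] with t ht
          rw [(hneg _ (gm t ht).2).fderiv, neg_apply]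
          exact neg_nonneg.2 (hQ _ (gm t ht).2))
      have h2 : 0 * (d - 0) ≤ -S.Q ((cotChart x).symm (cotChart x (γ d))) -
        -S.Q ((cotChart x).symm (cotChart x (γ 0))) := h1
      rw [(cotChart x).left_inv (gm d ⟨hd0, le_rfl⟩).1,
        (cotChart x).left_inv (gm 0 ⟨le_rfl, hd0⟩).1, g0, g1, Q, f2] at h2
      rw [hσ]
      simp only [Q]
      linarith

end Extremal

end

section

variable {E : Type*} [NormedAddCommGroup E] [NormedSpace ℝ E] [FiniteDimensional ℝ E]
  {M : Type*} [TopologicalSpace M] [ChartedSpace E M] [IsManifold 𝓘(ℝ, E) ∞ M]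

namespace Extremal

variable (S : Extremal E M)

theorem poisson_H₂_Q_neg : poisson S.H₂ S.Q (S.lam S.τ₂) < 0 := by
  have h1 := S.hswitch.2
  have h2 : poisson (lift S.h₃) (lift S.h₂) = fun ℓ : Cotangent E M => -S.Q ℓ :=
    funext fun ℓ => poisson_neg_symm ℓ
  have h3 : mfderiv (cotModel E) 𝓘(ℝ, ℝ) (fun ℓ : Cotangent E M => -S.Q ℓ) (S.lam S.τ₂) =
    -mfderiv (cotModel E) 𝓘(ℝ, ℝ) S.Q (S.lam S.τ₂) := mfderiv_neg
  rw [h2] at h1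
  have h4 : poisson S.H₂ (fun ℓ => -S.Q ℓ) (S.lam S.τ₂) = -poisson S.H₂ S.Q (S.lam S.τ₂) :=
    congrArg (fun A : E × (E →L[ℝ] ℝ) →L[ℝ] ℝ => A (hamField S.H₂ (S.lam S.τ₂))) h3
  linarith

variable [T2Space M]

theorem eventually_Q_decreasing : ∀ᶠ z in 𝓝 (cotChart (S.lam S.τ₂).1 (S.lam S.τ₂)),
    fderiv ℝ (fun z => S.Q ((cotChart (S.lam S.τ₂).1).symm z)) z
        (symGrad (fderiv ℝ (fun z => S.tH ((cotChart (S.lam S.τ₂).1).symm z)) z)) ≤ 0 ∧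
    fderiv ℝ (fun z => S.Q ((cotChart (S.lam S.τ₂).1).symm z)) z
        (symGrad (fderiv ℝ (fun z => S.H₂ ((cotChart (S.lam S.τ₂).1).symm z)) z)) ≤ 0 := by
  have hτ : S.τ₂ ∈ Icc S.τ₂ S.T := ⟨le_rfl, S.hτ₂.le⟩
  set x := (S.lam S.τ₂).1 with hx
  set z₀ := cotChart x (S.lam S.τ₂)
  have hs : S.lam S.τ₂ ∈ (cotChart x).source := mem_cotChart_source _
  have hz₀t := (cotChart x).map_source hs
  obtain ⟨R, hR, C, hC, hl⟩ := S.exists_tildeH hτ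
  have hzm := mem_ball_self (x := z₀) hR
  have heq := (hl.eq_of z₀ hzm (by rw [(cotChart x).left_inv hs]; exact S.Q_lam _ hτ)).2
  have hval : fderiv ℝ (fun z => S.Q ((cotChart x).symm z)) z₀
      (symGrad (fderiv ℝ (fun z => S.H₂ ((cotChart x).symm z)) z₀)) < 0 := by
    rw [← poisson_eq_fderiv (S.cotSmooth₂.mdifferentiableAt _) (S.cotSmoothQ.mdifferentiableAt _) hs]
    exact S.poisson_H₂_Q_neg
  have hcQ : ContinuousAt (fderiv ℝ (fun z => S.Q ((cotChart x).symm z))) z₀ :=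
    (((S.cotSmoothQ.contDiffAt hz₀t).of_le two_le_infty).fderiv_right (m := 1)
      (by norm_num)).continuousAt
  have hcH : ContinuousAt (fderiv ℝ (fun z => S.H₂ ((cotChart x).symm z))) z₀ :=
    (((S.cotSmooth₂.contDiffAt hz₀t).of_le two_le_infty).fderiv_right (m := 1)
      (by norm_num)).continuousAt
  have hcT : ContinuousAt (fderiv ℝ (fun z => S.tH ((cotChart x).symm z))) z₀ := by
    have h1 : LipschitzOnWith C.toNNReal (fderiv ℝ (fun z => S.tH ((cotChart x).symm z)))
        (ball z₀ R) := by
      refine LipschitzOnWith.of_dist_le_mul fun z hz z' hz' => ?_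
      rw [dist_eq_norm, dist_eq_norm]
      refine (hl.nice.lip z' hz' z hz).trans ?_
      gcongr
      exact Real.le_coe_toNNReal C
    exact h1.continuousOn.continuousAt (ball_mem_nhds _ hR)
  have hsg := (symGradL (E := E)).continuous
  have e1 : ContinuousAt (fun z => fderiv ℝ (fun z => S.Q ((cotChart x).symm z)) z
      (symGradL (fderiv ℝ (fun z => S.tH ((cotChart x).symm z)) z))) z₀ :=
    hcQ.clm_apply (hsg.continuousAt.comp hcT)
  have e2 : ContinuousAt (fun z => fderiv ℝ (fun z => S.Q ((cotChart x).symm z)) z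
      (symGradL (fderiv ℝ (fun z => S.H₂ ((cotChart x).symm z)) z))) z₀ :=
    hcQ.clm_apply (hsg.continuousAt.comp hcH)
  have v1 := e1.eventually_lt (continuousAt_const (y := (0 : ℝ))) (by
    simp only [symGradL_apply]
    have heq' : fderiv ℝ (fun z => S.tH ((cotChart x).symm z)) z₀ =
      fderiv ℝ (fun z => S.H₂ ((cotChart x).symm z)) z₀ := heq
    rw [heq']; exact hval)
  have v2 := e2.eventually_lt (continuousAt_const (y := (0 : ℝ)))
    (by simp only [symGradL_apply]; exact hval)
  filter_upwards [v1, v2] with z h1 h2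
  simp only [symGradL_apply] at h1 h2
  exact ⟨h1.le, h2.le⟩

theorem exists_window_switch₂ {U : Set (E × (E →L[ℝ] ℝ))}
    (hU : U ∈ 𝓝 (cotChart (S.lam S.τ₂).1 (S.lam S.τ₂))) :
    ∃ R C ε, S.NiceBall S.τ₂ R C ∧ 0 < ε ∧ ball (cotChart (S.lam S.τ₂).1 (S.lam S.τ₂)) R ⊆ U ∧
      ∀ a b, S.τ₂ - ε ≤ a → 0 ≤ a → a < S.τ₂ → b ≤ S.T → S.τ₂ ≤ b → b ≤ S.τ₂ + ε →
        S.Good S.τ₂ → S.Good b →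
        ∃ N ∈ 𝓝 S.η₀, N ⊆ S.N₀ ∧ ∃ C', S.LocalEst S.τ₂ a b R N C' := by
  have hτ : S.τ₂ ∈ Icc S.τ₂ S.T := ⟨le_rfl, S.hτ₂.le⟩
  have hτ' : S.τ₂ ∈ Icc 0 S.T := ⟨S.τ₂_pos.le, S.hτ₂.le⟩
  obtain ⟨R, C, ε, hball, hε, hεε₀, hCεR, hCε, hsub, hframe⟩ := S.exists_frame hτ'
    (inter_mem (inter_mem hU (S.eventually_edge S.smooth₂ (S.hsing _ hτ))) S.eventually_Q_decreasing)
    (ε₀ := (S.τ₂ - S.τ₁) / 2) (by have := S.hτ₁₂; linarith)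
  have hC := hball.nonneg
  have hR : 0 < R := by have := hball.pos; linarith
  refine ⟨3 * R, C, ε, hball, hε, fun z hz => (hsub hz).1.1,
    fun a b hεa ha0 haτ hbT htb hbε hgτ hgood => ?_⟩
  have hab : a ≤ b := haτ.le.trans htb
  have hCab : C * (b - a) ≤ 1 / 2 := le_trans (mul_le_mul_of_nonneg_left (by linarith) hC) hCε
  have hCε1 : C * ε ≤ C * (2 * ε) := mul_le_mul_of_nonneg_left (by linarith) hC
  obtain ⟨N₁, hN₁, hN₁₀, ⟨C₁, hC₁, hest⟩, hF, hnm, hstay⟩ := hframe a b hεa ha0 hab hbT htb hbε hgood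
    fun h => absurd h (lt_irrefl _)
  obtain ⟨N₂, hN₂, -, L, hL, hLip, hfacts⟩ := exists_switch_facts hgτ hball hε (hCε1.trans hCεR)
    (hCε1.trans hCε) fun z hz => (hsub hz).2.1
  have ev1 : ∀ᶠ η in 𝓝 S.η₀, a < S.σ₂ η :=
    hgτ.continuousAt_σ₂.eventually (lt_mem_nhds (by rwa [S.σ₂_η₀]))
  have ev2 : ∀ᶠ η in 𝓝 S.η₀, S.σ₁ η < a :=
    hgτ.continuousAt_σ₁.eventually (gt_mem_nhds (by rw [S.σ₁_η₀]; have := S.hτ₁₂; linarith))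
  set N := (N₁ ∩ N₂) ∩ {η | a < S.σ₂ η ∧ S.σ₁ η < a}
  have hN : N ∈ 𝓝 S.η₀ := inter_mem (inter_mem hN₁ hN₂) (ev1.and ev2)
  have hN₀ : N ⊆ S.N₀ := fun η hη => hN₁₀ hη.1.1
  set x := (S.lam S.τ₂).1 with hx
  set z₀ := cotChart x (S.lam S.τ₂)
  have hmem : ∀ η ∈ N, ∀ t ∈ Icc a b, S.W t η ∈ (cotChart x).source ∧
      cotChart x (S.W t η) ∈ ball z₀ (3 * R) := fun η hη t ht =>
    ⟨(hstay η hη.1.1 t ht).1, closedBall_subset_ball (by linarith) (hstay η hη.1.1 t ht).2⟩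
  have hσI : ∀ η ∈ N, S.σ₂ η ∈ Icc a b := fun η hη =>
    ⟨hη.2.1.le, (S.order (hN₀ hη)).2.2.trans htb⟩
  have hυ : ∀ᵐ t ∂volume.restrict (Icc a b), S.τ₂ ≤ t → |S.υ t| ≤ 1 := by
    have h1 : ∀ᵐ t, t ∈ Icc S.τ₂ S.T → S.υ t ∈ Ioo 0 1 :=
      (ae_restrict_iff' measurableSet_Icc).1 S.hυ
    filter_upwards [ae_restrict_of_ae h1, ae_restrict_mem measurableSet_Icc] with t h1 ht htτ
    have := h1 ⟨htτ, ht.2.trans hbT⟩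
    exact abs_le.2 ⟨by linarith [this.1], this.2.le⟩
  set A : ℝ → Cotangent E M → ℝ := fun t ℓ =>
    if S.τ₂ ≤ t then S.tH ℓ + S.υ t * S.F₁ ℓ else S.tH ℓ with hA
  have hmode : ∀ η ∈ N, ∀ t ∈ Icc a b, S.mode η t = if S.σ₂ η ≤ t then A t else S.H₂ := by
    intro η hη t ht
    funext ℓ
    have ho := S.order (hN₀ hη)
    by_cases h1 : S.τ₂ ≤ t
    · rw [mode, if_pos h1, if_pos (ho.2.2.trans h1), hA]
      simp only [if_pos h1]
    · rw [mode, if_neg h1, hA]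
      by_cases h2 : S.σ₂ η ≤ t
      · simp only [if_pos h2, if_neg h1]
      · rw [if_neg h2, if_neg h2, if_pos (hη.2.2.le.trans ht.1)]
  have hAn : ∀ᵐ t ∂volume.restrict (Icc a b),
      NiceHam (fun z => A t ((cotChart x).symm z)) (ball z₀ (3 * R)) C := by
    filter_upwards [hυ] with t ht
    by_cases h1 : S.τ₂ ≤ t
    · simp only [hA, if_pos h1]
      exact hball.sing hτ _ (ht h1)
    · simp only [hA, if_neg h1]
      exact (hball.tilde hτ).nice
  have hfol : ∀ η ∈ N, FollowsHam (S.mode η) (fun t => S.W t η) a b := fun η hη =>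
    (S.W_follows (hN₀ hη)).mono ha0 hbT
  have hcurve : ∀ η ∈ N, HamCurve (fun t z => S.mode η t ((cotChart x).symm z))
      (fun t => cotChart x (S.W t η)) a b C := fun η hη =>
    (hfol η hη).2 x a b _ C le_rfl hab le_rfl (hmem η hη)
      (hball.nice_mode hbT (hN₀ hη) (Or.inl hτ))
  have hF' : ∀ η ∈ N, ∀ t ∈ Icc a b, S.σ₂ η ≤ t → S.F₁ (S.W t η) = 0 := by
    intro η hη t ht htσ
    rw [← hF htb η hη.1.1]
    refine F₁_eq_of_follows (a := t) (b := b) hball hτ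
      ((hfol η hη).mono ht.1 le_rfl) ht.2
      (fun s hs => hmem η hη s ⟨ht.1.trans hs.1, hs.2⟩) ?_
    filter_upwards [ae_restrict_Icc_mono hυ ht.1 le_rfl, ae_restrict_mem measurableSet_Icc]
      with s h1 hs
    have hsσ := htσ.trans hs.1
    by_cases h2 : S.τ₂ ≤ s
    · exact ⟨S.υ s, h1 h2, funext fun ℓ => by rw [mode, if_pos h2]⟩
    · exact ⟨0, by simp, funext fun ℓ => by rw [mode, if_neg h2, if_pos hsσ, zero_mul, add_zero]⟩
  have hbefore : ∀ η ∈ N, ∀ t ∈ Icc a (S.σ₂ η), ∀ G : Cotangent E M → ℝ,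
      (∀ z ∈ ball z₀ (3 * R), DifferentiableAt ℝ (fun z => G ((cotChart x).symm z)) z ∧
        ‖fderiv ℝ (fun z => G ((cotChart x).symm z)) z‖ ≤ C) →
      (∀ r ∈ Ioo t (S.σ₂ η), 0 ≤ fderiv ℝ (fun z => G ((cotChart x).symm z)) (cotChart x (S.W r η))
        (symGrad (fderiv ℝ (fun z => S.H₂ ((cotChart x).symm z)) (cotChart x (S.W r η))))) →
      G (S.W t η) ≤ G (S.W (S.σ₂ η) η) := by
    intro η hη t ht G hG hd
    have hI := hσI η hη
    have h1 := ((hcurve η hη).mono ht.1 hI.2).mul_sub_le_comp (κ := 0) ht.2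
      (convex_ball z₀ (3 * R)) (fun s hs => (hmem η hη s ⟨ht.1.trans hs.1, hs.2.trans hI.2⟩).2) hG (by
        filter_upwards [ae_mem_Ioo t (S.σ₂ η)] with r hr
        have hm := hmode η hη r ⟨ht.1.trans hr.1.le, hr.2.le.trans hI.2⟩
        rw [if_neg (not_le.2 hr.2)] at hm
        rw [hm]
        exact hd r hr)
    have h2 : 0 * (S.σ₂ η - t) ≤ G ((cotChart x).symm (cotChart x (S.W (S.σ₂ η) η))) -
      G ((cotChart x).symm (cotChart x (S.W t η))) := h1
    rw [(cotChart x).left_inv (hmem η hη _ hI).1,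
      (cotChart x).left_inv (hmem η hη t ⟨ht.1, ht.2.trans hI.2⟩).1] at h2
    linarith
  have hQ' : ∀ η ∈ N, ∀ t ∈ Icc a (S.σ₂ η), 0 ≤ S.Q (S.W t η) := by
    intro η hη t ht
    have hI := hσI η hη
    have hneg : ∀ z ∈ ball z₀ (3 * R), HasFDerivAt (fun z => -S.Q ((cotChart x).symm z))
        (-fderiv ℝ (fun z => S.Q ((cotChart x).symm z)) z) z := fun z hz =>
      (hball.diffQ z hz).1.hasFDerivAt.neg
    have h1 := hbefore η hη t ht (fun ℓ => -S.Q ℓ) (fun z hz => ⟨(hneg z hz).differentiableAt, by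
        rw [(hneg z hz).fderiv, norm_neg]; exact (hball.diffQ z hz).2⟩) fun r hr => by
      have hm := (hmem η hη r ⟨ht.1.trans hr.1.le, hr.2.le.trans hI.2⟩).2
      rw [(hneg _ hm).fderiv, neg_apply]
      exact neg_nonneg.2 (hsub hm).2.2
    have h2 := (hfacts η hη.1.2).2.1
    linarith
  have hFneg : ∀ η ∈ N, ∀ t ∈ Icc a (S.σ₂ η), S.F₁ (S.W t η) ≤ 0 := by
    intro η hη t ht
    have hI := hσI η hη
    refine (hbefore η hη t ht S.F₁ (fun z hz => ⟨hball.niceF.diff z hz, hball.niceF.bound z hz⟩)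
      fun r hr => ?_).trans_eq (hF' η hη _ hI le_rfl)
    have hrI : r ∈ Icc a b := ⟨ht.1.trans hr.1.le, hr.2.le.trans hI.2⟩
    rw [← poisson_eq_fderiv (S.cotSmooth₂.mdifferentiableAt _) (S.cotSmoothF.mdifferentiableAt _)
      (hmem η hη r hrI).1, S.poissonF]
    exact hQ' η hη r ⟨hrI.1, hr.2.le⟩
  have hσL : ∀ η ∈ N, ∀ η' ∈ N, |S.σ₂ η' - S.σ₂ η| ≤ L * ‖η' - η‖ := by
    intro η hη η' hη'
    have h1 := abs_min_sub_min_le_max (S.t₂ (S.W S.τ₂ η')) S.τ₂ (S.t₂ (S.W S.τ₂ η)) S.τ₂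
    rw [sub_self, abs_zero, max_eq_left (abs_nonneg _)] at h1
    exact h1.trans (hLip η hη.1.2 η' hη'.1.2)
  refine ⟨N, hN, hN₀, NiceBall.localEst (A := A) (B := fun _ => S.H₂) (σ := S.σ₂)
    (K := L + (L * L + 2 * C * (C * L))) hball ha0
    hab hbT hCab hN₀ hmem (fun η hη => ?_) (fun η hη => hnm η hη.1.1) hAn
    (ae_of_all _ fun _ => hball.nice₂) hC₁ (by positivity) (fun η hη η' hη' => ?_)
    (fun η hη η' hη' => ?_) (hest.mono (fun η hη => hη.1.1) le_rfl)
    (fun η hη t ht h1 => hF' η hη t ht ((S.order (hN₀ hη)).2.2.trans h1)) fun i η hη => ?_⟩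
  · filter_upwards [ae_restrict_mem measurableSet_Icc] with t ht
    exact hmode η hη t ht
  · refine (hσL η hη η' hη').trans ?_
    gcongr
    have : 0 ≤ L * L + 2 * C * (C * L) := by positivity
    linarith
  · have hne : ∀ᵐ t ∂volume.restrict (Icc a b), t ≠ S.τ₂ :=
      ae_restrict_of_ae (Measure.ae_ne volume S.τ₂)
    filter_upwards [hne, ae_restrict_mem measurableSet_Icc] with t htne ht htm
    have hlt : t < S.τ₂ := lt_of_le_of_ne
      (htm.2.trans (max_le (S.order (hN₀ hη)).2.2 (S.order (hN₀ hη')).2.2)) htne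
    simp only [hA, if_neg (not_le.2 hlt)]
    have hts : |t - S.σ₂ η| ≤ L * ‖η' - η‖ := by
      refine le_trans ?_ (hσL η hη η' hη')
      have h1 := abs_sub_left_of_mem_uIcc (show t ∈ uIcc (S.σ₂ η) (S.σ₂ η') from htm)
      exact h1
    have hgp := abs_sub_sub_le_of_nice (hball.tilde hτ).nice hball.nice₂ hC
      (hmem η hη _ (hσI η hη)) (hmem η hη t ht) ((hcurve η hη).lip t ht _ (hσI η hη))
    have h0 := (hfacts η hη.1.2).1
    have hpos : max (S.t₂ (S.W S.τ₂ η) - S.τ₂) 0 ≤ L * ‖η' - η‖ := by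
      refine max_le ?_ (by positivity)
      rcases le_total (S.t₂ (S.W S.τ₂ η)) S.τ₂ with h | h
      · have : 0 ≤ L * ‖η' - η‖ := by positivity
        linarith
      · have h1 : S.σ₂ η = S.τ₂ := min_eq_right h
        have h2 : S.σ₂ η' < S.τ₂ := by
          by_contra hcon
          have h3 : S.τ₂ ≤ min (S.σ₂ η) (S.σ₂ η') := le_min h1.ge (not_lt.1 hcon)
          exact absurd (h3.trans htm.1) (not_le.2 hlt)
        have h3 : S.t₂ (S.W S.τ₂ η') < S.τ₂ := by
          by_contra hcon
          have : S.σ₂ η' = S.τ₂ := min_eq_right (not_lt.1 hcon)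
          linarith
        have h4 := (abs_le.1 (hLip η hη.1.2 η' hη'.1.2)).1
        linarith
    set G := S.tH (S.W t η) - S.H₂ (S.W t η) with hGd
    set G' := S.tH (S.W (S.σ₂ η) η) - S.H₂ (S.W (S.σ₂ η) η) with hGd'
    have e1 : |G| ≤ |G'| + |G - G'| := by
      have := abs_add_le G' (G - G')
      rwa [add_sub_cancel] at this
    have e2 : L * max (S.t₂ (S.W S.τ₂ η) - S.τ₂) 0 ≤ L * (L * ‖η' - η‖) := by gcongr
    have e3 : 2 * C * (C * |t - S.σ₂ η|) ≤ 2 * C * (C * (L * ‖η' - η‖)) := by gcongr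
    have e4 : 0 ≤ L * ‖η' - η‖ := by positivity
    calc |G| ≤ L * (L * ‖η' - η‖) + 2 * C * (C * (L * ‖η' - η‖)) := by
          change |S.tH (S.W t η) - S.H₂ (S.W t η) - (S.tH (S.W (S.σ₂ η) η) -
            S.H₂ (S.W (S.σ₂ η) η))| ≤ _ at hgp
          rw [← hGd, ← hGd'] at hgp
          linarith
      _ ≤ (L + (L * L + 2 * C * (C * L))) * ‖η' - η‖ := by linarith
  · filter_upwards [ae_restrict_mem measurableSet_Icc] with t ht
    have hzm := hmem η hη t ht
    have hi := (hsub hzm.2).1.2 i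
    rw [(cotChart x).left_inv hzm.1] at hi
    by_cases h1 : S.σ₂ η ≤ t
    · have hF0 := hF' η hη t ht h1
      have h2 : S.mode η t (S.W t η) = S.tH (S.W t η) := by
        rw [hmode η hη t ht, if_pos h1, hA]
        simp only [hF0, mul_zero, add_zero, ite_self]
      rw [h2]
      exact lift_le_tH hball hτ hzm.1 hzm.2 hF0 hi
    · rw [hmode η hη t ht, if_neg h1]
      rcases hi with ⟨s, hs, hi⟩ | hi
      · rw [hi, lift_add_smul_sub, ← S.F₁_eq]
        have h2 := mul_nonpos_of_nonneg_of_nonpos hs.1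
          (hFneg η hη t ⟨ht.1, (not_le.1 h1).le⟩)
        simp only [H₂]
        linarith
      · exact hi.le

end Extremal

end

section

/-- Downward induction on an interval. -/
theorem forall_Icc_of_step_left {P : ℝ → Prop} {α β : ℝ} (hβ : P β)
    (h : ∀ t₀ ∈ Icc α β, ∃ ε > 0, ∀ b, t₀ ≤ b → b ≤ t₀ + ε → b ≤ β → (t₀ < b ∨ t₀ = β) → P b →
      ∀ t ∈ Icc (max α (t₀ - ε)) b, P t) : ∀ t ∈ Icc α β, P t := by
  intro t ht
  have hαβ := ht.1.trans ht.2
  set B := {t | t ∈ Icc α β ∧ ∀ s ∈ Icc t β, P s}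
  have hβB : β ∈ B := ⟨⟨hαβ, le_rfl⟩, fun s hs => by rwa [le_antisymm hs.2 hs.1]⟩
  have hbdd : BddBelow B := ⟨α, fun t ht => ht.1.1⟩
  set σ := sInf B
  have hσα : α ≤ σ := le_csInf ⟨β, hβB⟩ fun t ht => ht.1.1
  have hσβ : σ ≤ β := csInf_le hbdd hβB
  obtain ⟨ε, hε, hstep⟩ := h σ ⟨hσα, hσβ⟩
  obtain ⟨b', hb'B, hb'⟩ := exists_lt_of_csInf_lt ⟨β, hβB⟩ (show sInf B < σ + ε by linarith)
  set b := max b' (min (σ + ε) β)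
  have hb'b : b' ≤ b := le_max_left _ _
  have hσb : σ ≤ b := (csInf_le hbdd hb'B).trans hb'b
  have hbβ : b ≤ β := max_le hb'B.1.2 (min_le_right _ _)
  have hbP : ∀ s ∈ Icc b β, P s := fun s hs => hb'B.2 s ⟨hb'b.trans hs.1, hs.2⟩
  have hlt : σ < b ∨ σ = β := by
    rcases hσβ.lt_or_eq with h1 | h1
    · exact Or.inl ((lt_min (by linarith) h1).trans_le (le_max_right _ _))
    · exact Or.inr h1
  have hnew := hstep b hσb (max_le hb'.le (min_le_left _ _)) hbβ hlt (hbP b ⟨le_rfl, hbβ⟩)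
  have hmem : max α (σ - ε) ∈ B := by
    refine ⟨⟨le_max_left _ _, max_le hαβ (by linarith)⟩, fun s hs => ?_⟩
    rcases le_total s b with h1 | h1
    · exact hnew s ⟨hs.1, h1⟩
    · exact hbP s ⟨h1, hs.2⟩
  have h1 : σ ≤ max α (σ - ε) := csInf_le hbdd hmem
  have h2 : max α (σ - ε) = α := by
    rcases le_max_iff.1 h1 with h2 | h2
    · exact max_eq_left (by linarith)
    · linarith
  rw [h2] at hmem
  exact hmem.2 t ht

variable {E : Type*} [NormedAddCommGroup E] [NormedSpace ℝ E] [FiniteDimensional ℝ E]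
  {M : Type*} [TopologicalSpace M] [ChartedSpace E M] [IsManifold 𝓘(ℝ, E) ∞ M]

namespace Extremal

variable (S : Extremal E M)

theorem poisson_H₂_sub (ℓ : Cotangent E M) :
    poisson S.H₂ (fun ℓ => S.H₂ ℓ - S.H₁ ℓ) ℓ = poisson S.H₁ S.H₂ ℓ := by
  have h1 := poisson_sub_right (F := S.H₂) S.cotSmooth₂ S.cotSmooth₁ ℓ
  have h2 := poisson_neg_symm (F := S.H₂) (G := S.H₂) ℓ
  have h3 := poisson_neg_symm (F := S.H₂) (G := S.H₁) ℓ
  rw [h1]; linarith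

theorem poisson_H₁_sub (ℓ : Cotangent E M) :
    poisson S.H₁ (fun ℓ => S.H₂ ℓ - S.H₁ ℓ) ℓ = poisson S.H₁ S.H₂ ℓ := by
  have h1 := poisson_sub_right (F := S.H₁) S.cotSmooth₂ S.cotSmooth₁ ℓ
  have h2 := poisson_neg_symm (F := S.H₁) (G := S.H₁) ℓ
  rw [h1]; linarith

variable [T2Space M]

variable {S} in
theorem Good.eventually_switch (hg : S.Good S.τ₂) :
    ∀ᶠ η in 𝓝 S.η₀, S.H₂ (S.W (S.σ₁ η) η) = S.H₁ (S.W (S.σ₁ η) η) := by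
  obtain ⟨R, C, ε, hball, hε, -, h1, h2, hsub, -⟩ := S.exists_frame
    ⟨S.τ₂_pos.le, S.hτ₂.le⟩ S.eventually_Q_decreasing one_pos
  have h3 : C * ε ≤ C * (2 * ε) := mul_le_mul_of_nonneg_left (by linarith) hball.nonneg
  obtain ⟨N, hN, -, _, -, -, h⟩ := exists_switch_facts hg hball hε (h3.trans h1) (h3.trans h2)
    fun z hz => (hsub hz).1
  filter_upwards [hN] with η hη
  exact (h η hη).2.2

theorem exists_window_switch₁ (hgτ : S.Good S.τ₂) {U : Set (E × (E →L[ℝ] ℝ))}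
    (hU : U ∈ 𝓝 (cotChart (S.lam S.τ₁).1 (S.lam S.τ₁))) :
    ∃ R C ε, S.NiceBall S.τ₁ R C ∧ 0 < ε ∧ ball (cotChart (S.lam S.τ₁).1 (S.lam S.τ₁)) R ⊆ U ∧
      ∀ a b, S.τ₁ - ε ≤ a → 0 ≤ a → a < S.τ₁ → S.τ₁ < b → b ≤ S.τ₁ + ε → S.Good b →
        ∃ N ∈ 𝓝 S.η₀, N ⊆ S.N₀ ∧ ∃ C', S.LocalEst S.τ₁ a b R N C' := by
  have hτT : S.τ₁ < S.T := S.hτ₁₂.trans S.hτ₂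
  have hτ' : S.τ₁ ∈ Icc 0 S.T := ⟨S.hτ₁.le, hτT.le⟩
  set κ := poisson S.H₁ S.H₂ (S.lam S.τ₁) / 2 with hκ
  have hκ0 : 0 < κ := by have := S.hswitch.1; simp only [hκ, H₁, H₂]; linarith
  have hκev := eventually_symm_lt (ℓ := S.lam S.τ₁) (F := fun _ => κ) (G := poisson S.H₁ S.H₂)
    continuous_const (S.cotSmooth₁.poisson S.cotSmooth₂).continuousOn
    (by simp only [hκ] at hκ0 ⊢; linarith)
  obtain ⟨R, C, ε, hball, hε, hεε₀, hCεR, hCε, hsub, hframe⟩ := S.exists_frame hτ'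
    (inter_mem (inter_mem hU (S.eventually_edge S.smooth₁ S.hsimple)) hκev)
    (ε₀ := (S.τ₂ - S.τ₁) / 2) (by have := S.hτ₁₂; linarith)
  have hC := hball.nonneg
  have hR : 0 < R := by have := hball.pos; linarith
  refine ⟨3 * R, C, ε, hball, hε, fun z hz => (hsub hz).1.1,
    fun a b hεa ha0 haτ htb hbε hgood => ?_⟩
  have hab : a ≤ b := (haτ.trans htb).le
  have hbτ : b < S.τ₂ := by have := S.hτ₁₂; linarith
  have hbT : b ≤ S.T := (hbτ.trans S.hτ₂).le
  have hCab : C * (b - a) ≤ 1 / 2 := le_trans (mul_le_mul_of_nonneg_left (by linarith) hC) hCε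
  have evσ₂ : ∀ᶠ η in 𝓝 S.η₀, b < S.σ₂ η :=
    hgτ.continuousAt_σ₂.eventually (lt_mem_nhds (by rwa [S.σ₂_η₀]))
  obtain ⟨N₁, hN₁, hN₁₀, ⟨C₁, hC₁, hest⟩, hF, hnm, hstay⟩ := hframe a b hεa ha0 hab hbT htb.le hbε
    hgood fun _ => evσ₂
  have ev1 : ∀ᶠ η in 𝓝 S.η₀, a < S.σ₁ η :=
    hgτ.continuousAt_σ₁.eventually (lt_mem_nhds (by rwa [S.σ₁_η₀]))
  have ev2 : ∀ᶠ η in 𝓝 S.η₀, S.σ₁ η < b :=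
    hgτ.continuousAt_σ₁.eventually (gt_mem_nhds (by rwa [S.σ₁_η₀]))
  set N := N₁ ∩ ({η | b < S.σ₂ η ∧ S.H₂ (S.W (S.σ₁ η) η) = S.H₁ (S.W (S.σ₁ η) η)} ∩
    {η | a < S.σ₁ η ∧ S.σ₁ η < b})
  have hN : N ∈ 𝓝 S.η₀ :=
    inter_mem hN₁ (inter_mem (evσ₂.and hgτ.eventually_switch) (ev1.and ev2))
  have hN₀ : N ⊆ S.N₀ := fun η hη => hN₁₀ hη.1
  set x := (S.lam S.τ₁).1 with hx
  set z₀ := cotChart x (S.lam S.τ₁)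
  have hmem : ∀ η ∈ N, ∀ t ∈ Icc a b, S.W t η ∈ (cotChart x).source ∧
      cotChart x (S.W t η) ∈ ball z₀ (3 * R) := fun η hη t ht =>
    ⟨(hstay η hη.1 t ht).1, closedBall_subset_ball (by linarith) (hstay η hη.1 t ht).2⟩
  have hσI : ∀ η ∈ N, S.σ₁ η ∈ Icc a b := fun η hη => ⟨hη.2.2.1.le, hη.2.2.2.le⟩
  have hmode : ∀ η ∈ N, ∀ t ∈ Icc a b, S.mode η t = if S.σ₁ η ≤ t then S.H₂ else S.H₁ := by
    intro η hη t ht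
    funext ℓ
    rw [mode, if_neg (not_le.2 (ht.2.trans_lt hbτ)), if_neg (not_le.2 (ht.2.trans_lt hη.2.1.1))]
    split_ifs <;> rfl
  have hfol : ∀ η ∈ N, FollowsHam (S.mode η) (fun t => S.W t η) a b := fun η hη =>
    (S.W_follows (hN₀ hη)).mono ha0 hbT
  have hcurve : ∀ η ∈ N, HamCurve (fun t z => S.mode η t ((cotChart x).symm z))
      (fun t => cotChart x (S.W t η)) a b C := fun η hη =>
    (hfol η hη).2 x a b _ C le_rfl hab le_rfl (hmem η hη)
      (hball.nice_mode hbT (hN₀ hη) (Or.inr hη.2.1.1))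
  set K : Cotangent E M → ℝ := fun ℓ => S.H₂ ℓ - S.H₁ ℓ with hKdef
  have hKs : CotSmooth K := S.cotSmooth₂.sub S.cotSmooth₁
  have hKd : ∀ z ∈ ball z₀ (3 * R), DifferentiableAt ℝ (fun z => K ((cotChart x).symm z)) z ∧
      ‖fderiv ℝ (fun z => K ((cotChart x).symm z)) z‖ ≤ C + C := by
    intro z hz
    have h1 : HasFDerivAt (fun z => K ((cotChart x).symm z)) _ z :=
      (hball.nice₂.diff z hz).hasFDerivAt.sub (hball.nice₁.diff z hz).hasFDerivAt
    refine ⟨h1.differentiableAt, ?_⟩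
    rw [h1.fderiv]
    exact (norm_sub_le _ _).trans (add_le_add (hball.nice₂.bound z hz) (hball.nice₁.bound z hz))
  have hinc : ∀ η ∈ N, ∀ s ∈ Icc a b, ∀ t ∈ Icc a b, s ≤ t →
      κ * (t - s) ≤ K (S.W t η) - K (S.W s η) := by
    intro η hη s hs t ht hst
    have h1 := ((hcurve η hη).mono hs.1 ht.2).mul_sub_le_comp (κ := κ) hst
      (convex_ball z₀ (3 * R)) (fun r hr => (hmem η hη r ⟨hs.1.trans hr.1, hr.2.trans ht.2⟩).2) hKd (by
        filter_upwards [ae_restrict_mem measurableSet_Icc] with r hr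
        have hrI : r ∈ Icc a b := ⟨hs.1.trans hr.1, hr.2.trans ht.2⟩
        have hm := hmem η hη r hrI
        have hk := (hsub hm.2).2
        simp only [Set.mem_ofPred_eq, (cotChart x).left_inv hm.1] at hk
        rw [hmode η hη r hrI]
        split_ifs
        · rw [← poisson_eq_fderiv (S.cotSmooth₂.mdifferentiableAt _) (hKs.mdifferentiableAt _) hm.1,
            hKdef, S.poisson_H₂_sub]
          exact hk.le
        · rw [← poisson_eq_fderiv (S.cotSmooth₁.mdifferentiableAt _) (hKs.mdifferentiableAt _) hm.1,
            hKdef, S.poisson_H₁_sub]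
          exact hk.le)
    have h2 : κ * (t - s) ≤ K ((cotChart x).symm (cotChart x (S.W t η))) -
      K ((cotChart x).symm (cotChart x (S.W s η))) := h1
    rwa [(cotChart x).left_inv (hmem η hη _ ht).1, (cotChart x).left_inv (hmem η hη _ hs).1] at h2
  have hK0 : ∀ η ∈ N, K (S.W (S.σ₁ η) η) = 0 := fun η hη => sub_eq_zero.2 hη.2.1.2
  have hLip : ∀ η ∈ N, ∀ η' ∈ N, S.σ₁ η ≤ S.σ₁ η' →
      S.σ₁ η' - S.σ₁ η ≤ (4 * C * C₁ / κ) * ‖η' - η‖ := by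
    intro η hη η' hη' hle
    set s' := S.σ₁ η' with hs'
    have hI := hσI η hη
    have hI' := hσI η' hη'
    have h1 := hinc η hη _ hI s' hI' hle
    rw [hK0 η hη, sub_zero] at h1
    have hm2 : ∀ η₁ ∈ N, S.σ₁ η₁ ≤ s' → FollowsHam (fun _ => S.H₂) (fun t => S.W t η₁) s' b := by
      intro η₁ hη₁ hle₁
      refine ((hfol η₁ hη₁).mono hI'.1 le_rfl).congr ?_
      filter_upwards [ae_restrict_mem measurableSet_Icc] with t ht
      rw [hmode η₁ hη₁ t ⟨hI'.1.trans ht.1, ht.2⟩, if_pos (hle₁.trans ht.1)]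
    have hm2' : ∀ η₁ ∈ N, S.σ₁ η₁ ≤ s' → HamCurve (fun _ z => S.H₂ ((cotChart x).symm z))
        (fun t => cotChart x (S.W t η₁)) s' b C := fun η₁ hη₁ hle₁ =>
      (hm2 η₁ hη₁ hle₁).2 x s' b _ C le_rfl hI'.2 le_rfl
        (fun t ht => hmem η₁ hη₁ t ⟨hI'.1.trans ht.1, ht.2⟩) (ae_of_all _ fun _ => hball.nice₂)
    have hd := norm_sub_le_of_hamCurve (α := 0) (β := 0) (hm2' η hη hle) (hm2' η' hη' le_rfl)
      (fun t ht => (hmem η hη t ⟨hI'.1.trans ht.1, ht.2⟩).2)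
      (fun t ht => (hmem η' hη' t ⟨hI'.1.trans ht.1, ht.2⟩).2)
      (ae_of_all _ fun _ => hball.nice₂) (ae_of_all _ fun _ => hball.nice₂) le_rfl (fun _ _ => rfl)
      hC (le_trans (mul_le_mul_of_nonneg_left (by linarith [hI'.1]) hC) hCab) ⟨hI'.2, le_rfl⟩
      s' ⟨le_rfl, hI'.2⟩
    have he := ((hest η hη.1).2 η' hη'.1).1
    simp only [sub_self, mul_zero, add_zero] at hd
    have hgp := abs_sub_sub_le_of_nice hball.nice₂ hball.nice₁ hC (hmem η hη s' hI')
      (hmem η' hη' s' hI') hd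
    have h0 := hK0 η' hη'
    simp only [hKdef] at h0 h1
    rw [← hs'] at h0
    rw [h0, zero_sub, abs_neg] at hgp
    have h2 := le_abs_self (S.H₂ (S.W s' η) - S.H₁ (S.W s' η))
    have h3 : 2 * C * (2 * ‖cotChart x (S.W b η') - cotChart x (S.W b η)‖) ≤
      2 * C * (2 * (C₁ * ‖η' - η‖)) := by gcongr
    have h4 : κ * (s' - S.σ₁ η) ≤ 4 * C * C₁ * ‖η' - η‖ := by linarith
    rw [div_mul_eq_mul_div, le_div_iff₀ hκ0]
    linarith
  have hσL : ∀ η ∈ N, ∀ η' ∈ N, |S.σ₁ η' - S.σ₁ η| ≤ (4 * C * C₁ / κ) * ‖η' - η‖ := by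
    intro η hη η' hη'
    rcases le_total (S.σ₁ η) (S.σ₁ η') with h | h
    · rw [abs_of_nonneg (sub_nonneg.2 h)]
      exact hLip η hη η' hη' h
    · rw [abs_sub_comm, abs_of_nonneg (sub_nonneg.2 h), norm_sub_rev]
      exact hLip η' hη' η hη h
  set L := 4 * C * C₁ / κ
  have hL0 : 0 ≤ L := by positivity
  refine ⟨N, hN, hN₀, NiceBall.localEst (A := fun _ => S.H₂) (B := fun _ => S.H₁) (σ := S.σ₁)
    (K := L + 2 * C * (C * L)) hball ha0
    hab hbT hCab hN₀ hmem (fun η hη => ?_) (fun η hη => hnm η hη.1)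
    (ae_of_all _ fun _ => hball.nice₂)
    (ae_of_all _ fun _ => hball.nice₁) hC₁ (by positivity) (fun η hη η' hη' => ?_)
    (fun η hη η' hη' => ?_) (hest.mono (fun η hη => hη.1) le_rfl)
    (fun η hη t ht h1 => absurd (h1.trans ht.2) (not_le.2 hbτ)) fun i η hη => ?_⟩
  · filter_upwards [ae_restrict_mem measurableSet_Icc] with t ht
    exact hmode η hη t ht
  · refine (hσL η hη η' hη').trans ?_
    gcongr
    have : 0 ≤ 2 * C * (C * L) := by positivity
    linarith
  · filter_upwards [ae_restrict_mem measurableSet_Icc] with t ht htm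
    have hts : |t - S.σ₁ η| ≤ L * ‖η' - η‖ := by
      refine le_trans ?_ (hσL η hη η' hη')
      exact abs_sub_left_of_mem_uIcc (show t ∈ uIcc (S.σ₁ η) (S.σ₁ η') from htm)
    have hgp := abs_sub_sub_le_of_nice hball.nice₂ hball.nice₁ hC
      (hmem η hη _ (hσI η hη)) (hmem η hη t ht) ((hcurve η hη).lip t ht _ (hσI η hη))
    have h0 := hK0 η hη
    simp only [hKdef] at h0
    rw [h0, sub_zero] at hgp
    refine hgp.trans ?_
    have e3 : 2 * C * (C * |t - S.σ₁ η|) ≤ 2 * C * (C * (L * ‖η' - η‖)) := by gcongr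
    have e4 : 0 ≤ L * ‖η' - η‖ := by positivity
    linarith
  · filter_upwards [ae_restrict_mem measurableSet_Icc] with t ht
    have hzm := hmem η hη t ht
    have hi := (hsub hzm.2).1.2 i
    rw [(cotChart x).left_inv hzm.1] at hi
    have hI := hσI η hη
    have h0 := hK0 η hη
    rw [hmode η hη t ht]
    by_cases h1 : S.σ₁ η ≤ t
    · rw [if_pos h1]
      have h2 := hinc η hη _ hI t ht h1
      have h3 : 0 ≤ κ * (t - S.σ₁ η) := mul_nonneg hκ0.le (sub_nonneg.2 h1)
      rw [h0, sub_zero] at h2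
      simp only [hKdef] at h2
      rcases hi with ⟨s, hs, hi⟩ | hi
      · rw [hi, lift_add_smul_sub]
        have h4 : 0 ≤ (1 - s) * (S.H₂ (S.W t η) - S.H₁ (S.W t η)) :=
          mul_nonneg (by linarith [hs.2]) (by linarith)
        simp only [H₂, H₁] at *
        linarith
      · simp only [H₂, H₁] at *
        linarith
    · rw [if_neg h1]
      have h2 := hinc η hη t ht _ hI (not_le.1 h1).le
      have h3 : 0 ≤ κ * (S.σ₁ η - t) := mul_nonneg hκ0.le (sub_nonneg.2 (not_le.1 h1).le)
      rw [h0, zero_sub] at h2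
      simp only [hKdef] at h2
      rcases hi with ⟨s, hs, hi⟩ | hi
      · rw [hi, lift_add_smul_sub]
        have h4 : s * (S.H₂ (S.W t η) - S.H₁ (S.W t η)) ≤ 0 :=
          mul_nonpos_of_nonneg_of_nonpos hs.1 (by linarith)
        simp only [H₂, H₁] at *
        linarith
      · exact hi.le

end Extremal

end

section

variable {E : Type*} [NormedAddCommGroup E] [NormedSpace ℝ E] [FiniteDimensional ℝ E]
  {M : Type*} [TopologicalSpace M] [ChartedSpace E M] [IsManifold 𝓘(ℝ, E) ∞ M]

namespace Extremal

variable (S : Extremal E M) [T2Space M]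

theorem good_singular : ∀ t ∈ Icc S.τ₂ S.T, S.Good t := by
  refine forall_Icc_of_step_left S.good_T fun t₀ ht₀ => ?_
  obtain ⟨R, C, ε, -, hε, -, -, h⟩ := S.exists_window_singular ht₀ univ_mem one_pos
  refine ⟨ε, hε, fun b htb hbε hbT hb hgood t ht => ?_⟩
  have hab : max S.τ₂ (t₀ - ε) ≤ b := max_le (ht₀.1.trans htb) (by linarith)
  rcases hab.lt_or_eq with hab | hab
  · obtain ⟨N, hN, hN₀, C', hloc⟩ := h _ b (le_max_right _ _) (le_max_left _ _) hab.le hbT htb hbε hgood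
    exact hloc.good hN hN₀ (hloc.nonneg hab ⟨_, mem_of_mem_nhds hN⟩)
      (S.τ₂_pos.le.trans (le_max_left _ _)) hbT ht
  · rw [hab] at ht
    rwa [le_antisymm ht.2 ht.1]

theorem good_τ₂ : S.Good S.τ₂ := S.good_singular _ ⟨le_rfl, S.hτ₂.le⟩

theorem exists_window {t₀ : ℝ} (ht₀ : t₀ ∈ Icc 0 S.T)
    {U : Set (E × (E →L[ℝ] ℝ))} (hU : U ∈ 𝓝 (cotChart (S.lam t₀).1 (S.lam t₀))) :
    ∃ R C ε, S.NiceBall t₀ R C ∧ 0 < ε ∧ ball (cotChart (S.lam t₀).1 (S.lam t₀)) R ⊆ U ∧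
      ∀ a b, t₀ - ε ≤ a → 0 ≤ a → (a < t₀ ∨ t₀ = 0) → a < b → t₀ ≤ b → (t₀ < b ∨ S.τ₂ ≤ t₀) →
        b ≤ S.T → b ≤ t₀ + ε → S.Good b → ∃ N ∈ 𝓝 S.η₀, N ⊆ S.N₀ ∧ ∃ C', S.LocalEst t₀ a b R N C' := by
  have hτ₁ := S.hτ₁
  have hτ₁₂ := S.hτ₁₂
  have hτ₂ := S.hτ₂
  have hσ₁ := S.good_τ₂.continuousAt_σ₁
  have hσ₂ := S.good_τ₂.continuousAt_σ₂
  have hord : ∀ᶠ η in 𝓝 S.η₀, S.σ₁ η < S.σ₂ η :=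
    hσ₁.eventually_lt hσ₂ (by rwa [S.σ₁_η₀, S.σ₂_η₀])
  rcases lt_trichotomy t₀ S.τ₁ with h | rfl | h
  · have e1 : ∀ᶠ η in 𝓝 S.η₀, (t₀ + S.τ₁) / 2 < S.σ₁ η :=
      hσ₁.eventually (lt_mem_nhds (by rw [S.σ₁_η₀]; linarith))
    obtain ⟨R, C, ε, hb, hε, hsub, hw⟩ := S.exists_window_bang ht₀ S.hh₁ (S.hbang.1 t₀ ⟨ht₀.1, h⟩)
      (α := t₀ - 1) (β := (t₀ + S.τ₁) / 2) (by linarith) (by linarith) (by linarith) (by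
        filter_upwards [e1, hord] with η h1 h2 t ht _
        refine ⟨by linarith [ht.2], funext fun ℓ => ?_⟩
        simp only [mode]
        rw [if_neg (by linarith [ht.2]), if_neg (by linarith [ht.2]), if_neg (by linarith [ht.2])])
      hU
    exact ⟨R, C, ε, hb, hε, hsub, fun a b h1 h2 _ h4 h5 _ _ h8 h9 => hw a b h1 h2 h4.le h5 h8 h9⟩
  · obtain ⟨R, C, ε, hb, hε, hsub, hw⟩ := S.exists_window_switch₁ S.good_τ₂ hU
    refine ⟨R, C, ε, hb, hε, hsub, fun a b h1 h2 h3 h4 h5 h6 _ h8 h9 => hw a b h1 h2 ?_ ?_ h8 h9⟩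
    · exact h3.resolve_right hτ₁.ne'
    · exact h6.resolve_right (by linarith)
  rcases lt_trichotomy t₀ S.τ₂ with h' | rfl | h'
  · have e1 : ∀ᶠ η in 𝓝 S.η₀, S.σ₁ η < (t₀ + S.τ₁) / 2 :=
      hσ₁.eventually (gt_mem_nhds (by rw [S.σ₁_η₀]; linarith))
    have e2 : ∀ᶠ η in 𝓝 S.η₀, (t₀ + S.τ₂) / 2 < S.σ₂ η :=
      hσ₂.eventually (lt_mem_nhds (by rw [S.σ₂_η₀]; linarith))
    obtain ⟨R, C, ε, hb, hε, hsub, hw⟩ := S.exists_window_bang ht₀ S.hh₂ (S.hbang.2 t₀ ⟨h, h'⟩)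
      (α := (t₀ + S.τ₁) / 2) (β := (t₀ + S.τ₂) / 2) (by linarith) (by linarith) (by linarith) (by
        filter_upwards [e1, e2] with η h1 h2 t ht _
        refine ⟨by linarith [ht.2], funext fun ℓ => ?_⟩
        simp only [mode]
        rw [if_neg (by linarith [ht.2]), if_neg (by linarith [ht.2]), if_pos (by linarith [ht.1])])
      hU
    exact ⟨R, C, ε, hb, hε, hsub, fun a b h1 h2 _ h4 h5 _ _ h8 h9 => hw a b h1 h2 h4.le h5 h8 h9⟩
  · obtain ⟨R, C, ε, hb, hε, hsub, hw⟩ := S.exists_window_switch₂ hU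
    exact ⟨R, C, ε, hb, hε, hsub, fun a b h1 h2 h3 h4 h5 h6 h7 h8 h9 =>
      hw a b h1 h2 (h3.resolve_right S.τ₂_pos.ne') h7 h5 h8 S.good_τ₂ h9⟩
  · obtain ⟨R, C, ε, hb, hε, hεε, hsub, hw⟩ := S.exists_window_singular (t₀ := t₀) ⟨h'.le, ht₀.2⟩ hU
      (ε₀ := (t₀ - S.τ₂) / 2) (by linarith)
    exact ⟨R, C, ε, hb, hε, hsub, fun a b h1 h2 h3 h4 h5 h6 h7 h8 h9 =>
      hw a b h1 (by linarith) h4.le h7 h5 h8 h9⟩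

theorem good {t : ℝ} (ht : t ∈ Icc 0 S.T) : S.Good t := by
  rcases le_total S.τ₂ t with h | h
  · exact S.good_singular t ⟨h, ht.2⟩
  refine forall_Icc_of_step_left S.good_τ₂ (fun t₀ ht₀ => ?_) t ⟨ht.1, h⟩
  obtain ⟨R, C, ε, -, hε, -, h⟩ := S.exists_window (t₀ := t₀) ⟨ht₀.1, ht₀.2.trans S.hτ₂.le⟩ univ_mem
  refine ⟨ε, hε, fun b htb hbε hbT hb hgood t ht => ?_⟩
  have h1 : max 0 (t₀ - ε) < t₀ ∨ t₀ = 0 := by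
    rcases ht₀.1.lt_or_eq with h1 | h1
    · exact .inl (max_lt h1 (by linarith))
    · exact .inr h1.symm
  have hb' : t₀ < b ∨ S.τ₂ ≤ t₀ := hb.imp_right fun h => h.ge
  have hab : max 0 (t₀ - ε) < b := by
    rcases h1 with h1 | h1
    · linarith
    · rcases hb' with h2 | h2
      · exact max_lt (by linarith) (by linarith)
      · have := S.τ₂_pos; linarith
  have hbT' : b ≤ S.T := hbT.trans S.hτ₂.le
  obtain ⟨N, hN, hN₀, C', hloc⟩ := h _ b (le_max_right _ _) (le_max_left _ _) h1 hab htb hb' hbT' hbε hgood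
  exact hloc.good hN hN₀ (hloc.nonneg hab ⟨_, mem_of_mem_nhds hN⟩) (le_max_left _ _) hbT' ht

/-- Near each time the flow satisfies uniform estimates in coordinates. -/
theorem exists_localEst {t₀ : ℝ} (ht₀ : t₀ ∈ Icc 0 S.T)
    {U : Set (E × (E →L[ℝ] ℝ))} (hU : U ∈ 𝓝 (cotChart (S.lam t₀).1 (S.lam t₀))) :
    ∃ R C a b, S.NiceBall t₀ R C ∧ ball (cotChart (S.lam t₀).1 (S.lam t₀)) R ⊆ U ∧
      0 ≤ a ∧ a ≤ t₀ ∧ t₀ ≤ b ∧ b ≤ S.T ∧ a < b ∧ (a < t₀ ∨ t₀ = 0) ∧ (t₀ < b ∨ t₀ = S.T) ∧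
      ∃ N ∈ 𝓝 S.η₀, N ⊆ S.N₀ ∧ ∃ C' ≥ 0, S.LocalEst t₀ a b R N C' := by
  obtain ⟨R, C, ε, hb, hε, hsub, h⟩ := S.exists_window ht₀ hU
  have hT := S.T_pos
  have h1 : max 0 (t₀ - ε) < t₀ ∨ t₀ = 0 := by
    rcases ht₀.1.lt_or_eq with h1 | h1
    · exact .inl (max_lt h1 (by linarith))
    · exact .inr h1.symm
  have h2 : t₀ < min S.T (t₀ + ε) ∨ t₀ = S.T := by
    rcases ht₀.2.lt_or_eq with h1 | h1
    · exact .inl (lt_min h1 (by linarith))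
    · exact .inr h1
  have h2' : t₀ < min S.T (t₀ + ε) ∨ S.τ₂ ≤ t₀ := h2.imp_right fun h => by rw [h]; exact S.hτ₂.le
  have h3 : t₀ ≤ min S.T (t₀ + ε) := le_min ht₀.2 (by linarith)
  have h0 : max 0 (t₀ - ε) ≤ t₀ := max_le ht₀.1 (by linarith)
  have hab : max 0 (t₀ - ε) < min S.T (t₀ + ε) := by
    rcases h1 with h1 | h1
    · linarith
    · exact h0.trans_lt (lt_min (h1 ▸ hT) (by linarith))
  obtain ⟨N, hN, hN₀, C', hloc⟩ := h _ _ (le_max_right _ _) (le_max_left _ _) h1 hab h3 h2'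
    (min_le_left _ _) (min_le_right _ _) (S.good ⟨ht₀.1.trans h3, min_le_left _ _⟩)
  exact ⟨R, C, _, _, hb, hsub, le_max_left _ _, h0, h3, min_le_left _ _, hab, h1, h2, N, hN, hN₀, C',
    hloc.nonneg hab ⟨_, mem_of_mem_nhds hN⟩, hloc⟩

end Extremal

end

section

theorem sub_le_of_forall_sub_le_sq {f : ℝ → ℝ} {α β c K : ℝ} (hαβ : α ≤ β)
    (h : ∀ t ∈ Icc α β, ∀ s ∈ Icc α β, t ≤ s → f s - f t ≤ c * (s - t) + K * (s - t) ^ 2) :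
    f β - f α ≤ c * (β - α) := by
  have key : ∀ n : ℕ, ∀ t ∈ Icc α β, ∀ s ∈ Icc α β, t ≤ s →
      f s - f t ≤ c * (s - t) + K * (s - t) ^ 2 * (1 / 2) ^ n := by
    intro n
    induction n with
    | zero => simpa using h
    | succ n ih =>
      intro t ht s hs hts
      have hm : (t + s) / 2 ∈ Icc α β := ⟨by linarith [ht.1, hs.1], by linarith [ht.2, hs.2]⟩
      have h1 := ih t ht _ hm (by linarith)
      have h2 := ih _ hm s hs (by linarith)
      have e : c * (s - t) + K * (s - t) ^ 2 * (1 / 2) ^ (n + 1) =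
        (c * ((t + s) / 2 - t) + K * ((t + s) / 2 - t) ^ 2 * (1 / 2) ^ n) +
        (c * (s - (t + s) / 2) + K * (s - (t + s) / 2) ^ 2 * (1 / 2) ^ n) := by ring
      linarith
  have hlim : Tendsto (fun n : ℕ => c * (β - α) + K * (β - α) ^ 2 * (1 / 2) ^ n) atTop
      (𝓝 (c * (β - α) + K * (β - α) ^ 2 * 0)) :=
    (tendsto_pow_atTop_nhds_zero_of_lt_one (by norm_num) (by norm_num)).const_mul _ |>.const_add _
  rw [mul_zero, add_zero] at hlim
  exact ge_of_tendsto' hlim fun n => key n α ⟨le_rfl, hαβ⟩ β ⟨hαβ, le_rfl⟩ hαβ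

variable {E : Type*} [NormedAddCommGroup E] [NormedSpace ℝ E]
  {ι : Type*} [Fintype ι]

theorem norm_sum_stdSimplex_le {F : Type*} [NormedAddCommGroup F] [NormedSpace ℝ F] {u : ι → ℝ}
    (hu : u ∈ stdSimplex ℝ ι) {v : ι → F} {K : ℝ} (hv : ∀ i, ‖v i‖ ≤ K) : ‖∑ i, u i • v i‖ ≤ K := by
  calc ‖∑ i, u i • v i‖ ≤ ∑ i, u i * K := norm_sum_le_of_le _ fun i _ => by
        rw [norm_smul, Real.norm_of_nonneg (hu.1 i)]
        exact mul_le_mul_of_nonneg_left (hv i) (hu.1 i)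
    _ = K := by rw [← Finset.sum_mul, hu.2, one_mul]

theorem sum_stdSimplex_le {u : ι → ℝ} (hu : u ∈ stdSimplex ℝ ι) {v : ι → ℝ} {K : ℝ}
    (hv : ∀ i, v i ≤ K) : ∑ i, u i * v i ≤ K := by
  calc ∑ i, u i * v i ≤ ∑ i, u i * K :=
        Finset.sum_le_sum fun i _ => mul_le_mul_of_nonneg_left (hv i) (hu.1 i)
    _ = K := by rw [← Finset.sum_mul, hu.2, one_mul]

/-- `g` is a calibration with momentum `P`, on the times `J` and the points `B`, for the control
system with the fields `k i`. -/
structure Calibration (k : ι → E → E) (g : ℝ → E → ℝ) (P : ℝ → E → E →L[ℝ] ℝ) (J : Set ℝ)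
    (B : Set E) (L : ℝ) : Prop where
  nonneg : 0 ≤ L
  norm_le : ∀ t ∈ J, ∀ y ∈ B, ‖P t y‖ ≤ L
  lip : ∀ t ∈ J, ∀ s ∈ J, ∀ y ∈ B, ∀ y' ∈ B, ‖P s y' - P t y‖ ≤ L * (|s - t| + ‖y' - y‖)
  le : ∀ i, ∀ t ∈ J, ∀ s ∈ J, t ≤ s → ∀ y ∈ B, ∀ y' ∈ B,
    g s y' - g t y ≤ P t y (y' - y) - P t y (k i y) * (s - t) + L * (s - t + ‖y' - y‖) ^ 2
  field_le : ∀ i, ∀ y ∈ B, ‖k i y‖ ≤ L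
  field_lip : ∀ i, ∀ y ∈ B, ∀ y' ∈ B, ‖k i y' - k i y‖ ≤ L * ‖y' - y‖

variable {k : ι → E → E} {g : ℝ → E → ℝ} {P : ℝ → E → E →L[ℝ] ℝ} {J : Set ℝ} {B : Set E}
  {L α β : ℝ}

/-- Along a curve that solves the control system up to an error `δ`, a calibration grows at
most linearly in `δ`. -/
theorem Calibration.sub_le [Nonempty ι] (h : Calibration k g P J B L) {ζ : ℝ → E} {δ : ℝ} (hαβ : α ≤ β)
    (hJ : Icc α β ⊆ J) (hδ1 : δ ≤ 1) (hac : AbsolutelyContinuousOnInterval ζ α β)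
    (hB : ∀ t ∈ Icc α β, ζ t ∈ B)
    (hζ : ∀ᵐ t ∂volume.restrict (Icc α β), ∃ u ∈ stdSimplex ℝ ι, ∃ w, HasDerivAt ζ w t ∧
      ‖w - ∑ i, u i • k i (ζ t)‖ ≤ δ) :
    g β (ζ β) - g α (ζ α) ≤ L * δ * (β - α) := by
  have hL := h.nonneg
  have hlip : ∀ s ∈ Icc α β, ∀ t ∈ Icc α β, ‖ζ s - ζ t‖ ≤ (L + 1) * |s - t| := by
    refine norm_sub_le_abs_of_ac hac ?_
    filter_upwards [hζ, ae_restrict_mem measurableSet_Icc] with t ⟨u, hu, w, hw, hwδ⟩ ht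
    refine ⟨w, hw, ?_⟩
    have h1 := norm_sum_stdSimplex_le hu fun i => h.field_le i (ζ t) (hB t ht)
    have h2 := norm_sub_norm_le w (∑ i, u i • k i (ζ t))
    linarith
  refine sub_le_of_forall_sub_le_sq (f := fun t => g t (ζ t)) (K := L * (L * (L + 1)) + L * (L + 2) ^ 2) hαβ
    fun t ht s hs hts => ?_
  have hst : 0 ≤ s - t := sub_nonneg.2 hts
  have hsub : Icc t s ⊆ Icc α β := Icc_subset_Icc ht.1 hs.2
  set p := P t (ζ t) with hp
  have hpL : ‖p‖ ≤ L := h.norm_le t (hJ ht) _ (hB t ht)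
  obtain ⟨i, hi⟩ := Finite.exists_max fun i => p (k i (ζ t))
  have h1 : p (ζ s) - p (ζ t) ≤ (p (k i (ζ t)) + L * (L * (L + 1)) * (s - t) + L * δ) * (s - t) := by
    refine sub_le_of_ac (f := fun τ => p (ζ τ)) hts ?_ ?_
    · exact absolutelyContinuous_comp_lipschitz (hac.mono (by
        rw [uIcc_of_le hts, uIcc_of_le hαβ]; exact hsub))
        (p.lipschitz.lipschitzOnWith (s := univ)) (mapsTo_univ _ _)
    filter_upwards [ae_restrict_Icc_mono hζ ht.1 hs.2, ae_restrict_mem measurableSet_Icc] with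
      τ ⟨u, hu, w, hw, hwδ⟩ hτ
    refine ⟨p w, (p.hasFDerivAt.comp_hasDerivAt τ hw), ?_⟩
    have e1 : p w = p (w - ∑ i, u i • k i (ζ τ)) + ∑ i, u i * p (k i (ζ τ)) := by
      rw [map_sub, map_sum]; simp
    have e2 : p (w - ∑ i, u i • k i (ζ τ)) ≤ L * δ :=
      (le_abs_self _).trans ((p.le_opNorm _).trans (mul_le_mul hpL hwδ (norm_nonneg _) hL))
    have e3 : ∑ j, u j * p (k j (ζ τ)) ≤ p (k i (ζ t)) + L * (L * (L + 1)) * (s - t) := by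
      refine sum_stdSimplex_le hu fun j => ?_
      have f1 := h.field_lip j _ (hB t ht) _ (hB τ (hsub hτ))
      have f2 := hlip τ (hsub hτ) t ht
      rw [abs_of_nonneg (by linarith [hτ.1])] at f2
      have f3 : p (k j (ζ τ) - k j (ζ t)) ≤ L * (L * ((L + 1) * (s - t))) := by
        refine (le_abs_self _).trans ((p.le_opNorm _).trans (mul_le_mul hpL (f1.trans ?_)
          (norm_nonneg _) hL))
        gcongr
        exact f2.trans (mul_le_mul_of_nonneg_left (by linarith [hτ.2]) (by linarith))
      rw [map_sub] at f3
      have f4 := hi j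
      linarith
    linarith
  have h2 := h.le i t (hJ ht) s (hJ hs) hts _ (hB t ht) _ (hB s hs)
  have h3 := hlip s hs t ht
  rw [abs_of_nonneg hst] at h3
  have h4 : L * (s - t + ‖ζ s - ζ t‖) ^ 2 ≤ L * ((L + 2) * (s - t)) ^ 2 := by
    gcongr; linarith
  rw [← hp, map_sub] at h2
  calc g s (ζ s) - g t (ζ t) ≤ _ := h2
    _ ≤ (p (k i (ζ t)) + L * (L * (L + 1)) * (s - t) + L * δ) * (s - t) - p (k i (ζ t)) * (s - t)
        + L * ((L + 2) * (s - t)) ^ 2 := by linarith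
    _ = _ := by ring

/-- Two-sided first order expansion at a fixed time. -/
theorem Calibration.abs_sub_le [Nonempty ι] (h : Calibration k g P J B L) {t : ℝ} (ht : t ∈ J) {y y' : E}
    (hy : y ∈ B) (hy' : y' ∈ B) :
    |g t y' - g t y - P t y (y' - y)| ≤ 2 * L * ‖y' - y‖ ^ 2 := by
  have i := Classical.arbitrary ι
  have h1 := h.le i t ht t ht le_rfl y hy y' hy'
  have h2 := h.le i t ht t ht le_rfl y' hy' y hy
  have h3 := h.lip t ht t ht y hy y' hy'
  have h4 : (P t y' - P t y) (y - y') ≤ L * ‖y' - y‖ * ‖y' - y‖ := by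
    refine (le_abs_self _).trans (((P t y' - P t y).le_opNorm _).trans ?_)
    rw [norm_sub_rev y y']
    gcongr
    simpa using h3
  rw [norm_sub_rev y y'] at h2
  simp only [sub_self, mul_zero, zero_add, sub_zero, _root_.sub_apply, map_sub] at h1 h2 h4
  have hL := mul_nonneg h.nonneg (sq_nonneg ‖y' - y‖)
  rw [map_sub, abs_le]
  constructor <;> nlinarith

end

section

variable {E : Type*} [NormedAddCommGroup E] [NormedSpace ℝ E] [FiniteDimensional ℝ E]
  {ι : Type*} [Fintype ι] [Nonempty ι]
  {k : ι → E → E} {g : ℝ → E → ℝ} {P : ℝ → E → E →L[ℝ] ℝ} {J : Set ℝ} {B : Set E}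
  {L α β : ℝ}

/-- Along a solution on which a calibration is constant, the momentum does not decrease, to first
order, along approximate solutions of the linearised equation. -/
theorem Calibration.variation_le (h : Calibration k g P J B L)
    (hd : ∀ i, ∀ y ∈ B, ∀ y' ∈ B, ‖k i y' - k i y - fderiv ℝ (k i) y (y' - y)‖ ≤ L * ‖y' - y‖ ^ 2)
    {ξ w w' : ℝ → E} {u : ℝ → ι → ℝ} {ρ Ω e t s : ℝ}
    (hρ : 0 < ρ) (hts : t ≤ s) (hJ : Icc t s ⊆ J) (hB : ∀ τ ∈ Icc t s, ball (ξ τ) ρ ⊆ B)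
    (hac : AbsolutelyContinuousOnInterval ξ t s) (hu : ∀ τ, u τ ∈ stdSimplex ℝ ι)
    (hξ : ∀ᵐ τ ∂volume.restrict (Icc t s), HasDerivAt ξ (∑ i, u τ i • k i (ξ τ)) τ)
    (hconst : g s (ξ s) = g t (ξ t)) (hwac : AbsolutelyContinuousOnInterval w t s)
    (hw : ∀ τ ∈ Icc t s, ‖w τ‖ ≤ Ω)
    (hwd : ∀ᵐ τ ∂volume.restrict (Icc t s), HasDerivAt w (w' τ) τ ∧
      ‖w' τ - ∑ i, u τ i • fderiv ℝ (k i) (ξ τ) (w τ)‖ ≤ e) :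
    P s (ξ s) (w s) - P t (ξ t) (w t) ≤ L * e * (s - t) := by
  have hL := h.nonneg
  have htm : t ∈ Icc t s := ⟨le_rfl, hts⟩
  have hsm : s ∈ Icc t s := ⟨hts, le_rfl⟩
  have hΩ : 0 ≤ Ω := (norm_nonneg _).trans (hw t htm)
  have hξB : ∀ τ ∈ Icc t s, ξ τ ∈ B := fun τ hτ => hB τ hτ (mem_ball_self hρ)
  have hlim : Tendsto (fun ε : ℝ => L * (L * Ω ^ 2 * ε + e) * (s - t) + 4 * L * Ω ^ 2 * ε) (𝓝[>] 0)
      (𝓝 (L * e * (s - t))) := by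
    refine tendsto_nhdsWithin_of_tendsto_nhds ?_
    have : Continuous fun ε : ℝ => L * (L * Ω ^ 2 * ε + e) * (s - t) + 4 * L * Ω ^ 2 * ε := by fun_prop
    simpa using this.tendsto 0
  refine ge_of_tendsto hlim ?_
  have ev1 : ∀ᶠ ε in 𝓝[>] (0 : ℝ), ε * Ω < ρ := by
    refine nhdsWithin_le_nhds (ContinuousAt.eventually_lt (by fun_prop) continuousAt_const ?_)
    simpa using hρ
  have ev2 : ∀ᶠ ε in 𝓝[>] (0 : ℝ), ε * (L * Ω ^ 2 * ε + e) < 1 := by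
    refine nhdsWithin_le_nhds (ContinuousAt.eventually_lt (by fun_prop) continuousAt_const ?_)
    simp
  filter_upwards [ev1, ev2, self_mem_nhdsWithin] with ε hε1 hε2 hε
  have hε0 : 0 < ε := hε
  have hnorm : ∀ τ ∈ Icc t s, ‖ε • w τ‖ ≤ ε * Ω := fun τ hτ => by
    rw [norm_smul, Real.norm_of_nonneg hε0.le]
    exact mul_le_mul_of_nonneg_left (hw τ hτ) hε0.le
  have hmem : ∀ τ ∈ Icc t s, ξ τ + ε • w τ ∈ B := fun τ hτ => hB τ hτ (by
    rw [mem_ball, dist_eq_norm, add_sub_cancel_left]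
    exact (hnorm τ hτ).trans_lt hε1)
  have hM := h.sub_le (ζ := fun τ => ξ τ + ε • w τ) (δ := ε * (L * Ω ^ 2 * ε + e)) hts hJ hε2.le
    (hac.add (hwac.const_smul ε)) hmem (by
      filter_upwards [hξ, hwd, ae_restrict_mem measurableSet_Icc] with τ h1 ⟨h2, h3⟩ hτ
      refine ⟨u τ, hu τ, _, h1.add (h2.const_smul ε), ?_⟩
      have e1 : ∑ i, u τ i • k i (ξ τ) + ε • w' τ - ∑ i, u τ i • k i (ξ τ + ε • w τ) =
          ε • (w' τ - ∑ i, u τ i • fderiv ℝ (k i) (ξ τ) (w τ)) -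
          ∑ i, u τ i • (k i (ξ τ + ε • w τ) - k i (ξ τ) - fderiv ℝ (k i) (ξ τ) (ε • w τ)) := by
        simp only [smul_sub, Finset.sum_sub_distrib, Finset.smul_sum, map_smul, smul_comm ε]
        abel
      have e2 : ‖∑ i, u τ i • (k i (ξ τ + ε • w τ) - k i (ξ τ) - fderiv ℝ (k i) (ξ τ) (ε • w τ))‖ ≤
          L * (ε * Ω) ^ 2 := by
        refine norm_sum_stdSimplex_le (hu τ) fun i => ?_
        have f1 := hd i _ (hξB τ hτ) _ (hmem τ hτ)
        rw [add_sub_cancel_left] at f1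
        refine f1.trans ?_
        gcongr
        exact hnorm τ hτ
      have e3 : ‖ε • (w' τ - ∑ i, u τ i • fderiv ℝ (k i) (ξ τ) (w τ))‖ ≤ ε * e := by
        rw [norm_smul, Real.norm_of_nonneg hε0.le]
        exact mul_le_mul_of_nonneg_left h3 hε0.le
      rw [e1]
      refine (norm_sub_le _ _).trans ((add_le_add e3 e2).trans (le_of_eq (by ring))))
  have hexp : ∀ τ ∈ Icc t s, |g τ (ξ τ + ε • w τ) - g τ (ξ τ) - ε * P τ (ξ τ) (w τ)| ≤
      2 * L * (ε * Ω) ^ 2 := fun τ hτ => by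
    have f1 := h.abs_sub_le (hJ hτ) (hξB τ hτ) (hmem τ hτ)
    rw [add_sub_cancel_left, map_smul, smul_eq_mul] at f1
    refine f1.trans ?_
    gcongr
    exact hnorm τ hτ
  have h1 := (abs_le.1 (hexp s hsm)).1
  have h2 := (abs_le.1 (hexp t htm)).2
  refine le_of_mul_le_mul_left ?_ hε0
  nlinarith

/-- The adjoint equation: along a solution on which a calibration is constant, the momentum
solves the adjoint of the linearised equation. -/
theorem Calibration.adjoint (h : Calibration k g P J B L)
    (hd : ∀ i, ∀ y ∈ B, ∀ y' ∈ B, ‖k i y' - k i y - fderiv ℝ (k i) y (y' - y)‖ ≤ L * ‖y' - y‖ ^ 2)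
    (hdn : ∀ i, ∀ y ∈ B, ‖fderiv ℝ (k i) y‖ ≤ L) (hdc : ∀ i, ContinuousOn (fderiv ℝ (k i)) B)
    {ξ : ℝ → E} {u : ℝ → ι → ℝ} {ρ : ℝ} (hρ : 0 < ρ) (hαβ : α ≤ β) (hJ : Icc α β ⊆ J)
    (hB : ∀ t ∈ Icc α β, ball (ξ t) ρ ⊆ B) (hac : AbsolutelyContinuousOnInterval ξ α β)
    (hu : ∀ t, u t ∈ stdSimplex ℝ ι)
    (hum : ∀ i, AEStronglyMeasurable (fun t => u t i) (volume.restrict (Icc α β)))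
    (hξ : ∀ᵐ t ∂volume.restrict (Icc α β), HasDerivAt ξ (∑ i, u t i • k i (ξ t)) t)
    (hconst : ∀ t ∈ Icc α β, g t (ξ t) = g α (ξ α)) :
    ∀ᵐ t ∂volume.restrict (Icc α β), HasDerivAt (fun t => P t (ξ t))
      (-(P t (ξ t)).comp (∑ i, u t i • fderiv ℝ (k i) (ξ t))) t := by
  have hL := h.nonneg
  have hcomp : CompleteSpace E := FiniteDimensional.complete ℝ E
  have hξB : ∀ τ ∈ Icc α β, ξ τ ∈ B := fun τ hτ => hB τ hτ (mem_ball_self hρ)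
  have hξc : ContinuousOn ξ (Icc α β) := by simpa only [uIcc_of_le hαβ] using hac.continuousOn
  set D : ℝ → E →L[ℝ] E := fun t => ∑ i, u t i • fderiv ℝ (k i) (ξ t) with hD
  have hDn : ∀ t ∈ Icc α β, ‖D t‖ ≤ L := fun t ht =>
    norm_sum_stdSimplex_le (hu t) fun i => hdn i _ (hξB t ht)
  have hDm : AEStronglyMeasurable D (volume.restrict (Icc α β)) :=
    Finset.aestronglyMeasurable_fun_sum _ fun i _ => (hum i).smul
      (((hdc i).comp hξc hξB).aestronglyMeasurable measurableSet_Icc)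
  have hDi : IntervalIntegrable D volume α β := by
    rw [intervalIntegrable_iff_integrableOn_Icc_of_le hαβ]
    refine Integrable.of_bound hDm L ?_
    filter_upwards [ae_restrict_mem measurableSet_Icc] with t ht using hDn t ht
  set A : ℝ → E →L[ℝ] E := fun t => ∫ τ in α..t, D τ
  have hAlip : ∀ s ∈ Icc α β, ∀ t ∈ Icc α β, ‖A s - A t‖ ≤ L * |s - t| := by
    intro s hs t ht
    have e1 : A s - A t = ∫ τ in t..s, D τ :=
      intervalIntegral.integral_interval_sub_left
        (hDi.mono_set (uIcc_subset_uIcc_left (by rwa [uIcc_of_le hαβ])))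
        (hDi.mono_set (uIcc_subset_uIcc_left (by rwa [uIcc_of_le hαβ])))
    rw [e1]
    refine intervalIntegral.norm_integral_le_of_norm_le_const fun τ hτ => hDn τ ?_
    have := uIoc_subset_uIcc hτ
    exact uIcc_subset_Icc ht hs this
  have hAd : ∀ᵐ t ∂volume.restrict (Icc α β), HasDerivAt A (D t) t := by
    rw [ae_restrict_iff' measurableSet_Icc]
    filter_upwards [hDi.ae_hasDerivAt_integral] with t ht htm
    exact ht (by rwa [uIcc_of_le hαβ]) α (by simp)
  have key : ∀ t ∈ Icc α β, ∀ s ∈ Icc α β, t ≤ s →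
      ‖P s (ξ s) - P t (ξ t) + (P s (ξ s)).comp (A s - A t)‖ ≤ L ^ 3 * (s - t) ^ 2 := by
    intro t ht s hs hts
    have hsub : Icc t s ⊆ Icc α β := Icc_subset_Icc ht.1 hs.2
    have hst : 0 ≤ s - t := sub_nonneg.2 hts
    have hx : ∀ w₀ : E, ‖w₀‖ ≤ 1 →
        (P s (ξ s) - P t (ξ t) + (P s (ξ s)).comp (A s - A t)) w₀ ≤ L ^ 3 * (s - t) ^ 2 := by
      intro w₀ hw₀
      have hbd : ∀ τ ∈ Icc t s, ‖(A τ - A t) w₀‖ ≤ L * (s - t) := fun τ hτ => by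
        have f1 := hAlip τ (hsub hτ) t ht
        rw [abs_of_nonneg (by linarith [hτ.1])] at f1
        calc ‖(A τ - A t) w₀‖ ≤ ‖A τ - A t‖ * ‖w₀‖ := ContinuousLinearMap.le_opNorm _ _
          _ ≤ (L * (τ - t)) * 1 := mul_le_mul f1 hw₀ (norm_nonneg _) (mul_nonneg hL (by linarith [hτ.1]))
          _ ≤ L * (s - t) := by rw [mul_one]; gcongr; exact hτ.2
      have hM := h.variation_le hd (w := fun τ => w₀ + (A τ - A t) w₀) (w' := fun τ => D τ w₀)
        (Ω := 1 + L * (s - t)) (e := L * (L * (s - t))) hρ hts (hsub.trans hJ)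
        (fun τ hτ => hB τ (hsub hτ)) (hac.mono (by
          rw [uIcc_of_le hts, uIcc_of_le hαβ]; exact hsub)) hu (ae_restrict_Icc_mono hξ ht.1 hs.2)
        ((hconst s hs).trans (hconst t ht).symm)
        (absolutelyContinuous_of_norm_sub_le (C := L) hts fun a ha b hb => by
          have f1 := (A a - A b).le_opNorm w₀
          rw [add_sub_add_left_eq_sub, ← _root_.sub_apply, sub_sub_sub_cancel_right]
          refine f1.trans ((mul_le_of_le_one_right (norm_nonneg _) hw₀).trans
            (hAlip a (hsub ha) b (hsub hb))))
        (fun τ hτ => (norm_add_le _ _).trans (add_le_add hw₀ (hbd τ hτ))) (by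
          filter_upwards [ae_restrict_Icc_mono hAd ht.1 hs.2, ae_restrict_mem measurableSet_Icc] with
            τ hτd hτ
          refine ⟨((hτd.sub_const (A t)).clm_apply (hasDerivAt_const τ w₀)).const_add w₀ |>.congr_deriv
            (by simp), ?_⟩
          have f1 : D τ w₀ - ∑ i, u τ i • fderiv ℝ (k i) (ξ τ) (w₀ + (A τ - A t) w₀) =
              - D τ ((A τ - A t) w₀) := by
            simp [hD, map_add, Finset.sum_add_distrib, _root_.sum_apply]
          rw [f1, norm_neg]
          exact ((D τ).le_opNorm _).trans (mul_le_mul (hDn τ (hsub hτ)) (hbd τ hτ) (norm_nonneg _) hL))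
      have e1 : (P s (ξ s) - P t (ξ t) + (P s (ξ s)).comp (A s - A t)) w₀ =
          P s (ξ s) (w₀ + (A s - A t) w₀) - P t (ξ t) (w₀ + (A t - A t) w₀) := by
        simp; ring
      rw [e1]
      exact hM.trans (le_of_eq (by ring))
    refine ContinuousLinearMap.opNorm_le_of_unit_norm (by positivity) fun w hw => ?_
    rw [Real.norm_eq_abs, abs_le]
    have f1 := hx w hw.le
    have f2 := hx (-w) (by rw [norm_neg]; exact hw.le)
    rw [map_neg] at f2
    exact ⟨by linarith, f1⟩
  have hlipξ : ∀ s ∈ Icc α β, ∀ t ∈ Icc α β, ‖ξ s - ξ t‖ ≤ L * |s - t| := by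
    refine norm_sub_le_abs_of_ac hac ?_
    filter_upwards [hξ, ae_restrict_mem measurableSet_Icc] with t ht htm
    exact ⟨_, ht, norm_sum_stdSimplex_le (hu t) fun i => h.field_le i _ (hξB t htm)⟩
  have key' : ∀ t ∈ Icc α β, ∀ s ∈ Icc α β,
      ‖P s (ξ s) - P t (ξ t) + (P t (ξ t)).comp (A s - A t)‖ ≤
        (L ^ 3 + L * (1 + L) * L) * (s - t) ^ 2 := by
    intro t ht s hs
    rcases le_total t s with hts | hts
    · have f1 := key t ht s hs hts
      have f2 := h.lip s (hJ hs) t (hJ ht) _ (hξB s hs) _ (hξB t ht)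
      have f3 : ‖(P t (ξ t) - P s (ξ s)).comp (A s - A t)‖ ≤ L * (1 + L) * L * (s - t) ^ 2 := by
        calc _ ≤ ‖P t (ξ t) - P s (ξ s)‖ * ‖A s - A t‖ := ContinuousLinearMap.opNorm_comp_le _ _
          _ ≤ (L * (|t - s| + L * |t - s|)) * (L * |s - t|) :=
            mul_le_mul (f2.trans (by gcongr; exact hlipξ t ht s hs)) (hAlip s hs t ht)
              (norm_nonneg _) (by positivity)
          _ = L * (1 + L) * L * |s - t| ^ 2 := by rw [abs_sub_comm t s]; ring
          _ = _ := by rw [sq_abs]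
      have e : P s (ξ s) - P t (ξ t) + (P t (ξ t)).comp (A s - A t) =
          (P s (ξ s) - P t (ξ t) + (P s (ξ s)).comp (A s - A t)) +
          (P t (ξ t) - P s (ξ s)).comp (A s - A t) := by
        rw [ContinuousLinearMap.sub_comp]; abel
      rw [e]
      exact (norm_add_le _ _).trans (by linarith)
    · have f1 := key s hs t ht hts
      have e : P s (ξ s) - P t (ξ t) + (P t (ξ t)).comp (A s - A t) =
          -(P t (ξ t) - P s (ξ s) + (P t (ξ t)).comp (A t - A s)) := by
        rw [ContinuousLinearMap.comp_sub, ContinuousLinearMap.comp_sub]; abel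
      rw [e, norm_neg]
      refine f1.trans ?_
      rw [← neg_sub t s, neg_sq]
      gcongr
      have : 0 ≤ L * (1 + L) * L := by positivity
      linarith
  filter_upwards [hAd, ae_mem_Ioo α β] with t hAt ht
  have htm := Ioo_subset_Icc_self ht
  have h1 : HasDerivAt (fun s => P s (ξ s) + (P t (ξ t)).comp (A s - A t)) 0 t := by
    rw [hasDerivAt_iff_hasFDerivAt]
    refine hasFDerivAt_of_norm_sub_le_sq (C := L ^ 3 + L * (1 + L) * L)
      (Icc_mem_nhds ht.1 ht.2) fun s hs => ?_
    have := key' t htm s hs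
    simp only [sub_self, ContinuousLinearMap.comp_zero, add_zero]
    simpa [add_sub_right_comm] using this
  have h2 : HasDerivAt (fun s => (P t (ξ t)).comp (A s - A t)) ((P t (ξ t)).comp (D t)) t :=
    (((ContinuousLinearMap.compL ℝ E E ℝ) (P t (ξ t))).hasFDerivAt.comp_hasDerivAt t
      (hAt.sub_const (A t)))
  have h3 := h1.sub h2
  simp only [Pi.sub_def, add_sub_cancel_right, zero_sub] at h3
  exact h3

end

section

variable {E : Type*} [NormedAddCommGroup E] [NormedSpace ℝ E] [FiniteDimensional ℝ E]
  {M : Type*} [TopologicalSpace M] [ChartedSpace E M] [IsManifold 𝓘(ℝ, E) ∞ M]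

/-- Bounds up to second order, on `B`, for the vector fields `k i`. -/
structure NiceFields {ι : Type*} (k : ι → E → E) (B : Set E) (L : ℝ) : Prop where
  le : ∀ i, ∀ y ∈ B, ‖k i y‖ ≤ L
  lip : ∀ i, ∀ y ∈ B, ∀ y' ∈ B, ‖k i y' - k i y‖ ≤ L * ‖y' - y‖
  diff : ∀ i, ∀ y ∈ B, DifferentiableAt ℝ (k i) y
  taylor : ∀ i, ∀ y ∈ B, ∀ y' ∈ B, ‖k i y' - k i y - fderiv ℝ (k i) y (y' - y)‖ ≤ L * ‖y' - y‖ ^ 2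
  fderiv_le : ∀ i, ∀ y ∈ B, ‖fderiv ℝ (k i) y‖ ≤ L
  continuousOn : ∀ i, ContinuousOn (fderiv ℝ (k i)) B

theorem NiceFields.mono {ι : Type*} {k : ι → E → E} {B B' : Set E} {L L' : ℝ} (h : NiceFields k B L)
    (hB : B' ⊆ B) (hL : L ≤ L') : NiceFields k B' L' where
  le i y hy := (h.le i y (hB hy)).trans hL
  lip i y hy y' hy' := (h.lip i y (hB hy) y' (hB hy')).trans (by gcongr)
  diff i y hy := h.diff i y (hB hy)
  taylor i y hy y' hy' := (h.taylor i y (hB hy) y' (hB hy')).trans (by gcongr)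
  fderiv_le i y hy := (h.fderiv_le i y (hB hy)).trans hL
  continuousOn i := (h.continuousOn i).mono hB

theorem exists_niceFields {ι : Type*} [Fintype ι] {k : ι → E → E} {y₀ : E}
    (hk : ∀ i, ContDiffAt ℝ 2 (k i) y₀) : ∃ R > 0, ∃ L ≥ 0, NiceFields k (ball y₀ R) L := by
  have h (i) : ∃ R > 0, ∃ L ≥ 0, NiceFields (fun _ : Unit => k i) (ball y₀ R) L := by
    obtain ⟨R, hR, C, hC, h1, h2⟩ := exists_ball_fderiv_bounds (hk i)
    have hcv := convex_ball y₀ R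
    refine ⟨R, hR, C, hC, fun _ y hy => (h1 y hy).2.1, fun _ y hy y' hy' => ?_,
      fun _ y hy => (h1 y hy).1, fun _ y hy y' hy' => ?_, fun _ y hy => (h1 y hy).2.2, fun _ => ?_⟩
    · exact hcv.norm_image_sub_le_of_norm_fderiv_le (fun y hy => (h1 y hy).1)
        (fun y hy => (h1 y hy).2.2) hy hy'
    · exact norm_sub_sub_fderiv_le hcv (fun y hy => (h1 y hy).1) h2 hC hy hy'
    · refine LipschitzOnWith.continuousOn (K := C.toNNReal) (LipschitzOnWith.of_dist_le_mul
        fun y hy y' hy' => ?_)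
      rw [dist_eq_norm, dist_eq_norm, Real.coe_toNNReal _ hC]
      exact h2 y' hy' y hy
  choose R hR L hL h using h
  obtain ⟨r, hr, hrR⟩ : ∃ r > 0, ∀ i, r ≤ R i := by
    rcases isEmpty_or_nonempty ι with _ | _
    · exact ⟨1, one_pos, fun i => isEmptyElim i⟩
    · obtain ⟨i, hi⟩ := Finite.exists_min R
      exact ⟨R i, hR i, hi⟩
  have h' (i) := (h i).mono (ball_subset_ball (hrR i))
    (Finset.single_le_sum (f := L) (fun j _ => hL j) (Finset.mem_univ i))
  exact ⟨r, hr, ∑ i, L i, Finset.sum_nonneg fun i _ => hL i, fun i => (h' i).le (),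
    fun i => (h' i).lip (), fun i => (h' i).diff (), fun i => (h' i).taylor (),
    fun i => (h' i).fderiv_le (), fun i => (h' i).continuousOn ()⟩

namespace Extremal

variable (S : Extremal E M)

/-- `Ψ` inverts the projected overmaximised flow on the neighbourhood `U` of the graph of the
reference trajectory. -/
structure Inverse (U : Set (ℝ × M)) (Ψ : ℝ × M → ℝ × Cotangent E M) : Prop where
  nhds : ∀ t ∈ Icc 0 S.T, U ∈ 𝓝[Icc 0 S.T ×ˢ univ] (t, S.ξr t)
  bij : BijOn (fun z : ℝ × Cotangent E M => (z.1, (S.Φ z.1 z.2).1))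
    (Icc 0 S.T ×ˢ (differential (fun x => -S.ct x) '' S.V)) U
  inv : InvOn Ψ (fun z : ℝ × Cotangent E M => (z.1, (S.Φ z.1 z.2).1))
    (Icc 0 S.T ×ˢ (differential (fun x => -S.ct x) '' S.V)) U
  lip : LocLipschitzOn (𝓘(ℝ, ℝ).prod 𝓘(ℝ, E)) (𝓘(ℝ, ℝ).prod (cotModel E)) Ψ U

/-- The opposite of the cost at the end point of the extremal over `x` at time `t`. -/
def G (Ψ : ℝ × M → ℝ × Cotangent E M) (t : ℝ) (x : M) : ℝ := -S.ct (Ψ (t, x)).2.1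

/-- The coordinates of the end point of the extremal over the point with coordinates `y`, in the
chart at the reference point at time `t₀`, at time `t`. -/
def param (Ψ : ℝ × M → ℝ × Cotangent E M) (t₀ t : ℝ) (y : E) : E :=
  S.φ (Ψ (t, (extChartAt 𝓘(ℝ, E) (S.lam t₀).1).symm y)).2.1

variable {S} {U : Set (ℝ × M)} {Ψ : ℝ × M → ℝ × Cotangent E M}

theorem Inverse.exists_eq (h : S.Inverse U Ψ) {t : ℝ} {x : M} (hx : (t, x) ∈ U) :
    ∃ v ∈ S.V, Ψ (t, x) = (t, differential (fun x => -S.ct x) v) ∧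
      (S.Φ t (differential (fun x => -S.ct x) v)).1 = x := by
  obtain ⟨⟨t', ℓ⟩, ⟨ht', v, hv, rfl⟩, hz⟩ := h.bij.surjOn hx
  have h1 := h.inv.1 (x := (t', differential (fun x => -S.ct x) v)) ⟨ht', v, hv, rfl⟩
  simp only at hz h1
  rw [hz] at h1
  obtain ⟨h2, h3⟩ := Prod.mk.inj hz
  exact ⟨v, hv, by rw [h1, h2], by rw [← h2]; exact h3⟩

variable [T2Space M]

theorem Inverse.apply_ref (h : S.Inverse U Ψ) {t : ℝ} (ht : t ∈ Icc 0 S.T) :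
    Ψ (t, S.ξr t) = (t, S.lam S.T) := by
  have e : differential (fun x => -S.ct x) (S.ξr S.T) = S.lam S.T := by
    rw [← S.W_T_η₀, S.W_T (mem_of_mem_nhds S.N₀_mem), S.symm_η₀]
  have h1 := h.inv.1 (x := (t, S.lam S.T)) ⟨ht, S.ξr S.T, S.hxV, e⟩
  have h2 : S.Φ t (S.lam S.T) = S.lam t := by
    rw [← S.W_η₀ t ht, W, S.symm_η₀, e]
  simp only at h1
  rwa [h2, S.hPMP.proj t ht] at h1

theorem Inverse.G_ref (h : S.Inverse U Ψ) {t : ℝ} (ht : t ∈ Icc 0 S.T) :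
    S.G Ψ t (S.ξr t) = -S.ct (S.ξr S.T) := by
  rw [G, h.apply_ref ht, S.hPMP.proj S.T S.T_mem]

theorem Inverse.G_T (h : S.Inverse U Ψ) {x : M} (hx : (S.T, x) ∈ U) : S.G Ψ S.T x = -S.ct x := by
  obtain ⟨v, hv, h1, h2⟩ := h.exists_eq hx
  rw [S.hΦ.final _ ⟨v, hv, rfl⟩] at h2
  rw [G, h1]
  exact congrArg (fun x => -S.ct x) h2

theorem Inverse.exists_param (h : S.Inverse U Ψ) {t₀ : ℝ} (ht₀ : t₀ ∈ Icc 0 S.T) {N : Set E}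
    (hN : N ∈ 𝓝 S.η₀) :
    ∃ ρ > 0, ∃ K ≥ 0, ∀ t ∈ Icc 0 S.T, |t - t₀| < ρ →
      ∀ y ∈ ball (cotChart (S.lam t₀).1 (S.lam t₀)).1 ρ,
      y ∈ (extChartAt 𝓘(ℝ, E) (S.lam t₀).1).target ∧
      S.param Ψ t₀ t y ∈ N ∧
      (S.W t (S.param Ψ t₀ t y)).1 = (extChartAt 𝓘(ℝ, E) (S.lam t₀).1).symm y ∧
      S.G Ψ t ((extChartAt 𝓘(ℝ, E) (S.lam t₀).1).symm y) = S.cf (S.param Ψ t₀ t y) ∧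
      ∀ s ∈ Icc 0 S.T, |s - t₀| < ρ →
        ∀ y' ∈ ball (cotChart (S.lam t₀).1 (S.lam t₀)).1 ρ,
        ‖S.param Ψ t₀ s y' - S.param Ψ t₀ t y‖ ≤ K * (|s - t| + ‖y' - y‖) := by
  set κ := extChartAt 𝓘(ℝ, E) (S.lam t₀).1 with hκ
  have hx₀ : (S.lam t₀).1 = S.ξr t₀ := S.hPMP.proj t₀ ht₀
  set y₀ := (cotChart (S.lam t₀).1 (S.lam t₀)).1 with hy₀
  have hy₀' : y₀ = κ (S.ξr t₀) := by rw [hy₀, cotChart_fst, ← hx₀]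
  have hsrc : S.ξr t₀ ∈ κ.source := by rw [hκ, hx₀]; exact mem_extChartAt_source _
  have hp : (t₀, S.ξr t₀) ∈ U := mem_of_mem_nhdsWithin (s := Icc 0 S.T ×ˢ univ) ⟨ht₀, mem_univ _⟩ (h.nhds t₀ ht₀)
  obtain ⟨hcont, K, W', hW', hlip⟩ := h.lip _ hp
  have htarget : κ.target ∈ 𝓝 y₀ := by
    rw [hy₀']
    exact (isOpen_extChartAt_target _).mem_nhds (κ.map_source hsrc)
  have hsymm : κ.symm y₀ = S.ξr t₀ := by rw [hy₀', κ.left_inv hsrc]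
  have hmap : Tendsto (fun z : ℝ × E => (z.1, κ.symm z.2)) (𝓝[Icc 0 S.T ×ˢ univ] (t₀, y₀))
      (𝓝[Icc 0 S.T ×ˢ univ] (t₀, S.ξr t₀)) := by
    refine tendsto_nhdsWithin_iff.2 ⟨?_, ?_⟩
    · refine tendsto_nhdsWithin_of_tendsto_nhds ?_
      have hc : ContinuousAt κ.symm y₀ := (continuousOn_extChartAt_symm _).continuousAt htarget
      have := (continuousAt_fst (p := (t₀, y₀))).prodMk (hc.comp (x := (t₀, y₀)) continuousAt_snd)
      rw [ContinuousAt] at this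
      simpa only [hsymm, Function.comp] using this
    · filter_upwards [self_mem_nhdsWithin] with z hz using ⟨hz.1, mem_univ _⟩
  have hU := h.nhds t₀ ht₀
  have hΨ : Tendsto (fun z => (Ψ z).2.1) (𝓝[Icc 0 S.T ×ˢ univ] (t₀, S.ξr t₀)) (𝓝 (S.ξr S.T)) := by
    have h1 : ContinuousWithinAt Ψ (Icc 0 S.T ×ˢ univ) (t₀, S.ξr t₀) :=
      hcont.mono_of_mem_nhdsWithin hU
    have h3 : ContinuousWithinAt (fun z => (Ψ z).2.1) (Icc 0 S.T ×ˢ univ) (t₀, S.ξr t₀) :=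
      (FiberBundle.continuous_proj _ _).continuousAt.comp_continuousWithinAt
        (continuous_snd.continuousAt.comp_continuousWithinAt h1)
    have h4 : (Ψ (t₀, S.ξr t₀)).2.1 = S.ξr S.T := by
      rw [h.apply_ref ht₀, S.hPMP.proj S.T S.T_mem]
    rw [ContinuousWithinAt, h4] at h3
    exact h3
  have hφ : Tendsto S.φ (𝓝 (S.ξr S.T)) (𝓝 S.η₀) := continuousAt_extChartAt _
  have ev1 := hmap.eventually (hΨ.eventually ((extChartAt_source_mem_nhds (I := 𝓘(ℝ, E)) (S.ξr S.T))))
  have ev2 := hmap.eventually (hΨ.eventually (hφ.eventually hN))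
  have ev3 := hmap.eventually hU
  have ev4 := hmap.eventually (nhdsWithin_le_nhds hW')
  have ev5 : ∀ᶠ z : ℝ × E in 𝓝[Icc 0 S.T ×ˢ univ] (t₀, y₀), z.2 ∈ κ.target :=
    nhdsWithin_le_nhds (continuousAt_snd.eventually htarget)
  obtain ⟨ρ, hρ, hball⟩ := mem_nhdsWithin_iff.1 ((ev1.and ev2).and ((ev3.and ev4).and ev5))
  have hin := fun t (ht : t ∈ Icc 0 S.T) (htρ : |t - t₀| < ρ) y (hy : y ∈ ball y₀ ρ) =>
    hball (a := (t, y)) ⟨by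
      rw [mem_ball, Prod.dist_eq]
      exact max_lt (by rwa [Real.dist_eq]) hy, ht, mem_univ _⟩
  have hproj : S.ξr S.T = (Ψ (t₀, S.ξr t₀)).2.1 := by
    rw [h.apply_ref ht₀, S.hPMP.proj S.T S.T_mem]
  have hparam : ∀ t ∈ Icc 0 S.T, |t - t₀| < ρ → ∀ y ∈ ball y₀ ρ,
      (t, y) ∈ extChartAt (𝓘(ℝ, ℝ).prod 𝓘(ℝ, E)) (t₀, S.ξr t₀) ''
        (U ∩ W' ∩ (extChartAt (𝓘(ℝ, ℝ).prod 𝓘(ℝ, E)) (t₀, S.ξr t₀)).source) ∧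
      (writtenInExtChartAt (𝓘(ℝ, ℝ).prod 𝓘(ℝ, E)) (𝓘(ℝ, ℝ).prod (cotModel E)) (t₀, S.ξr t₀) Ψ
        (t, y)).2.1 = S.param Ψ t₀ t y := by
    intro t ht htρ y hy
    obtain ⟨⟨-, -⟩, ⟨h3, h4⟩, h5⟩ := hin t ht htρ y hy
    simp only at h3 h4 h5
    refine ⟨⟨(t, κ.symm y), ⟨⟨h3, h4⟩, ?_⟩, ?_⟩, ?_⟩
    · rw [extChartAt_prod]
      refine ⟨by rw [extChartAt_model_space_eq_id]; trivial, ?_⟩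
      have := κ.map_target h5
      rw [hκ, hx₀] at this
      rw [hκ, hx₀]
      exact this
    · rw [extChartAt_prod]
      simp only [PartialEquiv.prod_coe]
      refine Prod.ext (by rw [extChartAt_model_space_eq_id]; rfl) ?_
      have := κ.right_inv h5
      simp only [hκ, hx₀] at this ⊢
      exact this
    · rw [writtenInExtChartAt, extChartAt_prod, extChartAt_prod, param, ← hκ]
      simp only [Function.comp, PartialEquiv.prod_coe, PartialEquiv.prod_symm]
      rw [show extChartAt (cotModel E) (Ψ (t₀, S.ξr t₀)).2 = cotChart (Ψ (t₀, S.ξr t₀)).2.1 by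
        rw [cotChart, FiberBundle.extChartAt, FiberBundle.extChartAt], cotChart_fst, φ, hproj]
      simp only [hκ, hx₀, extChartAt_model_space_eq_id, PartialEquiv.refl_symm, PartialEquiv.refl_coe, id]
  refine ⟨ρ, hρ, K, K.2, fun t ht htρ y hy => ?_⟩
  obtain ⟨⟨h1, h2⟩, ⟨h3, h4⟩, h5⟩ := hin t ht htρ y hy
  simp only at h1 h2 h3 h4 h5
  obtain ⟨v, hv, e1, e2⟩ := h.exists_eq h3
  have e3 : S.φ.symm (S.param Ψ t₀ t y) = v := by
    rw [param, ← hκ, e1]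
    rw [e1] at h1
    exact S.φ.left_inv h1
  refine ⟨h5, h2, ?_, ?_, fun s hs hsρ y' hy' => ?_⟩
  · rw [W, e3, e2]
  · rw [G, cf, e3, e1]
    rfl
  · obtain ⟨f1, f2⟩ := hparam t ht htρ y hy
    obtain ⟨f3, f4⟩ := hparam s hs hsρ y' hy'
    have f5 := hlip.dist_le_mul _ f3 _ f1
    rw [dist_eq_norm, dist_eq_norm] at f5
    rw [← f2, ← f4]
    refine le_trans ?_ (f5.trans ?_)
    · rw [← Prod.fst_sub, ← Prod.snd_sub]
      exact (norm_fst_le _).trans (norm_snd_le _)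
    · gcongr
      rw [Prod.norm_def]
      exact max_le (by simp) (by simp)

end Extremal

end

section

theorem Calibration.apply_le_apply_velocity {E ι : Type*} [NormedAddCommGroup E] [NormedSpace ℝ E]
    {k : ι → E → E} {g : ℝ → E → ℝ} {P : ℝ → E → E →L[ℝ] ℝ} {J : Set ℝ} {B : Set E} {L α β t : ℝ}
    (h : Calibration k g P J B L) (hJ : Icc α β ⊆ J) {ζ : ℝ → E} {v : E}
    (hB : ∀ t ∈ Icc α β, ζ t ∈ B) (hconst : ∀ t ∈ Icc α β, g t (ζ t) = g α (ζ α))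
    (ht : t ∈ Ioo α β) (hv : HasDerivAt ζ v t) (i : ι) :
    P t (ζ t) (k i (ζ t)) ≤ P t (ζ t) v := by
  set p := P t (ζ t) with hp
  have htm := Ioo_subset_Icc_self ht
  have hs : Tendsto (slope ζ t) (𝓝[>] t) (𝓝 v) :=
    (hasDerivAt_iff_tendsto_slope.1 hv).mono_left (nhdsWithin_mono _ fun s hs => ne_of_gt hs)
  have h1 : Tendsto (fun s => p (slope ζ t s) - p (k i (ζ t)) + L * (s - t) * (1 + ‖slope ζ t s‖) ^ 2)
      (𝓝[>] t) (𝓝 (p v - p (k i (ζ t)) + L * (t - t) * (1 + ‖v‖) ^ 2)) := by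
    have h2 : Tendsto (fun s : ℝ => L * (s - t)) (𝓝[>] t) (𝓝 (L * (t - t))) :=
      tendsto_nhdsWithin_of_tendsto_nhds
        ((continuous_const.mul (continuous_id.sub continuous_const)).tendsto t)
    exact (((p.continuous.tendsto v).comp hs).sub_const _).add
      (h2.mul ((hs.norm.const_add 1).pow 2))
  rw [sub_self, mul_zero, zero_mul, add_zero] at h1
  refine sub_nonneg.1 (ge_of_tendsto h1 ?_)
  filter_upwards [Ioo_mem_nhdsGT ht.2] with s hs'
  have hst : 0 < s - t := sub_pos.2 hs'.1
  have hsm : s ∈ Icc α β := ⟨htm.1.trans hs'.1.le, hs'.2.le⟩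
  have h2 := h.le i t (hJ htm) s (hJ hsm) hs'.1.le _ (hB t htm) _ (hB s hsm)
  rw [hconst t htm, hconst s hsm, sub_self, ← hp] at h2
  have h3 : ζ s - ζ t = (s - t) • slope ζ t s := by
    rw [slope_def_module, smul_inv_smul₀ hst.ne']
  rw [h3, map_smul, norm_smul, Real.norm_of_nonneg hst.le, smul_eq_mul] at h2
  refine nonneg_of_mul_nonneg_right (a := s - t) (by linarith) hst

variable {E : Type*} [NormedAddCommGroup E] [NormedSpace ℝ E] [FiniteDimensional ℝ E]
  {M : Type*} [TopologicalSpace M] [ChartedSpace E M] [IsManifold 𝓘(ℝ, E) ∞ M]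

omit [FiniteDimensional ℝ E] in
theorem IsAdmissible.coord {m : ℕ} {X : Fin m → (x : M) → TangentSpace 𝓘(ℝ, E) x} {x x₀ : M}
    {T α β : ℝ} {ξ : ℝ → M} (h : IsAdmissible X x T ξ) (hα : 0 ≤ α) (hαβ : α ≤ β) (hβ : β ≤ T)
    (hs : MapsTo ξ (Icc α β) (extChartAt 𝓘(ℝ, E) x₀).source) :
    AbsolutelyContinuousOnInterval (fun t => extChartAt 𝓘(ℝ, E) x₀ (ξ t)) α β ∧
    ∀ᵐ t ∂volume.restrict (Icc α β), ∃ u ∈ stdSimplex ℝ (Fin m),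
      HasDerivAt (fun t => extChartAt 𝓘(ℝ, E) x₀ (ξ t))
        (∑ i, u i • coordField x₀ (X i) (extChartAt 𝓘(ℝ, E) x₀ (ξ t))) t := by
  refine ⟨h.1.2 x₀ α β hα hαβ hβ hs, ?_⟩
  filter_upwards [ae_restrict_Icc_mono h.2.2 hα hβ, ae_restrict_mem measurableSet_Icc] with
    t ⟨v, ⟨u, hu, hv⟩, hvel⟩ ht
  refine ⟨u, hu, ?_⟩
  have h1 := hasDerivWithinAt_extChartAt_comp (hasMFDerivWithinAt_univ.2 hvel) (hs ht)
  rw [hasDerivWithinAt_univ, hv, ← coordField_apply (hs ht), comb_coordField] at h1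
  exact h1

namespace Extremal

variable (S : Extremal E M)

/-- A window `[a, b]` around `t₀` on which the flow, in the chart at the reference point at time
`t₀`, defines a calibration on the ball of radius `ρ`, with the extremals in `D`. -/
structure Frame (Ψ : ℝ × M → ℝ × Cotangent E M) (t₀ a b ρ L : ℝ) (D : Set (E × (E →L[ℝ] ℝ)))
    (P : ℝ → E → E →L[ℝ] ℝ) : Prop where
  pos : 0 < ρ
  a_nonneg : 0 ≤ a
  b_le : b ≤ S.T
  a_le : a ≤ t₀
  le_b : t₀ ≤ b
  a_lt : a < t₀ ∨ t₀ = 0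
  lt_b : t₀ < b ∨ t₀ = S.T
  nice : NiceFields (fun i => coordField (S.lam t₀).1 (S.X i))
    (ball (cotChart (S.lam t₀).1 (S.lam t₀)).1 ρ) L
  cal : Calibration (fun i => coordField (S.lam t₀).1 (S.X i))
    (fun t y => S.G Ψ t ((extChartAt 𝓘(ℝ, E) (S.lam t₀).1).symm y)) P (Icc a b)
    (ball (cotChart (S.lam t₀).1 (S.lam t₀)).1 ρ) L
  mem : ∀ t ∈ Icc a b, ∀ y ∈ ball (cotChart (S.lam t₀).1 (S.lam t₀)).1 ρ, (y, P t y) ∈ D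
  base : P t₀ (cotChart (S.lam t₀).1 (S.lam t₀)).1 = (cotChart (S.lam t₀).1 (S.lam t₀)).2
  F₁_eq_zero : ∀ t ∈ Icc a b, ∀ y ∈ ball (cotChart (S.lam t₀).1 (S.lam t₀)).1 ρ,
    S.τ₂ ≤ t → S.F₁ ((cotChart (S.lam t₀).1).symm (y, P t y)) = 0

variable {S} [T2Space M] {U : Set (ℝ × M)} {Ψ : ℝ × M → ℝ × Cotangent E M}

set_option maxHeartbeats 400000 in
theorem Inverse.exists_frame (h : S.Inverse U Ψ) {t₀ : ℝ} (ht₀ : t₀ ∈ Icc 0 S.T)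
    {D : Set (E × (E →L[ℝ] ℝ))} (hD : D ∈ 𝓝 (cotChart (S.lam t₀).1 (S.lam t₀))) :
    ∃ a b ρ L P, S.Frame Ψ t₀ a b ρ L D P := by
  set x₀ := (S.lam t₀).1 with hx₀
  set z₀ := cotChart x₀ (S.lam t₀) with hz₀
  obtain ⟨R, C₀, a, b, hb, hsub, ha0, hat, htb, hbT, -, hal, hbl, N, hN, hN₀, C, hC, hloc⟩ :=
    S.exists_localEst ht₀ hD
  obtain ⟨ρ, hρ, K, hK, hpar⟩ := h.exists_param ht₀ hN
  have hz₀t : z₀ ∈ (cotChart (E := E) x₀).target :=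
    (cotChart x₀).map_source (mem_cotChart_source _)
  obtain ⟨r, hr, Lf, hLf, hnice⟩ := exists_niceFields (y₀ := z₀.1)
    (k := fun i => coordField x₀ (S.X i)) fun i => by
      rw [cotChart_target] at hz₀t
      exact ((contDiffOn_coordField (S.hX i) x₀).contDiffAt
        ((isOpen_extChartAt_target _).mem_nhds hz₀t.1)).of_le two_le_infty
  set a' := max a (t₀ - ρ / 2) with ha'
  set b' := min b (t₀ + ρ / 2)
  have hJ : ∀ t ∈ Icc a' b', t ∈ Icc a b ∧ t ∈ Icc 0 S.T ∧ |t - t₀| < ρ := fun t ht => by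
    have e1 := (le_max_left _ _).trans ht.1
    have e2 := ht.2.trans (min_le_left _ _)
    have e3 := (le_max_right _ _).trans ht.1
    have e4 := ht.2.trans (min_le_right _ _)
    exact ⟨⟨e1, e2⟩, ⟨ha0.trans e1, e2.trans hbT⟩, abs_lt.2 ⟨by linarith, by linarith⟩⟩
  have hBρ : ball z₀.1 (min ρ r) ⊆ ball z₀.1 ρ := ball_subset_ball (min_le_left _ _)
  set ψ := S.param Ψ t₀ with hψ
  set P : ℝ → E → E →L[ℝ] ℝ := fun t y => (cotChart x₀ (S.W t (ψ t y))).2 with hP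
  have hψN : ∀ t ∈ Icc a' b', ∀ y ∈ ball z₀.1 (min ρ r), ψ t y ∈ N := fun t ht y hy =>
    (hpar t (hJ t ht).2.1 (hJ t ht).2.2 y (hBρ hy)).2.1
  have hψl : ∀ t ∈ Icc a' b', ∀ y ∈ ball z₀.1 (min ρ r), ∀ s ∈ Icc a' b',
      ∀ y' ∈ ball z₀.1 (min ρ r), ‖ψ s y' - ψ t y‖ ≤ K * (|s - t| + ‖y' - y‖) :=
    fun t ht y hy s hs y' hy' => (hpar t (hJ t ht).2.1 (hJ t ht).2.2 y (hBρ hy)).2.2.2.2 s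
      (hJ s hs).2.1 (hJ s hs).2.2 y' (hBρ hy')
  have hW : ∀ t ∈ Icc a' b', ∀ y ∈ ball z₀.1 (min ρ r),
      cotChart x₀ (S.W t (ψ t y)) = (y, P t y) := fun t ht y hy => by
    obtain ⟨h1, -, h2, -⟩ := hpar t (hJ t ht).2.1 (hJ t ht).2.2 y (hBρ hy)
    refine Prod.ext ?_ rfl
    rw [cotChart_fst, h2]
    exact (extChartAt 𝓘(ℝ, E) x₀).right_inv h1
  have hg : ∀ t ∈ Icc a' b', ∀ y ∈ ball z₀.1 (min ρ r),
      S.G Ψ t ((extChartAt 𝓘(ℝ, E) x₀).symm y) = S.cf (ψ t y) := fun t ht y hy =>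
    (hpar t (hJ t ht).2.1 (hJ t ht).2.2 y (hBρ hy)).2.2.2.1
  have hmem : ∀ t ∈ Icc a' b', ∀ y ∈ ball z₀.1 (min ρ r),
      (y, P t y) ∈ ball z₀ R := fun t ht y hy => by
    rw [← hW t ht y hy]
    exact hloc.mem _ (hψN t ht y hy) t (hJ t ht).1
  have hz₁ : z₀.1 = extChartAt 𝓘(ℝ, E) x₀ (S.ξr t₀) := by
    rw [hz₀, cotChart_fst, hx₀, S.hPMP.proj t₀ ht₀]
  have hψ₀ : ψ t₀ z₀.1 = S.η₀ := by
    rw [hψ, param, ← hx₀, hz₁, (extChartAt 𝓘(ℝ, E) x₀).left_inv (by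
      rw [hx₀, S.hPMP.proj t₀ ht₀]; exact mem_extChartAt_source _), h.apply_ref ht₀,
      S.hPMP.proj S.T S.T_mem, η₀]
  set L := (‖z₀‖ + R) + (C * K + C) + (C + C ^ 2 * K + C * K ^ 2) + Lf with hL
  have hR := hb.pos
  have hL1 : ‖z₀‖ + R ≤ L := by rw [hL]; linarith [show 0 ≤ C * K + C by positivity, show 0 ≤ C + C ^ 2 * K + C * K ^ 2 by positivity]
  have hL2 : C * K + C ≤ L := by rw [hL]; linarith [show 0 ≤ ‖z₀‖ + R by positivity, show 0 ≤ C + C ^ 2 * K + C * K ^ 2 by positivity]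
  have hL3 : C + C ^ 2 * K + C * K ^ 2 ≤ L := by rw [hL]; linarith [show 0 ≤ ‖z₀‖ + R by positivity, show 0 ≤ C * K + C by positivity]
  have hL4 : Lf ≤ L := by rw [hL]; linarith [show 0 ≤ ‖z₀‖ + R by positivity, show 0 ≤ C * K + C by positivity, show 0 ≤ C + C ^ 2 * K + C * K ^ 2 by positivity]
  have hnice' := hnice.mono (ball_subset_ball (min_le_right ρ r)) hL4
  refine ⟨a', b', min ρ r, L, P, lt_min hρ hr, ha0.trans (le_max_left _ _), (min_le_left _ _).trans hbT,
    max_le hat (by linarith), le_min htb (by linarith), hal.imp_left fun h => max_lt h (by linarith),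
    hbl.imp_left fun h => lt_min h (by linarith), hnice',
    ⟨hLf.trans hL4, fun t ht y hy => ?_, fun t ht s hs y hy y' hy' => ?_,
      fun i t ht s hs hts y hy y' hy' => ?_, hnice'.le, hnice'.lip⟩,
    fun t ht y hy => hsub (hmem t ht y hy), ?_, fun t ht y hy hτ => ?_⟩
  · have h1 := hmem t ht y hy
    rw [mem_ball, dist_eq_norm] at h1
    have h2 := norm_sub_norm_le (y, P t y) z₀
    have h3 := norm_snd_le (y, P t y)
    simp only at h3
    linarith
  · have h1 := ((hloc.est s (hJ s hs).1 _ (hψN t ht y hy)).2 _ (hψN s hs y' hy')).1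
    have h2 := hloc.lip _ (hψN t ht y hy) s (hJ s hs).1 t (hJ t ht).1
    have h3 : P s y' - P t y =
        (cotChart x₀ (S.W s (ψ s y')) - cotChart x₀ (S.W s (ψ t y))).2 +
        (cotChart x₀ (S.W s (ψ t y)) - cotChart x₀ (S.W t (ψ t y))).2 := by
      simp only [Prod.snd_sub, hP]; abel
    rw [h3]
    calc _ ≤ C * (K * (|s - t| + ‖y' - y‖)) + C * (|s - t| + ‖y' - y‖) := by
          refine (norm_add_le _ _).trans (add_le_add ((norm_snd_le _).trans (h1.trans ?_))
            ((norm_snd_le _).trans (h2.trans ?_)))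
          · gcongr; exact hψl t ht y hy s hs y' hy'
          · gcongr; linarith [norm_nonneg (y' - y)]
      _ = (C * K + C) * (|s - t| + ‖y' - y‖) := by ring
      _ ≤ _ := by gcongr
  · have hst := sub_nonneg.2 hts
    set Δ := s - t + ‖y' - y‖ with hΔ
    have hΔ0 : 0 ≤ Δ := by positivity
    have hη : ‖ψ s y' - ψ t y‖ ≤ K * Δ := by
      have := hψl t ht y hy s hs y' hy'
      rwa [abs_of_nonneg hst] at this
    obtain ⟨h1, h2⟩ := (hloc.est s (hJ s hs).1 _ (hψN t ht y hy)).2 _ (hψN s hs y' hy')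
    have h3 := hloc.lip _ (hψN t ht y hy) s (hJ s hs).1 t (hJ t ht).1
    have h4 := hloc.energy i _ (hψN t ht y hy) t (hJ t ht).1 s (hJ s hs).1 hts
    rw [lift_eq_coord (hloc.est t (hJ t ht).1 _ (hψN t ht y hy)).1, hW t ht y hy] at h4
    rw [abs_of_nonneg hst, hW t ht y hy] at h3
    rw [hW s hs y' hy'] at h1 h2
    set q := (cotChart x₀ (S.W s (ψ t y)))
    simp only at h2 h4
    have h5 : (q.2 - P t y) (y' - q.1) ≤ C * (s - t) * (C * (K * Δ)) := by
      refine (le_abs_self _).trans (((q.2 - P t y).le_opNorm _).trans (mul_le_mul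
        ((norm_snd_le (q - (y, P t y))).trans h3) ((norm_fst_le ((y', P s y') - q)).trans (h1.trans ?_))
        (norm_nonneg _) (by positivity)))
      gcongr
    have h6 : C * ‖ψ s y' - ψ t y‖ ^ 2 ≤ C * (K * Δ) ^ 2 := by gcongr
    have h7 : C * (s - t) * (C * (K * Δ)) ≤ C * Δ * (C * (K * Δ)) := by
      gcongr; rw [hΔ]; linarith [norm_nonneg (y' - y)]
    have h8 : C * (s - t) ^ 2 ≤ C * Δ ^ 2 := by
      gcongr; rw [hΔ]; linarith [norm_nonneg (y' - y)]
    have h9 : (C + C ^ 2 * K + C * K ^ 2) * Δ ^ 2 ≤ L * Δ ^ 2 := by gcongr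
    have h10 := (abs_le.1 h2).1
    rw [hg t ht y hy, hg s hs y' hy']
    have h11 : C * Δ ^ 2 + C * Δ * (C * (K * Δ)) + C * (K * Δ) ^ 2 =
      (C + C ^ 2 * K + C * K ^ 2) * Δ ^ 2 := by ring
    simp only [map_sub, _root_.sub_apply] at h4 h5 h10 ⊢
    linarith only [h4, h5, h6, h7, h8, h9, h10, h11]
  · rw [hP]
    simp only
    rw [hψ₀, S.W_η₀ t₀ ht₀]
  · rw [← hW t ht y hy, (cotChart x₀).left_inv (hloc.est t (hJ t ht).1 _ (hψN t ht y hy)).1]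
    exact hloc.F₁_eq_zero _ (hψN t ht y hy) t (hJ t ht).1 hτ

end Extremal

end

section

theorem antitoneOn_Icc_of_locally {f : ℝ → ℝ} {α β : ℝ}
    (h : ∀ t₀ ∈ Icc α β, ∃ ε > 0, AntitoneOn f (Icc α β ∩ Icc (t₀ - ε) (t₀ + ε))) :
    AntitoneOn f (Icc α β) := by
  rcases le_total α β with hαβ | hαβ
  swap
  · exact (subsingleton_Icc_of_ge hαβ).antitoneOn f
  refine forall_Icc_of_step_left (P := fun t => AntitoneOn f (Icc t β)) (by simp) (fun t₀ ht₀ => ?_)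
    α ⟨le_rfl, hαβ⟩
  obtain ⟨ε, hε, hf⟩ := h t₀ ht₀
  refine ⟨ε, hε, fun b h1 h2 h3 _ hb t ht => ?_⟩
  have h4 := (le_max_left _ _).trans ht.1
  have h5 := (le_max_right _ _).trans ht.1
  rw [← Icc_union_Icc_eq_Icc ht.2 h3]
  refine (hf.mono fun s hs => ⟨⟨h4.trans hs.1, hs.2.trans h3⟩, h5.trans hs.1, hs.2.trans h2⟩).union_right
    hb (isGreatest_Icc ht.2) (isLeast_Icc h3)

theorem eqOn_zero_of_norm_deriv_le {F : Type*} [NormedAddCommGroup F] [NormedSpace ℝ F] {f : ℝ → F}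
    {α β K : ℝ} (hf : AbsolutelyContinuousOnInterval f α β) (hK : 0 ≤ K) (hKs : K * (β - α) < 1)
    (h0 : f α = 0)
    (h : ∀ᵐ t ∂volume.restrict (Icc α β), ∃ v, HasDerivAt f v t ∧ ‖v‖ ≤ K * ‖f t‖) :
    ∀ t ∈ Icc α β, f t = 0 := by
  intro t ht
  have hαβ := ht.1.trans ht.2
  have hc : ContinuousOn f (Icc α β) := by simpa only [uIcc_of_le hαβ] using hf.continuousOn
  obtain ⟨t₁, ht₁, hmax⟩ := isCompact_Icc.exists_isMaxOn ⟨t, ht⟩ hc.norm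
  have h1 := norm_sub_le_of_ac (C := K * ‖f t₁‖) ht₁.1 (hf.mono (by
    rw [uIcc_of_le hαβ, uIcc_of_le ht₁.1]; exact Icc_subset_Icc_right ht₁.2)) (by
    filter_upwards [ae_restrict_Icc_mono h le_rfl ht₁.2, ae_restrict_mem measurableSet_Icc] with
      s ⟨v, hv, hvn⟩ hs
    exact ⟨v, hv, hvn.trans (mul_le_mul_of_nonneg_left (hmax ⟨hs.1, hs.2.trans ht₁.2⟩) hK)⟩)
  rw [h0, sub_zero] at h1
  have h2 : K * (t₁ - α) ≤ K * (β - α) := mul_le_mul_of_nonneg_left (by linarith [ht₁.2]) hK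
  have h3 : ‖f t₁‖ ≤ 0 := by
    by_contra h4
    push Not at h4
    nlinarith
  exact norm_le_zero_iff.1 ((hmax ht).trans h3)

variable {E : Type*} [NormedAddCommGroup E] [NormedSpace ℝ E] [FiniteDimensional ℝ E]

theorem exists_measurable_coeff {ξ : ℝ → E} {p k : E → E} {α β : ℝ} {B : Set E}
    (hp : ContinuousOn p B) (hk : ContinuousOn k B) (hξ : ContinuousOn ξ (Icc α β))
    (hB : MapsTo ξ (Icc α β) B) (h : ∀ᵐ t ∂volume.restrict (Icc α β), ∃ s ∈ Icc (0 : ℝ) 1,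
      HasDerivAt ξ (p (ξ t) + s • k (ξ t)) t) :
    ∃ s : ℝ → ℝ, (∀ t, s t ∈ Icc 0 1) ∧ AEStronglyMeasurable s (volume.restrict (Icc α β)) ∧
      ∀ᵐ t ∂volume.restrict (Icc α β), HasDerivAt ξ (p (ξ t) + s t • k (ξ t)) t := by
  have hcomp : CompleteSpace E := FiniteDimensional.complete ℝ E
  set c : Fin (Module.finrank ℝ E) → E →L[ℝ] ℝ := fun i =>
    LinearMap.toContinuousLinearMap ((Module.finBasis ℝ E).coord i)
  set r : ℝ → ℝ := fun t => (∑ i, c i (k (ξ t)) * c i (deriv ξ t - p (ξ t))) /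
    ∑ i, c i (k (ξ t)) * c i (k (ξ t)) with hr
  have hpm := (hp.comp hξ hB).aestronglyMeasurable (μ := volume) measurableSet_Icc
  have hkm := (hk.comp hξ hB).aestronglyMeasurable (μ := volume) measurableSet_Icc
  have hdm := aestronglyMeasurable_deriv ξ (volume.restrict (Icc α β))
  have hck (i) : AEStronglyMeasurable (fun t => c i (k (ξ t))) (volume.restrict (Icc α β)) :=
    (c i).continuous.comp_aestronglyMeasurable hkm
  have hrm : AEStronglyMeasurable r (volume.restrict (Icc α β)) := by
    refine AEMeasurable.aestronglyMeasurable (AEMeasurable.div ?_ ?_)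
    · exact (Finset.aestronglyMeasurable_fun_sum _ fun i _ => (hck i).mul
        ((c i).continuous.comp_aestronglyMeasurable (hdm.sub hpm))).aemeasurable
    · exact (Finset.aestronglyMeasurable_fun_sum _ fun i _ => (hck i).mul (hck i)).aemeasurable
  refine ⟨fun t => max 0 (min 1 (r t)), fun t => ⟨le_max_left _ _, max_le zero_le_one
    (min_le_left _ _)⟩, ((continuous_const.max (continuous_const.min
      continuous_id)).comp_aestronglyMeasurable hrm), ?_⟩
  filter_upwards [h] with t ⟨s, hs, hd⟩
  by_cases h0 : k (ξ t) = 0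
  · rw [h0, smul_zero] at hd ⊢
    exact hd
  have h1 : r t = s := by
    have h2 : ∑ i, c i (k (ξ t)) * c i (k (ξ t)) ≠ 0 := fun h2 => by
      refine h0 ((Module.finBasis ℝ E).ext_elem fun i => ?_)
      have h3 := (Finset.sum_eq_zero_iff_of_nonneg fun i _ => mul_self_nonneg _).1 h2 i
        (Finset.mem_univ i)
      rw [map_zero]
      exact mul_self_eq_zero.1 h3
    rw [hr]
    simp only [hd.deriv, add_sub_cancel_left, map_smul, smul_eq_mul]
    rw [div_eq_iff h2, Finset.mul_sum]
    exact Finset.sum_congr rfl fun i _ => by ring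
  rw [h1, min_eq_right hs.2, max_eq_right hs.1]
  exact hd

variable {M : Type*} [TopologicalSpace M] [ChartedSpace E M] [IsManifold 𝓘(ℝ, E) ∞ M]

namespace Extremal

variable {S : Extremal E M} {Ψ : ℝ × M → ℝ × Cotangent E M} {t₀ a b ρ L : ℝ}
  {D : Set (E × (E →L[ℝ] ℝ))} {P : ℝ → E → E →L[ℝ] ℝ}

theorem nonempty_fin (S : Extremal E M) : Nonempty (Fin S.m) := ⟨S.hh₁.choose⟩

theorem Frame.le (h : S.Frame Ψ t₀ a b ρ L D P) {ξ : ℝ → M} {x : M} {α β : ℝ}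
    (hξ : IsAdmissible S.X x S.T ξ) (hαβ : α ≤ β) (hα : a ≤ α) (hβ : β ≤ b)
    (hs : ∀ t ∈ Icc α β, ξ t ∈ (extChartAt 𝓘(ℝ, E) (S.lam t₀).1).source ∧
      extChartAt 𝓘(ℝ, E) (S.lam t₀).1 (ξ t) ∈
        ball (cotChart (S.lam t₀).1 (S.lam t₀)).1 ρ) :
    S.G Ψ β (ξ β) ≤ S.G Ψ α (ξ α) := by
  have := S.nonempty_fin
  obtain ⟨hac, hd⟩ := hξ.coord (h.a_nonneg.trans hα) hαβ (hβ.trans h.b_le) fun t ht => (hs t ht).1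
  have h1 := h.cal.sub_le (δ := 0) hαβ (Icc_subset_Icc hα hβ) zero_le_one hac
    (fun t ht => (hs t ht).2) (by
      filter_upwards [hd] with t ⟨u, hu, hut⟩
      exact ⟨u, hu, _, hut, by rw [sub_self, norm_zero]⟩)
  simp only [(extChartAt 𝓘(ℝ, E) (S.lam t₀).1).left_inv (hs α ⟨le_rfl, hαβ⟩).1,
    (extChartAt 𝓘(ℝ, E) (S.lam t₀).1).left_inv (hs β ⟨hαβ, le_rfl⟩).1] at h1
  linarith

theorem Frame.mem_nhdsWithin (h : S.Frame Ψ t₀ a b ρ L D P) : Icc a b ∈ 𝓝[Icc 0 S.T] t₀ := by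
  have h1 : Ici a ∈ 𝓝[Icc 0 S.T] t₀ := by
    rcases h.a_lt with h1 | h1
    · exact mem_nhdsWithin_of_mem_nhds (Ici_mem_nhds h1)
    · filter_upwards [self_mem_nhdsWithin] with t ht using (h.a_le.trans_eq h1).trans ht.1
  have h2 : Iic b ∈ 𝓝[Icc 0 S.T] t₀ := by
    rcases h.lt_b with h2 | h2
    · exact mem_nhdsWithin_of_mem_nhds (Iic_mem_nhds h2)
    · filter_upwards [self_mem_nhdsWithin] with t ht using ht.2.trans (h2.symm.trans_le h.le_b)
  rw [← Ici_inter_Iic]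
  exact inter_mem h1 h2

theorem isOpen_chart_ball (x₀ : M) (y : E) (r : ℝ) : IsOpen {x | x ∈ (extChartAt 𝓘(ℝ, E) x₀).source ∧
    extChartAt 𝓘(ℝ, E) x₀ x ∈ ball y r} :=
  (continuousOn_extChartAt x₀).isOpen_inter_preimage (isOpen_extChartAt_source x₀) isOpen_ball

variable [T2Space M] {U : Set (ℝ × M)}

/-- The value is monotone along the admissible trajectories that are close to the reference
trajectory. -/
theorem Inverse.exists_isOpen (h : S.Inverse U Ψ) : ∃ o : Set (ℝ × M), IsOpen o ∧
    (∀ t ∈ Icc 0 S.T, (t, S.ξr t) ∈ o) ∧ (∀ x, (S.T, x) ∈ o → x ∈ S.V ∧ (S.T, x) ∈ U) ∧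
    ∀ x ξ, IsAdmissible S.X x S.T ξ → (∀ t ∈ Icc 0 S.T, (t, ξ t) ∈ o) →
      AntitoneOn (fun t => S.G Ψ t (ξ t)) (Icc 0 S.T) := by
  set 𝒪 : Set (Set (ℝ × M)) := {o | IsOpen o ∧ ∀ x ξ, IsAdmissible S.X x S.T ξ → ∀ α ∈ Icc 0 S.T,
    ∀ β ∈ Icc 0 S.T, α ≤ β → (∀ t ∈ Icc α β, (t, ξ t) ∈ o) → S.G Ψ β (ξ β) ≤ S.G Ψ α (ξ α)}
  obtain ⟨oT, hoT, hToT, hoTU⟩ := mem_nhdsWithin.1 (h.nhds S.T S.T_mem)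
  refine ⟨⋃₀ 𝒪 ∩ {z | z.1 < S.T ∨ (z.2 ∈ S.V ∧ z ∈ oT)}, ?_, fun t ht => ⟨?_, ?_⟩,
    fun x hx => ?_, fun x ξ hξ hgr => ?_⟩
  · refine (isOpen_sUnion fun o ho => ho.1).inter ?_
    exact (isOpen_lt continuous_fst continuous_const).union
      ((S.hV.preimage continuous_snd).inter hoT)
  · obtain ⟨a, b, ρ, L, P, hF⟩ := h.exists_frame ht univ_mem
    obtain ⟨u, hu, htu, hsub⟩ := mem_nhdsWithin.1 hF.mem_nhdsWithin
    refine ⟨u ×ˢ _, ⟨hu.prod (isOpen_chart_ball (S.lam t).1 (cotChart (S.lam t).1 (S.lam t)).1 ρ),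
      fun x ξ hξ α hα β hβ hαβ hm => ?_⟩, htu, ?_⟩
    · exact hF.le hξ hαβ (hsub ⟨(hm α ⟨le_rfl, hαβ⟩).1, hα⟩).1 (hsub ⟨(hm β ⟨hαβ, le_rfl⟩).1, hβ⟩).2
        fun t ht => (hm t ht).2
    · simp only [← S.hPMP.proj t ht, cotChart_fst]
      exact ⟨mem_extChartAt_source _, mem_ball_self hF.pos⟩
  · rcases ht.2.lt_or_eq with h1 | h1
    · exact .inl h1
    · exact .inr ⟨by rw [h1]; exact S.hxV, by rw [h1]; exact hToT⟩
  · obtain ⟨h1, h2⟩ := hx.2.resolve_left (lt_irrefl _)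
    exact ⟨h1, hoTU ⟨h2, S.T_mem, mem_univ _⟩⟩
  · refine antitoneOn_Icc_of_locally fun t₁ ht₁ => ?_
    obtain ⟨o, ⟨ho, hmono⟩, ht₁o⟩ := (hgr t₁ ht₁).1
    have hc : ContinuousWithinAt (fun t => (t, ξ t)) (Icc 0 S.T) t₁ :=
      continuousWithinAt_id.prodMk (hξ.1.1 t₁ ht₁)
    obtain ⟨ε, hε, hball⟩ := mem_nhdsWithin_iff.1 (hc.preimage_mem_nhdsWithin (ho.mem_nhds ht₁o))
    refine ⟨ε / 2, by linarith, fun α hα β hβ hαβ => hmono x ξ hξ α hα.1 β hβ.1 hαβ fun t ht => ?_⟩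
    refine hball ⟨?_, hα.1.1.trans ht.1, ht.2.trans hβ.1.2⟩
    rw [mem_ball, Real.dist_eq, abs_lt]
    exact ⟨by linarith [hα.2.1, ht.1], by linarith [hβ.2.2, ht.2]⟩

end Extremal

end

section

variable {E : Type*} [NormedAddCommGroup E] [NormedSpace ℝ E] [FiniteDimensional ℝ E]
  {M : Type*} [TopologicalSpace M] [ChartedSpace E M] [IsManifold 𝓘(ℝ, E) ∞ M]

/-- The Hamiltonian vector field of `F` in the canonical coordinates given by the chart at `x₀`. -/
def coordHamField (x₀ : M) (F : Cotangent E M → ℝ) (z : E × (E →L[ℝ] ℝ)) : E × (E →L[ℝ] ℝ) :=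
  symGrad (fderiv ℝ (fun z => F ((cotChart x₀).symm z)) z)

theorem CotSmooth.contDiffAt_coordHamField {F : Cotangent E M → ℝ} (hF : CotSmooth F) {x₀ : M}
    {z : E × (E →L[ℝ] ℝ)} (hz : z ∈ (cotChart (E := E) x₀).target) :
    ContDiffAt ℝ 1 (coordHamField x₀ F) z :=
  symGradL.contDiff.contDiffAt.comp z (((hF.contDiffAt hz).of_le two_le_infty).fderiv_right
    (by norm_num))

theorem CotSmooth.fderiv_coordHamField {F G : Cotangent E M → ℝ} (hF : CotSmooth F)
    (hG : CotSmooth G) {x₀ : M} {z : E × (E →L[ℝ] ℝ)}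
    (hz : z ∈ (cotChart (E := E) x₀).target) :
    fderiv ℝ (fun z => G ((cotChart x₀).symm z)) z (coordHamField x₀ F z) =
      BangBangSingular.poisson F G ((cotChart x₀).symm z) :=
  (hF.poisson_cotChart_symm hG hz).symm

theorem coordHamField_sub {F G : Cotangent E M → ℝ} (hF : CotSmooth F)
    (hG : CotSmooth G) {x₀ : M} {z : E × (E →L[ℝ] ℝ)}
    (hz : z ∈ (cotChart (E := E) x₀).target) :
    coordHamField x₀ (fun ℓ => F ℓ - G ℓ) z = coordHamField x₀ F z - coordHamField x₀ G z := by
  rw [coordHamField, coordHamField, coordHamField, ← symGrad_sub]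
  congr 1
  exact fderiv_fun_sub ((hF.contDiffAt hz).differentiableAt (by simp))
    ((hG.contDiffAt hz).differentiableAt (by simp))

theorem coordHamField_lift {f : (x : M) → TangentSpace 𝓘(ℝ, E) x} {x₀ : M} {z : E × (E →L[ℝ] ℝ)}
    (hz : z ∈ (cotChart (E := E) x₀).target)
    (hf : DifferentiableAt ℝ (coordField x₀ f) z.1) :
    coordHamField x₀ (lift f) z =
      (coordField x₀ f z.1, -z.2.comp (fderiv ℝ (coordField x₀ f) z.1)) := by
  have h1 : HasFDerivAt (fun z : E × (E →L[ℝ] ℝ) => z.2 (coordField x₀ f z.1)) _ z :=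
    hasFDerivAt_snd.clm_apply (hf.hasFDerivAt.comp z hasFDerivAt_fst)
  have h2 : (fun z => lift f ((cotChart x₀).symm z)) =ᶠ[𝓝 z]
      fun z => z.2 (coordField x₀ f z.1) := by
    filter_upwards [(isOpen_cotChart_target x₀).mem_nhds hz] with w hw
    exact lift_cotChart_symm hw f
  rw [coordHamField, h2.fderiv_eq, h1.fderiv]
  refine (eq_symGrad fun v => ?_).symm
  simp [sform]
  ring

namespace Extremal

variable {S : Extremal E M} {Ψ : ℝ × M → ℝ × Cotangent E M} {t₀ a b ρ L β : ℝ}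
  {D : Set (E × (E →L[ℝ] ℝ))} {P : ℝ → E → E →L[ℝ] ℝ} {ξ : ℝ → M}

variable (S) in
/-- An admissible trajectory along which the value is constant, and which passes through the
reference point at time `t₀`. -/
structure Stationary (Ψ : ℝ × M → ℝ × Cotangent E M) (t₀ : ℝ) (ξ : ℝ → M) : Prop where
  adm : ∃ x, IsAdmissible S.X x S.T ξ
  eq : ξ t₀ = S.ξr t₀
  const : ∀ t ∈ Icc 0 S.T, S.G Ψ t (ξ t) = -S.ct (S.ξr S.T)

/-- The canonical coordinates of the momentum over a trajectory. -/
def momentum (S : Extremal E M) (P : ℝ → E → E →L[ℝ] ℝ) (t₀ : ℝ) (ξ : ℝ → M) (t : ℝ) : E × (E →L[ℝ] ℝ) :=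
  (extChartAt 𝓘(ℝ, E) (S.lam t₀).1 (ξ t), P t (extChartAt 𝓘(ℝ, E) (S.lam t₀).1 (ξ t)))

variable (S) in
/-- `ξ` stays on `[t₀, β]` near the reference point at time `t₀`. -/
def StaysNear (t₀ ρ β : ℝ) (ξ : ℝ → M) : Prop :=
  ∀ t ∈ Icc t₀ β, ξ t ∈ (extChartAt 𝓘(ℝ, E) (S.lam t₀).1).source ∧
    extChartAt 𝓘(ℝ, E) (S.lam t₀).1 (ξ t) ∈
      ball (cotChart (S.lam t₀).1 (S.lam t₀)).1 (ρ / 2)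

theorem Frame.exists_staysNear (h : S.Frame Ψ t₀ a b ρ L D P) (hξ : S.Stationary Ψ t₀ ξ)
    (ht₀ : t₀ < S.T) : ∃ ε > 0, t₀ + ε ≤ b ∧ S.StaysNear t₀ ρ (t₀ + ε) ξ := by
  obtain ⟨x, hx⟩ := hξ.adm
  have ht₀' : t₀ ∈ Icc 0 S.T := ⟨h.a_nonneg.trans h.a_le, ht₀.le⟩
  have hb : t₀ < b := h.lt_b.resolve_right ht₀.ne
  have hmem : ξ t₀ ∈ {x | x ∈ (extChartAt 𝓘(ℝ, E) (S.lam t₀).1).source ∧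
    extChartAt 𝓘(ℝ, E) (S.lam t₀).1 x ∈
      ball (cotChart (S.lam t₀).1 (S.lam t₀)).1 (ρ / 2)} := by
    rw [hξ.eq, ← S.hPMP.proj t₀ ht₀', cotChart_fst]
    exact ⟨mem_extChartAt_source _, mem_ball_self (half_pos h.pos)⟩
  obtain ⟨ε, hε, hball⟩ := mem_nhdsWithin_iff.1
    ((hx.1.1 t₀ ht₀').preimage_mem_nhdsWithin ((isOpen_chart_ball _ _ _).mem_nhds hmem))
  refine ⟨min (ε / 2) (b - t₀), lt_min (by linarith) (by linarith), ?_, fun t ht => hball ⟨?_, ?_⟩⟩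
  · linarith [min_le_right (ε / 2) (b - t₀)]
  · rw [mem_ball, Real.dist_eq, abs_of_nonneg (by linarith [ht.1])]
    linarith [min_le_left (ε / 2) (b - t₀), ht.2]
  · exact ⟨ht₀'.1.trans ht.1, by linarith [min_le_right (ε / 2) (b - t₀), ht.2, h.b_le]⟩

theorem Frame.momentum_mem (h : S.Frame Ψ t₀ a b ρ L D P) (hβ : β ≤ b) (hs : S.StaysNear t₀ ρ β ξ) :
    ∀ t ∈ Icc t₀ β, S.momentum P t₀ ξ t ∈ D := fun t ht =>
  h.mem t ⟨h.a_le.trans ht.1, ht.2.trans hβ⟩ _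
    (ball_subset_ball (by linarith [h.pos]) (hs t ht).2)

theorem Frame.momentum_t₀ (h : S.Frame Ψ t₀ a b ρ L D P) (hξ : S.Stationary Ψ t₀ ξ)
    (ht₀ : t₀ ≤ S.T) : S.momentum P t₀ ξ t₀ = cotChart (S.lam t₀).1 (S.lam t₀) := by
  have h1 : extChartAt 𝓘(ℝ, E) (S.lam t₀).1 (ξ t₀) = (cotChart (S.lam t₀).1 (S.lam t₀)).1 := by
    rw [hξ.eq, ← S.hPMP.proj t₀ ⟨h.a_nonneg.trans h.a_le, ht₀⟩, cotChart_fst]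
  rw [momentum, h1, h.base]

/-- If the maximising fields near the reference extremal are those on the edge from `X i` to `X j`,
then along a stationary trajectory the momentum follows the corresponding Hamiltonians. -/
theorem Frame.hasDerivAt_momentum (h : S.Frame Ψ t₀ a b ρ L D P)
    (hD : D ⊆ (cotChart (S.lam t₀).1 : PartialEquiv (Cotangent E M) _).target) {i j : Fin S.m}
    (hedge : ∀ z ∈ D, ∀ l, (∃ s ∈ Icc (0 : ℝ) 1, S.X l = fun x => S.X i x + s • (S.X j x - S.X i x)) ∨
      lift (S.X l) ((cotChart (S.lam t₀).1).symm z) < lift (S.X i) ((cotChart (S.lam t₀).1).symm z))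
    (hξ : S.Stationary Ψ t₀ ξ) (htβ : t₀ ≤ β) (hβ : β ≤ b) (hs : S.StaysNear t₀ ρ β ξ) :
    AbsolutelyContinuousOnInterval (S.momentum P t₀ ξ) t₀ β ∧
    ∀ᵐ t ∂volume.restrict (Icc t₀ β), ∃ s ∈ Icc (0 : ℝ) 1,
      HasDerivAt (S.momentum P t₀ ξ) (coordHamField (S.lam t₀).1 (lift (S.X i)) (S.momentum P t₀ ξ t) +
        s • (coordHamField (S.lam t₀).1 (lift (S.X j)) (S.momentum P t₀ ξ t) -
          coordHamField (S.lam t₀).1 (lift (S.X i)) (S.momentum P t₀ ξ t))) t ∧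
      lift (S.X j) ((cotChart (S.lam t₀).1).symm (S.momentum P t₀ ξ t)) ≤
        lift (S.X i) ((cotChart (S.lam t₀).1).symm (S.momentum P t₀ ξ t)) +
        s * (lift (S.X j) ((cotChart (S.lam t₀).1).symm (S.momentum P t₀ ξ t)) -
          lift (S.X i) ((cotChart (S.lam t₀).1).symm (S.momentum P t₀ ξ t))) := by
  have := S.nonempty_fin
  set x₀ := (S.lam t₀).1 with hx₀
  set y₀ := (cotChart x₀ (S.lam t₀)).1
  set κ := extChartAt 𝓘(ℝ, E) x₀ with hκ
  set k : Fin S.m → E → E := fun i => coordField x₀ (S.X i) with hk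
  set ζ : ℝ → E := fun t => κ (ξ t) with hζ
  set z := S.momentum P t₀ ξ
  have hJ : Icc t₀ β ⊆ Icc a b := Icc_subset_Icc h.a_le hβ
  have hL := h.cal.nonneg
  obtain ⟨x, hx⟩ := hξ.adm
  obtain ⟨hac, hd⟩ := hx.coord (h.a_nonneg.trans h.a_le) htβ (hβ.trans h.b_le) fun t ht => (hs t ht).1
  have hball : ∀ t ∈ Icc t₀ β, ball (ζ t) (ρ / 2) ⊆ ball y₀ ρ := fun t ht => by
    have := (hs t ht).2
    rw [mem_ball] at this
    exact ball_subset_ball' (by linarith)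
  have hζB : ∀ t ∈ Icc t₀ β, ζ t ∈ ball y₀ ρ := fun t ht =>
    hball t ht (mem_ball_self (half_pos h.pos))
  have hzD : ∀ t ∈ Icc t₀ β, z t ∈ D := h.momentum_mem hβ hs
  have hlift : ∀ t ∈ Icc t₀ β, ∀ l, lift (S.X l) ((cotChart x₀).symm (z t)) = P t (ζ t) (k l (ζ t)) :=
    fun t ht l => lift_cotChart_symm (hD (hzD t ht)) (S.X l)
  have hconst : ∀ t ∈ Icc t₀ β, S.G Ψ t (κ.symm (ζ t)) = S.G Ψ t₀ (κ.symm (ζ t₀)) := fun t ht => by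
    have h1 := hξ.const t ⟨(h.a_nonneg.trans h.a_le).trans ht.1, (ht.2.trans hβ).trans h.b_le⟩
    have h2 := hξ.const t₀ ⟨h.a_nonneg.trans h.a_le, (htβ.trans hβ).trans h.b_le⟩
    rw [hζ]
    simp only
    rw [κ.left_inv (hs t ht).1, κ.left_inv (hs t₀ ⟨le_rfl, htβ⟩).1, h1, h2]
  have hmax : ∀ t ∈ Ioo t₀ β, ∀ v, HasDerivAt ζ v t → ∀ l, P t (ζ t) (k l (ζ t)) ≤ P t (ζ t) v :=
    fun t ht v hv l => h.cal.apply_le_apply_velocity hJ hζB hconst ht hv l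
  have hcoord : ∀ l, ∀ s : ℝ, (S.X l = fun x => S.X i x + s • (S.X j x - S.X i x)) → ∀ y,
      k l y = k i y + s • (k j y - k i y) := fun l s hl y => by
    simp only [hk, hl, coordField]
    set A := tangentCoordChange 𝓘(ℝ, E) ((extChartAt 𝓘(ℝ, E) x₀).symm y) x₀
      ((extChartAt 𝓘(ℝ, E) x₀).symm y)
    refine (A.map_add _ _).trans ?_
    congr 1
    refine (A.map_smul s _).trans ?_
    congr 1
    exact A.map_sub _ _
  have hvel : ∀ᵐ t ∂volume.restrict (Icc t₀ β), ∃ s ∈ Icc (0 : ℝ) 1,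
      HasDerivAt ζ (k i (ζ t) + s • (k j (ζ t) - k i (ζ t))) t := by
    filter_upwards [hd, ae_mem_Ioo t₀ β] with t ⟨u, hu, hut⟩ ht
    have htm := Ioo_subset_Icc_self ht
    have h1 := hmax t ht _ hut i
    have h2 := hmax t ht _ hut j
    set m := max (P t (ζ t) (k i (ζ t))) (P t (ζ t) (k j (ζ t))) with hm
    have h3 : m ≤ ∑ l, u l * P t (ζ t) (k l (ζ t)) := by
      refine (max_le h1 h2).trans (le_of_eq ?_)
      rw [map_sum]
      exact Finset.sum_congr rfl fun l _ => by rw [map_smul, smul_eq_mul]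
    have h4 : ∀ l, P t (ζ t) (k l (ζ t)) ≤ m ∧ ∃ s ∈ Icc (0 : ℝ) 1,
        u l • k l (ζ t) = u l • (k i (ζ t) + s • (k j (ζ t) - k i (ζ t))) ∨
          P t (ζ t) (k l (ζ t)) < m := fun l => by
      rcases hedge _ (hzD t htm) l with ⟨s, hs, hl⟩ | hl
      · refine ⟨?_, s, hs, .inl (by rw [hcoord l s hl])⟩
        rw [hcoord l s hl, map_add, map_smul, map_sub, smul_eq_mul]
        have e1 := le_max_left (P t (ζ t) (k i (ζ t))) (P t (ζ t) (k j (ζ t)))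
        have e2 := le_max_right (P t (ζ t) (k i (ζ t))) (P t (ζ t) (k j (ζ t)))
        rw [← hm] at e1 e2
        nlinarith [hs.1, hs.2]
      · rw [hlift t htm, hlift t htm] at hl
        have e1 := hl.trans_le (le_max_left _ (P t (ζ t) (k j (ζ t))))
        exact ⟨e1.le, 0, ⟨le_rfl, zero_le_one⟩, .inr e1⟩
    have h5 : ∀ l, u l * (m - P t (ζ t) (k l (ζ t))) = 0 := fun l => by
      refine (Finset.sum_eq_zero_iff_of_nonneg fun l _ => mul_nonneg (hu.1 l)
        (sub_nonneg.2 (h4 l).1)).1 (le_antisymm ?_ (Finset.sum_nonneg fun l _ => mul_nonneg (hu.1 l)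
        (sub_nonneg.2 (h4 l).1))) l (Finset.mem_univ l)
      simp only [mul_sub, Finset.sum_sub_distrib, ← Finset.sum_mul, hu.2]
      linarith
    choose s hs hsu using fun l => (h4 l).2
    have h6 : ∀ l, u l • k l (ζ t) = u l • (k i (ζ t) + s l • (k j (ζ t) - k i (ζ t))) := fun l => by
      rcases hsu l with h | h
      · exact h
      · rw [(mul_eq_zero.1 (h5 l)).resolve_right (sub_pos.2 h).ne', zero_smul, zero_smul]
    refine ⟨∑ l, u l * s l, ⟨Finset.sum_nonneg fun l _ => mul_nonneg (hu.1 l) (hs l).1,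
      sum_stdSimplex_le hu fun l => (hs l).2⟩, hut.congr_deriv ?_⟩
    rw [Finset.sum_congr rfl fun l _ => h6 l]
    simp only [smul_add, Finset.sum_add_distrib, ← Finset.sum_smul, hu.2, one_smul, smul_smul]
  have hkc (l) : ContinuousOn (k l) (ball y₀ ρ) := fun y hy =>
    (h.nice.diff l y hy).continuousAt.continuousWithinAt
  obtain ⟨s, hs01, hsm, hsd⟩ := exists_measurable_coeff (hkc i) ((hkc j).sub (hkc i))
    (by simpa only [uIcc_of_le htβ] using hac.continuousOn) hζB hvel
  set u : ℝ → Fin S.m → ℝ := fun t => (1 - s t) • Pi.single i 1 + s t • Pi.single j 1 with hu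
  have hsum : ∀ t, ∀ {F : Type _} [NormedAddCommGroup F] [NormedSpace ℝ F] (v : Fin S.m → F),
      ∑ l, u t l • v l = v i + s t • (v j - v i) := fun t F _ _ v => by
    simp only [hu, Pi.add_apply, Pi.smul_apply, smul_eq_mul, add_smul, Finset.sum_add_distrib,
      mul_smul, ← Finset.smul_sum]
    simp [Pi.single_apply, ite_smul, sub_smul, smul_sub]
    abel
  have husimplex : ∀ t, u t ∈ stdSimplex ℝ (Fin S.m) := fun t =>
    convex_stdSimplex ℝ _ (single_mem_stdSimplex ℝ i) (single_mem_stdSimplex ℝ j)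
      (by linarith [(hs01 t).2]) (hs01 t).1 (by ring)
  have hadj := h.cal.adjoint h.nice.taylor h.nice.fderiv_le h.nice.continuousOn (u := u)
    (half_pos h.pos) htβ hJ hball hac husimplex (fun l => by
      simp only [hu, Pi.add_apply, Pi.smul_apply, smul_eq_mul]
      exact ((aestronglyMeasurable_const.sub hsm).mul_const _).add (hsm.mul_const _)) (by
      filter_upwards [hsd] with t ht
      rw [hsum]
      exact ht) hconst
  constructor
  · have hζl : ∀ s ∈ Icc t₀ β, ∀ t ∈ Icc t₀ β, ‖ζ s - ζ t‖ ≤ L * |s - t| := by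
      refine norm_sub_le_abs_of_ac hac ?_
      filter_upwards [hd, ae_restrict_mem measurableSet_Icc] with t ⟨u, hu, hut⟩ ht
      exact ⟨_, hut, norm_sum_stdSimplex_le hu fun l => h.nice.le l _ (hζB t ht)⟩
    refine absolutelyContinuous_of_norm_sub_le (C := L + L * (1 + L)) htβ fun r hr t ht => ?_
    have h1 := h.cal.lip t (hJ ht) r (hJ hr) _ (hζB t ht) _ (hζB r hr)
    have h2 := hζl r hr t ht
    have h3 : 0 ≤ L * |r - t| := by positivity
    have h4 : 0 ≤ L * ((1 + L) * |r - t|) := by positivity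
    have h5 : ‖P r (ζ r) - P t (ζ t)‖ ≤ L * ((1 + L) * |r - t|) :=
      h1.trans (mul_le_mul_of_nonneg_left (by linarith) hL)
    refine norm_prod_le_iff.2 ⟨?_, ?_⟩
    · exact h2.trans (by linarith)
    · exact h5.trans (by linarith)
  filter_upwards [hsd, hadj, ae_mem_Ioo t₀ β] with t h1 h2 ht
  have htm := Ioo_subset_Icc_self ht
  have hf (l) : coordHamField x₀ (lift (S.X l)) (z t) =
      (k l (ζ t), -(P t (ζ t)).comp (fderiv ℝ (k l) (ζ t))) :=
    coordHamField_lift (hD (hzD t htm)) (h.nice.diff l _ (hζB t htm))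
  refine ⟨s t, hs01 t, ?_, ?_⟩
  · refine (h1.prodMk h2).congr_deriv ?_
    rw [hf, hf, hsum]
    refine Prod.ext rfl ?_
    ext y
    simp
    ring
  · rw [hlift t htm, hlift t htm]
    have := hmax t ht _ h1 j
    rwa [map_add, map_smul, Pi.sub_apply, map_sub, smul_eq_mul] at this

end Extremal

end

section

variable {E : Type*} [NormedAddCommGroup E] [NormedSpace ℝ E] [FiniteDimensional ℝ E]
  {M : Type*} [TopologicalSpace M] [ChartedSpace E M] [IsManifold 𝓘(ℝ, E) ∞ M]

namespace Extremal

variable {S : Extremal E M} {Ψ : ℝ × M → ℝ × Cotangent E M} {t₀ : ℝ}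

variable (S) in
/-- On a window after `t₀` the momenta over all stationary trajectories solve the same Lipschitz
equation. -/
def HasFeedback (Ψ : ℝ × M → ℝ × Cotangent E M) (t₀ : ℝ) : Prop :=
  ∃ D ∈ 𝓝 (cotChart (S.lam t₀).1 (S.lam t₀)), ∃ Y K, LipschitzOnWith K Y D ∧
    ∀ a b ρ L P, S.Frame Ψ t₀ a b ρ L D P → ∀ ξ, S.Stationary Ψ t₀ ξ → ∀ β, t₀ ≤ β → β ≤ b →
      S.StaysNear t₀ ρ β ξ → AbsolutelyContinuousOnInterval (S.momentum P t₀ ξ) t₀ β ∧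
        ∀ᵐ t ∂volume.restrict (Icc t₀ β),
          HasDerivAt (S.momentum P t₀ ξ) (Y (S.momentum P t₀ ξ t)) t

theorem target_mem (ℓ : Cotangent E M) :
    (cotChart ℓ.1 : PartialEquiv (Cotangent E M) _).target ∈ 𝓝 (cotChart ℓ.1 ℓ) :=
  (isOpen_cotChart_target _).mem_nhds ((cotChart _).map_source (mem_cotChart_source _))

theorem hasFeedback_of_unique {h : (x : M) → TangentSpace 𝓘(ℝ, E) x} (hh : ∃ i, h = S.X i)
    (hmax : ∀ u ∈ stdSimplex ℝ (Fin S.m), comb S.X u ≠ h → lift (comb S.X u) (S.lam t₀) <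
      lift h (S.lam t₀)) : S.HasFeedback Ψ t₀ := by
  obtain ⟨i, rfl⟩ := hh
  have hedge := S.eventually_edge (h := S.X i) (k := S.X i) (ℓ := S.lam t₀) (S.hX i)
    fun u hu hne a _ => by
      rw [sub_self, mul_zero, add_zero]
      refine hmax u hu fun he => hne 0 ⟨le_rfl, zero_le_one⟩ (he.trans (funext fun x => ?_))
      rw [zero_smul]
      exact (add_zero (show E from S.X i x)).symm
  obtain ⟨K, D, hD, hK⟩ := ((cotSmooth_lift (S.hX i)).contDiffAt_coordHamField
    (mem_of_mem_nhds (target_mem (S.lam t₀)))).exists_lipschitzOnWith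
  refine ⟨_, inter_mem (inter_mem hedge (target_mem (S.lam t₀))) hD, _, K,
    hK.mono inter_subset_right, fun a b ρ L P hF ξ hξ β htβ hβ hs => ?_⟩
  obtain ⟨hac, hd⟩ := hF.hasDerivAt_momentum (fun z hz => hz.1.2) (fun z hz => hz.1.1) hξ htβ hβ hs
  refine ⟨hac, ?_⟩
  filter_upwards [hd] with t ⟨s, _, ht, _⟩
  rwa [sub_self, smul_zero, add_zero] at ht

theorem hasFeedback_switch : S.HasFeedback Ψ S.τ₁ := by
  obtain ⟨i, hi⟩ := S.hh₁
  obtain ⟨j, hj⟩ := S.hh₂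
  set x₀ := (S.lam S.τ₁).1
  have hτ : S.τ₁ ∈ Icc 0 S.T := ⟨S.hτ₁.le, (S.hτ₁₂.trans S.hτ₂).le⟩
  have htgt := mem_of_mem_nhds (target_mem (S.lam S.τ₁))
  have hedge := S.eventually_edge S.smooth₁ S.hsimple
  obtain ⟨K, D, hD, hK⟩ := (S.cotSmooth₂.contDiffAt_coordHamField htgt).exists_lipschitzOnWith
  have hKs : CotSmooth fun ℓ => S.H₂ ℓ - S.H₁ ℓ := S.cotSmooth₂.sub S.cotSmooth₁
  set g : E × (E →L[ℝ] ℝ) → ℝ := fun z => S.H₂ ((cotChart x₀).symm z) - S.H₁ ((cotChart x₀).symm z)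
    with hg
  obtain ⟨K', D', hD', hK'⟩ : ∃ K', ∃ D' ∈ 𝓝 (cotChart x₀ (S.lam S.τ₁)), LipschitzOnWith K' g D' :=
    ((hKs.contDiffAt htgt).of_le one_le_infty).exists_lipschitzOnWith
  set c := poisson S.H₁ S.H₂ (S.lam S.τ₁) / 2
  have hc0 : 0 < c := half_pos S.hswitch.1
  have hpos := eventually_symm_lt (ℓ := S.lam S.τ₁) (F := fun _ => c) (G := poisson S.H₁ S.H₂)
    continuous_const (S.cotSmooth₁.poisson S.cotSmooth₂).continuousOn (half_lt_self S.hswitch.1)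
  refine ⟨_, inter_mem (inter_mem (inter_mem hedge (target_mem (S.lam S.τ₁))) (inter_mem hD hD')) hpos,
    _, K, hK.mono fun z hz => hz.1.2.1, fun a b ρ L P hF ξ hξ β htβ hβ hs => ?_⟩
  have hzD := hF.momentum_mem hβ hs
  obtain ⟨hac, hd⟩ := hF.hasDerivAt_momentum (i := i) (j := j) (fun z hz => hz.1.1.2)
    (fun z hz => by rw [← hi, ← hj]; exact hz.1.1.1) hξ htβ hβ hs
  rw [← hi, ← hj] at hd
  refine ⟨hac, ?_⟩
  set z := S.momentum P S.τ₁ ξ with hz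
  have hsw : ∀ t ∈ Ioo S.τ₁ β, S.H₁ ((cotChart x₀).symm (z t)) < S.H₂ ((cotChart x₀).symm (z t)) := by
    intro t ht
    have hsub : Icc S.τ₁ t ⊆ Icc S.τ₁ β := Icc_subset_Icc_right ht.2.le
    have hac' : AbsolutelyContinuousOnInterval (fun t => -g (z t)) S.τ₁ t :=
      absolutelyContinuous_comp_lipschitz (hac.mono (by
        rw [uIcc_of_le ht.1.le, uIcc_of_le htβ]; exact hsub)) (g := fun z => -g z) (K := K') (S := D')
        (hK'.neg) fun τ hτ => by
          rw [uIcc_of_le ht.1.le] at hτ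
          exact (hzD τ (hsub hτ)).1.2.2
    have h1 := sub_le_of_ac (C := -c) ht.1.le hac' (by
      filter_upwards [ae_restrict_Icc_mono hd le_rfl ht.2.le, ae_restrict_mem measurableSet_Icc] with
        τ ⟨s, _, hτd, _⟩ hτ
      have hzτ := hzD τ (hsub hτ)
      have hzt := hzτ.1.1.2
      have hgd : HasFDerivAt g (fderiv ℝ g (z τ)) (z τ) :=
        ((hKs.contDiffAt hzt).differentiableAt (by simp)).hasFDerivAt
      refine ⟨_, (hgd.comp_hasDerivAt τ hτd).neg, neg_le_neg ?_⟩
      have e1 := S.cotSmooth₁.fderiv_coordHamField hKs hzt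
      have e2 := S.cotSmooth₂.fderiv_coordHamField hKs hzt
      rw [S.poisson_H₁_sub] at e1
      rw [S.poisson_H₂_sub] at e2
      rw [map_add, map_smul, map_sub, e1, e2, sub_self, smul_zero, add_zero]
      exact hzτ.2.le)
    simp only [hg] at h1
    have h2 := S.lift_le_max hτ i
    rw [← hi, show lift (refField S.h₁ S.h₂ S.h₃ S.τ₁ S.τ₂ S.υ S.τ₁) (S.lam S.τ₁) =
      S.H₂ (S.lam S.τ₁) by
        simp only [lift, refField, if_neg (lt_irrefl S.τ₁), if_pos S.hτ₁₂]] at h2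
    have h3 : (cotChart x₀).symm (z S.τ₁) = S.lam S.τ₁ := by
      rw [hz, hF.momentum_t₀ hξ hτ.2, (cotChart x₀).left_inv (mem_cotChart_source _)]
    rw [h3] at h1
    nlinarith [mul_pos hc0 (sub_pos.2 ht.1)]
  filter_upwards [hd, ae_mem_Ioo S.τ₁ β] with t ⟨s, hs01, htd, hle⟩ ht
  have h1 := hsw t ht
  have hs1 : s = 1 := by
    refine le_antisymm hs01.2 ?_
    by_contra h2
    push Not at h2
    simp only [H₁, H₂] at h1
    nlinarith
  rwa [hs1, one_smul, add_sub_cancel] at htd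

theorem hasFeedback_singular (ht₀ : t₀ ∈ Icc S.τ₂ S.T) : S.HasFeedback Ψ t₀ := by
  obtain ⟨i, hi⟩ := S.hh₂
  obtain ⟨j, hj⟩ := S.hh₃
  set x₀ := (S.lam t₀).1
  have htgt := mem_of_mem_nhds (target_mem (S.lam t₀))
  have hedge := S.eventually_edge S.smooth₂ (S.hsing t₀ ht₀)
  set A := poisson S.H₂ S.Q with hA
  set B := poisson S.F₁ S.Q
  have hAs : CotSmooth A := S.cotSmooth₂.poisson S.cotSmoothQ
  have hBs : CotSmooth B := S.cotSmoothF.poisson S.cotSmoothQ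
  have hB0 := S.legendre_pos t₀ ht₀
  have hpos := eventually_symm_lt (ℓ := S.lam t₀) (F := fun _ => 0) (G := B)
    continuous_const hBs.continuousOn hB0
  have hF : S.F₁ = fun ℓ => lift S.h₃ ℓ - S.H₂ ℓ := funext S.F₁_eq
  set Y : E × (E →L[ℝ] ℝ) → E × (E →L[ℝ] ℝ) := fun z => coordHamField x₀ S.H₂ z +
    (-A ((cotChart x₀).symm z) / B ((cotChart x₀).symm z)) • coordHamField x₀ S.F₁ z
  have hYs : ContDiffAt ℝ 1 Y (cotChart x₀ (S.lam t₀)) := by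
    refine (S.cotSmooth₂.contDiffAt_coordHamField htgt).add (ContDiffAt.fun_smul ?_
      (S.cotSmoothF.contDiffAt_coordHamField htgt))
    refine (((hAs.contDiffAt htgt).of_le one_le_infty).neg).div
      ((hBs.contDiffAt htgt).of_le one_le_infty) ?_
    rw [(cotChart x₀).left_inv (mem_cotChart_source _)]
    exact hB0.ne'
  obtain ⟨K, D, hD, hK⟩ := hYs.exists_lipschitzOnWith
  refine ⟨_, inter_mem (inter_mem (inter_mem hedge (target_mem (S.lam t₀))) hD) hpos,
    _, K, hK.mono fun z hz => hz.1.2, fun a b ρ L P hFr ξ hξ β htβ hβ hst => ?_⟩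
  have hzD := hFr.momentum_mem hβ hst
  obtain ⟨hac, hd⟩ := hFr.hasDerivAt_momentum (i := i) (j := j) (fun z hz => hz.1.1.2)
    (fun z hz => by rw [← hi, ← hj]; exact hz.1.1.1) hξ htβ hβ hst
  rw [← hi, ← hj] at hd
  refine ⟨hac, ?_⟩
  set z := S.momentum P t₀ ξ with hz
  rcases htβ.eq_or_lt with rfl | htβ'
  · simp
  have hd' : ∀ᵐ t ∂volume.restrict (Icc t₀ β), ∃ s : ℝ,
      HasDerivAt z (coordHamField x₀ S.H₂ (z t) + s • coordHamField x₀ S.F₁ (z t)) t := by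
    filter_upwards [hd, ae_restrict_mem measurableSet_Icc] with t ⟨s, _, ht, _⟩ htm
    refine ⟨s, ht.congr_deriv ?_⟩
    rw [hF, coordHamField_sub (cotSmooth_lift S.smooth₃) S.cotSmooth₂ (hzD t htm).1.1.2]
  have hzero : ∀ G : Cotangent E M → ℝ, CotSmooth G → (∀ t ∈ Icc t₀ β, G ((cotChart x₀).symm (z t)) = 0) →
      ∀ t ∈ Ioo t₀ β, ∀ s : ℝ,
        HasDerivAt z (coordHamField x₀ S.H₂ (z t) + s • coordHamField x₀ S.F₁ (z t)) t →
        poisson S.H₂ G ((cotChart x₀).symm (z t)) + s * poisson S.F₁ G ((cotChart x₀).symm (z t)) = 0 := by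
    intro G hG h0 t ht s hs
    have hzt := (hzD t (Ioo_subset_Icc_self ht)).1.1.2
    have h1 := ((hG.contDiffAt hzt).differentiableAt (by simp)).hasFDerivAt.comp_hasDerivAt t hs
    have h2 : (fun z => G ((cotChart x₀).symm z)) ∘ z =ᶠ[𝓝 t] fun _ => 0 := by
      filter_upwards [Icc_mem_nhds ht.1 ht.2] with τ hτ using h0 τ hτ
    have h3 := (h1.congr_of_eventuallyEq h2.symm).unique (hasDerivAt_const t 0)
    rwa [map_add, map_smul, S.cotSmooth₂.fderiv_coordHamField hG hzt,
      S.cotSmoothF.fderiv_coordHamField hG hzt, smul_eq_mul] at h3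
  have hQ : ∀ t ∈ Icc t₀ β, S.Q ((cotChart x₀).symm (z t)) = 0 := by
    have hcz : ContinuousOn z (Icc t₀ β) := by simpa only [uIcc_of_le htβ] using hac.continuousOn
    have hc : ContinuousOn (fun t => S.Q ((cotChart x₀).symm (z t))) (Icc t₀ β) :=
      S.cotSmoothQ.continuousOn.comp_continuousOn
        ((continuousOn_cotChart_symm x₀).comp hcz fun t ht => (hzD t ht).1.1.2)
    refine Measure.eqOn_Icc_of_ae_eq (μ := volume) htβ'.ne (g := fun _ => 0) ?_ hc continuousOn_const
    filter_upwards [hd', ae_mem_Ioo t₀ β] with t ⟨s, hs⟩ ht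
    have h1 := hzero S.F₁ S.cotSmoothF (fun t ht => hFr.F₁_eq_zero t
      ⟨hFr.a_le.trans ht.1, ht.2.trans hβ⟩ _ (ball_subset_ball (by linarith [hFr.pos])
        (hst t ht).2) (ht₀.1.trans ht.1)) t ht s hs
    have h2 := poisson_neg_symm (F := S.F₁) (G := S.F₁) ((cotChart x₀).symm (z t))
    rw [S.poissonF, show poisson S.F₁ S.F₁ ((cotChart x₀).symm (z t)) = 0 by linarith, mul_zero,
      add_zero] at h1
    exact h1
  filter_upwards [hd', ae_mem_Ioo t₀ β] with t ⟨s, hs⟩ ht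
  have h1 := hzero S.Q S.cotSmoothQ hQ t ht s hs
  have h2 : 0 < B ((cotChart x₀).symm (z t)) := (hzD t (Ioo_subset_Icc_self ht)).2
  have h3 : s = -A ((cotChart x₀).symm (z t)) / B ((cotChart x₀).symm (z t)) := by
    rw [eq_div_iff h2.ne']
    linarith
  rw [h3] at hs
  exact hs

theorem hasFeedback (ht₀ : t₀ ∈ Ico 0 S.T) : S.HasFeedback Ψ t₀ := by
  rcases lt_trichotomy t₀ S.τ₁ with h | rfl | h
  · exact hasFeedback_of_unique S.hh₁ (S.hbang.1 t₀ ⟨ht₀.1, h⟩)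
  · exact hasFeedback_switch
  · rcases lt_or_ge t₀ S.τ₂ with h' | h'
    · exact hasFeedback_of_unique S.hh₂ (S.hbang.2 t₀ ⟨h, h'⟩)
    · exact hasFeedback_singular ⟨h', ht₀.2.le⟩

variable [T2Space M] {U : Set (ℝ × M)}

theorem Inverse.eqOn_step (h : S.Inverse U Ψ) (ht₀ : t₀ ∈ Ico 0 S.T) {ξ ξ' : ℝ → M}
    (hξ : S.Stationary Ψ t₀ ξ) (hξ' : S.Stationary Ψ t₀ ξ') :
    ∃ ε > 0, EqOn ξ ξ' (Icc t₀ (t₀ + ε)) := by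
  obtain ⟨D, hD, Y, K, hK, hfb⟩ := hasFeedback (S := S) (Ψ := Ψ) ht₀
  obtain ⟨a, b, ρ, L, P, hF⟩ := h.exists_frame (Ico_subset_Icc_self ht₀) hD
  obtain ⟨ε₁, hε₁, hb₁, hs₁⟩ := hF.exists_staysNear hξ ht₀.2
  obtain ⟨ε₂, hε₂, hb₂, hs₂⟩ := hF.exists_staysNear hξ' ht₀.2
  set ε := min (min ε₁ ε₂) (1 / (2 * (K + 1)))
  have hK0 : (0 : ℝ) ≤ K := K.2
  have hε0 : 0 < ε := lt_min (lt_min hε₁ hε₂) (by positivity)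
  have hle₁ : t₀ + ε ≤ t₀ + ε₁ := by
    linarith [min_le_left (min ε₁ ε₂) (1 / (2 * ((K : ℝ) + 1))), min_le_left ε₁ ε₂]
  have hle₂ : t₀ + ε ≤ t₀ + ε₂ := by
    linarith [min_le_left (min ε₁ ε₂) (1 / (2 * ((K : ℝ) + 1))), min_le_right ε₁ ε₂]
  have hs₁' : S.StaysNear t₀ ρ (t₀ + ε) ξ := fun t ht => hs₁ t ⟨ht.1, ht.2.trans hle₁⟩
  have hs₂' : S.StaysNear t₀ ρ (t₀ + ε) ξ' := fun t ht => hs₂ t ⟨ht.1, ht.2.trans hle₂⟩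
  have hb := hle₁.trans hb₁
  obtain ⟨hac, hd⟩ := hfb a b ρ L P hF ξ hξ _ (by linarith) hb hs₁'
  obtain ⟨hac', hd'⟩ := hfb a b ρ L P hF ξ' hξ' _ (by linarith) hb hs₂'
  have hKε : K * (t₀ + ε - t₀) < 1 := by
    have : ε ≤ 1 / (2 * (K + 1)) := min_le_right _ _
    rw [le_div_iff₀ (by positivity)] at this
    nlinarith
  have h0 := eqOn_zero_of_norm_deriv_le (hac.sub hac') hK0 hKε (by
    rw [Pi.sub_apply, hF.momentum_t₀ hξ ht₀.2.le, hF.momentum_t₀ hξ' ht₀.2.le, sub_self]) (by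
    filter_upwards [hd, hd', ae_restrict_mem measurableSet_Icc] with t h1 h2 ht
    refine ⟨_, h1.sub h2, ?_⟩
    have := hK.dist_le_mul _ (hF.momentum_mem hb hs₁' t ht) _ (hF.momentum_mem hb hs₂' t ht)
    rwa [dist_eq_norm, dist_eq_norm] at this)
  refine ⟨ε, hε0, fun t ht => ?_⟩
  have h1 := congrArg Prod.fst (sub_eq_zero.1 (h0 t ht))
  exact (extChartAt 𝓘(ℝ, E) (S.lam t₀).1).injOn (hs₁' t ht).1 (hs₂' t ht).1 h1

omit [T2Space M] in
theorem isAdmissible_ref (S : Extremal E M) : IsAdmissible S.X (S.ξr 0) S.T S.ξr := by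
  obtain ⟨hac, hd⟩ := S.hξ
  refine ⟨hac, rfl, ?_⟩
  have hυ : ∀ᵐ t ∂volume.restrict (Icc 0 S.T), S.τ₂ ≤ t → S.υ t ∈ Ioo 0 1 := by
    rw [ae_restrict_iff' measurableSet_Icc]
    filter_upwards [(ae_restrict_iff' measurableSet_Icc).1 S.hυ] with t ht htT hτ using ht ⟨hτ, htT.2⟩
  have hvert : ∀ {f : (x : M) → TangentSpace 𝓘(ℝ, E) x}, (∃ i, f = S.X i) → ∀ x, f x ∈ velocities S.X x := by
    rintro f ⟨i, rfl⟩ x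
    exact ⟨_, single_mem_stdSimplex ℝ i, congrFun (S.single_mem i) x⟩
  filter_upwards [hd, hυ] with t ht hυt
  refine ⟨_, ?_, ht⟩
  rcases lt_or_ge t S.τ₁ with h1 | h1
  · rw [refField, if_pos h1]
    exact hvert S.hh₁ _
  rcases lt_or_ge t S.τ₂ with h2 | h2
  · rw [refField, if_neg (not_lt.2 h1), if_pos h2]
    exact hvert S.hh₂ _
  · rw [refField, if_neg (not_lt.2 h1), if_neg (not_lt.2 h2)]
    obtain ⟨u, hu, hu'⟩ := hvert S.hh₂ (S.ξr t)
    obtain ⟨w, hw, hw'⟩ := hvert S.hh₃ (S.ξr t)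
    obtain ⟨h3, h4⟩ := hυt h2
    refine ⟨(1 - S.υ t) • u + S.υ t • w, convex_stdSimplex ℝ _ hu hw (by linarith) h3.le (by ring), ?_⟩
    rw [hu', hw']
    have h5 : ∀ (u w : Fin S.m → ℝ) (p : Fin S.m → E), ∑ i, u i • p i + S.υ t • (∑ i, w i • p i - ∑ i, u i • p i) =
        ∑ i, ((1 - S.υ t) • u + S.υ t • w) i • p i := fun _ _ _ => by
      simp only [Pi.add_apply, Pi.smul_apply, smul_eq_mul, Finset.smul_sum,
        ← Finset.sum_sub_distrib, ← Finset.sum_add_distrib]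
      exact Finset.sum_congr rfl fun i _ => by module
    exact h5 u w fun i => S.X i (S.ξr t)

/-- The reference trajectory is a strict minimiser of the cost at the end point among the
admissible trajectories that are close to it. -/
theorem Inverse.exists_strictMin (h : S.Inverse U Ψ)
    (hadm : IsAdmissible S.X (S.ξr 0) S.T S.ξr) : ∃ o : Set (ℝ × M), IsOpen o ∧
    (∀ t ∈ Icc 0 S.T, (t, S.ξr t) ∈ o) ∧ (∀ x, (S.T, x) ∈ o → x ∈ S.O) ∧
    ∀ ξ, IsAdmissible S.X (S.ξr 0) S.T ξ → (∀ t ∈ Icc 0 S.T, (t, ξ t) ∈ o) →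
      ¬ EqOn ξ S.ξr (Icc 0 S.T) → S.ct (S.ξr S.T) < S.ct (ξ S.T) := by
  obtain ⟨o, ho, hro, hT, hanti⟩ := h.exists_isOpen
  refine ⟨o, ho, hro, fun x hx => S.hVO (hT x hx).1, fun ξ hξ hξo hne => ?_⟩
  have hmono := hanti _ ξ hξ hξo
  have h0 : (0 : ℝ) ∈ Icc 0 S.T := ⟨le_rfl, S.T_pos.le⟩
  have hG0 : S.G Ψ 0 (ξ 0) = -S.ct (S.ξr S.T) := by rw [hξ.2.1, h.G_ref h0]
  have hGT : S.G Ψ S.T (ξ S.T) = -S.ct (ξ S.T) := h.G_T (hT _ (hξo S.T S.T_mem)).2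
  have hle := hmono h0 S.T_mem S.T_pos.le
  simp only [hG0, hGT] at hle
  refine (neg_le_neg_iff.1 hle).lt_of_ne fun heq => hne ?_
  have hconst : ∀ t ∈ Icc 0 S.T, S.G Ψ t (ξ t) = -S.ct (S.ξr S.T) := fun t ht => by
    have h1 := hmono h0 ht ht.1
    have h2 := hmono ht S.T_mem ht.2
    simp only [hG0, hGT] at h1 h2
    exact le_antisymm h1 (by rw [heq]; exact h2)
  have hclosed : IsClosed ({t | ξ t = S.ξr t} ∩ Icc 0 S.T) := by
    rw [inter_comm]
    exact (hξ.1.1.prodMk hadm.1.1).preimage_isClosed_of_isClosed isClosed_Icc isClosed_diagonal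
  refine hclosed.Icc_subset_of_forall_exists_gt hξ.2.1 fun t ⟨ht, ht'⟩ y hy => ?_
  obtain ⟨ε, hε, heq⟩ := h.eqOn_step ht' (ξ := ξ) (ξ' := S.ξr) ⟨⟨_, hξ⟩, ht, hconst⟩
    ⟨⟨_, hadm⟩, rfl, fun t ht => h.G_ref ht⟩
  have hy' : t < y := hy
  have hlt : t < min (t + ε) y := lt_min (by linarith) hy'
  exact ⟨min (t + ε) y, heq ⟨hlt.le, min_le_left _ _⟩, hlt, min_le_right _ _⟩

end Extremal

end

end

end BangBangSingular

open BangBangSingular in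
theorem theorem2 {E : Type*} [NormedAddCommGroup E] [NormedSpace ℝ E] [FiniteDimensional ℝ E]
    {M : Type*} [TopologicalSpace M] [ChartedSpace E M] [IsManifold 𝓘(ℝ, E) ∞ M] [T2Space M]
    -- the control problem
    {m : ℕ} (X : Fin m → (x : M) → TangentSpace 𝓘(ℝ, E) x)
    (hX : ∀ i, ContMDiff 𝓘(ℝ, E) 𝓘(ℝ, E).tangent ∞
      (fun x => (⟨x, X i x⟩ : TangentBundle 𝓘(ℝ, E) M)))
    (c : M → ℝ) (hc : ContMDiff 𝓘(ℝ, E) 𝓘(ℝ, ℝ) ∞ c) (x₀ : M)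
    -- the reference trajectory
    (T τ₁ τ₂ : ℝ) (hτ₁ : 0 < τ₁) (hτ₁₂ : τ₁ < τ₂) (hτ₂ : τ₂ < T)
    (h₁ h₂ h₃ : (x : M) → TangentSpace 𝓘(ℝ, E) x)
    (hh₁ : ∃ i, h₁ = X i) (hh₂ : ∃ i, h₂ = X i) (hh₃ : ∃ i, h₃ = X i)
    (υ : ℝ → ℝ) (hυm : AEMeasurable υ (volume.restrict (Icc τ₂ T)))
    (hυ : ∀ᵐ t ∂(volume.restrict (Icc τ₂ T)), υ t ∈ Ioo 0 1)
    (ξr : ℝ → M) (hξ₀ : ξr 0 = x₀)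
    (hξ : IsCaratheodorySolution 𝓘(ℝ, E) (refField h₁ h₂ h₃ τ₁ τ₂ υ) ξr 0 T)
    -- the reference extremal and its regularity
    (lam : ℝ → Cotangent E M)
    (hPMP : PMP X c T (refField h₁ h₂ h₃ τ₁ τ₂ υ) ξr lam)
    (hbang : RegularBang X h₁ h₂ τ₁ τ₂ lam)
    (hsing : ∀ t ∈ Icc τ₂ T, OnlyEdgeMaximises X h₂ h₃ (lam t))
    (hsimple : OnlyEdgeMaximises X h₁ h₂ (lam τ₁))
    (hswitch : RegularSwitch h₁ h₂ h₃ τ₁ τ₂ lam)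
    (hSGLC : StrongLegendre h₂ h₃ τ₂ T lam)
    -- the modified cost and the graph of the differential of its opposite
    (O : Set M) (ct : M → ℝ) (hct : IsModifiedCost (fun x => h₃ x - h₂ x) c (ξr T) O ct)
    (V : Set M) (hV : IsOpen V) (hxV : ξr T ∈ V) (hVO : V ⊆ O)
    (Λ : Set (Cotangent E M)) (hΛ : Λ = differential (fun x => -ct x) '' V)
    -- the overmaximised flow from this graph
    (Os : Set (Cotangent E M)) (θ : Cotangent E M → ℝ) (hθ : IsTheta h₂ h₃ τ₂ T lam Os θ)
    (O₂ : Set (Cotangent E M)) (t₂ s₁ : Cotangent E M → ℝ)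
    (hsw : AreSwitchingTimes h₁ h₂ h₃ τ₁ τ₂ lam Os θ O₂ t₂ s₁)
    (Φ : ℝ → Cotangent E M → Cotangent E M)
    (hΦ : IsOvermaximisedFlow h₁ h₂ h₃ τ₂ T υ Os θ O₂ t₂ s₁ Λ Φ)
    (hinv : ProjectedFlowInvertible T Φ Λ ξr) :
    IsStrictStrongLocalMin X x₀ T O ct ξr := by
  subst hΛ hξ₀
  obtain ⟨U, Ψ, -, hnhds, hbij, hinvOn, hlip⟩ := hinv
  let S : Extremal E M := ⟨m, X, hX, c, hc, T, τ₁, τ₂, hτ₁, hτ₁₂, hτ₂, h₁, h₂, h₃, hh₁, hh₂, hh₃, υ, hυ,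
    ξr, hξ, lam, hPMP, hbang, hsing, hsimple, hswitch, hSGLC, O, ct, hct, V, hV, hxV, hVO, Os, θ, hθ,
    O₂, t₂, s₁, hsw, Φ, hΦ⟩
  have hS : S.Inverse U Ψ := ⟨hnhds, hbij, hinvOn, hlip⟩
  have hadm : IsAdmissible X (ξr 0) T ξr := S.isAdmissible_ref
  exact ⟨hadm, hS.exists_strictMin hadm⟩
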